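/- Let $(X,\omega)$ be a closed symplectic manifold of dimension $6$ with a smooth symplectic action of $S^1$ and a moment map $\Phi:X\to\mathbb R/T\mathbb Z$, where $T\in\mathbb R$ (for $T=0$ it is real valued); that is, locally $d\Phi=\omega(\cdot,\xi)$, where $\xi(x)=\frac{d}{dt}\big|_{t=0}e^{2\pi i t}\cdot x$. Let $M_\lambda=\Phi^{-1}(\lambda)/S^1$ be the reduced spaces. Let $p,q\ge 1$ be coprime integers and let $x_0$ be a fixed point with isotropy weights $(p,q,-1)$ which is the only fixed point at its level $\lambda_0=\Phi(x_0)$. Let $\bar x_0\in M_{\lambda_0}$ be its image. On $\mathbb C^n$ we use the symplectic form $\frac1\pi\sum_j dx_j\wedge dy_j$, so that $H(z)=p|z_1|^2+q|z_2|^2-|z_3|^2$ is a moment map of the action of $S^1$ on $\mathbb C^3$ with weights $(p,q,-1)$. For $\delta>0$ let $\delta E(q,p)=\{z\in\mathbb C^2: |z_1|^2/q+|z_2|^2/p\le\delta\}$. The $(p,q)$-weighted blowup of size $\delta$ of a symplectic $4$-orbifold $M$ at a smooth point $x$, performed in a Darboux chart $\psi:B\to M$ centered at $x$ with $\delta E(q,p)\subset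 B\subset\mathbb C^2$, is obtained by removing the interior of $\psi(\delta E(q,p))$ and collapsing each leaf of the characteristic foliation of the boundary to a point. It is an oriented orbifold. Write $r_1,r_2>0$ for the numbers with $p\,r_1^2+q|w|^2=pq\delta+|u|^2$ and $p|w|^2+q\,r_2^2=pq\delta+|u|^2$, and $\lambda=u/|u|$ (any $\lambda\in S^1$ if $u=0$). The orbifold charts on the part of the blowup that comes from $B$, and in particular near the collapsed boundary (the exceptional divisor), are $(w,u)\mapsto[\psi(\lambda^p r_1,\lambda^q w)]$ and $(w,u)\mapsto[\psi(\lambda^p w,\lambda^q r_2)]$, which are uniformizing charts for cyclic groups of orders $p$ and $q$; in these charts the symplectic form is the standard one. Then there are an $r>0$ and an equivariant Darboux chart $\Psi$ of $X$ centered at $x_0$, defined on the polydisc $D_r=\{z\in\mathbb C^3:|z_j|<r\}$ with the action of weights $(p,q,-1)$, such that $\Phi\circ\Psi=\lambda_0+H$ and such that the following holds. 1. Let $B=\{(z_1,z_2):(z_1,z_2,\sqrt{p|z_1|^2+q|z_2|^2})\in D_r\}$ and $\psi(z_1,z_2)=[\Psi(z_1,z_2,\sqrt{p|z_1|^2+q|z_2|^2})]$.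 Then $M_{\lambda_0}$ is a closed symplectic orbifold, whose structure is the reduced one away from $\bar x_0$, and for which $\bar x_0$ is a smooth point with Darboux chart $\psi:B\to M_{\lambda_0}$. 2. For all sufficiently small $\epsilon>0$ the reduced space $M_{\lambda_0+\epsilon}$ with its reduced structure is a closed symplectic orbifold, and it is the $(p,q)$-weighted blowup of size $\frac{\epsilon}{pq}$ of $M_{\lambda_0}$ at $\bar x_0$, performed in $\psi$; the ellipsoid that is removed is $\frac{\epsilon}{pq}E(q,p)=\{p|z_1|^2+q|z_2|^2\le\epsilon\}$. The identification is an orientation preserving diffeomorphism of orbifolds, and it is symplectic on the part of the blowup that comes from $B$. On this part it is the reduction of $\mathbb C^3$ at level $\epsilon$: the class of $\psi(z_1,z_2)$ in the blowup, where $(z_1,z_2)\in B$ and $p|z_1|^2+q|z_2|^2\ge\epsilon$, corresponds to the point $[\Psi(z_1,z_2,\sqrt{p|z_1|^2+q|z_2|^2-\epsilon})]$ of $M_{\lambda_0+\epsilon}$. -/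

import Mathlib

open scoped Manifold ContDiff Topology

noncomputable section

namespace SymplecticReduction

/-! ### Symplectic linear algebra and forms on `ℂ²` and `ℂ³` -/

/-- The form `dx ∧ dy` on `ℂ`. -/
def areaForm : ℂ [⋀^Fin 2]→L[ℝ] ℝ :=
  ContinuousMultilinearMap.alternatization
    (((ContinuousMultilinearMap.mkPiAlgebra ℝ (Fin 2) ℝ)).compContinuousLinearMap
      ![Complex.reCLM, Complex.imCLM])

theorem areaForm_apply (u v : ℂ) : areaForm ![u, v] = u.re * v.im - u.im * v.re := by
  simp [areaForm, ContinuousMultilinearMap.alternatization_apply_apply, Fin.prod_univ_two,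
    Finset.univ_perm_fin_succ, ← Finset.univ_product_univ]
  ring

/-- The standard symplectic form on `ℂ²`, normalized as `(1/π) (dx₁ ∧ dy₁ + dx₂ ∧ dy₂)`, so that
a rotation of period one with weights `(a, b)` has moment map `a |z₁|² + b |z₂|²`. -/
def stdForm2 : (ℂ × ℂ) [⋀^Fin 2]→L[ℝ] ℝ :=
  Real.pi⁻¹ • (areaForm.compContinuousLinearMap (ContinuousLinearMap.fst ℝ ℂ ℂ) +
    areaForm.compContinuousLinearMap (ContinuousLinearMap.snd ℝ ℂ ℂ))

/-- The standard symplectic form on `ℂ³`, with the same normalization. -/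
def stdForm3 : (ℂ × ℂ × ℂ) [⋀^Fin 2]→L[ℝ] ℝ :=
  Real.pi⁻¹ • areaForm.compContinuousLinearMap (ContinuousLinearMap.fst ℝ ℂ (ℂ × ℂ)) +
    stdForm2.compContinuousLinearMap (ContinuousLinearMap.snd ℝ ℂ (ℂ × ℂ))

/-- The Pfaffian of a two-form on `ℂ² = ℝ⁴`, that is, `(α ∧ α) / 2` evaluated on the standard
oriented basis. A symplectic form orients `ℂ²` according to its sign. -/
def pfaffian (α : (ℂ × ℂ) [⋀^Fin 2]→L[ℝ] ℝ) : ℝ :=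
  let e₁ : ℂ × ℂ := (1, 0)
  let e₂ : ℂ × ℂ := (Complex.I, 0)
  let e₃ : ℂ × ℂ := (0, 1)
  let e₄ : ℂ × ℂ := (0, Complex.I)
  α ![e₁, e₂] * α ![e₃, e₄] - α ![e₁, e₃] * α ![e₂, e₄] + α ![e₁, e₄] * α ![e₂, e₃]

/-! ### Symplectic orbifolds of real dimension four -/

/-- A local uniformizing chart of `M`: an open set `dom ⊆ ℂ²`, a finite group `Γ` acting
effectively on it by diffeomorphisms, and a `Γ`-invariant map onto an open subset of `M` that
induces a homeomorphism from `dom / Γ` onto its image; together with a `Γ`-invariant symplectic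
form on `dom`. Elements of `Γ` are written as permutations of all of `ℂ²`, but only their
restrictions to `dom` matter. -/
structure UniformizingChart (M : Type*) [TopologicalSpace M] where
  dom : Set (ℂ × ℂ)
  isOpen_dom : IsOpen dom
  Γ : Subgroup (Equiv.Perm (ℂ × ℂ))
  finite : Finite Γ
  maps_dom : ∀ γ ∈ Γ, ∀ z ∈ dom, γ z ∈ dom
  smooth_act : ∀ γ ∈ Γ, ContDiffOn ℝ ∞ γ dom
  effective : ∀ γ ∈ Γ, ∀ z ∈ dom, (∀ᶠ y in 𝓝 z, γ y = y) → γ = 1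
  map : ℂ × ℂ → M
  continuousOn_map : ContinuousOn map dom
  isOpen_image : ∀ W ⊆ dom, IsOpen W → IsOpen (map '' W)
  map_eq_iff : ∀ z ∈ dom, ∀ w ∈ dom, map z = map w ↔ ∃ γ ∈ Γ, γ z = w
  form : ℂ × ℂ → (ℂ × ℂ) [⋀^Fin 2]→L[ℝ] ℝ
  smooth_form : ContDiffOn ℝ ∞ form dom
  closed_form : ∀ z ∈ dom, extDeriv form z = 0
  nondegenerate_form : ∀ z ∈ dom, ∀ u, (∀ v, form z ![u, v] = 0) → u = 0
  invariant_form : ∀ γ ∈ Γ, ∀ z ∈ dom,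
    (form (γ z)).compContinuousLinearMap (fderiv ℝ γ z) = form z

/-- `h` is a diffeomorphism from a neighbourhood of `z` in `U` onto a neighbourhood of `w` in the
domain of the chart `d`, and it lifts the map `f` through `d`. -/
structure IsLocalLift {M : Type*} [TopologicalSpace M]
    (h : OpenPartialHomeomorph (ℂ × ℂ) (ℂ × ℂ)) (U : Set (ℂ × ℂ)) (f : ℂ × ℂ → M)
    (d : UniformizingChart M) (z w : ℂ × ℂ) : Prop where
  mem_source : z ∈ h.source
  map_point : h z = w
  source_subset : h.source ⊆ U
  target_subset : h.target ⊆ d.dom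
  smooth : ContDiffOn ℝ ∞ h h.source
  smooth_symm : ContDiffOn ℝ ∞ h.symm h.target
  lifts : ∀ y ∈ h.source, d.map (h y) = f y

/-- `h^* β = α`. -/
def PreservesForm (h : OpenPartialHomeomorph (ℂ × ℂ) (ℂ × ℂ))
    (α β : ℂ × ℂ → (ℂ × ℂ) [⋀^Fin 2]→L[ℝ] ℝ) : Prop :=
  ∀ y ∈ h.source, (β (h y)).compContinuousLinearMap (fderiv ℝ h y) = α y

/-- `h^* β` and `α` define the same orientation. -/
def PreservesOrientation (h : OpenPartialHomeomorph (ℂ × ℂ) (ℂ × ℂ))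
    (α β : ℂ × ℂ → (ℂ × ℂ) [⋀^Fin 2]→L[ℝ] ℝ) : Prop :=
  ∀ y ∈ h.source,
    0 < pfaffian ((β (h y)).compContinuousLinearMap (fderiv ℝ h y)) * pfaffian (α y)

/-- The structure of a closed symplectic orbifold of dimension four on `M`: an atlas of compatible
symplectic uniformizing charts on a compact Hausdorff space. -/
structure SymplecticOrbifold (M : Type*) [TopologicalSpace M] where
  compact : CompactSpace M
  hausdorff : T2Space M
  charts : Set (UniformizingChart M)
  cover : ∀ m : M, ∃ c ∈ charts, ∃ z ∈ c.dom, c.map z = m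
  compatible : ∀ c ∈ charts, ∀ d ∈ charts, ∀ z ∈ c.dom, ∀ w ∈ d.dom, d.map w = c.map z →
    ∃ h, IsLocalLift h c.dom c.map d z w ∧ PreservesForm h c.form d.form

/-- `f : U → M`, with `U` open in `ℂ²` carrying the standard form, is symplectic and a local
diffeomorphism of orbifolds. -/
def IsLocalSymplecto {M : Type*} [TopologicalSpace M] (O : SymplecticOrbifold M)
    (U : Set (ℂ × ℂ)) (f : ℂ × ℂ → M) : Prop :=
  ∀ z ∈ U, ∀ d ∈ O.charts, ∀ w ∈ d.dom, d.map w = f z →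
    ∃ h, IsLocalLift h U f d z w ∧ PreservesForm h (fun _ => stdForm2) d.form

/-- `ψ` is a Darboux chart of `M` on the open set `B ⊆ ℂ²` which is centered at `m`
(in particular `m` is a smooth point). -/
structure IsDarbouxChart {M : Type*} [TopologicalSpace M] (O : SymplecticOrbifold M)
    (B : Set (ℂ × ℂ)) (ψ : ℂ × ℂ → M) (m : M) : Prop where
  isOpen : IsOpen B
  zero_mem : (0 : ℂ × ℂ) ∈ B
  map_zero : ψ 0 = m
  injOn : Set.InjOn ψ B
  symplectic : IsLocalSymplecto O B ψ

/-! ### Weighted blowups -/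

/-- `|z₁|² / q + |z₂|² / p`; the ellipsoid `δ E(q, p)` is the set where this is at most `δ`. -/
def gauge (p q : ℕ) (z : ℂ × ℂ) : ℝ := ‖z.1‖ ^ 2 / q + ‖z.2‖ ^ 2 / p

/-- `z` and `w` lie on the same leaf of the characteristic foliation of the boundary of
`δ E(q, p)`: they are joined by a smooth curve in this boundary whose velocity is in the kernel
of the restriction of the standard symplectic form to the boundary. -/
def SameCharacteristicLeaf (p q : ℕ) (δ : ℝ) (z w : ℂ × ℂ) : Prop :=
  ∃ c : ℝ → ℂ × ℂ, ContDiff ℝ ∞ c ∧ c 0 = z ∧ c 1 = w ∧ (∀ t, gauge p q (c t) = δ) ∧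
    ∀ t v, fderiv ℝ (gauge p q) (c t) v = 0 → stdForm2 ![deriv c t, v] = 0

/-- The phase of a complex number, with value `1` at `0`. -/
def phase (u : ℂ) : ℂ := if u = 0 then 1 else u / (‖u‖ : ℂ)

/-- Domain of the first orbifold chart of the collapsed ellipsoid boundary. -/
def exceptionalDom₁ (p q : ℕ) (δ : ℝ) : Set (ℂ × ℂ) :=
  {y | q * ‖y.1‖ ^ 2 < p * q * δ + ‖y.2‖ ^ 2}

/-- The first orbifold chart of the collapsed ellipsoid boundary, before the collapse. It sends
`(w, u)` to the point `(λ ^ p r, λ ^ q w)`, where `λ = u / |u|` and the real number `r > 0` is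
such that `p r² + q |w|² = p q δ + |u|²`. After the collapse this is smooth also at `u = 0`, where
another choice of `λ` gives a point of the same leaf, and it is the quotient by the cyclic group of
order `p` that acts by `ξ (w, u) = (ξ ^ q w, ξ⁻¹ u)`. -/
def exceptionalMap₁ (p q : ℕ) (δ : ℝ) (y : ℂ × ℂ) : ℂ × ℂ :=
  (phase y.2 ^ p * (Real.sqrt ((p * q * δ + ‖y.2‖ ^ 2 - q * ‖y.1‖ ^ 2) / p) : ℂ),
    phase y.2 ^ q * y.1)

/-- Domain of the second orbifold chart. -/
def exceptionalDom₂ (p q : ℕ) (δ : ℝ) : Set (ℂ × ℂ) :=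
  {y | p * ‖y.1‖ ^ 2 < p * q * δ + ‖y.2‖ ^ 2}

/-- The second orbifold chart, in which the roles of the two coordinates are exchanged; here the
group is cyclic of order `q`. -/
def exceptionalMap₂ (p q : ℕ) (δ : ℝ) (y : ℂ × ℂ) : ℂ × ℂ :=
  (phase y.2 ^ p * y.1,
    phase y.2 ^ q * (Real.sqrt ((p * q * δ + ‖y.2‖ ^ 2 - p * ‖y.1‖ ^ 2) / q) : ℂ))

/-- The orbifold `O'` on `M'` is the `(p, q)`-weighted blowup of size `δ` of `O` at the point `m`,
performed in the Darboux chart `ψ : B → M` and with collapse map `κ`. The interior of `δ E(q, p)`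
is removed and its boundary is collapsed along the characteristic leaves; away from the
exceptional divisor `κ` is an orientation preserving diffeomorphism of orbifolds, and on the part
of the blowup that comes from the Darboux chart (which contains the exceptional divisor) the smooth
and the symplectic structure are those of the collapsed standard space. -/
structure IsWeightedBlowup {M M' : Type*} [TopologicalSpace M] [TopologicalSpace M']
    (O : SymplecticOrbifold M) (m : M) (p q : ℕ) (δ : ℝ) (B : Set (ℂ × ℂ)) (ψ : ℂ × ℂ → M)
    (O' : SymplecticOrbifold M') (κ : M → M') : Prop where
  size_pos : 0 < δ
  darboux : IsDarbouxChart O B ψ m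
  ellipsoid_subset : {z | gauge p q z ≤ δ} ⊆ B
  /-- `M'` is a topological quotient of the complement of the interior of the ellipsoid. -/
  quotient : Topology.IsQuotientMap ((ψ '' {z | gauge p q z < δ})ᶜ.domRestrict κ)
  /-- Exactly the characteristic leaves of the boundary are collapsed. -/
  collapse : ∀ a ∉ ψ '' {z | gauge p q z < δ}, ∀ b ∉ ψ '' {z | gauge p q z < δ},
    κ a = κ b ↔ a = b ∨
      ∃ z w, gauge p q z = δ ∧ gauge p q w = δ ∧ SameCharacteristicLeaf p q δ z w ∧
        a = ψ z ∧ b = ψ w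
  diffeo_outside : ∀ c ∈ O.charts, ∀ z ∈ c.dom, c.map z ∉ ψ '' {z | gauge p q z ≤ δ} →
    ∀ d ∈ O'.charts, ∀ w ∈ d.dom, d.map w = κ (c.map z) →
      ∃ h, IsLocalLift h c.dom (fun y => κ (c.map y)) d z w ∧
        PreservesOrientation h c.form d.form
  exceptional₁ : IsLocalSymplecto O' (exceptionalDom₁ p q δ ∩ exceptionalMap₁ p q δ ⁻¹' B)
    (fun y => κ (ψ (exceptionalMap₁ p q δ y)))
  exceptional₂ : IsLocalSymplecto O' (exceptionalDom₂ p q δ ∩ exceptionalMap₂ p q δ ⁻¹' B)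
    (fun y => κ (ψ (exceptionalMap₂ p q δ y)))

/-! ### Symplectic circle actions on six-manifolds -/

section Manifold

variable {X : Type*} [TopologicalSpace X] [ChartedSpace (EuclideanSpace ℝ (Fin 6)) X]

/-- The expression of a two-form on `X` in the preferred chart at `x`. -/
def formInChart (Ω : (x : X) → TangentSpace (𝓡 6) x [⋀^Fin 2]→L[ℝ] ℝ) (x : X)
    (y : EuclideanSpace ℝ (Fin 6)) : EuclideanSpace ℝ (Fin 6) [⋀^Fin 2]→L[ℝ] ℝ :=
  (Ω ((extChartAt (𝓡 6) x).symm y)).compContinuousLinearMap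
    (mfderiv 𝓘(ℝ, EuclideanSpace ℝ (Fin 6)) (𝓡 6) (extChartAt (𝓡 6) x).symm y)

/-- Smooth, closed, nondegenerate two-forms. -/
structure IsSymplecticForm (Ω : (x : X) → TangentSpace (𝓡 6) x [⋀^Fin 2]→L[ℝ] ℝ) : Prop where
  smooth : ∀ x, ContDiffOn ℝ ∞ (formInChart Ω x) (extChartAt (𝓡 6) x).target
  closed : ∀ x, ∀ y ∈ (extChartAt (𝓡 6) x).target, extDeriv (formInChart Ω x) y = 0
  nondegenerate : ∀ (x : X) (u : TangentSpace (𝓡 6) x),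
    (∀ v : TangentSpace (𝓡 6) x, Ω x ![u, v] = 0) → u = 0

variable [MulAction Circle X]

/-- The action preserves the form: `g^* Ω = Ω`. -/
def IsInvariantForm (Ω : (x : X) → TangentSpace (𝓡 6) x [⋀^Fin 2]→L[ℝ] ℝ) : Prop :=
  ∀ (g : Circle) (x : X),
    (Ω (g • x)).compContinuousLinearMap (mfderiv (𝓡 6) (𝓡 6) (fun y : X => g • y) x) = Ω x

/-- The vector field `d/dt (e^{2πit} • x)` at `t = 0`. -/
def generator (x : X) : TangentSpace (𝓡 6) x :=
  (mfderiv 𝓘(ℝ, ℝ) (𝓡 6) (fun t : ℝ => Circle.exp (2 * Real.pi * t) • x) 0 (1 : ℝ) :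
    EuclideanSpace ℝ (Fin 6))

/-- `Φ` is a moment map with values in `ℝ / Tℤ`: locally it lifts to a smooth function `f` with
`df = Ω(·, ξ)`, where `ξ` generates the action. For `T = 0` it is real valued. -/
def IsMomentMap (Ω : (x : X) → TangentSpace (𝓡 6) x [⋀^Fin 2]→L[ℝ] ℝ) {T : ℝ}
    (Φ : X → AddCircle T) : Prop :=
  ∀ x : X, ∃ U : Set X, IsOpen U ∧ x ∈ U ∧ ∃ f : X → ℝ, ContMDiffOn (𝓡 6) 𝓘(ℝ, ℝ) ∞ f U ∧
    ∀ y ∈ U, Φ y = (f y : AddCircle T) ∧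
      ∀ v : TangentSpace (𝓡 6) y,
        (mfderiv (𝓡 6) 𝓘(ℝ, ℝ) f y v : ℝ) = Ω y ![v, generator y]

/-- The linear circle action on `ℂ³` with weights `(a, b, c)`. -/
def weightAct (a b c : ℤ) (g : Circle) (z : ℂ × ℂ × ℂ) : ℂ × ℂ × ℂ :=
  (((g ^ a : Circle) : ℂ) * z.1, ((g ^ b : Circle) : ℂ) * z.2.1, ((g ^ c : Circle) : ℂ) * z.2.2)

/-- `x` is a fixed point whose isotropy weights are `(a, b, c)`: the isotropy representation on the
symplectic vector space `(T_x X, Ω_x)` is isomorphic to the standard space `ℂ³` on which the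
circle acts with these weights. -/
def HasIsotropyWeights (Ω : (x : X) → TangentSpace (𝓡 6) x [⋀^Fin 2]→L[ℝ] ℝ) (x : X)
    (a b c : ℤ) : Prop :=
  (∀ g : Circle, g • x = x) ∧
  ∃ A : (ℂ × ℂ × ℂ) ≃L[ℝ] TangentSpace (𝓡 6) x,
    (∀ u v, Ω x ![A u, A v] = stdForm3 ![u, v]) ∧
    ∀ (g : Circle) (u : ℂ × ℂ × ℂ),
      (mfderiv (𝓡 6) (𝓡 6) (fun y : X => g • y) x (A u) : EuclideanSpace ℝ (Fin 6)) =
        A (weightAct a b c g u)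

/-- The moment map of the action on `ℂ³` with weights `(a, b, c)`. -/
def stdMoment (a b c : ℤ) (z : ℂ × ℂ × ℂ) : ℝ :=
  a * ‖z.1‖ ^ 2 + b * ‖z.2.1‖ ^ 2 + c * ‖z.2.2‖ ^ 2

/-- `Ψ` is an equivariant Darboux chart of `X` centered at `x`, defined on the polydisc of radius
`r` in `ℂ³` on which the circle acts with weights `(a, b, c)`. -/
structure IsEquivariantDarbouxChart
    (Ω : (x : X) → TangentSpace (𝓡 6) x [⋀^Fin 2]→L[ℝ] ℝ) (x : X) (a b c : ℤ) (r : ℝ)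
    (Ψ : ℂ × ℂ × ℂ → X) : Prop where
  map_zero : Ψ 0 = x
  smooth : ContMDiffOn 𝓘(ℝ, ℂ × ℂ × ℂ) (𝓡 6) ∞ Ψ (Metric.ball 0 r)
  injOn : Set.InjOn Ψ (Metric.ball 0 r)
  equivariant : ∀ z ∈ Metric.ball (0 : ℂ × ℂ × ℂ) r, ∀ g : Circle,
    Ψ (weightAct a b c g z) = g • Ψ z
  symplectic : ∀ z ∈ Metric.ball (0 : ℂ × ℂ × ℂ) r,
    (Ω (Ψ z)).compContinuousLinearMap (mfderiv 𝓘(ℝ, ℂ × ℂ × ℂ) (𝓡 6) Ψ z) = stdForm3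

end Manifold

/-! ### Reduced spaces -/

section Reduced

variable {X : Type*} [MulAction Circle X] {T : ℝ}

/-- Two points of the level set of `Φ` at `l` are equivalent if they lie on one circle orbit. -/
def levelSetoid (Φ : X → AddCircle T) (l : AddCircle T) : Setoid {x : X // Φ x = l} where
  r a b := ∃ g : Circle, g • a.1 = b.1
  iseqv :=
    { refl := fun a => ⟨1, one_smul _ a.1⟩
      symm := fun {a b} ⟨g, hg⟩ => ⟨g⁻¹, by rw [← hg, inv_smul_smul]⟩
      trans := fun {a b c} ⟨g, hg⟩ ⟨k, hk⟩ => ⟨k * g, by rw [mul_smul, hg, hk]⟩ }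

/-- The reduced space `Φ⁻¹(l) / S¹`. -/
def ReducedSpace (Φ : X → AddCircle T) (l : AddCircle T) : Type _ :=
  Quotient (levelSetoid Φ l)

instance [TopologicalSpace X] (Φ : X → AddCircle T) (l : AddCircle T) :
    TopologicalSpace (ReducedSpace Φ l) :=
  inferInstanceAs (TopologicalSpace (Quotient (levelSetoid Φ l)))

/-- The image in the reduced space of a point of the level set. -/
def ReducedSpace.mk (Φ : X → AddCircle T) (l : AddCircle T) (x : X) (hx : Φ x = l) :
    ReducedSpace Φ l :=
  Quotient.mk (levelSetoid Φ l) ⟨x, hx⟩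

variable [TopologicalSpace X] [ChartedSpace (EuclideanSpace ℝ (Fin 6)) X]

/-- On the set `S`, the symplectic orbifold structure `O` on the reduced space is the one that
comes from `(X, Ω)` by reduction: locally each chart lifts to a smooth map `σ` into the level set,
and `σ^* Ω` is the form of the chart. -/
def IsReductionOn (Ω : (x : X) → TangentSpace (𝓡 6) x [⋀^Fin 2]→L[ℝ] ℝ)
    (Φ : X → AddCircle T) (l : AddCircle T) (O : SymplecticOrbifold (ReducedSpace Φ l))
    (S : Set (ReducedSpace Φ l)) : Prop :=
  ∀ c ∈ O.charts, ∀ z ∈ c.dom, c.map z ∈ S →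
    ∃ (W : Set (ℂ × ℂ)) (σ : ℂ × ℂ → X), IsOpen W ∧ z ∈ W ∧ W ⊆ c.dom ∧
      ContMDiffOn 𝓘(ℝ, ℂ × ℂ) (𝓡 6) ∞ σ W ∧
      ∀ y ∈ W, (∃ hy : Φ (σ y) = l, c.map y = ReducedSpace.mk Φ l (σ y) hy) ∧
        (Ω (σ y)).compContinuousLinearMap (mfderiv 𝓘(ℝ, ℂ × ℂ) (𝓡 6) σ y) = c.form y

end Reduced

/-- The point `(z₁, z₂, √(p |z₁|² + q |z₂|² - s))` of `ℂ³`; where the radicand is nonnegative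
it lies on the level `s` of `p |z₁|² + q |z₂|² - |z₃|²`. -/
def levelSection (p q : ℕ) (s : ℝ) (z : ℂ × ℂ) : ℂ × ℂ × ℂ :=
  (z.1, z.2, (Real.sqrt (p * ‖z.1‖ ^ 2 + q * ‖z.2‖ ^ 2 - s) : ℂ))

end SymplecticReduction

end

open SymplecticReduction

noncomputable section

set_option linter.unusedSectionVars false

namespace SymplecticReduction

local notation "E₆" => EuclideanSpace ℝ (Fin 6)

local notation "ℂ²" => ℂ × ℂ

local notation "ℂ³" => ℂ × ℂ × ℂ

/-! ### Smoothness of the composition operator -/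

section CompositionOperator

variable {K : Type} [TopologicalSpace K] [CompactSpace K]

/-- Pointwise application of a continuous family of continuous linear maps. -/
def pointwiseApply (K : Type) [TopologicalSpace K] [CompactSpace K] (E F : Type)
    [NormedAddCommGroup E] [NormedSpace ℝ E] [NormedAddCommGroup F] [NormedSpace ℝ F] :
    C(K, E →L[ℝ] F) →L[ℝ] C(K, E) →L[ℝ] C(K, F) :=
  LinearMap.mkContinuous₂
    (LinearMap.mk₂ ℝ (fun (A : C(K, E →L[ℝ] F)) (h : C(K, E)) =>
      (⟨fun t => A t (h t), by fun_prop⟩ : C(K, F)))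
      (fun _ _ _ => by ext; simp) (fun _ _ _ => by ext; simp)
      (fun _ _ _ => by ext; simp) (fun _ _ _ => by ext; simp)) 1
    (fun A h => by
      refine (ContinuousMap.norm_le _ (by positivity)).2 fun t => ?_
      simp only [LinearMap.mk₂_apply, ContinuousMap.coe_mk, one_mul]
      exact ((A t).le_opNorm _).trans
        (mul_le_mul (A.norm_coe_le_norm t) (h.norm_coe_le_norm t) (norm_nonneg _) (by positivity)))

variable {E F : Type} [NormedAddCommGroup E] [NormedSpace ℝ E] [NormedAddCommGroup F]
  [NormedSpace ℝ F]

theorem hasFDerivAt_comp_continuousMap (f : C(E, F)) (f' : C(E, E →L[ℝ] F))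
    (hf : ∀ x, HasFDerivAt f (f' x) x) (γ : C(K, E)) :
    HasFDerivAt (fun γ : C(K, E) => f.comp γ) (pointwiseApply K E F (f'.comp γ)) γ := by
  rw [hasFDerivAt_iff_isLittleO_nhds_zero, Asymptotics.isLittleO_iff]
  intro ε hε
  have hc : ContinuousAt (fun η : C(K, E) => f'.comp η) γ :=
    (ContinuousMap.continuous_postcomp f').continuousAt
  obtain ⟨δ, hδ, hδ'⟩ := (Metric.continuousAt_iff (α := C(K, E)) (β := C(K, E →L[ℝ] F))).1 hc ε hε
  filter_upwards [Metric.ball_mem_nhds (0 : C(K, E)) hδ] with h hh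
  refine (ContinuousMap.norm_le _ (by positivity)).2 fun t => ?_
  have key := Convex.norm_image_sub_le_of_norm_hasFDerivWithin_le' (f := f) (f' := fun x => f' x)
    (s := segment ℝ (γ t) (γ t + h t)) (x := γ t) (y := γ t + h t) (φ := f' (γ t)) (C := ε)
    (fun x _ => (hf x).hasFDerivWithinAt) (by
      rintro x ⟨a, b, ha, hb, hab, rfl⟩
      have hη : dist (γ + b • h) γ < δ := by
        rw [dist_eq_norm, add_sub_cancel_left, norm_smul, Real.norm_of_nonneg hb]
        rw [mem_ball_zero_iff] at hh
        have : b ≤ 1 := by linarith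
        nlinarith [norm_nonneg h]
      have h1 := (ContinuousMap.dist_lt_iff hε).1 (hδ' hη) t
      have e : a • γ t + b • (γ t + h t) = (γ + b • h) t := by
        simp only [ContinuousMap.add_apply, ContinuousMap.smul_apply, smul_add, ← add_assoc,
          ← add_smul, hab, one_smul]
      rw [e, ← dist_eq_norm]
      exact h1.le) (convex_segment _ _) (left_mem_segment _ _ _) (right_mem_segment _ _ _)
  rw [add_sub_cancel_left] at key
  exact key.trans (mul_le_mul_of_nonneg_left (h.norm_coe_le_norm t) hε.le)

theorem contDiff_comp_continuousMap_nat (n : ℕ) : ∀ {F : Type} [NormedAddCommGroup F]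
    [NormedSpace ℝ F] (f : C(E, F)), ContDiff ℝ n f →
    ContDiff ℝ n (fun γ : C(K, E) => f.comp γ) := by
  induction n with
  | zero =>
    intro F _ _ f _
    exact contDiff_zero.2 (ContinuousMap.continuous_postcomp f)
  | succ n ih =>
    intro F _ _ f hf
    obtain ⟨f', hf', hd⟩ := contDiff_succ_iff_hasFDerivAt.1 (by exact_mod_cast hf)
    push_cast
    refine contDiff_succ_iff_hasFDerivAt.2
      ⟨_, ?_, fun γ => hasFDerivAt_comp_continuousMap f ⟨f', hf'.continuous⟩ hd γ⟩
    exact (pointwiseApply K E F).contDiff.comp (ih ⟨f', hf'.continuous⟩ hf')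

theorem contDiff_comp_continuousMap (f : C(E, F)) (hf : ContDiff ℝ ∞ f) :
    ContDiff ℝ ∞ (fun γ : C(K, E) => f.comp γ) :=
  contDiff_infty.2 fun n => contDiff_comp_continuousMap_nat n f (hf.of_le (by exact_mod_cast le_top))

end CompositionOperator

/-! ### Local inverses -/

theorem exists_smooth_localInverse {E F : Type*} [NormedAddCommGroup E] [NormedSpace ℝ E]
    [CompleteSpace E] [NormedAddCommGroup F] [NormedSpace ℝ F] {f : E → F} {U : Set E}
    (hU : IsOpen U) (hf : ContDiffOn ℝ ∞ f U) {a : E} (ha : a ∈ U) {f' : E ≃L[ℝ] F}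
    (hf' : HasFDerivAt f (f' : E →L[ℝ] F) a) :
    ∃ h : OpenPartialHomeomorph E F, a ∈ h.source ∧ h.source ⊆ U ∧ (∀ y, h y = f y) ∧
      ContDiffOn ℝ ∞ h.symm h.target ∧
      ∀ y ∈ h.source, fderiv ℝ f y ∈ Set.range ((↑) : (E ≃L[ℝ] F) → (E →L[ℝ] F)) := by
  have hfa : ContDiffAt ℝ ∞ f a := hf.contDiffAt (hU.mem_nhds ha)
  set h₀ := hfa.toOpenPartialHomeomorph f hf' (by simp) with hh₀
  have hcont : ContinuousOn (fderiv ℝ f) U := (hf.continuousOn_fderiv_of_isOpen hU (by simp))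
  set V : Set E := U ∩ fderiv ℝ f ⁻¹' Set.range ((↑) : (E ≃L[ℝ] F) → (E →L[ℝ] F)) with hV
  have hVo : IsOpen V := hcont.isOpen_inter_preimage hU ContinuousLinearEquiv.isOpen
  have haV : a ∈ V := ⟨ha, by rw [Set.mem_preimage, hf'.fderiv]; exact ⟨f', rfl⟩⟩
  refine ⟨h₀.restrOpen V hVo, ⟨hfa.mem_toOpenPartialHomeomorph_source hf' (by simp), haV⟩,
    fun y hy => hy.2.1, fun y => rfl, ?_, fun y hy => hy.2.2⟩
  intro y hy
  set h := h₀.restrOpen V hVo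
  have hs : h.symm y ∈ h.source := h.map_target hy
  obtain ⟨e, he⟩ := hs.2.2
  have hd : ContDiffAt ℝ ∞ f (h.symm y) := hf.contDiffAt (hU.mem_nhds hs.2.1)
  refine (h.contDiffAt_symm hy (f₀' := e) ?_ hd).contDiffWithinAt
  rw [he]
  exact (hd.differentiableAt (by simp)).hasFDerivAt

theorem exists_localDiffeo {E F : Type*} [NormedAddCommGroup E] [NormedSpace ℝ E]
    [FiniteDimensional ℝ E] [NormedAddCommGroup F] [NormedSpace ℝ F] [FiniteDimensional ℝ F]
    (hdim : Module.finrank ℝ E = Module.finrank ℝ F) {f : E → F} {U : Set E}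
    (hU : IsOpen U) (hf : ContDiffOn ℝ ∞ f U) {a : E} (ha : a ∈ U)
    (hinj : ∀ u, fderiv ℝ f a u = 0 → u = 0) :
    ∃ h : OpenPartialHomeomorph E F, a ∈ h.source ∧ h.source ⊆ U ∧ (∀ y, h y = f y) ∧
      ContDiffOn ℝ ∞ h.symm h.target ∧
      ∀ y ∈ h.source, ∀ u, fderiv ℝ f y u = 0 → u = 0 := by
  have : CompleteSpace E := FiniteDimensional.complete ℝ E
  have hi : Function.Injective (fderiv ℝ f a) :=
    (injective_iff_map_eq_zero (fderiv ℝ f a)).2 hinj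
  let f' : E ≃L[ℝ] F := (LinearEquiv.ofInjectiveOfFinrankEq (fderiv ℝ f a).toLinearMap hi
    hdim).toContinuousLinearEquiv
  have hf' : HasFDerivAt f (f' : E →L[ℝ] F) a := by
    have h1 := ((hf.contDiffAt (hU.mem_nhds ha)).differentiableAt (by simp)).hasFDerivAt
    convert h1
    ext u; rfl
  obtain ⟨h, h1, h2, h3, h4, h5⟩ := exists_smooth_localInverse hU hf ha hf'
  refine ⟨h, h1, h2, h3, h4, fun y hy u hu => ?_⟩
  obtain ⟨e, he⟩ := h5 y hy
  rw [← he] at hu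
  simpa using hu

/-! ### Ordinary differential equations: smooth dependence on parameters and initial values -/

section Flow

/-- The time interval on which integral curves are considered. -/
abbrev TimeInterval : Set ℝ := Set.Icc (-2) 2

/-- The extension of a function on the time interval that is constant outside. -/
def extendTime {E : Type} (γ : TimeInterval → E) (t : ℝ) : E :=
  Set.IccExtend (by norm_num : (-2 : ℝ) ≤ 2) γ t

theorem extendTime_of_mem {E : Type} (γ : TimeInterval → E) {t : ℝ} (ht : t ∈ TimeInterval) :
    extendTime γ t = γ ⟨t, ht⟩ := Set.IccExtend_of_mem _ _ ht

variable {P E : Type} [NormedAddCommGroup E] [NormedSpace ℝ E]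
  [NormedAddCommGroup P] [NormedSpace ℝ P]

omit [NormedSpace ℝ E] in
theorem continuous_extendTime (γ : C(TimeInterval, E)) : Continuous (extendTime γ) :=
  γ.continuous.Icc_extend'

/-- The operator that sends `γ` to its primitive with value zero at time zero. -/
def primitive (E : Type) [NormedAddCommGroup E] [NormedSpace ℝ E] :
    C(TimeInterval, E) →L[ℝ] C(TimeInterval, E) :=
  LinearMap.mkContinuous
    { toFun := fun γ => ⟨fun t => ∫ s in (0 : ℝ)..t, extendTime γ s,
        (intervalIntegral.continuous_primitive
          (fun a b => (continuous_extendTime γ).intervalIntegrable a b) 0).comp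
          continuous_subtype_val⟩
      map_add' := fun γ η => by
        ext t
        exact intervalIntegral.integral_add ((continuous_extendTime γ).intervalIntegrable _ _)
          ((continuous_extendTime η).intervalIntegrable _ _)
      map_smul' := fun c γ => by
        ext t
        exact intervalIntegral.integral_smul c _ } 2
    (fun γ => by
      refine (ContinuousMap.norm_le _ (by positivity)).2 fun t => ?_
      refine (intervalIntegral.norm_integral_le_of_norm_le_const (C := ‖γ‖)
        fun s _ => γ.norm_coe_le_norm _).trans ?_
      have h2 : |(t : ℝ) - 0| ≤ 2 := by rw [sub_zero]; exact abs_le.2 t.2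
      nlinarith [norm_nonneg γ])

theorem primitive_apply (γ : C(TimeInterval, E)) (t : TimeInterval) :
    primitive E γ t = ∫ s in (0 : ℝ)..t, extendTime γ s := rfl

theorem hasDerivAt_of_eq_primitive [CompleteSpace E] {γ η : C(TimeInterval, E)} {x : E}
    (h : γ = ContinuousMap.const _ x + primitive E η) {t : ℝ} (ht : t ∈ Set.Ioo (-2 : ℝ) 2) :
    HasDerivAt (extendTime γ) (extendTime η t) t := by
  have h1 : HasDerivAt (fun t => x + ∫ s in (0 : ℝ)..t, extendTime η s) (extendTime η t) t :=
    ((continuous_extendTime η).integral_hasStrictDerivAt 0 t).hasDerivAt.const_add x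
  refine h1.congr_of_eventuallyEq ?_
  filter_upwards [Ioo_mem_nhds ht.1 ht.2] with s hs
  rw [extendTime_of_mem _ (Set.Ioo_subset_Icc_self hs), h]
  rfl

/-- The linear part of `γ ↦ (t ↦ (t, π, γ t))`. -/
def graphLinear (P E : Type) [NormedAddCommGroup E] [NormedSpace ℝ E]
    [NormedAddCommGroup P] [NormedSpace ℝ P] :
    P × C(TimeInterval, E) →L[ℝ] C(TimeInterval, ℝ × P × E) :=
  LinearMap.mkContinuous
    { toFun := fun z => ⟨fun t => (0, z.1, z.2 t), by fun_prop⟩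
      map_add' := fun z w => by ext t <;> simp
      map_smul' := fun c z => by ext t <;> simp } 1
    (fun z => by
      refine (ContinuousMap.norm_le _ (by positivity)).2 fun t => ?_
      simp only [LinearMap.coe_mk, AddHom.coe_mk, ContinuousMap.coe_mk, one_mul]
      refine norm_prod_le_iff.2 ⟨by simp, norm_prod_le_iff.2 ⟨norm_fst_le z, ?_⟩⟩
      exact (z.2.norm_coe_le_norm t).trans (norm_snd_le z))

/-- The curve `t ↦ (t, π, γ t)`. -/
def graphPath (z : P × C(TimeInterval, E)) : C(TimeInterval, ℝ × P × E) :=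
  ⟨fun t => (t, z.1, z.2 t), by fun_prop⟩

theorem hasFDerivAt_graphPath (z : P × C(TimeInterval, E)) :
    HasFDerivAt (graphPath (P := P) (E := E)) (graphLinear P E) z := by
  have h : (graphPath (P := P) (E := E)) = fun z => graphPath 0 + graphLinear P E z := by
    funext z; ext t <;> simp [graphPath, graphLinear]
  rw [h]
  exact (graphLinear P E).hasFDerivAt.const_add _

theorem contDiff_graphPath : ContDiff ℝ ∞ (graphPath (P := P) (E := E)) := by
  have h : (graphPath (P := P) (E := E)) = fun z => graphPath 0 + graphLinear P E z := by
    funext z; ext t <;> simp [graphPath, graphLinear]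
  rw [h]
  exact contDiff_const.add (graphLinear P E).contDiff

/-- Constant curves. -/
def constCLM (E : Type) [NormedAddCommGroup E] [NormedSpace ℝ E] :
    E →L[ℝ] C(TimeInterval, E) :=
  ContinuousLinearMap.const ℝ TimeInterval

theorem constCLM_apply (x : E) : constCLM E x = ContinuousMap.const _ x := rfl

/-- A time-dependent differential equation `y' = f (t, π, y)` with parameter `π`, for which `y₀` is
a stationary point with vanishing linearization at the parameter `π₀`, has near `(π₀, y₀)` solutions
on the whole time interval, which depend smoothly on the parameter and on the initial value. -/
theorem exists_smooth_solution [CompleteSpace E] [CompleteSpace P] (f : C(ℝ × P × E, E))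
    (hf : ContDiff ℝ ∞ f)
    (π₀ : P) (y₀ : E) (h0 : ∀ t ∈ TimeInterval, f (t, π₀, y₀) = 0)
    (h1 : ∀ t ∈ TimeInterval, ∀ v, fderiv ℝ f (t, π₀, y₀) (0, 0, v) = 0) :
    ∃ (U : Set (P × E)) (G : P × E → C(TimeInterval, E)), IsOpen U ∧ (π₀, y₀) ∈ U ∧
      ContDiffOn ℝ ∞ G U ∧ G (π₀, y₀) = ContinuousMap.const _ y₀ ∧
      ∀ z ∈ U, G z = ContinuousMap.const _ z.2 + primitive E (f.comp (graphPath (z.1, G z))) := by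
  let Q : (P × E) × C(TimeInterval, E) → C(TimeInterval, E) := fun w =>
    w.2 - constCLM E w.1.2 - primitive E (f.comp (graphPath (w.1.1, w.2)))
  have hQ : ContDiff ℝ ∞ Q := by
    refine (contDiff_snd.sub ((constCLM E).contDiff.comp (contDiff_snd.comp contDiff_fst))).sub
      ((primitive E).contDiff.comp ((contDiff_comp_continuousMap f hf).comp
        (contDiff_graphPath.comp ((contDiff_fst.comp contDiff_fst).prodMk contDiff_snd))))
  let a : (P × E) × C(TimeInterval, E) := ((π₀, y₀), ContinuousMap.const _ y₀)
  let Q' := fderiv ℝ Q a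
  have hQ' : HasFDerivAt Q Q' a := (hQ.differentiable (by simp) a).hasFDerivAt
  have hQ2 : ∀ h, Q' (0, h) = h := by
    intro h
    have hd : HasFDerivAt (fun γ : C(TimeInterval, E) => Q ((π₀, y₀), γ))
        (ContinuousLinearMap.id ℝ _ - 0 - (primitive E).comp
          ((pointwiseApply TimeInterval (ℝ × P × E) E
            ((⟨fderiv ℝ f, hf.continuous_fderiv (by simp)⟩ : C(ℝ × P × E, _)).comp
              (graphPath (π₀, ContinuousMap.const _ y₀)))).comp
            ((graphLinear P E).comp (ContinuousLinearMap.inr ℝ P _))))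
        (ContinuousMap.const _ y₀) := by
      refine HasFDerivAt.fun_sub (f := fun γ => id γ - constCLM E y₀)
        (g := fun γ => primitive E (f.comp (graphPath (π₀, γ))))
        ((hasFDerivAt_id _).fun_sub (hasFDerivAt_const (constCLM E y₀) _)) ?_
      refine (primitive E).hasFDerivAt.comp (f := fun γ : C(TimeInterval, E) =>
          f.comp (graphPath (π₀, γ))) _ ?_
      refine (hasFDerivAt_comp_continuousMap f _
        (fun x => (hf.differentiable (by simp) x).hasFDerivAt) _).comp
          (f := fun γ : C(TimeInterval, E) => graphPath (π₀, γ)) _ ?_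
      exact (hasFDerivAt_graphPath (π₀, ContinuousMap.const _ y₀)).comp
        (f := fun γ : C(TimeInterval, E) => (π₀, γ)) _ (hasFDerivAt_prodMk_right _ _)
    have hd' : HasFDerivAt (fun γ : C(TimeInterval, E) => Q ((π₀, y₀), γ))
        (Q'.comp (ContinuousLinearMap.inr ℝ (P × E) _)) (ContinuousMap.const _ y₀) :=
      hQ'.comp (f := fun γ : C(TimeInterval, E) => ((π₀, y₀), γ)) _ (hasFDerivAt_prodMk_right _ _)
    have := congrArg (fun L => L h) (hd'.unique hd)
    simp only [ContinuousLinearMap.comp_apply, ContinuousLinearMap.inr_apply] at this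
    rw [this]
    have hz : (pointwiseApply TimeInterval (ℝ × P × E) E
            ((⟨fderiv ℝ f, hf.continuous_fderiv (by simp)⟩ : C(ℝ × P × E, _)).comp
              (graphPath (π₀, ContinuousMap.const _ y₀)))) (graphLinear P E (0, h)) = 0 := by
      ext t
      exact h1 t t.2 (h t)
    simp [hz]
  let e : ((P × E) × C(TimeInterval, E)) ≃L[ℝ] ((P × E) × C(TimeInterval, E)) :=
    ContinuousLinearEquiv.skewProd (ContinuousLinearEquiv.refl ℝ _)
      (ContinuousLinearEquiv.refl ℝ _) (Q'.comp (ContinuousLinearMap.inl ℝ _ _))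
  have hΞ' : HasFDerivAt (fun w : (P × E) × C(TimeInterval, E) => (w.1, Q w))
      (e : _ →L[ℝ] _) a := by
    have he : (e : _ →L[ℝ] _) = (ContinuousLinearMap.fst ℝ _ _).prod Q' := ?_
    · rw [he]
      exact hasFDerivAt_fst.prodMk hQ'
    refine ContinuousLinearMap.ext fun w => ?_
    have : w = (w.1, 0) + (0, w.2) := by simp
    have h3 : Q' w = Q' (w.1, 0) + w.2 := by
      conv_lhs => rw [this, map_add, hQ2]
    simp [e, h3, add_comm]
  obtain ⟨h, h1, -, h3, h4, -⟩ := exists_smooth_localInverse isOpen_univ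
    (contDiff_fst.prodMk hQ).contDiffOn (Set.mem_univ a) hΞ'
  have hQa : Q a = 0 := by
    have : f.comp (graphPath (π₀, ContinuousMap.const _ y₀)) = 0 := by
      ext t; exact h0 t t.2
    simp [Q, a, this, constCLM_apply]
  have hha : h a = ((π₀, y₀), 0) := by rw [h3, hQa]
  refine ⟨(fun z => (z, 0)) ⁻¹' h.target, fun z => (h.symm (z, 0)).2,
    h.open_target.preimage (by fun_prop), ?_, ?_, ?_, ?_⟩
  · rw [Set.mem_preimage, ← hha]; exact h.map_source h1
  · exact contDiff_snd.comp_contDiffOn (h4.comp (contDiff_id.prodMk contDiff_const).contDiffOn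
      fun z hz => hz)
  · change (h.symm ((π₀, y₀), 0)).2 = _
    rw [← hha, h.left_inv h1]
  · intro z hz
    have hr : (((h.symm (z, 0)).1, Q (h.symm (z, 0))) : (P × E) × C(TimeInterval, E)) = (z, 0) := by
      rw [← h3, h.right_inv hz]
    obtain ⟨hr1, hr2⟩ := Prod.ext_iff.1 hr
    simp only at hr1 hr2
    simp only [Q, hr1, sub_sub, constCLM_apply] at hr2
    exact sub_eq_zero.1 hr2

end Flow

section Flow

variable {P E : Type} [NormedAddCommGroup E] [NormedSpace ℝ E]
  [NormedAddCommGroup P] [NormedSpace ℝ P]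

/-- The variational equation. -/
theorem hasDerivAt_fderiv_solution [CompleteSpace E] {f : C(ℝ × P × E, E)} (hf : ContDiff ℝ ∞ f)
    {U : Set (P × E)} {G : P × E → C(TimeInterval, E)} (hU : IsOpen U)
    (hG : ContDiffOn ℝ ∞ G U)
    (hsol : ∀ z ∈ U, G z = ContinuousMap.const _ z.2 +
      primitive E (f.comp (graphPath (z.1, G z))))
    {z : P × E} (hz : z ∈ U) (u : P × E) {t : ℝ} (ht : t ∈ Set.Ioo (-2 : ℝ) 2) :
    HasDerivAt (fun t => extendTime (fderiv ℝ G z u) t)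
      (fderiv ℝ f (t, z.1, extendTime (G z) t) (0, u.1, extendTime (fderiv ℝ G z u) t)) t := by
  have hGz : HasFDerivAt G (fderiv ℝ G z) z :=
    ((hG.contDiffAt (hU.mem_nhds hz)).differentiableAt (by simp)).hasFDerivAt
  let f' : C(ℝ × P × E, ℝ × P × E →L[ℝ] E) := ⟨fderiv ℝ f, hf.continuous_fderiv (by simp)⟩
  have h1 : HasFDerivAt (fun z : P × E => constCLM E z.2 +
      primitive E (f.comp (graphPath (z.1, G z))))
      ((constCLM E).comp (ContinuousLinearMap.snd ℝ P E) + (primitive E).comp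
        ((pointwiseApply TimeInterval (ℝ × P × E) E (f'.comp (graphPath (z.1, G z)))).comp
        ((graphLinear P E).comp
          ((ContinuousLinearMap.fst ℝ P E).prod (fderiv ℝ G z))))) z := by
    refine ((constCLM E).hasFDerivAt.comp (f := Prod.snd) z hasFDerivAt_snd).fun_add ?_
    refine (primitive E).hasFDerivAt.comp (f := fun z : P × E =>
      f.comp (graphPath (z.1, G z))) z ?_
    refine (hasFDerivAt_comp_continuousMap f f'
      (fun x => (hf.differentiable (by simp) x).hasFDerivAt) _).comp
        (f := fun z : P × E => graphPath (z.1, G z)) z ?_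
    exact (hasFDerivAt_graphPath (z.1, G z)).comp (f := fun z : P × E => (z.1, G z)) z
      (hasFDerivAt_fst.prodMk hGz)
  have h2 : HasFDerivAt G _ z := h1.congr_of_eventuallyEq
    (by filter_upwards [hU.mem_nhds hz] with w hw using hsol w hw)
  have h3 := congrArg (fun L => L u) (hGz.unique h2)
  have h4 := hasDerivAt_of_eq_primitive (x := u.2) h3 ht
  convert h4 using 1
  have ht' := Set.Ioo_subset_Icc_self ht
  rw [extendTime_of_mem _ ht', extendTime_of_mem _ ht', extendTime_of_mem _ ht']
  rfl

theorem hasFDerivAt_extendTime {G : P → C(TimeInterval, E)} {G' : P →L[ℝ] C(TimeInterval, E)}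
    {z : P} (hG : HasFDerivAt G G' z) (t : TimeInterval) :
    HasFDerivAt (fun z => extendTime (G z) t)
      ((ContinuousMap.evalCLM ℝ t).comp G') z := by
  have h := (ContinuousMap.evalCLM ℝ t : C(TimeInterval, E) →L[ℝ] E).hasFDerivAt.comp z hG
  refine h.congr_of_eventuallyEq (Filter.Eventually.of_forall fun z => ?_)
  exact extendTime_of_mem _ t.2

theorem contDiffOn_extendTime {G : P → C(TimeInterval, E)} {U : Set P}
    (hG : ContDiffOn ℝ ∞ G U) {t : ℝ} (ht : t ∈ TimeInterval) :
    ContDiffOn ℝ ∞ (fun z => extendTime (G z) t) U := by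
  have h := (ContinuousMap.evalCLM ℝ (⟨t, ht⟩ : TimeInterval) :
    C(TimeInterval, E) →L[ℝ] E).contDiff.comp_contDiffOn hG
  exact h.congr fun z _ => extendTime_of_mem _ ht

end Flow

/-! ### Cutting off and parametric integrals -/

theorem exists_contDiff_eventuallyEq {E F : Type*} [NormedAddCommGroup E] [NormedSpace ℝ E]
    [FiniteDimensional ℝ E] [NormedAddCommGroup F] [NormedSpace ℝ F] {O C : Set E}
    (hO : IsOpen O) (hC : IsClosed C) (hCO : C ⊆ O) {f : E → F} (hf : ContDiffOn ℝ ∞ f O) :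
    ∃ g : E → F, ContDiff ℝ ∞ g ∧ ∀ᶠ x in 𝓝ˢ C, g x = f x := by
  obtain ⟨u, hu, hCu, huO⟩ := normal_exists_closure_subset hC hO hCO
  obtain ⟨χ, h1, h2, -⟩ := exists_contMDiffMap_one_nhds_of_subset_interior (n := ⊤)
    𝓘(ℝ, E) hC (hCu.trans (interior_maximal subset_closure hu))
  refine ⟨fun x => χ x • f x, ?_, ?_⟩
  · have hχ : ContDiff ℝ ∞ χ := χ.contMDiff.contDiff
    refine contDiff_iff_contDiffAt.2 fun x => ?_
    by_cases hx : x ∈ O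
    · exact hχ.contDiffAt.smul (hf.contDiffAt (hO.mem_nhds hx))
    · have : ∀ᶠ y in 𝓝 x, χ y • f y = 0 := by
        filter_upwards [isClosed_closure.isOpen_compl.mem_nhds fun h => hx (huO h)] with y hy
        rw [h2 y hy, zero_smul]
      exact (contDiffAt_const (c := (0 : F))).congr_of_eventuallyEq this
  · filter_upwards [h1] with x hx
    rw [hx, one_smul]

theorem contDiffOn_parametric_integral {E F : Type} [NormedAddCommGroup E] [NormedSpace ℝ E]
    [FiniteDimensional ℝ E] [NormedAddCommGroup F] [NormedSpace ℝ F] [CompleteSpace F]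
    {O : Set (ℝ × E)} (hO : IsOpen O) {f : ℝ × E → F} (hf : ContDiffOn ℝ ∞ f O) {x₀ : E}
    (hx₀ : ∀ t ∈ Set.Icc (0 : ℝ) 1, (t, x₀) ∈ O) :
    ∃ U : Set E, IsOpen U ∧ x₀ ∈ U ∧ (∀ x ∈ U, ∀ t ∈ Set.Icc (0 : ℝ) 1, (t, x) ∈ O) ∧
      ContDiffOn ℝ ∞ (fun x => ∫ t in (0 : ℝ)..1, f (t, x)) U ∧
      ∀ x ∈ U, ∀ u, fderiv ℝ (fun x => ∫ t in (0 : ℝ)..1, f (t, x)) x u =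
        ∫ t in (0 : ℝ)..1, fderiv ℝ f (t, x) (0, u) := by
  have hK : IsCompact (Set.Icc (0 : ℝ) 1 ×ˢ {x₀}) := isCompact_Icc.prod isCompact_singleton
  have hKO : Set.Icc (0 : ℝ) 1 ×ˢ {x₀} ⊆ O := by
    rintro ⟨t, x⟩ ⟨ht, rfl⟩; exact hx₀ t ht
  obtain ⟨g, hg, hgf⟩ := exists_contDiff_eventuallyEq hO hK.isClosed hKO hf
  obtain ⟨O', hO', hKO', hgO'⟩ := mem_nhdsSet_iff_exists.1 hgf
  obtain ⟨S, U, hS, hU, hS', hU', hSU⟩ := generalized_tube_lemma isCompact_Icc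
    isCompact_singleton (hO'.inter hO) (Set.subset_inter hKO' hKO)
  have hmem : ∀ x ∈ U, ∀ t ∈ Set.Icc (0 : ℝ) 1, (t, x) ∈ O' ∩ O := fun x hx t ht =>
    hSU ⟨hS' ht, hx⟩
  let ĝ : C(ℝ × E × ℝ, F) := ⟨fun w => g (w.1, w.2.1), by have := hg.continuous; fun_prop⟩
  have hĝ : ContDiff ℝ ∞ ĝ := hg.comp (contDiff_fst.prodMk (contDiff_fst.comp contDiff_snd))
  have h1 : (1 : ℝ) ∈ TimeInterval := by norm_num
  let J : E → F := fun x => primitive F (ĝ.comp (graphPath (x, 0))) ⟨1, h1⟩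
  have hJ : ContDiff ℝ ∞ J :=
    (ContinuousMap.evalCLM ℝ (⟨1, h1⟩ : TimeInterval) : C(TimeInterval, F) →L[ℝ] F).contDiff.comp
      ((primitive F).contDiff.comp ((contDiff_comp_continuousMap ĝ hĝ).comp
        (contDiff_graphPath.comp (contDiff_id.prodMk contDiff_const))))
  have hsub : ∀ t ∈ Set.uIcc (0 : ℝ) 1, t ∈ TimeInterval := fun t ht => by
    rw [Set.uIcc_of_le zero_le_one] at ht
    exact ⟨by linarith [ht.1], by linarith [ht.2]⟩
  have hJf : ∀ x ∈ U, ∫ t in (0 : ℝ)..1, f (t, x) = J x := by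
    intro x hx
    refine intervalIntegral.integral_congr fun t ht => ?_
    rw [extendTime_of_mem _ (hsub t ht)]
    rw [Set.uIcc_of_le zero_le_one] at ht
    exact (hgO' (hmem x hx t ht).1).symm
  refine ⟨U, hU, by simpa using hU', fun x hx t ht => (hmem x hx t ht).2,
    hJ.contDiffOn.congr hJf, fun x hx u => ?_⟩
  have hev : (fun x => ∫ t in (0 : ℝ)..1, f (t, x)) =ᶠ[𝓝 x] J := by
    filter_upwards [hU.mem_nhds hx] with y hy using hJf y hy
  rw [hev.fderiv_eq]
  let ĝ' : C(ℝ × E × ℝ, ℝ × E × ℝ →L[ℝ] F) := ⟨fderiv ℝ ĝ, hĝ.continuous_fderiv (by simp)⟩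
  have hd : HasFDerivAt J ((ContinuousMap.evalCLM ℝ (⟨1, h1⟩ : TimeInterval)).comp
      ((primitive F).comp ((pointwiseApply TimeInterval (ℝ × E × ℝ) F
        (ĝ'.comp (graphPath (x, 0)))).comp ((graphLinear E ℝ).comp
          (ContinuousLinearMap.inl ℝ _ _))))) x := by
    refine (ContinuousMap.evalCLM ℝ (⟨1, h1⟩ : TimeInterval) :
      C(TimeInterval, F) →L[ℝ] F).hasFDerivAt.comp
      (f := fun x : E => primitive F (ĝ.comp (graphPath (x, 0)))) x ?_
    refine (primitive F).hasFDerivAt.comp (f := fun x : E => ĝ.comp (graphPath (x, 0))) x ?_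
    refine (hasFDerivAt_comp_continuousMap ĝ ĝ'
      (fun x => (hĝ.differentiable (by simp) x).hasFDerivAt) _).comp
        (f := fun x : E => graphPath (x, 0)) x ?_
    exact (hasFDerivAt_graphPath (x, 0)).comp (f := fun x : E => (x, (0 : C(TimeInterval, ℝ)))) x
      (hasFDerivAt_prodMk_left _ _)
  rw [hd.fderiv]
  refine (intervalIntegral.integral_congr fun t ht => ?_).symm
  rw [extendTime_of_mem _ (hsub t ht)]
  rw [Set.uIcc_of_le zero_le_one] at ht
  have e1 : fderiv ℝ f (t, x) = fderiv ℝ g (t, x) := by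
    refine Filter.EventuallyEq.fderiv_eq ?_
    filter_upwards [hO'.mem_nhds (hmem x hx t ht).1] with y hy using (hgO' hy).symm
  rw [e1]
  change _ = fderiv ℝ ĝ (t, x, 0) (0, u, 0)
  have e2 : HasFDerivAt ĝ ((fderiv ℝ g (t, x)).comp ((ContinuousLinearMap.fst ℝ ℝ (E × ℝ)).prod
      ((ContinuousLinearMap.fst ℝ E ℝ).comp (ContinuousLinearMap.snd ℝ ℝ (E × ℝ)))))
      ((t, x, 0) : ℝ × E × ℝ) :=
    HasFDerivAt.comp (g := g) (f := fun w : ℝ × E × ℝ => (w.1, w.2.1)) _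
      (hg.differentiable (by simp) (t, x)).hasFDerivAt
      (hasFDerivAt_fst.prodMk (hasFDerivAt_fst.comp _ hasFDerivAt_snd))
  rw [e2.fderiv]
  rfl

/-! ### The Poincaré lemma for two-forms -/

section Poincare

variable {E : Type} [NormedAddCommGroup E] [NormedSpace ℝ E]

omit [NormedAddCommGroup E] [NormedSpace ℝ E] in
theorem update_pair_zero (a b c : E) : Function.update ![a, b] 0 c = ![c, b] := by
  ext i; fin_cases i <;> rfl

omit [NormedAddCommGroup E] [NormedSpace ℝ E] in
theorem update_pair_one (a b c : E) : Function.update ![a, b] 1 c = ![a, c] := by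
  ext i; fin_cases i <;> rfl

/-- A two-form as a bilinear map. -/
def formBilinAux (η : E [⋀^Fin 2]→L[ℝ] ℝ) : E →L[ℝ] E →L[ℝ] ℝ :=
  LinearMap.mkContinuous₂
    (LinearMap.mk₂ ℝ (fun u v : E => η ![u, v])
      (fun a b v => by
        simpa only [update_pair_zero] using η.map_update_add ![a, v] 0 a b)
      (fun c a v => by
        simpa only [update_pair_zero] using η.map_update_smul ![a, v] 0 c a)
      (fun u a b => by
        simpa only [update_pair_one] using η.map_update_add ![u, a] 1 a b)
      (fun c u a => by
        simpa only [update_pair_one] using η.map_update_smul ![u, a] 1 c a)) ‖η‖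
    (fun u v => by
      have := η.le_opNorm ![u, v]
      simpa [Fin.prod_univ_two, mul_assoc] using this)

/-- Two-forms as bilinear maps. -/
def formBilin (E : Type) [NormedAddCommGroup E] [NormedSpace ℝ E] :
    (E [⋀^Fin 2]→L[ℝ] ℝ) →L[ℝ] E →L[ℝ] E →L[ℝ] ℝ :=
  LinearMap.mkContinuous
    { toFun := formBilinAux
      map_add' := fun η ζ => by ext; rfl
      map_smul' := fun c η => by ext; rfl } 1
    (fun η => by
      rw [one_mul]
      exact LinearMap.mkContinuous₂_norm_le (C := ‖η‖) _ (norm_nonneg _) (fun u v => by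
        have := η.le_opNorm ![u, v]
        simpa [Fin.prod_univ_two, mul_assoc] using this))

@[simp]
theorem formBilin_apply (η : E [⋀^Fin 2]→L[ℝ] ℝ) (u v : E) : formBilin E η u v = η ![u, v] := rfl

theorem hasFDerivAt_formBilin (η : E [⋀^Fin 2]→L[ℝ] ℝ) :
    HasFDerivAt (fun η => formBilin E η) (formBilin E) η :=
  ContinuousLinearMap.hasFDerivAt (E := E [⋀^Fin 2]→L[ℝ] ℝ) (F := E →L[ℝ] E →L[ℝ] ℝ) (formBilin E)

theorem contDiff_formBilin : ContDiff ℝ ∞ (fun η => formBilin E η) :=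
  ContinuousLinearMap.contDiff (𝕜 := ℝ) (E := E [⋀^Fin 2]→L[ℝ] ℝ) (F := E →L[ℝ] E →L[ℝ] ℝ) (formBilin E)

theorem form_swap (η : E [⋀^Fin 2]→L[ℝ] ℝ) (u v : E) : η ![u, v] = -η ![v, u] := by
  have h := η.toAlternatingMap.map_swap ![v, u] (i := 0) (j := 1) (by decide)
  have e : ![v, u] ∘ Equiv.swap (0 : Fin 2) 1 = ![u, v] := by
    ext i; fin_cases i <;> simp
  rw [e] at h
  exact h

theorem form_self (η : E [⋀^Fin 2]→L[ℝ] ℝ) (u : E) : η ![u, u] = 0 := by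
  linarith [form_swap η u u]

theorem form_ext {η ζ : E [⋀^Fin 2]→L[ℝ] ℝ} (h : ∀ u v, η ![u, v] = ζ ![u, v]) : η = ζ := by
  ext m
  have : m = ![m 0, m 1] := by ext i; fin_cases i <;> rfl
  rw [this]
  exact h _ _

theorem compContinuousLinearMap_pair {F : Type} [NormedAddCommGroup F] [NormedSpace ℝ F]
    (η : F [⋀^Fin 2]→L[ℝ] ℝ) (A : E →L[ℝ] F) (u v : E) :
    η.compContinuousLinearMap A ![u, v] = η ![A u, A v] := by
  rw [ContinuousAlternatingMap.compContinuousLinearMap_apply]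
  congr 1
  ext i; fin_cases i <;> rfl

theorem fderiv_formBilin_closed {η : E → E [⋀^Fin 2]→L[ℝ] ℝ} {x : E}
    (hd : DifferentiableAt ℝ η x) (hcl : extDeriv η x = 0) (a b c : E) :
    fderiv ℝ (fun y => formBilin E (η y)) x a b c - fderiv ℝ (fun y => formBilin E (η y)) x b a c +
      fderiv ℝ (fun y => formBilin E (η y)) x c a b = 0 := by
  have h : (0 : ℝ) = ∑ i : Fin 3, (-1) ^ (i : ℕ) •
      fderiv ℝ (fun y => η y (Fin.removeNth i ![a, b, c])) x (![a, b, c] i) := by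
    have := extDeriv_apply hd ![a, b, c]
    rw [hcl] at this
    exact this
  have hB : HasFDerivAt (fun y => formBilin E (η y))
      (fderiv ℝ (fun y => formBilin E (η y)) x) x :=
    (HasFDerivAt.comp (G := E →L[ℝ] E →L[ℝ] ℝ) (g := fun η => formBilin E η) x
      (hasFDerivAt_formBilin (η x)) hd.hasFDerivAt).differentiableAt.hasFDerivAt
  have key : ∀ u v w : E, fderiv ℝ (fun y => η y ![u, v]) x w =
      fderiv ℝ (fun y => formBilin E (η y)) x w u v := by
    intro u v w
    have h1 := ((hB.clm_apply (hasFDerivAt_const u x)).clm_apply (hasFDerivAt_const v x)).fderiv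
    simp only [formBilin_apply] at h1
    rw [h1]
    simp
  have r0 : Fin.removeNth 0 ![a, b, c] = ![b, c] := by ext i; fin_cases i <;> rfl
  have r1 : Fin.removeNth 1 ![a, b, c] = ![a, c] := by ext i; fin_cases i <;> rfl
  have r2 : Fin.removeNth 2 ![a, b, c] = ![a, b] := by ext i; fin_cases i <;> rfl
  simp only [Fin.sum_univ_three, r0, r1, r2, key] at h
  simp at h
  linarith

theorem fderiv_formBilin_swap {η : E → E [⋀^Fin 2]→L[ℝ] ℝ} {x : E}
    (hd : DifferentiableAt ℝ η x) (a b c : E) :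
    fderiv ℝ (fun y => formBilin E (η y)) x a b c =
      -fderiv ℝ (fun y => formBilin E (η y)) x a c b := by
  have hf : fderiv ℝ (fun y => formBilin E (η y)) x = (formBilin E).comp (fderiv ℝ η x) :=
    (HasFDerivAt.comp (G := E →L[ℝ] E →L[ℝ] ℝ) (g := fun η => formBilin E η) x
      (hasFDerivAt_formBilin (η x)) hd.hasFDerivAt).fderiv
  rw [hf]
  exact form_swap _ _ _

theorem hasFDerivAt_comp_smul {W : Type*} [NormedAddCommGroup W] [NormedSpace ℝ W] {B : E → W}
    {B' : E →L[ℝ] W} {t : ℝ} {x : E} (h : HasFDerivAt B B' (t • x)) :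
    HasFDerivAt (fun y : E => B (t • y)) (B'.comp (t • ContinuousLinearMap.id ℝ E)) x :=
  HasFDerivAt.comp (g := B) (f := fun y : E => t • y) x h ((hasFDerivAt_id x).const_smul t)

theorem hasDerivAt_comp_smul {W : Type*} [NormedAddCommGroup W] [NormedSpace ℝ W] {B : E → W}
    {B' : E →L[ℝ] W} {t : ℝ} {x : E} (h : HasFDerivAt B B' (t • x)) :
    HasDerivAt (fun t : ℝ => B (t • x)) (B' x) t := by
  have hs : HasDerivAt (fun t : ℝ => t • x) x t := by
    simpa using (hasDerivAt_id t).smul_const x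
  exact h.comp_hasDerivAt t hs

/-- The integrand of the cone operator. -/
def coneIntegrand (B : E → E →L[ℝ] E →L[ℝ] ℝ) (p : ℝ × E) : E →L[ℝ] ℝ :=
  p.1 • (B (p.1 • p.2) p.2 - B 0 p.2)

theorem contDiffOn_coneIntegrand {B : E → E →L[ℝ] E →L[ℝ] ℝ} {S : Set E}
    (hB : ContDiffOn ℝ ∞ B S) :
    ContDiffOn ℝ ∞ (coneIntegrand B) ((fun p : ℝ × E => p.1 • p.2) ⁻¹' S) := by
  have hsm : ContDiff ℝ ∞ (fun p : ℝ × E => p.1 • p.2) := contDiff_fst.smul contDiff_snd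
  refine contDiffOn_fst.smul (ContDiffOn.sub ?_ ?_)
  · exact (hB.comp hsm.contDiffOn fun p hp => hp).clm_apply contDiffOn_snd
  · exact contDiffOn_const.clm_apply contDiffOn_snd

theorem fderiv_coneIntegrand {B : E → E →L[ℝ] E →L[ℝ] ℝ} {S : Set E} (hS : IsOpen S)
    (hB : ContDiffOn ℝ ∞ B S) {t : ℝ} {x : E} (h : t • x ∈ S) (u v : E) :
    fderiv ℝ (coneIntegrand B) (t, x) (0, u) v =
      t * (t * fderiv ℝ B (t • x) u x v + (B (t • x) u v - B 0 u v)) := by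
  have hBd : HasFDerivAt B (fderiv ℝ B (t • x)) (t • x) :=
    ((hB.contDiffAt (hS.mem_nhds h)).differentiableAt (by simp)).hasFDerivAt
  have hc : HasFDerivAt (fun y : E => B (t • y))
      ((fderiv ℝ B (t • x)).comp (t • ContinuousLinearMap.id ℝ E)) x :=
    hasFDerivAt_comp_smul (W := E →L[ℝ] E →L[ℝ] ℝ) (B := B) (B' := fderiv ℝ B (t • x)) hBd
  have h1 : HasFDerivAt (fun y : E => t • (B (t • y) y - B 0 y)) _ x :=
    ((hc.clm_apply (hasFDerivAt_id x)).fun_sub (B 0).hasFDerivAt).const_smul t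
  have h2 : HasFDerivAt (fun y : E => coneIntegrand B (t, y))
      ((fderiv ℝ (coneIntegrand B) (t, x)).comp (ContinuousLinearMap.inr ℝ ℝ E)) x :=
    ((((contDiffOn_coneIntegrand hB).contDiffAt ((hS.preimage (by fun_prop)).mem_nhds
      h)).differentiableAt (by simp)).hasFDerivAt).comp x (hasFDerivAt_prodMk_right t x)
  have h3 := congrArg (fun L => L u v) (h2.unique h1)
  simp at h3
  rw [h3]; ring

theorem hasDerivAt_sq_mul_form {B : E → E →L[ℝ] E →L[ℝ] ℝ} {S : Set E} (hS : IsOpen S)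
    (hB : ContDiffOn ℝ ∞ B S) {t : ℝ} {x : E} (h : t • x ∈ S) (u v : E) :
    HasDerivAt (fun t : ℝ => t ^ 2 * (B (t • x) u v - B 0 u v))
      (2 * t * (B (t • x) u v - B 0 u v) + t ^ 2 * fderiv ℝ B (t • x) x u v) t := by
  have hBd : HasFDerivAt B (fderiv ℝ B (t • x)) (t • x) :=
    ((hB.contDiffAt (hS.mem_nhds h)).differentiableAt (by simp)).hasFDerivAt
  have h1 : HasDerivAt (fun t : ℝ => B (t • x) u v) (fderiv ℝ B (t • x) x u v) t := by
    have h0 : HasDerivAt (fun t : ℝ => B (t • x)) (fderiv ℝ B (t • x) x) t :=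
      hasDerivAt_comp_smul (W := E →L[ℝ] E →L[ℝ] ℝ) (B := B) (B' := fderiv ℝ B (t • x)) hBd
    have h3 : HasDerivAt (fun t : ℝ => B (t • x) u) (fderiv ℝ B (t • x) x u) t := by
      simpa using h0.clm_apply (hasDerivAt_const t u)
    simpa using h3.clm_apply (hasDerivAt_const t v)
  have h2 := (hasDerivAt_pow 2 t).fun_mul (h1.sub_const (B 0 u v))
  simpa using h2

/-- Primitives of closed two-forms that vanish at the origin. -/
theorem exists_primitive [FiniteDimensional ℝ E] {η : E → E [⋀^Fin 2]→L[ℝ] ℝ} {R : ℝ}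
    (hR : 0 < R) (hη : ContDiffOn ℝ ∞ η (Metric.ball 0 R))
    (hcl : ∀ x ∈ Metric.ball 0 R, extDeriv η x = 0) :
    ∃ (U : Set E) (α : E → E →L[ℝ] ℝ), IsOpen U ∧ (0 : E) ∈ U ∧ U ⊆ Metric.ball 0 R ∧
      ContDiffOn ℝ ∞ α U ∧ α 0 = 0 ∧ fderiv ℝ α 0 = 0 ∧
      (∀ x ∈ U, ∀ u v, fderiv ℝ α x u v - fderiv ℝ α x v u = η x ![u, v] - η 0 ![u, v]) ∧
      ∀ L : E →L[ℝ] E, (∀ x ∈ Metric.ball 0 R, L x ∈ Metric.ball 0 R ∧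
        (η (L x)).compContinuousLinearMap L = η x) →
        ∀ x ∈ U, ∀ v, α (L x) (L v) = α x v := by
  obtain ⟨B, hB⟩ : ∃ B : E → E →L[ℝ] E →L[ℝ] ℝ, B = fun x => formBilin E (η x) := ⟨_, rfl⟩
  have hBη : ∀ x u v, B x u v = η x ![u, v] := fun x u v => by rw [hB]; rfl
  have hBs : ContDiffOn ℝ ∞ B (Metric.ball 0 R) := by
    rw [hB]
    exact ContDiff.comp_contDiffOn (G := E →L[ℝ] E →L[ℝ] ℝ) (g := fun η => formBilin E η)
      contDiff_formBilin hη
  have hO : IsOpen ((fun p : ℝ × E => p.1 • p.2) ⁻¹' Metric.ball 0 R) :=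
    Metric.isOpen_ball.preimage (by fun_prop)
  have hf := contDiffOn_coneIntegrand hBs
  obtain ⟨U, hU, h0U, hUO, hα, hα'⟩ := contDiffOn_parametric_integral hO hf (x₀ := 0)
    (fun t _ => by simp [hR])
  have hUR : U ⊆ Metric.ball 0 R := fun x hx => by
    simpa using hUO x hx 1 (by norm_num)
  have hcont : ∀ x ∈ U, ∀ u, ContinuousOn (fun t : ℝ => fderiv ℝ (coneIntegrand B) (t, x) (0, u))
      (Set.uIcc (0 : ℝ) 1) := by
    intro x hx u
    rw [Set.uIcc_of_le zero_le_one]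
    have h1 := hf.continuousOn_fderiv_of_isOpen hO (by simp)
    exact (h1.comp (f := fun t : ℝ => (t, x)) (by fun_prop)
      fun t ht => hUO x hx t ht).clm_apply continuousOn_const
  have hDα : ∀ x ∈ U, ∀ u v,
      fderiv ℝ (fun x => ∫ t in (0 : ℝ)..1, coneIntegrand B (t, x)) x u v =
      ∫ t in (0 : ℝ)..1, fderiv ℝ (coneIntegrand B) (t, x) (0, u) v := by
    intro x hx u v
    rw [hα' x hx u]
    exact ContinuousLinearMap.intervalIntegral_apply (hcont x hx u).intervalIntegrable v
  refine ⟨U, _, hU, h0U, hUR, hα, ?_, ?_, ?_, ?_⟩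
  · simp [coneIntegrand]
  · ext u v
    rw [hDα 0 h0U]
    have : ∀ t ∈ Set.uIcc (0 : ℝ) 1, fderiv ℝ (coneIntegrand B) (t, 0) (0, u) v = 0 := by
      intro t ht
      rw [Set.uIcc_of_le zero_le_one] at ht
      rw [fderiv_coneIntegrand Metric.isOpen_ball hBs (hUO 0 h0U t ht)]
      simp
    rw [intervalIntegral.integral_congr this]
    simp
  · intro x hx u v
    rw [hDα x hx, hDα x hx, ← intervalIntegral.integral_sub
      ((hcont x hx u).clm_apply continuousOn_const).intervalIntegrable
      ((hcont x hx v).clm_apply continuousOn_const).intervalIntegrable]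
    have hderiv : ∀ t ∈ Set.uIcc (0 : ℝ) 1,
        HasDerivAt (fun t : ℝ => t ^ 2 * (B (t • x) u v - B 0 u v))
          (fderiv ℝ (coneIntegrand B) (t, x) (0, u) v -
            fderiv ℝ (coneIntegrand B) (t, x) (0, v) u) t := by
      intro t ht
      rw [Set.uIcc_of_le zero_le_one] at ht
      have hmem := hUO x hx t ht
      have hηd : DifferentiableAt ℝ η (t • x) :=
        (hη.contDiffAt (Metric.isOpen_ball.mem_nhds hmem)).differentiableAt (by simp)
      have h2 := hasDerivAt_sq_mul_form Metric.isOpen_ball hBs hmem u v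
      have c1 := fderiv_formBilin_closed hηd (hcl _ hmem) u x v
      have c2 := fderiv_formBilin_swap hηd v u x
      have c3 := form_swap (η (t • x)) u v
      have c4 := form_swap (η 0) u v
      rw [← hB] at c1 c2
      rw [← hBη, ← hBη] at c3 c4
      rw [fderiv_coneIntegrand Metric.isOpen_ball hBs hmem,
        fderiv_coneIntegrand Metric.isOpen_ball hBs hmem]
      convert h2 using 1
      linear_combination t ^ 2 * c1 - t ^ 2 * c2 - t * c3 + t * c4
    rw [intervalIntegral.integral_eq_sub_of_hasDerivAt hderiv
      (((hcont x hx u).clm_apply continuousOn_const).sub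
        ((hcont x hx v).clm_apply continuousOn_const)).intervalIntegrable]
    simp [hBη]
  · intro L hL x hx v
    have hfc : ∀ y ∈ Metric.ball (0 : E) R, ContinuousOn (fun t : ℝ => coneIntegrand B (t, y))
        (Set.uIcc (0 : ℝ) 1) := by
      intro y hy
      rw [Set.uIcc_of_le zero_le_one]
      refine hf.continuousOn.comp (by fun_prop) fun t ht => ?_
      simp only [Set.mem_preimage, mem_ball_zero_iff, norm_smul, Real.norm_eq_abs,
        abs_of_nonneg ht.1] at hy ⊢
      nlinarith [norm_nonneg y, ht.2]
    rw [ContinuousLinearMap.intervalIntegral_apply (hfc _ (hL x (hUR hx)).1).intervalIntegrable,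
      ContinuousLinearMap.intervalIntegral_apply (hfc _ (hUR hx)).intervalIntegrable]
    refine intervalIntegral.integral_congr fun t ht => ?_
    rw [Set.uIcc_of_le zero_le_one] at ht
    have e1 : ∀ y ∈ Metric.ball (0 : E) R, ∀ a b, η (L y) ![L a, L b] = η y ![a, b] := by
      intro y hy a b
      rw [← compContinuousLinearMap_pair, (hL y hy).2]
    have h2 := e1 (t • x) (hUO x hx t ht) x v
    have h3 := e1 0 (Metric.mem_ball_self hR) x v
    rw [map_zero] at h3
    rw [map_smul] at h2
    simp only [coneIntegrand]
    simp [hBη, h2, h3]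

end Poincare

/-! ### Moser's argument -/

section Moser

theorem exists_contDiff_solve_linear {M E W : Type*} [NormedAddCommGroup M] [NormedSpace ℝ M]
    [FiniteDimensional ℝ M] [NormedAddCommGroup E] [NormedSpace ℝ E] [CompleteSpace E]
    [NormedAddCommGroup W] [NormedSpace ℝ W] {A : M → E →L[ℝ] W} {b : M → W} {O C : Set M}
    (hO : IsOpen O) (hC : IsClosed C) (hCO : C ⊆ O) (hA : ContDiffOn ℝ ∞ A O)
    (hb : ContDiffOn ℝ ∞ b O) (hinv : ∀ p ∈ C, ∃ e : E ≃L[ℝ] W, (e : E →L[ℝ] W) = A p) :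
    ∃ f : M → E, ContDiff ℝ ∞ f ∧ ∀ᶠ p in 𝓝ˢ C, A p (f p) = b p ∧
      ∀ u, A p u = 0 → u = 0 := by
  set O' : Set M := O ∩ A ⁻¹' Set.range ((↑) : (E ≃L[ℝ] W) → (E →L[ℝ] W)) with hO'
  have hO'o : IsOpen O' := hA.continuousOn.isOpen_inter_preimage hO ContinuousLinearEquiv.isOpen
  have hCO' : C ⊆ O' := fun p hp => ⟨hCO hp, hinv p hp⟩
  have hV : ContDiffOn ℝ ∞ (fun p => (A p).inverse (b p)) O' := by
    refine ContDiffOn.clm_apply (fun p hp => ?_) (hb.mono Set.inter_subset_left)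
    obtain ⟨e, he⟩ := hp.2
    have h1 : ContDiffAt ℝ ∞ ContinuousLinearMap.inverse (A p) := by
      rw [← he]; exact contDiffAt_map_inverse e
    exact (h1.comp p (hA.contDiffAt (hO.mem_nhds hp.1))).contDiffWithinAt
  obtain ⟨f, hf, hfV⟩ := exists_contDiff_eventuallyEq hO'o hC hCO' hV
  refine ⟨f, hf, ?_⟩
  filter_upwards [hfV, hO'o.mem_nhdsSet.2 hCO'] with p hp hpO
  obtain ⟨e, he⟩ := hpO.2
  rw [hp, ← he, ContinuousLinearMap.inverse_equiv]
  exact ⟨e.apply_symm_apply _, fun u hu => by simpa using hu⟩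

variable {E : Type} [NormedAddCommGroup E] [NormedSpace ℝ E] [FiniteDimensional ℝ E]

theorem exists_equiv_of_nondegenerate {B : E →L[ℝ] E →L[ℝ] ℝ}
    (h : ∀ u, (∀ v, B u v = 0) → u = 0) :
    ∃ e : E ≃L[ℝ] (E →L[ℝ] ℝ), (e : E →L[ℝ] E →L[ℝ] ℝ) = B := by
  have hi : Function.Injective B := (injective_iff_map_eq_zero B).2 fun u hu =>
    h u fun v => by rw [hu]; rfl
  have hdim : Module.finrank ℝ E = Module.finrank ℝ (E →L[ℝ] ℝ) := by
    rw [← (LinearMap.toContinuousLinearMap (𝕜 := ℝ) (E := E) (F' := ℝ)).finrank_eq]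
    exact (Subspace.dual_finrank_eq (K := ℝ) (V := E)).symm
  exact ⟨(LinearEquiv.ofInjectiveOfFinrankEq B.toLinearMap hi hdim).toContinuousLinearEquiv,
    by ext; rfl⟩

/-- The segment from `B 0` to `B`. -/
def formSegment {E Z : Type} [NormedAddCommGroup E] [NormedSpace ℝ E] [NormedAddCommGroup Z]
    [NormedSpace ℝ Z] (B : E → Z) (p : ℝ × E) : Z :=
  B 0 + p.1 • (B p.2 - B 0)

section Segment

variable {E Z : Type} [NormedAddCommGroup E] [NormedSpace ℝ E] [NormedAddCommGroup Z]
    [NormedSpace ℝ Z]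

theorem formSegment_zero (B : E → Z) (t : ℝ) : formSegment B (t, 0) = B 0 := by
  simp [formSegment]

theorem contDiffOn_formSegment {B : E → Z} {S : Set E}
    (hB : ContDiffOn ℝ ∞ B S) : ContDiffOn ℝ ∞ (formSegment B) (Set.univ ×ˢ S) :=
  contDiffOn_const.add (contDiffOn_fst.smul
    ((hB.comp contDiffOn_snd fun _ hp => hp.2).sub contDiffOn_const))

theorem hasDerivAt_formSegment {B : E → Z} {B' : E →L[ℝ] Z} {t : ℝ} {y : ℝ → E} {y' : E}
    (hB : HasFDerivAt B B' (y t)) (hy : HasDerivAt y y' t) :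
    HasDerivAt (fun t => formSegment B (t, y t)) (t • B' y' + (B (y t) - B 0)) t := by
  have h1 : HasDerivAt (fun t => B (y t)) (B' y') t := hB.comp_hasDerivAt t hy
  have h2 := ((hasDerivAt_id t).fun_smul (h1.sub_const (B 0))).const_add (B 0)
  rw [one_smul] at h2
  exact h2

theorem hasFDerivAt_formSegment {B : E → Z} {B' : E →L[ℝ] Z} {t : ℝ} {x : E}
    (hB : HasFDerivAt B B' x) : HasFDerivAt (fun y => formSegment B (t, y)) (t • B') x :=
  ((hB.sub_const (B 0)).const_smul t).const_add (B 0)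

theorem hasDerivAt_formSegment_apply {B : E → E →L[ℝ] Z} {B' : E →L[ℝ] E →L[ℝ] Z} {t : ℝ}
    {y : ℝ → E} {y' : E} (hB : HasFDerivAt B B' (y t)) (hy : HasDerivAt y y' t) {a : ℝ → E}
    {a' : E} (ha : HasDerivAt a a' t) :
    HasDerivAt (fun t => formSegment B (t, y t) (a t))
      (t • B' y' (a t) + (B (y t) (a t) - B 0 (a t)) + formSegment B (t, y t) a') t :=
  (hasDerivAt_formSegment (Z := E →L[ℝ] Z) hB hy).clm_apply ha

theorem hasFDerivAt_formSegment_apply {B : E → E →L[ℝ] Z} {B' : E →L[ℝ] E →L[ℝ] Z} {t : ℝ} {x : E}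
    (hB : HasFDerivAt B B' x) {g : E → E} {g' : E →L[ℝ] E} (hg : HasFDerivAt g g' x) :
    HasFDerivAt (fun y => formSegment B (t, y) (g y))
      ((formSegment B (t, x)).comp g' + (t • B').flip (g x)) x :=
  (hasFDerivAt_formSegment (Z := E →L[ℝ] Z) hB).clm_apply hg

end Segment

theorem exists_moser_field {B : E → E →L[ℝ] E →L[ℝ] ℝ} {U : Set E} (hU : IsOpen U)
    (h0U : (0 : E) ∈ U) (hB : ContDiffOn ℝ ∞ B U) (hnd : ∀ u, (∀ v, B 0 u v = 0) → u = 0)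
    {α : E → E →L[ℝ] ℝ} (hα : ContDiffOn ℝ ∞ α U) :
    ∃ (δ : ℝ) (f : ℝ × E → E), 0 < δ ∧ Metric.ball 0 δ ⊆ U ∧ ContDiff ℝ ∞ f ∧
      ∀ t ∈ TimeInterval, ∀ x ∈ Metric.ball (0 : E) δ,
        (∀ w, formSegment B (t, x) (f (t, x)) w = -α x w) ∧
        ∀ u, (∀ w, formSegment B (t, x) u w = 0) → u = 0 := by
  have : CompleteSpace E := FiniteDimensional.complete ℝ E
  have hK : IsCompact (TimeInterval ×ˢ {(0 : E)}) := isCompact_Icc.prod isCompact_singleton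
  obtain ⟨e, he⟩ := exists_equiv_of_nondegenerate hnd
  obtain ⟨f, hf, hfe⟩ := exists_contDiff_solve_linear (W := E →L[ℝ] ℝ) (A := formSegment B)
    (b := fun p => -α p.2) (isOpen_univ.prod hU) hK.isClosed
    (by rintro ⟨t, x⟩ ⟨-, rfl⟩; exact ⟨trivial, h0U⟩) (contDiffOn_formSegment (Z := E →L[ℝ] E →L[ℝ] ℝ) hB)
    ((hα.comp contDiffOn_snd fun _ hp => hp.2).neg)
    (by rintro ⟨t, x⟩ ⟨-, rfl⟩; exact ⟨e, by rw [he]; exact (formSegment_zero (Z := E →L[ℝ] E →L[ℝ] ℝ) B t).symm⟩)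
  obtain ⟨O, hO, hKO, hOf⟩ := mem_nhdsSet_iff_exists.1 hfe
  obtain ⟨S, V, hS, hV, hS', hV', hSV⟩ := generalized_tube_lemma isCompact_Icc
    isCompact_singleton hO hKO
  obtain ⟨δ, hδ, hδV⟩ := Metric.isOpen_iff.1 (hV.inter hU) 0 ⟨by simpa using hV', h0U⟩
  refine ⟨δ, f, hδ, fun x hx => (hδV hx).2, hf, fun t ht x hx => ?_⟩
  obtain ⟨h1, h2⟩ := hOf (hSV (show (t, x) ∈ S ×ˢ V from ⟨hS' ht, (hδV hx).1⟩))
  refine ⟨fun w => by rw [h1]; rfl, fun u hu => h2 u ?_⟩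
  ext w
  exact hu w

omit [FiniteDimensional ℝ E] in
theorem hasDerivAt_formSegment_apply₂ {B : E → E →L[ℝ] E →L[ℝ] ℝ}
    {B' : E →L[ℝ] E →L[ℝ] E →L[ℝ] ℝ} {t : ℝ} {y : ℝ → E} {y' : E}
    (hB : HasFDerivAt B B' (y t)) (hy : HasDerivAt y y' t) {a b : ℝ → E} {a' b' : E}
    (ha : HasDerivAt a a' t) (hb : HasDerivAt b b' t) :
    HasDerivAt (fun t => formSegment B (t, y t) (a t) (b t))
      (t * B' y' (a t) (b t) + (B (y t) (a t) (b t) - B 0 (a t) (b t)) +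
        formSegment B (t, y t) a' (b t) + formSegment B (t, y t) (a t) b') t :=
  (hasDerivAt_formSegment_apply (Z := E →L[ℝ] ℝ) (B' := B') hB hy ha).clm_apply hb

omit [FiniteDimensional ℝ E] in
/-- The linearization of the equation that defines the Moser field. -/
theorem formSegment_fderiv_field {B : E → E →L[ℝ] E →L[ℝ] ℝ} {α : E → E →L[ℝ] ℝ} {t : ℝ}
    {f : ℝ × E → E} {S : Set E} (hS : IsOpen S)
    (h : ∀ y ∈ S, ∀ w, formSegment B (t, y) (f (t, y)) w = -α y w) {x : E} (hx : x ∈ S)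
    (hB : DifferentiableAt ℝ B x) (hα : DifferentiableAt ℝ α x)
    (hf : DifferentiableAt ℝ f (t, x)) (a w : E) :
    formSegment B (t, x) (fderiv ℝ f (t, x) (0, a)) w =
      -fderiv ℝ α x a w - t * fderiv ℝ B x a (f (t, x)) w := by
  have hfx : HasFDerivAt (fun y => f (t, y))
      ((fderiv ℝ f (t, x)).comp (ContinuousLinearMap.inr ℝ ℝ E)) x :=
    hf.hasFDerivAt.comp x (hasFDerivAt_prodMk_right t x)
  have h2 := hasFDerivAt_formSegment_apply (Z := E →L[ℝ] ℝ) (t := t) (B' := fderiv ℝ B x)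
    hB.hasFDerivAt hfx
  have h3 : HasFDerivAt (fun y => formSegment B (t, y) (f (t, y))) (-fderiv ℝ α x) x := by
    refine (HasFDerivAt.fun_neg hα.hasFDerivAt).congr_of_eventuallyEq ?_
    filter_upwards [hS.mem_nhds hx] with y hy
    ext w
    exact h y hy w
  have h4 := congrArg (fun L => L a w) (h2.unique h3)
  have h5 : formSegment B (t, x) (fderiv ℝ f (t, x) (0, a)) w + t * fderiv ℝ B x a (f (t, x)) w =
      -fderiv ℝ α x a w := h4
  linarith

theorem exists_moser_diffeo {η : E → E [⋀^Fin 2]→L[ℝ] ℝ} {R : ℝ}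
    (hR : 0 < R) (hη : ContDiffOn ℝ ∞ η (Metric.ball 0 R))
    (hcl : ∀ x ∈ Metric.ball 0 R, extDeriv η x = 0)
    (hnd : ∀ u, (∀ v, η 0 ![u, v] = 0) → u = 0) (S : Set (E →L[ℝ] E))
    (hS : ∀ L ∈ S, ∀ x, ‖L x‖ = ‖x‖)
    (hinv : ∀ L ∈ S, ∀ x ∈ Metric.ball 0 R, (η (L x)).compContinuousLinearMap L = η x) :
    ∃ (r : ℝ) (ρ : E → E), 0 < r ∧ ContDiffOn ℝ ∞ ρ (Metric.ball 0 r) ∧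
      Set.MapsTo ρ (Metric.ball 0 r) (Metric.ball 0 R) ∧ ρ 0 = 0 ∧
      Set.InjOn ρ (Metric.ball 0 r) ∧
      (∀ x ∈ Metric.ball 0 r, (η (ρ x)).compContinuousLinearMap (fderiv ℝ ρ x) = η 0) ∧
      ∀ L ∈ S, ∀ x ∈ Metric.ball 0 r, ρ (L x) = L (ρ x) := by
  have : CompleteSpace E := FiniteDimensional.complete ℝ E
  obtain ⟨U, α, hU, h0U, hUR, hα, hα0, hα0', hdα, hαL⟩ := exists_primitive hR hη hcl
  obtain ⟨B, hB⟩ : ∃ B : E → E →L[ℝ] E →L[ℝ] ℝ, B = fun x => formBilin E (η x) := ⟨_, rfl⟩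
  have hBη : ∀ x u v, B x u v = η x ![u, v] := fun x u v => by rw [hB]; rfl
  have hBs : ContDiffOn ℝ ∞ B U := by
    rw [hB]
    exact ContDiff.comp_contDiffOn (G := E →L[ℝ] E →L[ℝ] ℝ) (g := fun η => formBilin E η)
      contDiff_formBilin (hη.mono hUR)
  have hB0 : ∀ u, (∀ v, B 0 u v = 0) → u = 0 := fun u hu =>
    hnd u fun v => by rw [← hBη]; exact hu v
  obtain ⟨δ, f, hδ, hδU, hf, hfδ⟩ := exists_moser_field hU h0U hBs hB0 hα
  have hball : IsOpen (Metric.ball (0 : E) δ) := Metric.isOpen_ball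
  have h0δ : (0 : E) ∈ Metric.ball 0 δ := Metric.mem_ball_self hδ
  have hBd : ∀ x ∈ Metric.ball (0 : E) δ, HasFDerivAt B (fderiv ℝ B x) x := fun x hx =>
    ((hBs.contDiffAt (hU.mem_nhds (hδU hx))).differentiableAt (by simp)).hasFDerivAt
  have hαd : ∀ x ∈ Metric.ball (0 : E) δ, DifferentiableAt ℝ α x := fun x hx =>
    (hα.contDiffAt (hU.mem_nhds (hδU hx))).differentiableAt (by simp)
  have hfd : Differentiable ℝ f := hf.differentiable (by simp)
  have hlin : ∀ t ∈ TimeInterval, ∀ x ∈ Metric.ball (0 : E) δ, ∀ a w,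
      formSegment B (t, x) (fderiv ℝ f (t, x) (0, a)) w =
        -fderiv ℝ α x a w - t * fderiv ℝ B x a (f (t, x)) w := fun t ht x hx a w =>
    formSegment_fderiv_field hball (fun y hy => (hfδ t ht y hy).1) hx
      (hBd x hx).differentiableAt (hαd x hx) (hfd _) a w
  have hf0 : ∀ t ∈ TimeInterval, f (t, 0) = 0 := fun t ht =>
    (hfδ t ht 0 h0δ).2 _ fun w => by rw [(hfδ t ht 0 h0δ).1, hα0]; simp
  have hf0' : ∀ t ∈ TimeInterval, ∀ v, fderiv ℝ f (t, 0) (0, v) = 0 := fun t ht v =>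
    (hfδ t ht 0 h0δ).2 _ fun w => by
      rw [hlin t ht 0 h0δ, hα0', hf0 t ht]; simp
  let F : C(ℝ × ℝ × E, E) := ⟨fun p => f (p.1, p.2.2), by have := hf.continuous; fun_prop⟩
  have hF : ContDiff ℝ ∞ F := hf.comp (contDiff_fst.prodMk (contDiff_snd.comp contDiff_snd))
  have hF' : ∀ t s x u, fderiv ℝ F (t, s, x) u = fderiv ℝ f (t, x) (u.1, u.2.2) := by
    intro t s x u
    have h : HasFDerivAt F ((fderiv ℝ f (t, x)).comp ((ContinuousLinearMap.fst ℝ ℝ (ℝ × E)).prod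
        ((ContinuousLinearMap.snd ℝ ℝ E).comp (ContinuousLinearMap.snd ℝ ℝ (ℝ × E)))))
        ((t, s, x) : ℝ × ℝ × E) :=
      HasFDerivAt.comp (g := f) (f := fun w : ℝ × ℝ × E => (w.1, w.2.2)) _
        (hfd (t, x)).hasFDerivAt
        (hasFDerivAt_fst.prodMk (hasFDerivAt_snd.comp _ hasFDerivAt_snd))
    rw [h.fderiv]; rfl
  obtain ⟨Z, G, hZ, h0Z, hG, hG0, hsol⟩ := exists_smooth_solution F hF 0 0
    (fun t ht => hf0 t ht) (fun t ht v => by rw [hF']; exact hf0' t ht v)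
  have hGball : IsOpen (Z ∩ G ⁻¹' Metric.ball (ContinuousMap.const _ 0) δ) :=
    hG.continuousOn.isOpen_inter_preimage hZ Metric.isOpen_ball
  obtain ⟨r₀, hr₀, hr₀Z⟩ := Metric.isOpen_iff.1
    (hGball.preimage (by fun_prop : Continuous fun x : E => ((0 : ℝ), x))) 0
    ⟨h0Z, by rw [Set.mem_preimage, hG0]; exact Metric.mem_ball_self hδ⟩
  have hmem : ∀ x ∈ Metric.ball (0 : E) r₀, ∀ t, extendTime (G (0, x)) t ∈ Metric.ball 0 δ := by
    intro x hx t
    have h1 := (hr₀Z hx).2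
    rw [Set.mem_preimage, mem_ball_iff_norm] at h1
    rw [mem_ball_zero_iff]
    refine lt_of_le_of_lt ?_ h1
    have h2 := (G (0, x) - ContinuousMap.const _ 0).norm_coe_le_norm
      (Set.projIcc (-2) 2 (by norm_num) t)
    rw [ContinuousMap.sub_apply, ContinuousMap.const_apply, sub_zero] at h2
    exact h2
  have hsmooth : ContDiffOn ℝ ∞ (fun x => extendTime (G (0, x)) 1) (Metric.ball 0 r₀) :=
    contDiffOn_extendTime (hG.comp (contDiff_const.prodMk contDiff_id).contDiffOn
      fun x hx => (hr₀Z hx).1) (by norm_num)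
  have hIoo : ∀ t ∈ Set.Icc (0 : ℝ) 1, t ∈ Set.Ioo (-2 : ℝ) 2 := fun t ht =>
    ⟨by linarith [ht.1], by linarith [ht.2]⟩
  have hderiv : ∀ x ∈ Metric.ball (0 : E) r₀, ∀ t ∈ Set.Icc (0 : ℝ) 1,
      HasDerivAt (extendTime (G (0, x))) (f (t, extendTime (G (0, x)) t)) t := by
    intro x hx t ht
    convert hasDerivAt_of_eq_primitive (hsol _ (hr₀Z hx).1) (hIoo t ht) using 1
    rw [extendTime_of_mem _ (Set.Ioo_subset_Icc_self (hIoo t ht)),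
      extendTime_of_mem _ (Set.Ioo_subset_Icc_self (hIoo t ht))]
    rfl
  have hinit : ∀ x ∈ Metric.ball (0 : E) r₀, extendTime (G (0, x)) 0 = x := by
    intro x hx
    rw [extendTime_of_mem _ (by norm_num : (0 : ℝ) ∈ TimeInterval), hsol _ (hr₀Z hx).1]
    simp [primitive_apply]
  have hGd : ∀ x ∈ Metric.ball (0 : E) r₀, HasFDerivAt (fun y => G (0, y))
      ((fderiv ℝ G (0, x)).comp (ContinuousLinearMap.inr ℝ ℝ E)) x := fun x hx =>
    (((hG.contDiffAt (hZ.mem_nhds (hr₀Z hx).1)).differentiableAt (by simp)).hasFDerivAt).comp x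
      (hasFDerivAt_prodMk_right 0 x)
  have hfd1 : ∀ t ∈ TimeInterval, ∀ x ∈ Metric.ball (0 : E) r₀, ∀ u,
      fderiv ℝ (fun y => extendTime (G (0, y)) t) x u = extendTime (fderiv ℝ G (0, x) (0, u)) t := by
    intro t ht x hx u
    rw [(hasFDerivAt_extendTime (hGd x hx) ⟨t, ht⟩).fderiv, extendTime_of_mem _ ht]
    rfl
  have hpull : ∀ x ∈ Metric.ball (0 : E) r₀, (η (extendTime (G (0, x)) 1)).compContinuousLinearMap
      (fderiv ℝ (fun y => extendTime (G (0, y)) 1) x) = η 0 := by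
    intro x hx
    refine form_ext fun u v => ?_
    rw [compContinuousLinearMap_pair, hfd1 1 (by norm_num) x hx, hfd1 1 (by norm_num) x hx]
    let a : ℝ → E := extendTime (fderiv ℝ G (0, x) (0, u))
    let b : ℝ → E := extendTime (fderiv ℝ G (0, x) (0, v))
    let y : ℝ → E := extendTime (G (0, x))
    have hab : ∀ w : E, ∀ t ∈ Set.Icc (0 : ℝ) 1,
        HasDerivAt (extendTime (fderiv ℝ G (0, x) (0, w)))
          (fderiv ℝ f (t, y t) (0, extendTime (fderiv ℝ G (0, x) (0, w)) t)) t := by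
      intro w t ht
      convert hasDerivAt_fderiv_solution hF hZ hG hsol (hr₀Z hx).1 (0, w) (hIoo t ht) using 1
      rw [hF']
    have hc : ∀ t ∈ Set.Icc (0 : ℝ) 1,
        HasDerivAt (fun t => formSegment B (t, y t) (a t) (b t)) 0 t := by
      intro t ht
      have ht' := Set.Ioo_subset_Icc_self (hIoo t ht)
      have hy := hmem x hx t
      convert hasDerivAt_formSegment_apply₂ (hBd (y t) hy) (hderiv x hx t ht) (hab u t ht)
        (hab v t ht) using 1
      have hηd : DifferentiableAt ℝ η (y t) := (hη.contDiffAt (Metric.isOpen_ball.mem_nhds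
        (hUR (hδU hy)))).differentiableAt (by simp)
      have c1 := fderiv_formBilin_closed hηd (hcl _ (hUR (hδU hy))) (f (t, y t)) (a t) (b t)
      have c3 := hlin t ht' (y t) hy (a t) (b t)
      have c4 := hlin t ht' (y t) hy (b t) (a t)
      have c5 := hdα (y t) (hδU hy) (a t) (b t)
      have c6 : formSegment B (t, y t) (a t) (fderiv ℝ f (t, y t) (0, b t)) =
          -formSegment B (t, y t) (fderiv ℝ f (t, y t) (0, b t)) (a t) := by
        have h7 : ∀ z w, B 0 z w = -B 0 w z := fun z w => by rw [hBη, hBη, form_swap]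
        have h8 : ∀ z w, B (y t) z w = -B (y t) w z := fun z w => by rw [hBη, hBη, form_swap]
        have h9 : ∀ z w, formSegment B (t, y t) z w =
          B 0 z w + t * (B (y t) z w - B 0 z w) := fun z w => rfl
        rw [h9, h9, h7, h8]; ring
      rw [← hB] at c1
      rw [← hBη, ← hBη] at c5
      change 0 = t * fderiv ℝ B (y t) (f (t, y t)) (a t) (b t) +
        (B (y t) (a t) (b t) - B 0 (a t) (b t)) +
        formSegment B (t, y t) (fderiv ℝ f (t, y t) (0, a t)) (b t) +
        formSegment B (t, y t) (a t) (fderiv ℝ f (t, y t) (0, b t))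
      rw [c6, c3, c4]
      linear_combination c5 - t * c1
    have hconst := constant_of_has_deriv_right_zero (a := (0 : ℝ)) (b := 1)
      (fun t ht => (hc t ht).continuousAt.continuousWithinAt)
      (fun t ht => (hc t (Set.Ico_subset_Icc_self ht)).hasDerivWithinAt) 1 (by norm_num)
    have hy0 : ∀ w, extendTime (fderiv ℝ G (0, x) (0, w)) 0 = w := by
      intro w
      rw [← hfd1 0 (by norm_num) x hx]
      have : (fun y => extendTime (G (0, y)) 0) =ᶠ[𝓝 x] id := by
        filter_upwards [Metric.isOpen_ball.mem_nhds hx] with z hz using hinit z hz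
      rw [this.fderiv_eq, fderiv_id]; rfl
    have e1 : formSegment B (1, y 1) (a 1) (b 1) = B (y 1) (a 1) (b 1) := by
      change B 0 (a 1) (b 1) + 1 * (B (y 1) (a 1) (b 1) - B 0 (a 1) (b 1)) = _
      ring
    have e0 : formSegment B (0, y 0) (a 0) (b 0) = B 0 u v := by
      change B 0 (a 0) (b 0) + 0 * (B (y 0) (a 0) (b 0) - B 0 (a 0) (b 0)) = _
      rw [zero_mul, add_zero]
      simp only [a, b, hy0]
    rw [e1, e0, hBη, hBη] at hconst
    exact hconst
  obtain ⟨h, hh0, hhs, hhe, -, -⟩ := exists_localDiffeo rfl Metric.isOpen_ball hsmooth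
    (Metric.mem_ball_self hr₀) (fun u hu => hnd u fun v => by
      rw [← hpull 0 (Metric.mem_ball_self hr₀), compContinuousLinearMap_pair, hu]
      exact (η _).map_coord_zero 0 rfl)
  obtain ⟨r, hr, hrh⟩ := Metric.isOpen_iff.1 h.open_source 0 hh0
  have hrr : Metric.ball 0 r ⊆ Metric.ball (0 : E) r₀ := hrh.trans hhs
  refine ⟨r, _, hr, hsmooth.mono hrr, fun x hx => hUR (hδU (hmem x (hrr hx) 1)), ?_, ?_,
    fun x hx => hpull x (hrr hx), ?_⟩
  · rw [hG0, extendTime_of_mem _ (by norm_num)]; rfl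
  · have := h.injOn.mono hrh
    exact this.congr fun x hx => hhe x
  · intro L hL x hx
    have hLx : ∀ z s, z ∈ Metric.ball (0 : E) s → L z ∈ Metric.ball (0 : E) s := fun z s hz => by
      rw [mem_ball_zero_iff, hS L hL]; exact mem_ball_zero_iff.1 hz
    have hcomp : IsCompact (TimeInterval ×ˢ Metric.closedBall (0 : E) δ) :=
      isCompact_Icc.prod (isCompact_closedBall 0 δ)
    obtain ⟨C, hC⟩ := hcomp.exists_bound_of_continuousOn
      (hf.continuous_fderiv (by simp)).continuousOn
    have hCpos : 0 ≤ C := (norm_nonneg _).trans (hC (0, 0) ⟨by norm_num,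
      Metric.mem_closedBall_self hδ.le⟩)
    have hLip : ∀ t ∈ Set.Ico (0 : ℝ) 1,
        LipschitzOnWith ⟨C, hCpos⟩ (fun z => f (t, z)) (Metric.ball 0 δ) := by
      intro t ht
      refine Convex.lipschitzOnWith_of_nnnorm_hasFDerivWithin_le
        (f' := fun z => (fderiv ℝ f (t, z)).comp (ContinuousLinearMap.inr ℝ ℝ E))
        (fun z _ => ((hfd (t, z)).hasFDerivAt.comp z
          (hasFDerivAt_prodMk_right t z)).hasFDerivWithinAt) (fun z hz => ?_) (convex_ball _ _)
      change ‖_‖ ≤ C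
      refine ContinuousLinearMap.opNorm_le_bound _ hCpos fun w => ?_
      refine ((fderiv ℝ f (t, z)).le_opNorm _).trans ?_
      refine mul_le_mul (hC (t, z) ⟨Set.Ioo_subset_Icc_self (hIoo t (Set.Ico_subset_Icc_self ht)),
        Metric.ball_subset_closedBall hz⟩) ?_ (norm_nonneg _) hCpos
      simp
    have hsurj : Function.Surjective L := by
      have hinj : Function.Injective L := (injective_iff_map_eq_zero L).2 fun z hz => by
        rw [← norm_eq_zero, ← hS L hL, hz, norm_zero]
      exact LinearMap.injective_iff_surjective.1 hinj
    have hBL : ∀ z ∈ Metric.ball (0 : E) R, ∀ a b, B (L z) (L a) (L b) = B z a b := by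
      intro z hz a b
      rw [hBη, hBη, ← compContinuousLinearMap_pair, hinv L hL z hz]
    have hfL : ∀ t ∈ TimeInterval, ∀ z ∈ Metric.ball (0 : E) δ, f (t, L z) = L (f (t, z)) := by
      intro t ht z hz
      refine sub_eq_zero.1 ((hfδ t ht (L z) (hLx z δ hz)).2 _ fun w => ?_)
      obtain ⟨w, rfl⟩ := hsurj w
      rw [map_sub, sub_apply, (hfδ t ht (L z) (hLx z δ hz)).1,
        hαL L (fun x hx => ⟨hLx x R hx, hinv L hL x hx⟩) z (hδU hz)]
      have h1 := (hfδ t ht z hz).1 w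
      change B 0 _ _ + t * (B z _ _ - B 0 _ _) = _ at h1
      change _ - (B 0 _ _ + t * (B (L z) _ _ - B 0 _ _)) = _
      have h2 := hBL 0 (Metric.mem_ball_self hR) (f (t, z)) w
      rw [map_zero] at h2
      rw [h2, hBL z (hUR (hδU hz)), h1]
      ring
    have huniq := ODE_solution_unique_of_mem_Icc_right (a := (0 : ℝ)) (b := 1)
      (v := fun t z => f (t, z)) (s := fun _ => Metric.ball (0 : E) δ)
      (f := extendTime (G (0, L x))) (g := fun t => L (extendTime (G (0, x)) t)) hLip
      (continuous_extendTime _).continuousOn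
      (fun t ht => (hderiv (L x) (hrr (hLx x r hx)) t
        (Set.Ico_subset_Icc_self ht)).hasDerivWithinAt)
      (fun t _ => hmem _ (hrr (hLx x r hx)) t)
      (L.continuous.comp (continuous_extendTime _)).continuousOn
      (fun t ht => by
        have h1 := hderiv x (hrr hx) t (Set.Ico_subset_Icc_self ht)
        have h2 := L.hasFDerivAt.comp_hasDerivAt t h1
        rw [hfL t (Set.Ioo_subset_Icc_self (hIoo t (Set.Ico_subset_Icc_self ht))) _
          (hmem x (hrr hx) t)]
        exact h2.hasDerivWithinAt)
      (fun t _ => hLx _ _ (hmem _ (hrr hx) t))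
      (by rw [hinit _ (hrr (hLx x r hx)), hinit _ (hrr hx)])
    exact huniq (by norm_num)

end Moser

/-! ### Smoothness of two-forms -/

theorem contDiffOn_of_injective_comp {M V W : Type} [NormedAddCommGroup M] [NormedSpace ℝ M]
    [NormedAddCommGroup V] [NormedSpace ℝ V] [NormedAddCommGroup W] [NormedSpace ℝ W]
    [FiniteDimensional ℝ W] {f : M → V} {s : Set M} (L : V →L[ℝ] W)
    (hL : Function.Injective L) (h : ContDiffOn ℝ ∞ (fun y => L (f y)) s) :
    ContDiffOn ℝ ∞ f s := by
  obtain ⟨Λ, hΛ⟩ := LinearMap.exists_leftInverse_of_injective L.toLinearMap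
    (LinearMap.ker_eq_bot.2 hL)
  refine ((LinearMap.toContinuousLinearMap Λ).contDiff.comp_contDiffOn h).congr fun y _ => ?_
  exact (LinearMap.congr_fun hΛ (f y)).symm

theorem contDiffOn_clm_apply_pair {M E : Type} [NormedAddCommGroup M] [NormedSpace ℝ M]
    [NormedAddCommGroup E] [NormedSpace ℝ E] {b : M → E →L[ℝ] E →L[ℝ] ℝ} {f g : M → E} {s : Set M}
    (hb : ContDiffOn ℝ ∞ b s) (hf : ContDiffOn ℝ ∞ f s) (hg : ContDiffOn ℝ ∞ g s) :
    ContDiffOn ℝ ∞ (fun y => b y (f y) (g y)) s := by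
  have h1 : ContDiffOn ℝ ∞ (fun y => b y (f y)) s :=
    ContDiffOn.clm_apply (F := E) (G := E →L[ℝ] ℝ) hb hf
  exact ContDiffOn.clm_apply (F := E) (G := ℝ) h1 hg

theorem contDiffOn_form_iff {M E : Type} [NormedAddCommGroup M] [NormedSpace ℝ M]
    [NormedAddCommGroup E] [NormedSpace ℝ E] [FiniteDimensional ℝ E]
    {η : M → E [⋀^Fin 2]→L[ℝ] ℝ} {s : Set M} :
    ContDiffOn ℝ ∞ η s ↔ ∀ u v, ContDiffOn ℝ ∞ (fun y => η y ![u, v]) s := by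
  constructor
  · intro h u v
    have h1 : ContDiffOn ℝ ∞ (fun y => formBilin E (η y)) s := ContDiff.comp_contDiffOn
      (G := E →L[ℝ] E →L[ℝ] ℝ) (g := fun η => formBilin E η) contDiff_formBilin h
    exact contDiffOn_clm_apply_pair h1 contDiffOn_const contDiffOn_const
  · intro h
    have hinj : Function.Injective (formBilin E) := fun η ζ hηζ => form_ext fun u v =>
      congrArg (fun L : E →L[ℝ] E →L[ℝ] ℝ => L u v) hηζ
    have h1 : ContDiffOn ℝ ∞ (fun y => formBilin E (η y)) s :=
      contDiffOn_clm_apply.2 fun u => contDiffOn_clm_apply.2 fun v => h u v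
    exact contDiffOn_of_injective_comp (W := E →L[ℝ] E →L[ℝ] ℝ) (formBilin E) hinj h1

theorem contDiffOn_pullback {M E : Type} [NormedAddCommGroup M] [NormedSpace ℝ M]
    [FiniteDimensional ℝ M] [NormedAddCommGroup E] [NormedSpace ℝ E]
    {η : E → E [⋀^Fin 2]→L[ℝ] ℝ} {g : M → E} {s : Set M} {t : Set E} (hs : IsOpen s)
    (hη : ContDiffOn ℝ ∞ η t) (hg : ContDiffOn ℝ ∞ g s) (hst : Set.MapsTo g s t) :
    ContDiffOn ℝ ∞ (fun y => (η (g y)).compContinuousLinearMap (fderiv ℝ g y)) s := by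
  refine contDiffOn_form_iff.2 fun u v => ?_
  have h1 : ContDiffOn ℝ ∞ (fun y => formBilin E (η (g y))) s := ContDiff.comp_contDiffOn
      (G := E →L[ℝ] E →L[ℝ] ℝ) (g := fun η => formBilin E η) contDiff_formBilin (hη.comp hg hst)
  have h2 : ContDiffOn ℝ ∞ (fderiv ℝ g) s := hg.fderiv_of_isOpen hs (by simp)
  have h3 := contDiffOn_clm_apply_pair h1 (h2.clm_apply (contDiffOn_const (c := u)))
    (h2.clm_apply (contDiffOn_const (c := v)))
  exact h3.congr fun y _ => compContinuousLinearMap_pair _ _ _ _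

theorem form_zero_left {E : Type} [NormedAddCommGroup E] [NormedSpace ℝ E]
    (η : E [⋀^Fin 2]→L[ℝ] ℝ) (v : E) : η ![0, v] = 0 := η.map_coord_zero 0 rfl

/-! ### Two-forms on manifolds and their pullbacks -/

section Manifold

variable {X : Type*} [TopologicalSpace X] [ChartedSpace E₆ X]

/-- The pullback of a two-form on `X` to a normed space. -/
def pullbackForm {F : Type} [NormedAddCommGroup F] [NormedSpace ℝ F]
    (Ω : (x : X) → TangentSpace (𝓡 6) x [⋀^Fin 2]→L[ℝ] ℝ) (σ : F → X) (y : F) :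
    F [⋀^Fin 2]→L[ℝ] ℝ :=
  (Ω (σ y)).compContinuousLinearMap (mfderiv 𝓘(ℝ, F) (𝓡 6) σ y)

variable {F F' : Type} [NormedAddCommGroup F] [NormedSpace ℝ F]
  [NormedAddCommGroup F'] [NormedSpace ℝ F']
  {Ω : (x : X) → TangentSpace (𝓡 6) x [⋀^Fin 2]→L[ℝ] ℝ}

theorem pullbackForm_apply (σ : F → X) (y u v : F) : pullbackForm Ω σ y ![u, v] =
    Ω (σ y) ![mfderiv 𝓘(ℝ, F) (𝓡 6) σ y u, mfderiv 𝓘(ℝ, F) (𝓡 6) σ y v] :=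
  compContinuousLinearMap_pair (E := F) (F := E₆) _ _ _ _

theorem pullbackForm_congr {σ τ : F → X} {y : F} (h : σ =ᶠ[𝓝 y] τ) :
    pullbackForm Ω σ y = pullbackForm Ω τ y := by
  have key : ∀ (x x' : X) (A A' : F →L[ℝ] E₆), x = x' → A = A' →
      (Ω x).compContinuousLinearMap A = (Ω x').compContinuousLinearMap A' := by
    rintro x _ A _ rfl rfl
    rfl
  exact key _ _ _ _ h.eq_of_nhds h.mfderiv_eq

theorem mfderiv_comp_normedSpace {σ : F → X} {h : F' → F} {y : F'}
    (hσ : MDifferentiableAt 𝓘(ℝ, F) (𝓡 6) σ (h y)) (hh : DifferentiableAt ℝ h y) (u : F') :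
    mfderiv 𝓘(ℝ, F') (𝓡 6) (fun y => σ (h y)) y u =
      mfderiv 𝓘(ℝ, F) (𝓡 6) σ (h y) (fderiv ℝ h y u) := by
  have := mfderiv_comp (I := 𝓘(ℝ, F')) (I' := 𝓘(ℝ, F)) (I'' := 𝓡 6) y hσ hh.mdifferentiableAt
  change mfderiv 𝓘(ℝ, F') (𝓡 6) (σ ∘ h) y u = _
  rw [this, mfderiv_eq_fderiv]
  rfl

theorem pullbackForm_comp {σ : F → X} {h : F' → F} {y : F'}
    (hσ : MDifferentiableAt 𝓘(ℝ, F) (𝓡 6) σ (h y)) (hh : DifferentiableAt ℝ h y) :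
    pullbackForm Ω (fun y => σ (h y)) y =
      (pullbackForm Ω σ (h y)).compContinuousLinearMap (fderiv ℝ h y) := by
  refine form_ext fun u v => ?_
  rw [compContinuousLinearMap_pair, pullbackForm_apply, pullbackForm_apply,
    mfderiv_comp_normedSpace hσ hh, mfderiv_comp_normedSpace hσ hh]

variable [IsManifold (𝓡 6) ∞ X]

theorem contMDiffAt_extChartAt_symm {x : X} {y : E₆}
    (hy : y ∈ (extChartAt (𝓡 6) x).target) :
    ContMDiffAt 𝓘(ℝ, E₆) (𝓡 6) ∞ (extChartAt (𝓡 6) x).symm y :=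
  (contMDiffOn_extChartAt_symm x).contMDiffAt
    ((isOpen_extChartAt_target x).mem_nhds hy)

theorem contMDiffAt_chart {x y : X} (hy : y ∈ (extChartAt (𝓡 6) x).source) :
    ContMDiffAt (𝓡 6) 𝓘(ℝ, E₆) ∞ (extChartAt (𝓡 6) x) y :=
  contMDiffAt_extChartAt' (by rwa [extChartAt_source] at hy)

theorem contDiffAt_chart_comp {σ : F → X} {y : F} {x : X}
    (hσ : ContMDiffAt 𝓘(ℝ, F) (𝓡 6) ∞ σ y) (hx : σ y ∈ (extChartAt (𝓡 6) x).source) :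
    ContDiffAt ℝ ∞ (fun z => extChartAt (𝓡 6) x (σ z)) y :=
  ((contMDiffAt_chart hx).comp y hσ).contDiffAt

theorem mfderiv_chart_comp {σ : F → X} {y : F} {x : X}
    (hσ : MDifferentiableAt 𝓘(ℝ, F) (𝓡 6) σ y) (hx : σ y ∈ (extChartAt (𝓡 6) x).source) (u : F) :
    fderiv ℝ (fun z => extChartAt (𝓡 6) x (σ z)) y u =
      mfderiv (𝓡 6) 𝓘(ℝ, E₆) (extChartAt (𝓡 6) x) (σ y)
        (mfderiv 𝓘(ℝ, F) (𝓡 6) σ y u) := by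
  have h := mfderiv_comp (I := 𝓘(ℝ, F)) (I' := 𝓡 6)
    (I'' := 𝓘(ℝ, E₆)) (g := extChartAt (𝓡 6) x) y
    ((contMDiffAt_chart hx).mdifferentiableAt (by simp)) hσ
  rw [mfderiv_eq_fderiv] at h
  exact congrArg (fun L : F →L[ℝ] E₆ => L u) h

theorem fderiv_chart_comp_eq_zero_iff {σ : F → X} {y : F} {x : X}
    (hσ : MDifferentiableAt 𝓘(ℝ, F) (𝓡 6) σ y) (hx : σ y ∈ (extChartAt (𝓡 6) x).source) {u : F} :
    fderiv ℝ (fun z => extChartAt (𝓡 6) x (σ z)) y u = 0 ↔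
      mfderiv 𝓘(ℝ, F) (𝓡 6) σ y u = 0 := by
  rw [mfderiv_chart_comp hσ hx]
  have hinv := isInvertible_mfderiv_extChartAt (I := 𝓡 6) (x := x) hx
  refine ⟨fun h => hinv.injective ?_, fun h => ?_⟩
  · rw [h]; exact (map_zero _).symm
  · rw [h]; exact map_zero _

theorem pullbackForm_eventuallyEq {σ : F → X} {y : F} {s : Set F} (hs : s ∈ 𝓝 y)
    (hσ : ContMDiffOn 𝓘(ℝ, F) (𝓡 6) ∞ σ s) :
    ∀ᶠ z in 𝓝 y, pullbackForm Ω σ z =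
      (formInChart Ω (σ y) (extChartAt (𝓡 6) (σ y) (σ z))).compContinuousLinearMap
        (fderiv ℝ (fun z => extChartAt (𝓡 6) (σ y) (σ z)) z) := by
  obtain ⟨t, hts, ht, hyt⟩ := mem_nhds_iff.1 hs
  have hσ' := hσ.mono hts
  have ho : IsOpen (t ∩ σ ⁻¹' (extChartAt (𝓡 6) (σ y)).source) :=
    hσ'.continuousOn.isOpen_inter_preimage ht (isOpen_extChartAt_source _)
  filter_upwards [ho.mem_nhds ⟨hyt, mem_extChartAt_source _⟩] with z hz
  have hσz := hσ'.contMDiffAt (ht.mem_nhds hz.1)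
  have hev : σ =ᶠ[𝓝 z]
      fun w => (extChartAt (𝓡 6) (σ y)).symm (extChartAt (𝓡 6) (σ y) (σ w)) := by
    filter_upwards [ho.mem_nhds hz] with w hw
    exact ((extChartAt (𝓡 6) (σ y)).left_inv hw.2).symm
  rw [pullbackForm_congr hev]
  exact pullbackForm_comp ((contMDiffAt_extChartAt_symm
    ((extChartAt (𝓡 6) (σ y)).map_source hz.2)).mdifferentiableAt (by simp))
    ((contDiffAt_chart_comp hσz hz.2).differentiableAt (by simp))

theorem contDiffOn_pullbackForm [FiniteDimensional ℝ F] (hΩ : IsSymplecticForm Ω) {σ : F → X}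
    {s : Set F} (hs : IsOpen s) (hσ : ContMDiffOn 𝓘(ℝ, F) (𝓡 6) ∞ σ s) :
    ContDiffOn ℝ ∞ (pullbackForm Ω σ) s := by
  intro y hy
  have ho : IsOpen (s ∩ σ ⁻¹' (extChartAt (𝓡 6) (σ y)).source) :=
    hσ.continuousOn.isOpen_inter_preimage hs (isOpen_extChartAt_source _)
  have h := contDiffOn_pullback ho (hΩ.smooth (σ y))
    (g := fun z => extChartAt (𝓡 6) (σ y) (σ z)) (fun z hz => (contDiffAt_chart_comp
      (hσ.contMDiffAt (hs.mem_nhds hz.1)) hz.2).contDiffWithinAt)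
    (fun z hz => (extChartAt (𝓡 6) (σ y)).map_source hz.2)
  exact ((h.contDiffAt (ho.mem_nhds ⟨hy, mem_extChartAt_source _⟩)).congr_of_eventuallyEq
    (pullbackForm_eventuallyEq (hs.mem_nhds hy) hσ)).contDiffWithinAt

theorem extDeriv_pullbackForm (hΩ : IsSymplecticForm Ω) {σ : F → X} {s : Set F} {y : F}
    (hs : s ∈ 𝓝 y) (hσ : ContMDiffOn 𝓘(ℝ, F) (𝓡 6) ∞ σ s) :
    extDeriv (pullbackForm Ω σ) y = 0 := by
  rw [Filter.EventuallyEq.extDeriv_eq (pullbackForm_eventuallyEq (Ω := Ω) hs hσ)]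
  have hmem := mem_extChartAt_target (I := 𝓡 6) (σ y)
  have hφ : ContDiffAt ℝ ∞ (fun z => extChartAt (𝓡 6) (σ y) (σ z)) y :=
    contDiffAt_chart_comp (hσ.contMDiffAt hs) (mem_extChartAt_source _)
  have hη : DifferentiableAt ℝ (formInChart Ω (σ y)) (extChartAt (𝓡 6) (σ y) (σ y)) :=
    ((hΩ.smooth (σ y)).contDiffAt
      ((isOpen_extChartAt_target _).mem_nhds hmem)).differentiableAt (by simp)
  rw [extDeriv_pullback (f := fun z => extChartAt (𝓡 6) (σ y) (σ z)) hη hφ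
      (by simp only [minSmoothness_of_isRCLikeNormedField]; exact ENat.LEInfty.out),
    hΩ.closed _ _ hmem]
  ext v
  rfl

end Manifold

/-! ### Rotations -/

/-- The rotation by the angle `2 π t`. -/
def rotation (t : ℝ) : Circle := Circle.exp (2 * Real.pi * t)

theorem rotation_zero : rotation 0 = 1 := by simp [rotation]

theorem rotation_one : rotation 1 = 1 := by simp [rotation]

theorem rotation_add (s t : ℝ) : rotation (s + t) = rotation s * rotation t := by
  simp [rotation, mul_add, Circle.exp_add]

theorem rotation_surjective : Function.Surjective rotation := by
  intro g
  refine ⟨Circle.argEquiv g / (2 * Real.pi), ?_⟩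
  rw [rotation, mul_div_cancel₀ _ (by positivity)]
  exact Circle.exp_arg g

theorem contMDiff_rotation : ContMDiff 𝓘(ℝ, ℝ) (𝓡 1) ∞ rotation := by
  have h : ContMDiff 𝓘(ℝ, ℝ) 𝓘(ℝ, ℝ) ∞ (fun t : ℝ => 2 * Real.pi * t) :=
    (contDiff_const.mul contDiff_id).contMDiff
  exact contMDiff_circleExp.comp h

theorem eventually_exists_rotation {P : Circle → Prop} (h : ∀ᶠ t in 𝓝[≠] (0 : ℝ), P (rotation t)) :
    ∀ᶠ g in 𝓝[≠] (1 : Circle), P g := by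
  have hc : ContinuousAt (fun g : Circle => Complex.arg g / (2 * Real.pi)) 1 := by
    have h1 : ContinuousAt Complex.arg ((1 : Circle) : ℂ) := Complex.continuousAt_arg (by simp)
    have h2 : ContinuousAt (fun g : Circle => (g : ℂ)) 1 := continuous_subtype_val.continuousAt
    exact (ContinuousAt.comp (f := fun g : Circle => (g : ℂ)) h1 h2).div_const _
  have h0 : Complex.arg ((1 : Circle) : ℂ) / (2 * Real.pi) = 0 := by simp
  have hr : ∀ g : Circle, rotation (Complex.arg g / (2 * Real.pi)) = g := fun g => by
    rw [rotation, mul_div_cancel₀ _ (by positivity)]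
    exact Circle.exp_arg g
  have hc' : Filter.Tendsto (fun g : Circle => Complex.arg g / (2 * Real.pi)) (𝓝[≠] 1) (𝓝[≠] 0) := by
    refine tendsto_nhdsWithin_iff.2 ⟨?_, ?_⟩
    · have := hc.tendsto
      rw [h0] at this
      exact this.mono_left nhdsWithin_le_nhds
    · filter_upwards [self_mem_nhdsWithin] with g hg h
      refine hg ?_
      rw [Set.mem_singleton_iff] at h ⊢
      rw [← hr g, h, rotation_zero]
  filter_upwards [hc'.eventually h] with g hg
  rwa [hr] at hg

theorem exists_pos_of_coe_eq (T : ℝ) :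
    ∃ δ : ℝ, 0 < δ ∧ ∀ a b : ℝ, |a - b| < δ → (a : AddCircle T) = b → a = b := by
  have key : ∀ a b : ℝ, (a : AddCircle T) = b → ∃ n : ℤ, n * T = a - b := fun a b h => by
    have h1 : ((a - b : ℝ) : AddCircle T) = 0 := by
      rw [AddCircle.coe_sub, h, sub_self]
    obtain ⟨n, hn⟩ := (AddCircle.coe_eq_zero_iff T).1 h1
    exact ⟨n, by rw [← hn, zsmul_eq_mul]⟩
  by_cases hT : T = 0
  · refine ⟨1, one_pos, fun a b _ h => ?_⟩
    obtain ⟨n, hn⟩ := key a b h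
    rw [hT, mul_zero] at hn
    linarith
  · refine ⟨|T|, abs_pos.2 hT, fun a b hab h => ?_⟩
    obtain ⟨n, hn⟩ := key a b h
    rw [← hn, abs_mul] at hab
    have h1 : |(n : ℝ)| < 1 := by
      by_contra! h2
      nlinarith [abs_pos.2 hT]
    have h2 : n = 0 := by
      rw [← Int.abs_lt_one_iff]
      exact_mod_cast h1
    rw [h2] at hn
    push_cast at hn
    linarith

section Action

variable {X : Type*} [TopologicalSpace X] [ChartedSpace E₆ X]
  [MulAction Circle X] [ContMDiffSMul (𝓡 1) (𝓡 6) ∞ Circle X]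
  {F : Type} [NormedAddCommGroup F] [NormedSpace ℝ F]
  {Ω : (x : X) → TangentSpace (𝓡 6) x [⋀^Fin 2]→L[ℝ] ℝ}

theorem contMDiffAt_rotation_smul {θ : F → ℝ} {σ : F → X} {y : F} (hθ : ContDiffAt ℝ ∞ θ y)
    (hσ : ContMDiffAt 𝓘(ℝ, F) (𝓡 6) ∞ σ y) :
    ContMDiffAt 𝓘(ℝ, F) (𝓡 6) ∞ (fun z => rotation (θ z) • σ z) y :=
  ContMDiffAt.smul (I := 𝓡 1) (contMDiff_rotation.contMDiffAt.comp y hθ.contMDiffAt) hσ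

theorem contMDiff_const_smul (g : Circle) : ContMDiff (𝓡 6) (𝓡 6) ∞ (fun x : X => g • x) :=
  ContMDiffSMul.contMDiff_const_smul (I := 𝓡 1) g

theorem contMDiffAt_const_smul {σ : F → X} {y : F} (g : Circle)
    (hσ : ContMDiffAt 𝓘(ℝ, F) (𝓡 6) ∞ σ y) :
    ContMDiffAt 𝓘(ℝ, F) (𝓡 6) ∞ (fun z => g • σ z) y :=
  (contMDiff_const_smul g).contMDiffAt.comp y hσ

theorem mfderiv_smul_comp {σ : F → X} {y : F} (g : Circle)
    (hσ : MDifferentiableAt 𝓘(ℝ, F) (𝓡 6) σ y) (u : F) :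
    mfderiv 𝓘(ℝ, F) (𝓡 6) (fun z => g • σ z) y u =
      mfderiv (𝓡 6) (𝓡 6) (fun x : X => g • x) (σ y) (mfderiv 𝓘(ℝ, F) (𝓡 6) σ y u) :=
  mfderiv_comp_apply (I := 𝓘(ℝ, F)) (I' := 𝓡 6) (I'' := 𝓡 6) (g := fun x : X => g • x) y
    ((contMDiff_const_smul g).mdifferentiableAt (by simp)) hσ u

theorem pullbackForm_smul (hinv : IsInvariantForm Ω) {σ : F → X} {y : F} (g : Circle)
    (hσ : MDifferentiableAt 𝓘(ℝ, F) (𝓡 6) σ y) :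
    pullbackForm Ω (fun z => g • σ z) y = pullbackForm Ω σ y := by
  refine form_ext fun u v => ?_
  rw [pullbackForm_apply, pullbackForm_apply, mfderiv_smul_comp g hσ, mfderiv_smul_comp g hσ,
    ← hinv g (σ y)]
  exact (compContinuousLinearMap_pair (E := E₆)
    (F := E₆) _ _ _ _).symm

theorem contMDiff_orbit (x : X) : ContMDiff 𝓘(ℝ, ℝ) (𝓡 6) ∞ (fun t : ℝ => rotation t • x) :=
  fun _ => contMDiffAt_rotation_smul contDiffAt_id contMDiffAt_const

theorem mfderiv_orbit (x : X) (t : ℝ) :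
    (mfderiv 𝓘(ℝ, ℝ) (𝓡 6) (fun t : ℝ => rotation t • x) t (1 : ℝ) : E₆) =
      generator (rotation t • x) := by
  have h := mfderiv_comp_normedSpace (σ := fun s : ℝ => rotation s • (rotation t • x))
    (h := fun s : ℝ => s - t) (y := t) ((contMDiff_orbit _).mdifferentiableAt (by simp))
    (by fun_prop) 1
  have he : (fun s : ℝ => rotation (s - t) • (rotation t • x)) = fun s : ℝ => rotation s • x := by
    funext s
    rw [smul_smul, ← rotation_add, sub_add_cancel]
  rw [he] at h
  refine h.trans ?_
  have h1 : fderiv ℝ (fun s : ℝ => s - t) t 1 = 1 := by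
    rw [fderiv_sub_const]; simp
  rw [h1, sub_self]
  rfl

theorem mfderiv_smul_generator (g : Circle) (x : X) :
    (mfderiv (𝓡 6) (𝓡 6) (fun x : X => g • x) x (generator x) : E₆) =
      generator (g • x) := by
  obtain ⟨t, rfl⟩ := rotation_surjective g
  have e0 : ∀ y : X, (generator (rotation 0 • y) : E₆) = generator y := fun y =>
    congrArg (fun y : X => (generator y : E₆))
      (by rw [rotation_zero, one_smul])
  have h1 : (mfderiv 𝓘(ℝ, ℝ) (𝓡 6) (fun s : ℝ => rotation t • (rotation s • x)) 0 (1 : ℝ) :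
      E₆) = mfderiv (𝓡 6) (𝓡 6) (fun x : X => rotation t • x)
        (rotation 0 • x) (mfderiv 𝓘(ℝ, ℝ) (𝓡 6) (fun s : ℝ => rotation s • x) 0 (1 : ℝ)) :=
    mfderiv_smul_comp (σ := fun s : ℝ => rotation s • x) (y := 0) (rotation t)
      ((contMDiff_orbit _).mdifferentiableAt (by simp)) 1
  have h2 : (fun s : ℝ => rotation t • (rotation s • x)) =
      fun s : ℝ => rotation s • (rotation t • x) := by
    funext s
    rw [smul_smul, smul_smul, mul_comm]
  have h3 : (mfderiv 𝓘(ℝ, ℝ) (𝓡 6) (fun s : ℝ => rotation t • (rotation s • x)) 0 (1 : ℝ) :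
      E₆) = generator (rotation t • x) :=
    ((congrArg (fun f : ℝ → X => (mfderiv 𝓘(ℝ, ℝ) (𝓡 6) f 0 (1 : ℝ) : E₆))
      h2).trans (mfderiv_orbit (rotation t • x) 0)).trans (e0 _)
  have h4 : ∀ (y : X) (v v' : E₆), y = x → v = v' →
      (mfderiv (𝓡 6) (𝓡 6) (fun x : X => rotation t • x) y v : E₆) =
        mfderiv (𝓡 6) (𝓡 6) (fun x : X => rotation t • x) x v' := by
    rintro y v v' rfl rfl; rfl
  exact (h4 (rotation 0 • x) _ _ (by rw [rotation_zero, one_smul])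
    ((mfderiv_orbit x 0).trans (e0 x))).symm.trans (h1.symm.trans h3)

theorem mfderiv_rotation_smul {τ : F → X} {t : ℝ} {w : F}
    (hτ : ContMDiffAt 𝓘(ℝ, F) (𝓡 6) ∞ τ w) (s : ℝ) (u : F) :
    (mfderiv 𝓘(ℝ, ℝ × F) (𝓡 6) (fun z : ℝ × F => rotation z.1 • τ z.2) (t, w) (s, u) :
      E₆) = s • (generator (rotation t • τ w) : E₆) +
      mfderiv 𝓘(ℝ, F) (𝓡 6) (fun z => rotation t • τ z) w u := by
  have ha : MDifferentiableAt 𝓘(ℝ, ℝ × F) (𝓡 6) (fun z : ℝ × F => rotation z.1 • τ z.2) (t, w) :=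
    (contMDiffAt_rotation_smul contDiffAt_fst
      (ContMDiffAt.comp (t, w) hτ contDiffAt_snd.contMDiffAt)).mdifferentiableAt (by simp)
  have h1 := mfderiv_comp_normedSpace (h := fun s : ℝ => (s, w)) (y := t) ha (by fun_prop) s
  have h2 := mfderiv_comp_normedSpace (h := fun z : F => (t, z)) (y := w) ha (by fun_prop) u
  have e1 : fderiv ℝ (fun s : ℝ => (s, w)) t s = (s, 0) := by
    rw [(hasFDerivAt_prodMk_left t w).fderiv]; rfl
  have e2 : fderiv ℝ (fun z : F => (t, z)) w u = (0, u) := by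
    rw [(hasFDerivAt_prodMk_right t w).fderiv]; rfl
  rw [e1] at h1
  rw [e2] at h2
  have h3 : (s, u) = (s, (0 : F)) + (0, u) := by simp
  rw [h3]
  refine (map_add _ _ _).trans ?_
  refine congrArg₂ (fun a b : E₆ => a + b) (h1.symm.trans ?_) h2.symm
  have h4 := mfderiv_orbit (τ w) t
  rw [← h4]
  have h5 : s = s • (1 : ℝ) := by simp
  conv_lhs => rw [h5]
  exact map_smul _ _ _

/-! ### Fixed points and stabilizers -/

section Fixed

variable [IsManifold (𝓡 6) ∞ X]

theorem smul_eq_of_generator_eq_zero {x : X} (h : (generator x : E₆) = 0)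
    (g : Circle) : g • x = x := by
  obtain ⟨t, rfl⟩ := rotation_surjective g
  have hgen : ∀ t : ℝ, (generator (rotation t • x) : E₆) = 0 := fun t => by
    rw [← mfderiv_smul_generator, h]
    exact map_zero _
  have hloc : ∀ s ∈ Set.univ, ∀ᶠ s' in 𝓝[Set.univ] s, rotation s • x = rotation s' • x := by
    intro s _
    rw [nhdsWithin_univ]
    have ho : IsOpen ((fun t : ℝ => rotation t • x) ⁻¹' (extChartAt (𝓡 6) (rotation s • x)).source) :=
      (isOpen_extChartAt_source _).preimage (contMDiff_orbit x).continuous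
    obtain ⟨δ, hδ, hb⟩ := Metric.isOpen_iff.1 ho s (mem_extChartAt_source _)
    have hd : ∀ t ∈ Metric.ball s δ, HasDerivAt
        (fun t : ℝ => extChartAt (𝓡 6) (rotation s • x) (rotation t • x)) 0 t := by
      intro t ht
      have h1 := ((contDiffAt_chart_comp ((contMDiff_orbit x) t)
        (hb ht)).differentiableAt (by simp)).hasFDerivAt.hasDerivAt
      rwa [(fderiv_chart_comp_eq_zero_iff (((contMDiff_orbit x) t).mdifferentiableAt (by simp))
        (hb ht)).2 ((mfderiv_orbit x t).trans (hgen t))] at h1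
    filter_upwards [Metric.ball_mem_nhds s hδ] with t ht
    have h2 := Metric.isOpen_ball.is_const_of_deriv_eq_zero (convex_ball s δ).isPreconnected
      (fun t ht => (hd t ht).differentiableAt.differentiableWithinAt) (fun t ht => (hd t ht).deriv)
      (Metric.mem_ball_self hδ) ht
    exact (extChartAt (𝓡 6) (rotation s • x)).injOn (mem_extChartAt_source _) (hb ht) h2
  have h3 := isPreconnected_univ.induction₂ (fun s s' : ℝ => rotation s • x = rotation s' • x) hloc
    (fun _ _ _ _ _ _ => Eq.trans) (fun _ _ _ _ => Eq.symm) (Set.mem_univ t) (Set.mem_univ 0)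
  rw [h3, rotation_zero, one_smul]

omit [IsManifold (𝓡 6) ∞ X] in
theorem generator_eq_zero_of_smul_eq {x : X} (h : ∀ g : Circle, g • x = x) :
    (generator x : E₆) = 0 := by
  have h1 : (fun t : ℝ => rotation t • x) = fun _ => x := funext fun t => h _
  have h2 : (mfderiv 𝓘(ℝ, ℝ) (𝓡 6) (fun _ : ℝ => x) 0 (1 : ℝ) : E₆) = 0 := by
    rw [mfderiv_const]; rfl
  exact (congrArg (fun f : ℝ → X => (mfderiv 𝓘(ℝ, ℝ) (𝓡 6) f 0 (1 : ℝ) :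
    E₆)) h1).trans h2

theorem eventually_rotation_smul_ne {x : X} (h : (generator x : E₆) ≠ 0) :
    ∀ᶠ t in 𝓝[≠] (0 : ℝ), rotation t • x ≠ x := by
  have hx : rotation 0 • x ∈ (extChartAt (𝓡 6) x).source := by
    rw [rotation_zero, one_smul]; exact mem_extChartAt_source x
  have h1 := ((contDiffAt_chart_comp ((contMDiff_orbit x) 0)
    hx).differentiableAt (by simp)).hasFDerivAt.hasDerivAt
  have h2 := h1.eventually_ne (c := extChartAt (𝓡 6) x x) (fun h0 => h (by
    have h3 := (fderiv_chart_comp_eq_zero_iff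
      (((contMDiff_orbit x) 0).mdifferentiableAt (by simp)) hx).1 h0
    exact h3))
  filter_upwards [h2] with t ht h0
  exact ht (by rw [h0])

theorem finite_stabilizer [T2Space X] {x : X}
    (h : (generator x : E₆) ≠ 0) : Finite (MulAction.stabilizer Circle x) := by
  have hcs : ContinuousSMul Circle X := ContMDiffSMul.continuousSMul (I := 𝓡 1) (I' := 𝓡 6) ∞
  have hev := eventually_exists_rotation (P := fun g => g • x ≠ x) (eventually_rotation_smul_ne h)
  by_contra hfin
  have hinf : (MulAction.stabilizer Circle x : Set Circle).Infinite := Set.infinite_coe_iff.1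
    (not_finite_iff_infinite.1 hfin)
  obtain ⟨g, -, hg⟩ := hinf.exists_accPt_of_subset_isCompact isCompact_univ (Set.subset_univ _)
  have hclosed : IsClosed (MulAction.stabilizer Circle x : Set Circle) :=
    isClosed_eq (f := fun g : Circle => g • x) (continuous_id.smul continuous_const)
      continuous_const
  have hgm : g ∈ MulAction.stabilizer Circle x := hclosed.closure_subset hg.clusterPt.mem_closure
  have hfreq := accPt_iff_frequently_nhdsNE.1 hg
  have hmap : Filter.Tendsto (fun k : Circle => g⁻¹ * k) (𝓝[≠] g) (𝓝[≠] 1) := by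
    refine tendsto_nhdsWithin_iff.2 ⟨?_, ?_⟩
    · have : Continuous (fun k : Circle => g⁻¹ * k) := by fun_prop
      have := this.tendsto g
      rw [inv_mul_cancel] at this
      exact this.mono_left nhdsWithin_le_nhds
    · filter_upwards [self_mem_nhdsWithin] with k hk h1
      exact hk ((inv_mul_eq_one.1 h1).symm)
  obtain ⟨k, hk, hk'⟩ := (hfreq.and_eventually (hmap.eventually hev)).exists
  refine hk' ?_
  have hkx : k • x = x := hk
  rw [mul_smul, hkx, inv_smul_eq_iff]
  exact hgm.symm

end Fixed

/-! ### Moment maps -/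

section Moment

variable {T : ℝ} {Φ : X → AddCircle T}

theorem moment_comp_fderiv (hΦ : IsMomentMap Ω Φ) {σ : F → X} {h : F → ℝ} {l : AddCircle T} {y : F}
    (hσ : ContMDiffAt 𝓘(ℝ, F) (𝓡 6) ∞ σ y) (hh : ContinuousAt h y)
    (hl : ∀ᶠ z in 𝓝 y, Φ (σ z) = l + (h z : AddCircle T)) :
    ∃ c : ℝ, ∃ f : X → ℝ, ContMDiffAt (𝓡 6) 𝓘(ℝ, ℝ) ∞ f (σ y) ∧ (∀ᶠ x in 𝓝 (σ y), Φ x = f x) ∧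
      (∀ v : TangentSpace (𝓡 6) (σ y), (mfderiv (𝓡 6) 𝓘(ℝ, ℝ) f (σ y) v : ℝ) =
        Ω (σ y) ![v, generator (σ y)]) ∧ ∀ᶠ z in 𝓝 y, f (σ z) = h z + c := by
  obtain ⟨U, hU, hyU, f, hf, hfU⟩ := hΦ (σ y)
  obtain ⟨δ, hδ, hT⟩ := exists_pos_of_coe_eq T
  have hfy : ContMDiffAt (𝓡 6) 𝓘(ℝ, ℝ) ∞ f (σ y) := hf.contMDiffAt (hU.mem_nhds hyU)
  refine ⟨f (σ y) - h y, f, hfy, ?_, (hfU _ hyU).2, ?_⟩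
  · filter_upwards [hU.mem_nhds hyU] with x hx using (hfU x hx).1
  have hc : ContinuousAt (fun z => f (σ z) - h z) y :=
    (ContinuousAt.comp (f := σ) hfy.continuousAt hσ.continuousAt).sub hh
  filter_upwards [hl, hσ.continuousAt.eventually (hU.mem_nhds hyU),
    hc.eventually (Metric.ball_mem_nhds _ hδ)] with z hz hzU hzδ
  have h1 := hT _ _ hzδ (by
    have e1 := (hfU _ hzU).1
    have e2 := (hfU _ hyU).1
    rw [AddCircle.coe_sub, AddCircle.coe_sub, ← e1, ← e2, hz, hl.self_of_nhds]
    abel)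
  linarith

theorem fderiv_moment_comp {σ : F → X} {f : X → ℝ} {y : F}
    (hσ : MDifferentiableAt 𝓘(ℝ, F) (𝓡 6) σ y) (hf : MDifferentiableAt (𝓡 6) 𝓘(ℝ, ℝ) f (σ y))
    (hΩ : ∀ v : TangentSpace (𝓡 6) (σ y), (mfderiv (𝓡 6) 𝓘(ℝ, ℝ) f (σ y) v : ℝ) =
        Ω (σ y) ![v, generator (σ y)]) :
    DifferentiableAt ℝ (fun z => f (σ z)) y ∧ ∀ u, fderiv ℝ (fun z => f (σ z)) y u =
      Ω (σ y) ![mfderiv 𝓘(ℝ, F) (𝓡 6) σ y u, generator (σ y)] := by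
  refine ⟨(MDifferentiableAt.comp y hf hσ).differentiableAt, fun u => ?_⟩
  rw [← hΩ]
  have := mfderiv_comp_apply (I := 𝓘(ℝ, F)) (I' := 𝓡 6) (I'' := 𝓘(ℝ, ℝ)) (g := f) y hf hσ u
  rw [mfderiv_eq_fderiv] at this
  exact this

/-- If the moment map is `l + h` along `σ`, then its derivative along `σ` is that of `h`. -/
theorem form_generator_eq_fderiv (hΦ : IsMomentMap Ω Φ) {σ : F → X} {h : F → ℝ} {l : AddCircle T}
    {y : F} (hσ : ContMDiffAt 𝓘(ℝ, F) (𝓡 6) ∞ σ y) (hh : ContinuousAt h y)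
    (hl : ∀ᶠ z in 𝓝 y, Φ (σ z) = l + (h z : AddCircle T)) (u : F) :
    Ω (σ y) ![mfderiv 𝓘(ℝ, F) (𝓡 6) σ y u, generator (σ y)] = fderiv ℝ h y u := by
  obtain ⟨c, f, hf, -, hΩ, hc⟩ := moment_comp_fderiv hΦ hσ hh hl
  rw [← (fderiv_moment_comp (hσ.mdifferentiableAt (by simp)) (hf.mdifferentiableAt (by simp))
    hΩ).2 u, Filter.EventuallyEq.fderiv_eq (f := fun z => h z + c) hc, fderiv_add_const]

theorem form_generator_eq_zero (hΦ : IsMomentMap Ω Φ) {σ : F → X} {l : AddCircle T}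
    {y : F} (hσ : ContMDiffAt 𝓘(ℝ, F) (𝓡 6) ∞ σ y) (hl : ∀ᶠ z in 𝓝 y, Φ (σ z) = l) (u : F) :
    Ω (σ y) ![mfderiv 𝓘(ℝ, F) (𝓡 6) σ y u, generator (σ y)] = 0 := by
  rw [form_generator_eq_fderiv hΦ (h := fun _ => 0) (l := l) hσ continuousAt_const
    (by simpa using hl) u]
  simp

/-- A map along which the moment map has the same derivative as a function `h`. -/
theorem moment_sub_eq_of_fderiv_eq (hΦ : IsMomentMap Ω Φ) {σ : F → X} {h : F → ℝ} {J : Set F}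
    (hJ : IsOpen J) (hJ' : IsPreconnected J) (hσ : ContMDiffOn 𝓘(ℝ, F) (𝓡 6) ∞ σ J)
    (hh : DifferentiableOn ℝ h J)
    (hd : ∀ y ∈ J, ∀ u, Ω (σ y) ![mfderiv 𝓘(ℝ, F) (𝓡 6) σ y u, generator (σ y)] = fderiv ℝ h y u)
    {y z : F} (hy : y ∈ J) (hz : z ∈ J) :
    Φ (σ y) - (h y : AddCircle T) = Φ (σ z) - (h z : AddCircle T) := by
  refine hJ'.induction₂ (fun y z => Φ (σ y) - (h y : AddCircle T) = Φ (σ z) - (h z : AddCircle T))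
    ?_ (fun _ _ _ _ _ _ => Eq.trans) (fun _ _ _ _ => Eq.symm) hy hz
  intro y hy
  refine mem_nhdsWithin_of_mem_nhds ?_
  obtain ⟨U, hU, hyU, f, hf, hfU⟩ := hΦ (σ y)
  obtain ⟨δ, hδ, hb⟩ := Metric.isOpen_iff.1 (hσ.continuousOn.isOpen_inter_preimage hJ hU) y ⟨hy, hyU⟩
  have hd' : ∀ z ∈ Metric.ball y δ, DifferentiableAt ℝ (fun z => f (σ z) - h z) z ∧
      fderiv ℝ (fun z => f (σ z) - h z) z = 0 := by
    intro z hz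
    obtain ⟨hzJ, hzU⟩ := hb hz
    have h1 := fderiv_moment_comp ((hσ.contMDiffAt (hJ.mem_nhds hzJ)).mdifferentiableAt (by simp))
      ((hf.contMDiffAt (hU.mem_nhds hzU)).mdifferentiableAt (by simp)) (hfU _ hzU).2
    have h2 := (hh z hzJ).differentiableAt (hJ.mem_nhds hzJ)
    refine ⟨h1.1.fun_sub h2, ?_⟩
    ext u
    rw [fderiv_fun_sub h1.1 h2]
    simp only [sub_apply, h1.2, hd z hzJ u, sub_self, zero_apply]
  filter_upwards [Metric.ball_mem_nhds y hδ] with z hz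
  have h2 := Metric.isOpen_ball.is_const_of_fderiv_eq_zero (𝕜 := ℝ) (convex_ball y δ).isPreconnected
    (fun t ht => (hd' t ht).1.differentiableWithinAt) (fun t ht => (hd' t ht).2)
    (Metric.mem_ball_self hδ) hz
  change f (σ y) - h y = f (σ z) - h z at h2
  have e1 := (hfU _ (hb hz).2).1
  have e2 := (hfU _ hyU).1
  change Φ (σ y) - _ = Φ (σ z) - _
  rw [e1, e2, ← AddCircle.coe_sub, ← AddCircle.coe_sub, h2]

theorem moment_smul (hΦ : IsMomentMap Ω Φ) (g : Circle) (x : X) : Φ (g • x) = Φ x := by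
  obtain ⟨t, rfl⟩ := rotation_surjective g
  have h := moment_sub_eq_of_fderiv_eq hΦ (σ := fun t : ℝ => rotation t • x) (h := fun _ => 0)
    isOpen_univ isPreconnected_univ (contMDiff_orbit x).contMDiffOn
    (differentiableOn_const _) (fun s _ (u : ℝ) => by
      have h1 : (mfderiv 𝓘(ℝ, ℝ) (𝓡 6) (fun t : ℝ => rotation t • x) s u :
          E₆) = u • (generator (rotation s • x) :
            E₆) := by
        rw [← mfderiv_orbit]
        have h5 : u = u • (1 : ℝ) := by simp
        conv_lhs => rw [h5]
        exact map_smul _ _ _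
      have h2 : ∀ (η : E₆ [⋀^Fin 2]→L[ℝ] ℝ) (v : E₆),
          η ![u • v, v] = 0 := fun η v => by
        have := form_self η v
        rw [← formBilin_apply, map_smul, smul_apply, formBilin_apply, this, smul_zero]
      refine (congrArg (fun v : E₆ => (Ω (rotation s • x) :
        E₆ [⋀^Fin 2]→L[ℝ] ℝ) ![v, generator (rotation s • x)]) h1).trans ?_
      rw [fderiv_const_apply]
      exact h2 _ _) (Set.mem_univ t) (Set.mem_univ 0)
  simpa [rotation_zero] using h

/-- The form of a family of rotated points of a level set. -/
theorem pullbackForm_rotation_smul (hinv : IsInvariantForm Ω) (hΦ : IsMomentMap Ω Φ) {τ : F → X}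
    {l : AddCircle T} {t : ℝ} {w : F} (hτ : ContMDiffAt 𝓘(ℝ, F) (𝓡 6) ∞ τ w)
    (hl : ∀ᶠ z in 𝓝 w, Φ (τ z) = l) (s s' : ℝ) (u u' : F) :
    pullbackForm Ω (fun z : ℝ × F => rotation z.1 • τ z.2) (t, w) ![(s, u), (s', u')] =
      pullbackForm Ω τ w ![u, u'] := by
  have hg := contMDiffAt_const_smul (rotation t) hτ
  have h0 : ∀ v, Ω (rotation t • τ w) ![mfderiv 𝓘(ℝ, F) (𝓡 6) (fun z => rotation t • τ z) w v,
      generator (rotation t • τ w)] = 0 := form_generator_eq_zero hΦ (l := l) hg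
    (by filter_upwards [hl] with z hz; rw [moment_smul hΦ, hz])
  rw [← pullbackForm_smul hinv (rotation t) (hτ.mdifferentiableAt (by simp)), pullbackForm_apply,
    pullbackForm_apply]
  have h2 : ∀ (η : E₆ [⋀^Fin 2]→L[ℝ] ℝ) (x a b : E₆),
      η ![a, x] = 0 → η ![b, x] = 0 → η ![s • x + a, s' • x + b] = η ![a, b] := by
    intro η x a b ha hb
    have hb' := form_swap η x b
    rw [← formBilin_apply] at ha hb hb' ⊢
    simp only [map_add, map_smul, add_apply, smul_apply, formBilin_apply, form_self,
      smul_eq_mul, mul_zero, zero_add] at ha hb hb' ⊢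
    rw [ha, hb', hb]; simp
  have e := mfderiv_rotation_smul (t := t) hτ s u
  have e' := mfderiv_rotation_smul (t := t) hτ s' u'
  refine (congrArg₂ (fun v v' : E₆ => (Ω (rotation t • τ w) :
        E₆ [⋀^Fin 2]→L[ℝ] ℝ) ![v, v']) e e').trans ?_
  exact h2 _ _ _ _ (h0 u) (h0 u')

end Moment

end Action

section Lift

variable {X : Type*} [TopologicalSpace X] [ChartedSpace E₆ X]
  [IsManifold (𝓡 6) ∞ X]
  [MulAction Circle X] [ContMDiffSMul (𝓡 1) (𝓡 6) ∞ Circle X]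
  {Ω : (x : X) → TangentSpace (𝓡 6) x [⋀^Fin 2]→L[ℝ] ℝ} {T : ℝ} {Φ : X → AddCircle T}

/-! ### Coordinates near a point that is not fixed -/

theorem exists_moment_coordinate (hΩ : IsSymplecticForm Ω) (hΦ : IsMomentMap Ω Φ) {x : X}
    (hx : (generator x : E₆) ≠ 0) :
    ∃ (f : E₆ → ℝ) (V : Set E₆), IsOpen V ∧
      extChartAt (𝓡 6) x x ∈ V ∧ ContDiffOn ℝ ∞ f V ∧
      (∀ᶠ y in 𝓝 x, Φ y = f (extChartAt (𝓡 6) x y)) ∧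
      ∃ n, fderiv ℝ f (extChartAt (𝓡 6) x x) n = 1 := by
  set y₀ := extChartAt (𝓡 6) x x with hy₀
  have hmem : y₀ ∈ (extChartAt (𝓡 6) x).target := mem_extChartAt_target x
  have hx' : (extChartAt (𝓡 6) x).symm y₀ = x := extChartAt_to_inv x
  obtain ⟨U, hU, hyU, f, hf, hfU⟩ := hΦ ((extChartAt (𝓡 6) x).symm y₀)
  have hσ := contMDiffAt_extChartAt_symm hmem
  have hfy := hf.contMDiffAt (hU.mem_nhds hyU)
  have ho : IsOpen ((extChartAt (𝓡 6) x).target ∩ (extChartAt (𝓡 6) x).symm ⁻¹' U) :=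
    (continuousOn_extChartAt_symm x).isOpen_inter_preimage (isOpen_extChartAt_target x) hU
  refine ⟨fun y => f ((extChartAt (𝓡 6) x).symm y), _, ho, ⟨hmem, hyU⟩, fun y hy =>
    (ContMDiffAt.comp y (hf.contMDiffAt (hU.mem_nhds hy.2))
      (contMDiffAt_extChartAt_symm hy.1)).contDiffAt.contDiffWithinAt, ?_, ?_⟩
  · rw [hx'] at hyU
    filter_upwards [hU.mem_nhds hyU, extChartAt_source_mem_nhds (I := 𝓡 6) x] with y hy hys
    rw [(extChartAt (𝓡 6) x).left_inv hys]
    exact (hfU y hy).1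
  · have hd := (fderiv_moment_comp (hσ.mdifferentiableAt (by simp)) (hfy.mdifferentiableAt (by simp))
      (hfU _ hyU).2).2
    by_contra! hn
    have h0 : ∀ u, fderiv ℝ (fun y => f ((extChartAt (𝓡 6) x).symm y)) y₀ u = 0 := by
      intro u
      by_contra hu
      refine hn ((fderiv ℝ (fun y => f ((extChartAt (𝓡 6) x).symm y)) y₀ u)⁻¹ • u) ?_
      rw [map_smul, smul_eq_mul, inv_mul_cancel₀ hu]
    have hinv := isInvertible_mfderivWithin_extChartAt_symm (I := 𝓡 6) (x := x) hmem
    rw [ModelWithCorners.range_eq_univ, mfderivWithin_univ] at hinv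
    have h1 : (generator ((extChartAt (𝓡 6) x).symm y₀) : E₆) = 0 := by
      refine hΩ.nondegenerate ((extChartAt (𝓡 6) x).symm y₀) _ fun v => ?_
      obtain ⟨u, rfl⟩ := hinv.surjective v
      have h2 := hd u
      refine (form_swap (E := E₆) _ _ _).trans ?_
      rw [neg_eq_zero]
      exact h2.symm.trans (h0 u)
    refine hx ((congrArg (fun y : X => (generator y : E₆)) hx').symm.trans h1)

/-- Near a point that is not fixed, a level set is the product of a symplectic section with an
interval of rotations. -/
theorem exists_tube_coordinates (hΩ : IsSymplecticForm Ω)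
    (hinv : IsInvariantForm Ω) (hΦ : IsMomentMap Ω Φ)
    {τ : ℂ² → X} {W : Set ℂ²} {w : ℂ²} {l : AddCircle T} (hW : IsOpen W) (hw : w ∈ W)
    (hτ : ContMDiffOn 𝓘(ℝ, ℂ²) (𝓡 6) ∞ τ W) (hl : ∀ z ∈ W, Φ (τ z) = l)
    (hx : (generator (τ w) : E₆) ≠ 0)
    (hnd : ∀ u, (∀ v, pullbackForm Ω τ w ![u, v] = 0) → u = 0) :
    ∃ (N : Set X) (θ : X → ℝ) (π : X → ℂ²), IsOpen N ∧ τ w ∈ N ∧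
      ContMDiffOn (𝓡 6) 𝓘(ℝ, ℝ) ∞ θ N ∧ ContMDiffOn (𝓡 6) 𝓘(ℝ, ℂ²) ∞ π N ∧
      θ (τ w) = 0 ∧ π (τ w) = w ∧ (∀ x ∈ N, π x ∈ W) ∧
      (∀ x ∈ N, Φ x = l → rotation (θ x) • τ (π x) = x) ∧
      ∀ᶠ z in 𝓝 ((0 : ℝ), w), rotation z.1 • τ z.2 ∈ N ∧ θ (rotation z.1 • τ z.2) = z.1 ∧
        π (rotation z.1 • τ z.2) = z.2 := by
  set x := τ w with hxdef
  set φ := extChartAt (𝓡 6) x with hφ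
  obtain ⟨f, V, hV, hxV, hfV, hfΦ, n, hn⟩ := exists_moment_coordinate hΩ hΦ hx
  have hf := hfV.contDiffAt (hV.mem_nhds hxV)
  have hcs : ContinuousSMul Circle X := ContMDiffSMul.continuousSMul (I := 𝓡 1) (I' := 𝓡 6) ∞
  obtain ⟨δ, hδ, hT⟩ := exists_pos_of_coe_eq T
  -- the map `b (t, z) = rotation t • τ z`
  have hb : ∀ t : ℝ, ∀ z ∈ W, ContMDiffAt 𝓘(ℝ, ℝ × ℂ²) (𝓡 6) ∞
      (fun z : ℝ × ℂ² => rotation z.1 • τ z.2) (t, z) := fun t z hz =>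
    contMDiffAt_rotation_smul contDiffAt_fst
      (ContMDiffAt.comp (t, z) (hτ.contMDiffAt (hW.mem_nhds hz)) contDiffAt_snd.contMDiffAt)
  set b : ℝ × ℂ² → X := fun z => rotation z.1 • τ z.2 with hbdef
  have hb0 : b (0, w) = x := by simp [hbdef, rotation_zero, hxdef]
  have hcont : ContinuousOn b (Prod.snd ⁻¹' W) := fun z hz =>
    (hb z.1 z.2 hz).continuousAt.continuousWithinAt
  have hO : IsOpen (Prod.snd ⁻¹' W ∩ b ⁻¹' φ.source) :=
    hcont.isOpen_inter_preimage (hW.preimage continuous_snd) (isOpen_extChartAt_source _)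
  set O := Prod.snd ⁻¹' W ∩ b ⁻¹' φ.source with hOdef
  have h0O : ((0 : ℝ), w) ∈ O := ⟨hw, by
    change b (0, w) ∈ φ.source
    rw [hb0]; exact mem_extChartAt_source (I := 𝓡 6) x⟩
  set a : ℝ × ℂ² → E₆ := fun z => φ (b z) with hadef
  have ha0 : a (0, w) = φ x := by rw [hadef]; simp only [hb0]
  have ha : ContDiffOn ℝ ∞ a O := fun z hz =>
    (contDiffAt_chart_comp (hb z.1 z.2 hz.1) hz.2).contDiffWithinAt
  have hbl : ∀ z ∈ O, Φ (b z) = l := fun z hz => by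
    rw [hbdef]
    simp only
    rw [moment_smul hΦ, hl _ hz.1]
  have haD : DifferentiableAt ℝ a (0, w) := (ha.contDiffAt (hO.mem_nhds h0O)).differentiableAt (by simp)
  have haτ : ∀ (s : ℝ) (u : ℂ²), fderiv ℝ a (0, w) (s, u) = 0 → s = 0 ∧ u = 0 := by
    intro s u h0
    have h1 := (fderiv_chart_comp_eq_zero_iff ((hb 0 w hw).mdifferentiableAt (by simp)) h0O.2).1 h0
    have hu : u = 0 := by
      refine hnd u fun v => ?_
      have h2 := pullbackForm_rotation_smul hinv hΦ (t := 0)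
        (hτ.contMDiffAt (hW.mem_nhds hw)) (l := l)
        (by filter_upwards [hW.mem_nhds hw] with z hz using hl z hz) s 0 u v
      rw [← h2, pullbackForm_apply]
      refine (congrArg (fun e : E₆ => (Ω (b (0, w)) :
        E₆ [⋀^Fin 2]→L[ℝ] ℝ) ![e, _]) h1).trans ?_
      exact form_zero_left (E := E₆) _ _
    subst hu
    refine ⟨?_, rfl⟩
    have h2 := mfderiv_rotation_smul (t := 0) (hτ.contMDiffAt (hW.mem_nhds hw)) s 0
    have h3 : s • (generator (b (0, w)) : E₆) = 0 := by
      have h4 : (mfderiv 𝓘(ℝ, ℂ²) (𝓡 6) (fun z => rotation 0 • τ z) w (0 : ℂ²) :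
        E₆) = 0 := map_zero _
      rw [h4, add_zero] at h2
      exact h2.symm.trans h1
    rw [hb0] at h3
    exact (smul_eq_zero.1 h3).resolve_right hx
  have hac : ContinuousAt a (0, w) := haD.continuousAt
  have hfc : ContinuousAt (fun z => f (a z)) (0, w) := by
    refine ContinuousAt.comp (f := a) ?_ hac
    rw [ha0]; exact hf.continuousAt
  have hbc : ContinuousAt b (0, w) := (hb 0 w hw).continuousAt
  have hloc : ∀ᶠ z in 𝓝 ((0 : ℝ), w), f (a z) = f (φ x) := by
    have hbΦ := hbc.tendsto.eventually (by rw [hb0]; exact hfΦ)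
    filter_upwards [hfc.eventually (Metric.ball_mem_nhds _ hδ), hO.mem_nhds h0O, hbΦ]
      with z hz hzO hzΦ
    rw [← ha0]
    refine hT _ _ hz ?_
    have e1 := hbΦ.self_of_nhds
    have e2 := hbl _ hzO
    have e3 := hbl _ h0O
    rw [hzΦ] at e2
    rw [e1] at e3
    exact e2.trans e3.symm
  have hℓ : ∀ u, fderiv ℝ f (φ x) (fderiv ℝ a (0, w) u) = 0 := by
    intro u
    have h1 : HasFDerivAt (fun z => f (a z)) ((fderiv ℝ f (φ x)).comp (fderiv ℝ a (0, w))) (0, w) :=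
      HasFDerivAt.comp (f := a) (0, w) (by rw [ha0]; exact (hf.differentiableAt (by simp)).hasFDerivAt)
        haD.hasFDerivAt
    have h2 := h1.fderiv
    rw [Filter.EventuallyEq.fderiv_eq (f := fun _ => f (φ x)) hloc, fderiv_const_apply] at h2
    exact (congrArg (fun L : ℝ × ℂ² →L[ℝ] ℝ => L u) h2).symm
  -- the chart
  set G : (ℝ × ℂ²) × ℝ → E₆ := fun z => a z.1 + z.2 • n with hG
  have hGs : ContDiffOn ℝ ∞ G (Prod.fst ⁻¹' O) :=
    (ha.comp contDiff_fst.contDiffOn (fun _ h => h)).add (contDiff_snd.smul contDiff_const).contDiffOn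
  have hGd : ∀ u, fderiv ℝ G ((0, w), 0) u = fderiv ℝ a (0, w) u.1 + u.2 • n := by
    intro u
    have h1 : HasFDerivAt (fun z : (ℝ × ℂ²) × ℝ => a z.1)
      ((fderiv ℝ a (0, w)).comp (ContinuousLinearMap.fst ℝ _ _)) ((0, w), 0) :=
      HasFDerivAt.comp (f := Prod.fst) ((0, w), (0 : ℝ)) haD.hasFDerivAt hasFDerivAt_fst
    have h2 : HasFDerivAt (fun z : (ℝ × ℂ²) × ℝ => z.2 • n)
      ((ContinuousLinearMap.snd ℝ (ℝ × ℂ²) ℝ).smulRight n) ((0, w), 0) :=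
      ((ContinuousLinearMap.snd ℝ (ℝ × ℂ²) ℝ).smulRight n).hasFDerivAt
    rw [hG, (h1.fun_add h2).fderiv]
    rfl
  obtain ⟨h, h0, hsrc, hGh, hsymm, -⟩ := exists_localDiffeo (by simp) (hO.preimage continuous_fst)
    hGs (a := ((0, w), (0 : ℝ))) h0O (by
      rintro ⟨⟨s, u⟩, c⟩ hu
      rw [hGd] at hu
      have hc : c = 0 := by
        have := congrArg (fderiv ℝ f (φ x)) hu
        rw [map_add, map_smul, hℓ, hn] at this
        simpa using this
      subst hc
      simp only [zero_smul, add_zero] at hu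
      obtain ⟨rfl, rfl⟩ := haτ s u hu
      rfl)
  have hh0 : h ((0, w), 0) = φ x := by rw [hGh, hG]; simp [ha0]
  have hφt : φ x ∈ h.target := hh0 ▸ h.map_source h0
  have hs0 : h.symm (φ x) = ((0, w), 0) := by rw [← hh0, h.left_inv h0]
  have hhc : ContinuousAt (fun y => h.symm (φ y)) x :=
    ContinuousAt.comp (f := φ) (h.continuousAt_symm hφt) (continuousAt_extChartAt x)
  have hhc1 : ContinuousAt (fun y => (h.symm (φ y)).1) x := continuousAt_fst.comp hhc
  have hsx : (h.symm (φ x)).1 = (0, w) := by rw [hs0]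
  have hφc : ContinuousAt φ x := continuousAt_extChartAt x
  -- points on the level have vanishing last coordinate
  have hstrict := (hf.hasStrictFDerivAt (by simp)).isLittleO.def
    (c := (2 * (‖n‖ + 1))⁻¹) (by positivity)
  have hpair : Filter.Tendsto (fun y => (φ y, a (h.symm (φ y)).1)) (𝓝 x) (𝓝 (φ x, φ x)) := by
    refine hφc.tendsto.prodMk_nhds ?_
    have h1 : ContinuousAt a (h.symm (φ x)).1 := by rw [hsx]; exact hac
    have h2 := (ContinuousAt.comp (f := fun y => (h.symm (φ y)).1) h1 hhc1).tendsto
    simp only [Function.comp_def, hsx, ha0] at h2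
    exact h2
  have hzero : ∀ᶠ y in 𝓝 x, Φ y = l → (h.symm (φ y)).2 = 0 := by
    have hfy : ContinuousAt (fun y => f (φ y)) x := ContinuousAt.comp (f := φ) hf.continuousAt hφc
    filter_upwards [hpair.eventually hstrict, hfΦ, hfy.eventually (Metric.ball_mem_nhds _ hδ),
      hφc.eventually (h.open_target.mem_nhds hφt), (hhc1.tendsto).eventually (by rw [hsx]; exact hloc)]
      with y hy hyΦ hyδ hyt hyloc hyl
    have e1 : f (φ y) = f (φ x) := by
      refine hT _ _ hyδ ?_
      rw [← hyΦ, ← hfΦ.self_of_nhds, hyl, ← hb0, hbl _ h0O]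
    have e2 : φ y - a (h.symm (φ y)).1 = (h.symm (φ y)).2 • n := by
      have := h.right_inv hyt
      rw [hGh] at this
      rw [sub_eq_iff_eq_add']
      exact this.symm
    rw [hyloc, e1, sub_self, e2, map_smul, hn, smul_eq_mul, mul_one, zero_sub, norm_neg,
      norm_smul] at hy
    by_contra hne
    have h1 : 0 < ‖(h.symm (φ y)).2‖ := norm_pos_iff.2 hne
    have h2 : (2 * (‖n‖ + 1))⁻¹ * ‖n‖ < 1 := by
      rw [inv_mul_lt_iff₀ (by positivity)]
      linarith [norm_nonneg n]
    nlinarith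
  obtain ⟨N₀, hN₀, hN₀o, hxN₀⟩ := mem_nhds_iff.1 hzero
  have hNo : IsOpen (φ.source ∩ φ ⁻¹' h.target) :=
    (continuousOn_extChartAt x).isOpen_inter_preimage (isOpen_extChartAt_source x) h.open_target
  have hxN : x ∈ N₀ ∩ (φ.source ∩ φ ⁻¹' h.target) :=
    ⟨hxN₀, mem_extChartAt_source (I := 𝓡 6) x, hφt⟩
  have hsm : ContMDiffOn (𝓡 6) 𝓘(ℝ, (ℝ × ℂ²) × ℝ) ∞ (fun y => h.symm (φ y))
      (N₀ ∩ (φ.source ∩ φ ⁻¹' h.target)) := fun y hy =>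
    ((hsymm.contDiffAt (h.open_target.mem_nhds hy.2.2)).contMDiffAt.comp y
      (contMDiffAt_chart hy.2.1)).contMDiffWithinAt
  have hs1 : ∀ y ∈ φ.source ∩ φ ⁻¹' h.target, (h.symm (φ y)).1 ∈ O := fun y hy =>
    hsrc (h.map_target hy.2)
  have hbx : b (0, w) ∈ N₀ ∩ (φ.source ∩ φ ⁻¹' h.target) := hb0 ▸ hxN
  refine ⟨N₀ ∩ (φ.source ∩ φ ⁻¹' h.target), fun y => (h.symm (φ y)).1.1,
    fun y => (h.symm (φ y)).1.2, hN₀o.inter hNo, hxN, ?_, ?_, ?_, ?_, fun y hy => (hs1 y hy.2).1,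
    ?_, ?_⟩
  · exact (contDiff_fst.comp contDiff_fst).contMDiff.comp_contMDiffOn hsm
  · exact (contDiff_snd.comp contDiff_fst).contMDiff.comp_contMDiffOn hsm
  · exact congrArg Prod.fst hsx
  · exact congrArg Prod.snd hsx
  · intro y hy hyl
    have e1 := hN₀ hy.1 hyl
    have e2 := h.right_inv hy.2.2
    rw [hGh, hG] at e2
    simp only [e1, zero_smul, add_zero] at e2
    exact φ.injOn (hs1 y hy.2).2 hy.2.1 e2
  · have hsrcz : ∀ᶠ z in 𝓝 ((0 : ℝ), w), (z, (0 : ℝ)) ∈ h.source :=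
      (Continuous.prodMk_left (0 : ℝ)).continuousAt.eventually (h.open_source.mem_nhds h0)
    filter_upwards [hsrcz, hbc.eventually ((hN₀o.inter hNo).mem_nhds hbx)] with z hz hzN
    have e1 : φ (b z) = h (z, 0) := by rw [hGh, hG]; simp [hadef]
    have e2 : h.symm (φ (b z)) = (z, 0) := by rw [e1, h.left_inv hz]
    refine ⟨hzN, ?_, ?_⟩
    · change (h.symm (φ (b z))).1.1 = _
      rw [e2]
    · change (h.symm (φ (b z))).1.2 = _
      rw [e2]

/-- Two symplectic sections into a level set through points of one orbit differ, up to rotations,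
by a symplectic diffeomorphism. -/
theorem exists_lift_between_sections (hΩ : IsSymplecticForm Ω)
    (hinv : IsInvariantForm Ω) (hΦ : IsMomentMap Ω Φ)
    {σ τ : ℂ² → X} {V W : Set ℂ²} {z w : ℂ²} {l : AddCircle T}
    (hV : IsOpen V) (hz : z ∈ V) (hσ : ContMDiffOn 𝓘(ℝ, ℂ²) (𝓡 6) ∞ σ V)
    (hσl : ∀ y ∈ V, Φ (σ y) = l)
    (hσnd : ∀ u, (∀ v, pullbackForm Ω σ z ![u, v] = 0) → u = 0)
    (hW : IsOpen W) (hw : w ∈ W) (hτ : ContMDiffOn 𝓘(ℝ, ℂ²) (𝓡 6) ∞ τ W)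
    (hτl : ∀ y ∈ W, Φ (τ y) = l)
    (hτnd : ∀ u, (∀ v, pullbackForm Ω τ w ![u, v] = 0) → u = 0)
    (hx : (generator (τ w) : E₆) ≠ 0) {g : Circle} (hg : g • τ w = σ z) :
    ∃ h : OpenPartialHomeomorph ℂ² ℂ², z ∈ h.source ∧ h z = w ∧ h.source ⊆ V ∧
      h.target ⊆ W ∧ ContDiffOn ℝ ∞ h h.source ∧ ContDiffOn ℝ ∞ h.symm h.target ∧
      (∀ y ∈ h.source, ∃ k : Circle, k • τ (h y) = σ y) ∧
      PreservesForm h (pullbackForm Ω σ) (pullbackForm Ω τ) := by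
  obtain ⟨N, θ, π, hN, hwN, hθ, hπ, hθ0, hπ0, hπW, hNl, -⟩ :=
    exists_tube_coordinates hΩ hinv hΦ hW hw hτ hτl hx hτnd
  set σ' : ℂ² → X := fun y => g⁻¹ • σ y with hσ'
  have hσ's : ContMDiffOn 𝓘(ℝ, ℂ²) (𝓡 6) ∞ σ' V := fun y hy =>
    (contMDiffAt_const_smul _ (hσ.contMDiffAt (hV.mem_nhds hy))).contMDiffWithinAt
  have hσ'z : σ' z = τ w := by rw [hσ']; simp only [← hg, inv_smul_smul]
  have hUo : IsOpen (V ∩ σ' ⁻¹' N) := hσ's.continuousOn.isOpen_inter_preimage hV hN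
  set U := V ∩ σ' ⁻¹' N with hU
  have hzU : z ∈ U := ⟨hz, by rw [Set.mem_preimage, hσ'z]; exact hwN⟩
  have hfs : ContDiffOn ℝ ∞ (fun y => π (σ' y)) U := fun y hy =>
    (ContMDiffAt.comp y (hπ.contMDiffAt (hN.mem_nhds hy.2))
      (hσ's.contMDiffAt (hV.mem_nhds hy.1))).contDiffAt.contDiffWithinAt
  have hts : ContDiffOn ℝ ∞ (fun y => θ (σ' y)) U := fun y hy =>
    (ContMDiffAt.comp y (hθ.contMDiffAt (hN.mem_nhds hy.2))
      (hσ's.contMDiffAt (hV.mem_nhds hy.1))).contDiffAt.contDiffWithinAt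
  have hlift : ∀ y ∈ U, rotation (θ (σ' y)) • τ (π (σ' y)) = σ' y := fun y hy =>
    hNl _ hy.2 (by rw [hσ']; simp only; rw [moment_smul hΦ, hσl y hy.1])
  have hform : ∀ y ∈ U, (pullbackForm Ω τ (π (σ' y))).compContinuousLinearMap
      (fderiv ℝ (fun y => π (σ' y)) y) = pullbackForm Ω σ y := by
    intro y hy
    have hτy := hτ.contMDiffAt (hW.mem_nhds (hπW _ hy.2))
    have hd1 := (hts.contDiffAt (hUo.mem_nhds hy)).differentiableAt (by simp)
    have hd2 := (hfs.contDiffAt (hUo.mem_nhds hy)).differentiableAt (by simp)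
    have hev : σ' =ᶠ[𝓝 y] fun y => (fun z : ℝ × ℂ² => rotation z.1 • τ z.2)
        (θ (σ' y), π (σ' y)) := by
      filter_upwards [hUo.mem_nhds hy] with y' hy' using (hlift y' hy').symm
    rw [← pullbackForm_smul hinv g⁻¹
      ((hσ.contMDiffAt (hV.mem_nhds hy.1)).mdifferentiableAt (by simp)),
      pullbackForm_congr (σ := fun z => g⁻¹ • σ z) hev,
      pullbackForm_comp (σ := fun z : ℝ × ℂ² => rotation z.1 • τ z.2)
        (h := fun y => (θ (σ' y), π (σ' y))) (F := ℝ × ℂ²)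
        ((contMDiffAt_rotation_smul contDiffAt_fst
          (ContMDiffAt.comp (θ (σ' y), π (σ' y)) hτy contDiffAt_snd.contMDiffAt)).mdifferentiableAt
            (by simp)) (hd1.prodMk hd2)]
    refine form_ext fun u v => ?_
    rw [compContinuousLinearMap_pair, compContinuousLinearMap_pair,
      (hd1.hasFDerivAt.prodMk hd2.hasFDerivAt).fderiv]
    exact (pullbackForm_rotation_smul hinv hΦ hτy
      (by filter_upwards [hW.mem_nhds (hπW _ hy.2)] with z hz using hτl z hz) _ _ _ _).symm
  obtain ⟨h, hzh, hhU, hh, hsymm, -⟩ := exists_localDiffeo rfl hUo hfs hzU (by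
    intro u hu
    refine hσnd u fun v => ?_
    rw [← hform z hzU, compContinuousLinearMap_pair, hu, form_zero_left])
  have hheq : (h : ℂ² → ℂ²) = fun y => π (σ' y) := funext hh
  refine ⟨h, hzh, ?_, fun y hy => (hhU hy).1, ?_, ?_, hsymm, ?_, ?_⟩
  · rw [hh, hσ'z, hπ0]
  · intro y hy
    rw [← h.right_inv hy, hh]
    exact hπW _ (hhU (h.map_target hy)).2
  · rw [hheq]; exact hfs.mono hhU
  · intro y hy
    refine ⟨g * rotation (θ (σ' y)), ?_⟩
    rw [hh, mul_smul, hlift y (hhU hy), hσ']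
    simp
  · intro y hy
    rw [hheq]
    exact hform y (hhU hy)

end Lift

section EquivariantChart

variable {X : Type*} [TopologicalSpace X] [ChartedSpace E₆ X]
  [IsManifold (𝓡 6) ∞ X]
  [MulAction Circle X] [ContMDiffSMul (𝓡 1) (𝓡 6) ∞ Circle X]
  {Ω : (x : X) → TangentSpace (𝓡 6) x [⋀^Fin 2]→L[ℝ] ℝ} {T : ℝ} {Φ : X → AddCircle T}
  {E : Type} [NormedAddCommGroup E] [NormedSpace ℝ E]

/-! ### Inverting equivariant coordinates -/

theorem exists_equivariant_inverse [FiniteDimensional ℝ E] (hE : Module.finrank ℝ E = 6)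
    {K : Set Circle}
    (hK : IsCompact K) {x : X} (hx : ∀ k ∈ K, k • x = x) {θ : X → E}
    {U : Set E₆} (hU : IsOpen U) (hxU : extChartAt (𝓡 6) x x ∈ U)
    (hθ : ContDiffOn ℝ ∞ (fun y => θ ((extChartAt (𝓡 6) x).symm y)) U) (hθ0 : θ x = 0)
    (hinj : ∀ u, fderiv ℝ (fun y => θ ((extChartAt (𝓡 6) x).symm y)) (extChartAt (𝓡 6) x x) u = 0 →
      u = 0) {ρ : Circle → E → E}
    (heq : ∀ᶠ y in 𝓝 x, ∀ k ∈ K, θ (k • y) = ρ k (θ y)) :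
    ∃ (δ : ℝ) (Ψ : E → X), 0 < δ ∧ Ψ 0 = x ∧
      ContMDiffOn 𝓘(ℝ, E) (𝓡 6) ∞ Ψ (Metric.ball 0 δ) ∧
      (∀ v ∈ Metric.ball 0 δ, θ (Ψ v) = v) ∧
      (∀ v ∈ Metric.ball 0 δ, ∀ k ∈ K, ρ k v ∈ Metric.ball 0 δ → Ψ (ρ k v) = k • Ψ v) ∧
      ∀ u, fderiv ℝ (fun y => θ ((extChartAt (𝓡 6) x).symm y)) (extChartAt (𝓡 6) x x)
        (fderiv ℝ (fun v => extChartAt (𝓡 6) x (Ψ v)) 0 u) = u := by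
  have hcs : ContinuousSMul Circle X := ContMDiffSMul.continuousSMul (I := 𝓡 1) (I' := 𝓡 6) ∞
  set φ := extChartAt (𝓡 6) x with hφ
  have hmem : φ x ∈ φ.target := mem_extChartAt_target (I := 𝓡 6) x
  have htar : IsOpen φ.target := isOpen_extChartAt_target (I := 𝓡 6) x
  obtain ⟨h, hxh, hhU, hh, hsymm, -⟩ := exists_localDiffeo (by rw [hE]; simp) (hU.inter htar)
    (hθ.mono Set.inter_subset_left) ⟨hxU, hmem⟩ hinj
  have hhx : h (φ x) = 0 := by
    rw [hh, extChartAt_to_inv, hθ0]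
  have h0t : (0 : E) ∈ h.target := hhx ▸ h.map_source hxh
  have hs0 : h.symm 0 = φ x := by rw [← hhx, h.left_inv hxh]
  have hst : ∀ v ∈ h.target, h.symm v ∈ φ.target := fun v hv => (hhU (h.map_target hv)).2
  set Ψ : E → X := fun v => φ.symm (h.symm v) with hΨ
  have hΨ0 : Ψ 0 = x := by rw [hΨ]; simp only [hs0]; exact extChartAt_to_inv x
  have hΨs : ContMDiffOn 𝓘(ℝ, E) (𝓡 6) ∞ Ψ h.target := fun v hv =>
    (ContMDiffAt.comp v (contMDiffAt_extChartAt_symm (hst v hv))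
      (hsymm.contDiffAt (h.open_target.mem_nhds hv)).contMDiffAt).contMDiffWithinAt
  have hθΨ : ∀ v ∈ h.target, θ (Ψ v) = v := fun v hv => by
    have := h.right_inv hv
    rwa [hh] at this
  -- the set on which `θ` is injective
  have hN₁ : IsOpen (φ.source ∩ φ ⁻¹' h.source) :=
    (continuousOn_extChartAt x).isOpen_inter_preimage (isOpen_extChartAt_source x) h.open_source
  have hθinj : Set.InjOn θ (φ.source ∩ φ ⁻¹' h.source) := by
    intro y hy z hz hyz
    have e : ∀ y ∈ φ.source ∩ φ ⁻¹' h.source, h (φ y) = θ y := fun y hy => by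
      rw [hh, φ.left_inv hy.1]
    rw [← e y hy, ← e z hz] at hyz
    exact φ.injOn hy.1 hz.1 (h.injOn hy.2 hz.2 hyz)
  have hxN₁ : x ∈ φ.source ∩ φ ⁻¹' h.source := ⟨mem_extChartAt_source (I := 𝓡 6) x, hxh⟩
  have hN₂ : ∀ᶠ y in 𝓝 x, ∀ k ∈ K, k • y ∈ φ.source ∩ φ ⁻¹' h.source := by
    refine hK.eventually_forall_of_forall_eventually fun k hk => ?_
    have hc : Continuous fun z : X × Circle => z.2 • z.1 := by fun_prop
    refine hc.continuousAt.eventually (hN₁.mem_nhds ?_)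
    simpa only [hx k hk] using hxN₁
  have hev : ∀ᶠ v in 𝓝 (0 : E), v ∈ h.target ∧ (∀ k ∈ K, k • Ψ v ∈ φ.source ∩ φ ⁻¹' h.source) ∧
      (∀ k ∈ K, θ (k • Ψ v) = ρ k (θ (Ψ v))) ∧ Ψ v ∈ φ.source ∩ φ ⁻¹' h.source := by
    have hc : Filter.Tendsto Ψ (𝓝 0) (𝓝 x) := by
      have := ((hΨs.contMDiffAt (h.open_target.mem_nhds h0t)).continuousAt).tendsto
      rwa [hΨ0] at this
    filter_upwards [h.open_target.mem_nhds h0t, hc.eventually hN₂, hc.eventually heq,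
      hc.eventually (hN₁.mem_nhds hxN₁)] with v h1 h2 h3 h4 using ⟨h1, h2, h3, h4⟩
  obtain ⟨δ, hδ, hb⟩ := Metric.eventually_nhds_iff_ball.1 hev
  refine ⟨δ, Ψ, hδ, hΨ0, hΨs.mono fun v hv => (hb v hv).1, fun v hv => hθΨ v (hb v hv).1, ?_, ?_⟩
  · intro v hv k hk hkv
    refine hθinj (hb _ hkv).2.2.2 ((hb v hv).2.1 k hk) ?_
    rw [(hb v hv).2.2.1 k hk, hθΨ v (hb v hv).1, hθΨ _ (hb _ hkv).1]
  · intro u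
    have hΨφ : DifferentiableAt ℝ (fun v => φ (Ψ v)) 0 := by
      refine (contDiffAt_chart_comp (hΨs.contMDiffAt (h.open_target.mem_nhds h0t)) ?_).differentiableAt
        (by simp)
      rw [hΨ0]; exact mem_extChartAt_source x
    have hd : DifferentiableAt ℝ (fun y => θ (φ.symm y)) (φ (Ψ 0)) := by
      rw [hΨ0]
      exact (hθ.contDiffAt (hU.mem_nhds hxU)).differentiableAt (by simp)
    have hc := HasFDerivAt.comp (f := fun v => φ (Ψ v)) (0 : E) hd.hasFDerivAt hΨφ.hasFDerivAt
    have hid : (fun y => θ (φ.symm y)) ∘ (fun v => φ (Ψ v)) =ᶠ[𝓝 0] id := by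
      filter_upwards [hev] with v hv
      simp only [Function.comp_apply, id]
      rw [φ.left_inv hv.2.2.2.1, hθΨ v hv.1]
    have h1 := hc.fderiv
    rw [hid.fderiv_eq, fderiv_id, hΨ0] at h1
    exact (congrArg (fun L : E →L[ℝ] E => L u) h1).symm

/-! ### The isotropy representation -/

/-- The action of `g` in the preferred chart at `x`. -/
def chartAct (g : Circle) (x : X) (y : E₆) : E₆ :=
  extChartAt (𝓡 6) x (g • (extChartAt (𝓡 6) x).symm y)

/-- The derivative of the action of `g` at a point `x` that it fixes. -/
def isotropyDeriv (g : Circle) (x : X) :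
    E₆ →L[ℝ] E₆ :=
  fderiv ℝ (chartAct g x) (extChartAt (𝓡 6) x x)

theorem contDiffOn_chartAct (x : X) :
    IsOpen {z : ℝ × E₆ | z.2 ∈ (extChartAt (𝓡 6) x).target ∧
      rotation z.1 • (extChartAt (𝓡 6) x).symm z.2 ∈ (extChartAt (𝓡 6) x).source} ∧
    ContDiffOn ℝ ∞ (fun z : ℝ × E₆ => chartAct (rotation z.1) x z.2)
      {z : ℝ × E₆ | z.2 ∈ (extChartAt (𝓡 6) x).target ∧
      rotation z.1 • (extChartAt (𝓡 6) x).symm z.2 ∈ (extChartAt (𝓡 6) x).source} := by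
  have hsm : ∀ z : ℝ × E₆, z.2 ∈ (extChartAt (𝓡 6) x).target →
      ContMDiffAt 𝓘(ℝ, ℝ × E₆) (𝓡 6) ∞
        (fun z : ℝ × E₆ => rotation z.1 • (extChartAt (𝓡 6) x).symm z.2) z :=
    fun z hz => contMDiffAt_rotation_smul contDiffAt_fst
      (ContMDiffAt.comp z (contMDiffAt_extChartAt_symm hz) contDiffAt_snd.contMDiffAt)
  refine ⟨?_, fun z hz => (contDiffAt_chart_comp (hsm z hz.1) hz.2).contDiffWithinAt⟩
  exact ContinuousOn.isOpen_inter_preimage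
    (f := fun z : ℝ × E₆ => rotation z.1 • (extChartAt (𝓡 6) x).symm z.2)
    (s := Prod.snd ⁻¹' (extChartAt (𝓡 6) x).target)
    (fun z hz => (hsm z hz).continuousAt.continuousWithinAt)
    ((isOpen_extChartAt_target x).preimage continuous_snd) (isOpen_extChartAt_source x)

theorem contDiffAt_chartAct {g : Circle} {x : X} (hg : g • x = x) :
    ContDiffAt ℝ ∞ (chartAct g x) (extChartAt (𝓡 6) x x) := by
  refine contDiffAt_chart_comp (contMDiffAt_const_smul g
    (contMDiffAt_extChartAt_symm (mem_extChartAt_target x))) ?_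
  rw [extChartAt_to_inv, hg]
  exact mem_extChartAt_source x

theorem chartAct_self {g : Circle} {x : X} (hg : g • x = x) :
    chartAct g x (extChartAt (𝓡 6) x x) = extChartAt (𝓡 6) x x := by
  rw [chartAct, extChartAt_to_inv, hg]

theorem isotropyDeriv_eq {g : Circle} {x : X} (hg : g • x = x) (u : E₆) :
    isotropyDeriv g x u =
      (mfderiv (𝓡 6) (𝓡 6) (fun y : X => g • y) x u : E₆) := by
  have h1 := (((contMDiff_const_smul (X := X) g).mdifferentiableAt (x := x) (by simp))).mfderiv
  have h2 : (fderivWithin ℝ (writtenInExtChartAt (𝓡 6) (𝓡 6) x (fun y : X => g • y))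
      (Set.range (𝓡 6)) (extChartAt (𝓡 6) x x)) = isotropyDeriv g x := by
    rw [ModelWithCorners.range_eq_univ, fderivWithin_univ, isotropyDeriv]
    congr 1
    funext y
    simp only [writtenInExtChartAt, hg, Function.comp_apply, chartAct]
  rw [← h2]
  exact (congrArg (fun L : E₆ →L[ℝ] E₆ => L u) h1).symm

theorem isotropyDeriv_mul {g k : Circle} {x : X} (hg : g • x = x) (hk : k • x = x)
    (u : E₆) :
    isotropyDeriv (g * k) x u = isotropyDeriv g x (isotropyDeriv k x u) := by
  have hcs : ContinuousSMul Circle X := ContMDiffSMul.continuousSMul (I := 𝓡 1) (I' := 𝓡 6) ∞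
  have hd : DifferentiableAt ℝ (chartAct g x) (chartAct k x (extChartAt (𝓡 6) x x)) := by
    rw [chartAct_self hk]
    exact (contDiffAt_chartAct hg).differentiableAt (by simp)
  have h1 := HasFDerivAt.comp (f := chartAct k x) (extChartAt (𝓡 6) x x) hd.hasFDerivAt
    ((contDiffAt_chartAct hk).differentiableAt (by simp)).hasFDerivAt
  have hev : chartAct g x ∘ chartAct k x =ᶠ[𝓝 (extChartAt (𝓡 6) x x)] chartAct (g * k) x := by
    have hc : ContinuousAt (fun y => k • (extChartAt (𝓡 6) x).symm y) (extChartAt (𝓡 6) x x) :=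
      (contMDiffAt_const_smul k
        (contMDiffAt_extChartAt_symm (mem_extChartAt_target x))).continuousAt
    filter_upwards [hc.eventually ((isOpen_extChartAt_source (I := 𝓡 6) x).mem_nhds (by
      change k • (extChartAt (𝓡 6) x).symm (extChartAt (𝓡 6) x x) ∈ (extChartAt (𝓡 6) x).source
      rw [extChartAt_to_inv, hk]; exact mem_extChartAt_source x))] with y hy
    simp only [Function.comp_apply, chartAct]
    rw [(extChartAt (𝓡 6) x).left_inv hy, mul_smul]
  have h2 := h1.fderiv
  rw [hev.fderiv_eq, chartAct_self hk] at h2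
  exact congrArg (fun L : E₆ →L[ℝ] E₆ => L u) h2

theorem isotropyDeriv_one (x : X) (u : E₆) : isotropyDeriv 1 x u = u := by
  have hev : chartAct 1 x =ᶠ[𝓝 (extChartAt (𝓡 6) x x)] id := by
    filter_upwards [(isOpen_extChartAt_target (I := 𝓡 6) x).mem_nhds (mem_extChartAt_target x)]
      with y hy
    rw [chartAct, one_smul, (extChartAt (𝓡 6) x).right_inv hy, id]
  rw [isotropyDeriv, hev.fderiv_eq, fderiv_id]
  rfl

theorem isotropyDeriv_form (hinv : IsInvariantForm Ω) {g : Circle} {x : X} (hg : g • x = x)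
    (u v : E₆) :
    (Ω x : E₆ [⋀^Fin 2]→L[ℝ] ℝ) ![isotropyDeriv g x u, isotropyDeriv g x v] =
      (Ω x : E₆ [⋀^Fin 2]→L[ℝ] ℝ) ![u, v] := by
  have key : ∀ (y : X) (a b : E₆), y = x →
      (Ω y : E₆ [⋀^Fin 2]→L[ℝ] ℝ) ![a, b] =
        (Ω x : E₆ [⋀^Fin 2]→L[ℝ] ℝ) ![a, b] := by
    rintro y a b rfl; rfl
  rw [isotropyDeriv_eq hg, isotropyDeriv_eq hg]
  refine (key _ _ _ hg).symm.trans ?_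
  exact (compContinuousLinearMap_pair (E := E₆)
    (F := E₆) _ _ _ _).symm.trans
    (congrArg (fun η : E₆ [⋀^Fin 2]→L[ℝ] ℝ => η ![u, v]) (hinv g x))

theorem isotropyDeriv_generator {g : Circle} {x : X} (hg : g • x = x) :
    isotropyDeriv g x (generator x : E₆) = generator x := by
  refine (isotropyDeriv_eq hg _).trans ((mfderiv_smul_generator g x).trans ?_)
  exact congrArg (fun y : X => (generator y : E₆)) hg

theorem pullbackForm_eq_chart {F : Type} [NormedAddCommGroup F] [NormedSpace ℝ F] {σ : F → X}
    {y : F} {x : X} (h : σ y = x) (hσ : MDifferentiableAt 𝓘(ℝ, F) (𝓡 6) σ y) (u v : F) :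
    pullbackForm Ω σ y ![u, v] = (Ω x : E₆ [⋀^Fin 2]→L[ℝ] ℝ)
      ![fderiv ℝ (fun z => extChartAt (𝓡 6) x (σ z)) y u,
        fderiv ℝ (fun z => extChartAt (𝓡 6) x (σ z)) y v] := by
  subst h
  rw [pullbackForm_apply]
  have h1 : ∀ u, fderiv ℝ (fun z => extChartAt (𝓡 6) (σ y) (σ z)) y u =
      (mfderiv 𝓘(ℝ, F) (𝓡 6) σ y u : E₆) := fun u => by
    rw [mfderiv_chart_comp hσ (mem_extChartAt_source _), mfderiv_extChartAt_self]
    rfl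
  rw [h1, h1]

/-! ### Averaging -/

theorem exists_average_finite {K : Subgroup Circle} [Finite K] {x : X} (hx : ∀ k ∈ K, k • x = x) :
    ∃ (θ : X → E₆) (U : Set E₆), IsOpen U ∧
      extChartAt (𝓡 6) x x ∈ U ∧ U ⊆ (extChartAt (𝓡 6) x).target ∧
      ContDiffOn ℝ ∞ (fun y => θ ((extChartAt (𝓡 6) x).symm y)) U ∧ θ x = 0 ∧
      (∀ u, fderiv ℝ (fun y => θ ((extChartAt (𝓡 6) x).symm y)) (extChartAt (𝓡 6) x x) u = u) ∧
      ∀ y, ∀ k ∈ K, θ (k • y) = isotropyDeriv k x (θ y) := by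
  have hcs : ContinuousSMul Circle X := ContMDiffSMul.continuousSMul (I := 𝓡 1) (I' := 𝓡 6) ∞
  have : Fintype K := Fintype.ofFinite K
  set φ := extChartAt (𝓡 6) x with hφ
  set c : ℝ := (Fintype.card K : ℝ)⁻¹ with hc
  have hcard : c * Fintype.card K = 1 := inv_mul_cancel₀ (by simp)
  have hinvx : ∀ k : K, (k⁻¹ : Circle) • x = x := fun k => hx _ (K.inv_mem k.2)
  set θ : X → E₆ := fun y =>
    c • ∑ k : K, isotropyDeriv (k⁻¹ : Circle) x (φ ((k : Circle) • y) - φ x) with hθ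
  have hUo : ∀ k : K, IsOpen (φ.target ∩ (fun y => (k : Circle) • φ.symm y) ⁻¹' φ.source) :=
    fun k => ContinuousOn.isOpen_inter_preimage (fun y hy => (contMDiffAt_const_smul _
      (contMDiffAt_extChartAt_symm hy)).continuousAt.continuousWithinAt)
      (isOpen_extChartAt_target x) (isOpen_extChartAt_source x)
  have hsmooth : ∀ k : K, ContDiffOn ℝ ∞ (chartAct (k : Circle) x)
      (φ.target ∩ (fun y => (k : Circle) • φ.symm y) ⁻¹' φ.source) := fun k y hy =>
    (contDiffAt_chart_comp (contMDiffAt_const_smul _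
      (contMDiffAt_extChartAt_symm hy.1)) hy.2).contDiffWithinAt
  refine ⟨θ, ⋂ k : K, (φ.target ∩ (fun y => (k : Circle) • φ.symm y) ⁻¹' φ.source),
    isOpen_iInter_of_finite hUo, ?_, fun y hy => (Set.mem_iInter.1 hy 1).1, ?_, ?_, ?_, ?_⟩
  · refine Set.mem_iInter.2 fun k => ⟨mem_extChartAt_target x, ?_⟩
    rw [Set.mem_preimage, extChartAt_to_inv, hx _ k.2]
    exact mem_extChartAt_source x
  · refine ContDiffOn.const_smul c (ContDiffOn.sum fun k _ => ?_)
    refine (isotropyDeriv (k⁻¹ : Circle) x).contDiff.comp_contDiffOn ?_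
    exact ((hsmooth k).mono (Set.iInter_subset _ k)).sub contDiffOn_const
  · simp only [hθ]
    rw [Finset.sum_eq_zero, smul_zero]
    intro k _
    rw [hx _ k.2, sub_self, map_zero]
  · intro u
    have hd : HasFDerivAt (fun y => θ (φ.symm y)) (c • ∑ k : K,
        (isotropyDeriv (k⁻¹ : Circle) x).comp (isotropyDeriv (k : Circle) x)) (φ x) := by
      refine HasFDerivAt.const_smul (HasFDerivAt.fun_sum fun k _ => ?_) c
      refine (isotropyDeriv (k⁻¹ : Circle) x).hasFDerivAt.comp (φ x) ?_
      exact (((contDiffAt_chartAct (hx _ k.2)).differentiableAt (by simp)).hasFDerivAt).sub_const _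
    rw [hd.fderiv]
    have e : ∀ k : K, (isotropyDeriv (k⁻¹ : Circle) x).comp (isotropyDeriv (k : Circle) x) u = u :=
      fun k => by
        rw [ContinuousLinearMap.comp_apply, ← isotropyDeriv_mul (hinvx k) (hx _ k.2),
          inv_mul_cancel, isotropyDeriv_one]
    simp only [smul_apply, sum_apply, e, Finset.sum_const, Finset.card_univ]
    rw [← Nat.cast_smul_eq_nsmul ℝ, smul_smul, hcard, one_smul]
  · intro y j hj
    simp only [hθ, map_smul, map_sum]
    congr 1
    refine Fintype.sum_equiv (Equiv.mulRight ⟨j, hj⟩) _ _ fun k => ?_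
    simp only [Equiv.coe_mulRight, Subgroup.coe_mul, mul_smul]
    rw [← isotropyDeriv_mul (hx _ hj)]
    · congr 2
      rw [mul_inv_rev, mul_inv_cancel_left]
    · exact hx _ (K.inv_mem (K.mul_mem k.2 hj))

theorem exists_average_circle [FiniteDimensional ℝ E] {x : X} (hx : ∀ k : Circle, k • x = x)
    (ρ : Circle → E ≃L[ℝ] E) (hρmul : ∀ g k u, ρ (g * k) u = ρ g (ρ k u))
    (hρ : ContDiff ℝ ∞ (fun z : ℝ × E => ρ (rotation z.1) z.2))
    (L : E₆ →L[ℝ] E) (hL : ∀ g u, L (isotropyDeriv g x u) = ρ g (L u)) :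
    ∃ (θ : X → E) (U : Set E₆), IsOpen U ∧
      extChartAt (𝓡 6) x x ∈ U ∧
      ContDiffOn ℝ ∞ (fun y => θ ((extChartAt (𝓡 6) x).symm y)) U ∧ θ x = 0 ∧
      (∀ u, fderiv ℝ (fun y => θ ((extChartAt (𝓡 6) x).symm y)) (extChartAt (𝓡 6) x x) u = L u) ∧
      ∀ y, ∀ k : Circle, θ (k • y) = ρ k (θ y) := by
  set φ := extChartAt (𝓡 6) x with hφ
  have hρ1 : ∀ u, ρ 1 u = u := fun u => (ρ 1).injective (by rw [← hρmul, mul_one])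
  obtain ⟨hO, hact⟩ := contDiffOn_chartAct x
  set O := {z : ℝ × E₆ | z.2 ∈ (extChartAt (𝓡 6) x).target ∧
      rotation z.1 • (extChartAt (𝓡 6) x).symm z.2 ∈ (extChartAt (𝓡 6) x).source} with hOdef
  set f : ℝ × E₆ → E := fun z =>
    ρ (rotation (-z.1)) (L (chartAct (rotation z.1) x z.2 - φ x)) with hf
  have hfs : ContDiffOn ℝ ∞ f O := by
    have h1 : ContDiffOn ℝ ∞ (fun z : ℝ × E₆ =>
        (-z.1, L (chartAct (rotation z.1) x z.2 - φ x))) O :=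
      contDiff_fst.neg.contDiffOn.prodMk
        (L.contDiff.comp_contDiffOn (hact.sub contDiffOn_const))
    exact hρ.comp_contDiffOn h1
  have hxO : ∀ t, (t, φ x) ∈ O := fun t => ⟨mem_extChartAt_target x, by
    simp only
    rw [extChartAt_to_inv, hx]
    exact mem_extChartAt_source x⟩
  obtain ⟨U, hU, hxU, -, hUs, hUd⟩ := contDiffOn_parametric_integral hO hfs (x₀ := φ x)
    (fun t _ => hxO t)
  refine ⟨fun y => ∫ t in (0 : ℝ)..1, ρ (rotation (-t)) (L (φ (rotation t • y) - φ x)), U, hU, hxU,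
    hUs, ?_, ?_, ?_⟩
  · simp [hx]
  · intro u
    refine (hUd _ hxU u).trans ?_
    have e : ∀ t : ℝ, fderiv ℝ f (t, φ x) (0, u) = L u := by
      intro t
      have h1 : HasFDerivAt (fun y => f (t, y)) ((fderiv ℝ f (t, φ x)).comp
          (ContinuousLinearMap.inr ℝ ℝ E₆)) (φ x) :=
        HasFDerivAt.comp (f := fun y => (t, y)) (φ x)
          ((hfs.contDiffAt (hO.mem_nhds (hxO t))).differentiableAt (by simp)).hasFDerivAt
          (hasFDerivAt_prodMk_right t (φ x))
      have h2 : HasFDerivAt (fun y => f (t, y)) (((ρ (rotation (-t))).toContinuousLinearMap.comp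
          L).comp (isotropyDeriv (rotation t) x)) (φ x) := by
        refine HasFDerivAt.comp (φ x) ((ρ (rotation (-t))).toContinuousLinearMap.comp L).hasFDerivAt ?_
        exact (((contDiffAt_chartAct (hx (rotation t))).differentiableAt
          (by simp)).hasFDerivAt).sub_const (φ x)
      have h3 := congrArg (fun A : E₆ →L[ℝ] E => A u) (h1.unique h2)
      refine h3.trans ?_
      change ρ (rotation (-t)) (L (isotropyDeriv (rotation t) x u)) = L u
      rw [hL, ← hρmul, ← rotation_add, neg_add_cancel, rotation_zero, hρ1]
    simp only [e]
    simp
  · intro y k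
    obtain ⟨s, rfl⟩ := rotation_surjective k
    set F : ℝ → E := fun t => ρ (rotation (-t)) (L (φ (rotation t • y) - φ x)) with hF
    have hper : Function.Periodic F 1 := by
      intro t
      simp only [hF]
      rw [rotation_add t 1, rotation_one, mul_one]
      have : rotation (-(t + 1)) = rotation (-t) := by
        have h1 : rotation (-1) = 1 := by
          have := rotation_add 1 (-1)
          rw [add_neg_cancel, rotation_zero, rotation_one, one_mul] at this
          exact this.symm
        rw [neg_add, rotation_add, h1, mul_one]
      rw [this]
    have e1 : ∀ t : ℝ, ρ (rotation (-t)) (L (φ (rotation t • rotation s • y) - φ x)) =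
        ρ (rotation s) (F (t + s)) := by
      intro t
      simp only [hF]
      rw [← hρmul, ← rotation_add, smul_smul, ← rotation_add]
      congr 3
      ring
    simp only [e1]
    have e2 : ∀ G : ℝ → E, ∫ t in (0 : ℝ)..1, ρ (rotation s) (G t) =
        ρ (rotation s) (∫ t in (0 : ℝ)..1, G t) := fun G => by
      rw [intervalIntegral.integral_of_le zero_le_one, intervalIntegral.integral_of_le zero_le_one,
        ContinuousLinearEquiv.integral_comp_comm]
    rw [e2 (fun t => F (t + s)), intervalIntegral.integral_comp_add_right]
    have := hper.intervalIntegral_add_eq s 0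
    rw [zero_add, add_comm 1 s, this, zero_add]

end EquivariantChart

/-! ### The Pfaffian -/

theorem form_expand (α : ℂ² [⋀^Fin 2]→L[ℝ] ℝ) (u v : ℂ²) :
    α ![u, v] = α ![(1, 0), (Complex.I, 0)] * (u.1.re * v.1.im - u.1.im * v.1.re) +
      α ![(1, 0), (0, 1)] * (u.1.re * v.2.re - u.2.re * v.1.re) +
      α ![(1, 0), (0, Complex.I)] * (u.1.re * v.2.im - u.2.im * v.1.re) +
      α ![(Complex.I, 0), (0, 1)] * (u.1.im * v.2.re - u.2.re * v.1.im) +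
      α ![(Complex.I, 0), (0, Complex.I)] * (u.1.im * v.2.im - u.2.im * v.1.im) +
      α ![(0, 1), (0, Complex.I)] * (u.2.re * v.2.im - u.2.im * v.2.re) := by
  have hdec : ∀ u : ℂ², u = u.1.re • ((1 : ℂ), (0 : ℂ)) + u.1.im • (Complex.I, (0 : ℂ)) +
      u.2.re • ((0 : ℂ), (1 : ℂ)) + u.2.im • ((0 : ℂ), Complex.I) := by
    intro u
    ext <;> simp
  have h : formBilin ℂ² α u v = formBilin ℂ² α
      (u.1.re • ((1 : ℂ), (0 : ℂ)) + u.1.im • (Complex.I, (0 : ℂ)) +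
        u.2.re • ((0 : ℂ), (1 : ℂ)) + u.2.im • ((0 : ℂ), Complex.I))
      (v.1.re • ((1 : ℂ), (0 : ℂ)) + v.1.im • (Complex.I, (0 : ℂ)) +
        v.2.re • ((0 : ℂ), (1 : ℂ)) + v.2.im • ((0 : ℂ), Complex.I)) := by
    rw [← hdec u, ← hdec v]
  rw [formBilin_apply] at h
  rw [h]
  simp only [map_add, map_smul, add_apply, smul_apply, formBilin_apply, form_self, smul_eq_mul]
  rw [form_swap α (Complex.I, 0) (1, 0), form_swap α (0, 1) (1, 0),
    form_swap α (0, Complex.I) (1, 0), form_swap α (0, 1) (Complex.I, 0),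
    form_swap α (0, Complex.I) (Complex.I, 0), form_swap α (0, Complex.I) (0, 1)]
  ring

theorem pfaffian_ne_zero_iff (α : ℂ² [⋀^Fin 2]→L[ℝ] ℝ) :
    pfaffian α ≠ 0 ↔ ∀ u, (∀ v, α ![u, v] = 0) → u = 0 := by
  constructor
  · intro h u hu
    have h1 := hu (1, 0)
    have h2 := hu (Complex.I, 0)
    have h3 := hu (0, 1)
    have h4 := hu (0, Complex.I)
    rw [form_expand] at h1 h2 h3 h4
    simp only [pfaffian] at h
    simp only [Complex.one_re, Complex.one_im, Complex.I_re, Complex.I_im, Complex.zero_re,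
      Complex.zero_im, mul_zero, mul_one, zero_sub, sub_zero, zero_add, add_zero] at h1 h2 h3 h4
    set a := α ![(1, 0), (Complex.I, 0)]
    set b := α ![(1, 0), (0, 1)]
    set c := α ![(1, 0), (0, Complex.I)]
    set d := α ![(Complex.I, 0), (0, 1)]
    set e := α ![(Complex.I, 0), (0, Complex.I)]
    set f := α ![(0, 1), (0, Complex.I)]
    have k1 : u.1.re = 0 := by
      refine (mul_eq_zero.1 ?_).resolve_left h
      linear_combination f * h2 - e * h3 + d * h4
    have k2 : u.1.im = 0 := by
      refine (mul_eq_zero.1 ?_).resolve_left h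
      linear_combination -f * h1 + c * h3 - b * h4
    have k3 : u.2.re = 0 := by
      refine (mul_eq_zero.1 ?_).resolve_left h
      linear_combination e * h1 - c * h2 + a * h4
    have k4 : u.2.im = 0 := by
      refine (mul_eq_zero.1 ?_).resolve_left h
      linear_combination -d * h1 + b * h2 - a * h3
    exact Prod.ext (Complex.ext k1 k2) (Complex.ext k3 k4)
  · intro h h0
    simp only [pfaffian] at h0
    set a := α ![(1, 0), (Complex.I, 0)] with ha
    set b := α ![(1, 0), (0, 1)] with hb
    set c := α ![(1, 0), (0, Complex.I)] with hc
    set d := α ![(Complex.I, 0), (0, 1)] with hd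
    set e := α ![(Complex.I, 0), (0, Complex.I)] with he
    set f := α ![(0, 1), (0, Complex.I)] with hf
    have key : ∀ r s t w : ℝ, (∀ v : ℂ², α ![((⟨r, s⟩ : ℂ), (⟨t, w⟩ : ℂ)), v] = 0) →
        r = 0 ∧ s = 0 ∧ t = 0 ∧ w = 0 := by
      intro r s t w hv
      have := h _ hv
      rw [Prod.mk_eq_zero, Complex.ext_iff, Complex.ext_iff] at this
      exact ⟨this.1.1, this.1.2, this.2.1, this.2.2⟩
    have h1 := key 0 f (-e) d fun v => by
      rw [form_expand]
      simp only [← ha, ← hb, ← hc, ← hd, ← he, ← hf]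
      linear_combination (-v.1.re) * h0
    have h2 := key (-f) 0 c (-b) fun v => by
      rw [form_expand]
      simp only [← ha, ← hb, ← hc, ← hd, ← he, ← hf]
      linear_combination (-v.1.im) * h0
    have h3 := key e (-c) 0 a fun v => by
      rw [form_expand]
      simp only [← ha, ← hb, ← hc, ← hd, ← he, ← hf]
      linear_combination (-v.2.re) * h0
    have hall : a = 0 ∧ b = 0 ∧ c = 0 ∧ d = 0 ∧ e = 0 ∧ f = 0 :=
      ⟨h3.2.2.2, neg_eq_zero.1 h2.2.2.2, h2.2.2.1, h1.2.2.2, h3.1, h1.2.1⟩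
    have h5 : ((1 : ℂ), (0 : ℂ)) = 0 := h _ fun v => by
      rw [form_expand]
      simp only [← ha, ← hb, ← hc, ← hd, ← he, ← hf, hall.1, hall.2.1, hall.2.2.1, hall.2.2.2.1,
        hall.2.2.2.2.1, hall.2.2.2.2.2]
      ring
    simp at h5

theorem continuousOn_pfaffian {M : Type} [TopologicalSpace M]
    {η : M → ℂ² [⋀^Fin 2]→L[ℝ] ℝ} {s : Set M}
    (h : ∀ u v, ContinuousOn (fun y => η y ![u, v]) s) :
    ContinuousOn (fun y => pfaffian (η y)) s := by
  simp only [pfaffian]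
  exact (((h _ _).mul (h _ _)).sub ((h _ _).mul (h _ _))).add ((h _ _).mul (h _ _))

/-! ### Orbits in a level set -/

section Orbit

variable {X : Type*} [MulAction Circle X] {T : ℝ} {Φ : X → AddCircle T} {l : AddCircle T}

/-- The class of `y` in the reduced space, with the class of a base point as default value. -/
def orbitClass (Φ : X → AddCircle T) {l : AddCircle T} {x : X} (hx : Φ x = l) (y : X) :
    ReducedSpace Φ l :=
  open Classical in if h : Φ y = l then ReducedSpace.mk Φ l y h else ReducedSpace.mk Φ l x hx

theorem orbitClass_eq {x : X} (hx : Φ x = l) {y : X} (hy : Φ y = l) :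
    orbitClass Φ hx y = ReducedSpace.mk Φ l y hy := dif_pos hy

theorem mk_eq_mk_iff {y z : X} (hy : Φ y = l) (hz : Φ z = l) :
    ReducedSpace.mk Φ l y hy = ReducedSpace.mk Φ l z hz ↔ ∃ g : Circle, g • y = z :=
  Quotient.eq (r := levelSetoid Φ l)

theorem exists_mk_eq (m : ReducedSpace Φ l) : ∃ (y : X) (hy : Φ y = l),
    ReducedSpace.mk Φ l y hy = m := by
  obtain ⟨⟨y, hy⟩, rfl⟩ := Quotient.exists_rep m
  exact ⟨y, hy, rfl⟩

theorem orbitClass_eq_iff {x : X} (hx : Φ x = l) {y z : X} (hy : Φ y = l) (hz : Φ z = l) :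
    orbitClass Φ hx y = orbitClass Φ hx z ↔ ∃ g : Circle, g • y = z := by
  rw [orbitClass_eq hx hy, orbitClass_eq hx hz, mk_eq_mk_iff]

variable [TopologicalSpace X]

theorem continuous_mk : Continuous fun y : {x : X // Φ x = l} => ReducedSpace.mk Φ l y.1 y.2 :=
  continuous_quotient_mk' (s := levelSetoid Φ l)

theorem isOpen_reducedSpace_iff {O : Set (ReducedSpace Φ l)} :
    IsOpen O ↔ IsOpen {y : {x : X // Φ x = l} | ReducedSpace.mk Φ l y.1 y.2 ∈ O} :=
  (isQuotientMap_quotient_mk' (s := levelSetoid Φ l)).isOpen_preimage.symm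

theorem continuousOn_orbitClass {F : Type*} [TopologicalSpace F] {x : X} (hx : Φ x = l) {σ : F → X}
    {S : Set F} (hσ : ContinuousOn σ S) (hl : ∀ z ∈ S, Φ (σ z) = l) :
    ContinuousOn (fun z => orbitClass Φ hx (σ z)) S := by
  rw [continuousOn_iff_continuous_domRestrict] at hσ ⊢
  have h1 : Continuous fun z : S => (⟨σ z, hl z z.2⟩ : {x : X // Φ x = l}) := hσ.subtype_mk _
  refine (continuous_mk.comp h1).congr fun z => ?_
  exact (orbitClass_eq hx (hl z z.2)).symm

end Orbit

section Section

variable {X : Type*} [TopologicalSpace X] [ChartedSpace E₆ X]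
  [IsManifold (𝓡 6) ∞ X]
  [MulAction Circle X] [ContMDiffSMul (𝓡 1) (𝓡 6) ∞ Circle X]
  {Ω : (x : X) → TangentSpace (𝓡 6) x [⋀^Fin 2]→L[ℝ] ℝ} {T : ℝ} {Φ : X → AddCircle T}
  {l : AddCircle T}

/-- A symplectic section: a smooth map from an open subset of `ℂ²` to the points of the level set
that are not fixed, along which the form is nondegenerate. -/
structure IsSymplecticSection (Ω : (x : X) → TangentSpace (𝓡 6) x [⋀^Fin 2]→L[ℝ] ℝ)
    (Φ : X → AddCircle T) (l : AddCircle T) (W : Set ℂ²) (σ : ℂ² → X) : Prop where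
  isOpen : IsOpen W
  smooth : ContMDiffOn 𝓘(ℝ, ℂ²) (𝓡 6) ∞ σ W
  level : ∀ z ∈ W, Φ (σ z) = l
  nondegenerate : ∀ z ∈ W, ∀ u, (∀ v, pullbackForm Ω σ z ![u, v] = 0) → u = 0
  not_fixed : ∀ z ∈ W, (generator (σ z) : E₆) ≠ 0

theorem IsSymplecticSection.mono {V W : Set ℂ²} {σ : ℂ² → X}
    (h : IsSymplecticSection Ω Φ l W σ) (hV : IsOpen V) (hVW : V ⊆ W) :
    IsSymplecticSection Ω Φ l V σ :=
  ⟨hV, h.smooth.mono hVW, fun z hz => h.level z (hVW hz), fun z hz => h.nondegenerate z (hVW hz),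
    fun z hz => h.not_fixed z (hVW hz)⟩

theorem IsSymplecticSection.isOpen_image {W : Set ℂ²} {σ : ℂ² → X} {x : X} (hx : Φ x = l)
    (hΩ : IsSymplecticForm Ω) (hinv : IsInvariantForm Ω) (hΦ : IsMomentMap Ω Φ)
    (h : IsSymplecticSection Ω Φ l W σ) {V : Set ℂ²} (hVW : V ⊆ W) (hV : IsOpen V) :
    IsOpen ((fun z => orbitClass Φ hx (σ z)) '' V) := by
  have hcs : ContinuousSMul Circle X := ContMDiffSMul.continuousSMul (I := 𝓡 1) (I' := 𝓡 6) ∞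
  rw [isOpen_reducedSpace_iff, isOpen_iff_mem_nhds]
  rintro ⟨y, hy⟩ ⟨z, hz, hzy⟩
  have h' := h.mono hV hVW
  change orbitClass Φ hx (σ z) = ReducedSpace.mk Φ l y hy at hzy
  rw [orbitClass_eq hx (h'.level z hz), eq_comm, mk_eq_mk_iff] at hzy
  obtain ⟨g, hg⟩ := hzy
  obtain ⟨N, θ, π, hN, hzN, -, -, -, -, hπV, hNl, -⟩ := exists_tube_coordinates hΩ hinv hΦ hV hz
    h'.smooth h'.level (h'.not_fixed z hz) (h'.nondegenerate z hz)
  have hc : Continuous fun y : {x : X // Φ x = l} => g • y.1 :=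
    (continuous_const_smul g).comp continuous_subtype_val
  filter_upwards [(hN.preimage hc).mem_nhds (x := ⟨y, hy⟩) (by
    change g • y ∈ N
    rw [hg]; exact hzN)] with w hw
  have hgw : Φ (g • w.1) = l := by rw [moment_smul hΦ, w.2]
  refine ⟨π (g • w.1), hπV _ hw, ?_⟩
  change orbitClass Φ hx _ = _
  rw [orbitClass_eq hx (h'.level _ (hπV _ hw)), mk_eq_mk_iff]
  refine ⟨g⁻¹ * rotation (θ (g • w.1)), ?_⟩
  rw [mul_smul, hNl _ hw hgw, inv_smul_smul]

theorem isClosed_fixed [T2Space X] :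
    IsClosed {x : X | (generator x : E₆) = 0} := by
  have hcs : ContinuousSMul Circle X := ContMDiffSMul.continuousSMul (I := 𝓡 1) (I' := 𝓡 6) ∞
  have h : {x : X | (generator x : E₆) = 0} =
      ⋂ g : Circle, {x : X | g • x = x} := by
    ext x
    simp only [Set.mem_ofPred_eq, Set.mem_iInter]
    exact ⟨fun h => smul_eq_of_generator_eq_zero h, generator_eq_zero_of_smul_eq⟩
  rw [h]
  exact isClosed_iInter fun g => isClosed_eq (continuous_const_smul g) continuous_id

theorem generator_smul_ne_zero (g : Circle) {x : X}
    (h : (generator x : E₆) ≠ 0) :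
    (generator (g • x) : E₆) ≠ 0 := by
  intro h0
  refine h (generator_eq_zero_of_smul_eq fun k => ?_)
  have := smul_eq_of_generator_eq_zero h0 k
  rw [smul_smul, mul_comm, mul_smul, smul_left_cancel_iff] at this
  exact this

theorem fderiv_moment_coordinate (hΦ : IsMomentMap Ω Φ) {x : X} {f : E₆ → ℝ}
    (hf : ContinuousAt f (extChartAt (𝓡 6) x x))
    (hfΦ : ∀ᶠ y in 𝓝 x, Φ y = f (extChartAt (𝓡 6) x y)) (u : E₆) :
    fderiv ℝ f (extChartAt (𝓡 6) x x) u =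
      (Ω x : E₆ [⋀^Fin 2]→L[ℝ] ℝ) ![u, generator x] := by
  set φ := extChartAt (𝓡 6) x with hφ
  have hmem : φ x ∈ φ.target := mem_extChartAt_target (I := 𝓡 6) x
  have hσ := contMDiffAt_extChartAt_symm (X := X) hmem
  have hx' : φ.symm (φ x) = x := extChartAt_to_inv x
  have hev : ∀ᶠ z in 𝓝 (φ x), Φ (φ.symm z) = 0 + (f z : AddCircle T) := by
    have hc := hσ.continuousAt.tendsto
    rw [hx'] at hc
    filter_upwards [hc.eventually hfΦ, (isOpen_extChartAt_target x).mem_nhds hmem] with z hz hzt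
    rw [hz, φ.right_inv hzt, zero_add]
  rw [← form_generator_eq_fderiv hΦ hσ hf hev u]
  have h1 : (mfderiv 𝓘(ℝ, E₆) (𝓡 6) φ.symm (φ x) u :
      E₆) = u := by
    have h2 := mfderiv_chart_comp (x := φ.symm (φ x)) (hσ.mdifferentiableAt (by simp))
      (mem_extChartAt_source _) u
    rw [mfderiv_extChartAt_self] at h2
    refine h2.symm.trans ?_
    rw [hx']
    have : (fun z => φ (φ.symm z)) =ᶠ[𝓝 (φ x)] id := by
      filter_upwards [(isOpen_extChartAt_target x).mem_nhds hmem] with z hz using φ.right_inv hz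
    rw [this.fderiv_eq, fderiv_id]
    rfl
  have key : ∀ (y : X) (a : E₆), y = x → a = u →
      (Ω y : E₆ [⋀^Fin 2]→L[ℝ] ℝ) ![a, generator y] =
        (Ω x : E₆ [⋀^Fin 2]→L[ℝ] ℝ) ![u, generator x] := by
    rintro y a rfl rfl; rfl
  exact key _ _ hx' h1

end Section

section Slice

variable {X : Type*} [TopologicalSpace X] [ChartedSpace E₆ X]
  [IsManifold (𝓡 6) ∞ X]
  [MulAction Circle X] [ContMDiffSMul (𝓡 1) (𝓡 6) ∞ Circle X]
  {Ω : (x : X) → TangentSpace (𝓡 6) x [⋀^Fin 2]→L[ℝ] ℝ} {T : ℝ} {Φ : X → AddCircle T}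
  {l : AddCircle T}

/-- A linear slice: the stabilizer `K` of `x` acts linearly on a symplectic section through `x`. -/
theorem exists_linear_slice [T2Space X] (hΩ : IsSymplecticForm Ω) (hinv : IsInvariantForm Ω)
    (hΦ : IsMomentMap Ω Φ) {x : X} (hx : Φ x = l)
    (hgen : (generator x : E₆) ≠ 0) :
    ∃ (W : Set ℂ²) (τ : ℂ² → X)
      (R : MulAction.stabilizer Circle x →* (ℂ² →L[ℝ] ℂ²)), (0 : ℂ²) ∈ W ∧ τ 0 = x ∧
      IsSymplecticSection Ω Φ l W τ ∧
      ∀ k, ∀ z ∈ W, R k z ∈ W → τ (R k z) = (k : Circle) • τ z := by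
  have hcs : ContinuousSMul Circle X := ContMDiffSMul.continuousSMul (I := 𝓡 1) (I' := 𝓡 6) ∞
  set K := MulAction.stabilizer Circle x with hK
  have hfin : Finite K := finite_stabilizer hgen
  have : Fintype K := Fintype.ofFinite K
  have hKx : ∀ k ∈ K, k • x = x := fun k hk => hk
  have hKc : IsCompact (K : Set Circle) := (Set.toFinite _).isCompact
  set φ := extChartAt (𝓡 6) x with hφ
  obtain ⟨f, V, hV, hxV, hfV, hfΦ, n, hn⟩ := exists_moment_coordinate hΩ hΦ hgen
  have hf := hfV.contDiffAt (hV.mem_nhds hxV)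
  obtain ⟨η, hη⟩ : ∃ η : E₆ [⋀^Fin 2]→L[ℝ] ℝ, η = Ω x := ⟨Ω x, rfl⟩
  obtain ⟨ξ, hξ⟩ : ∃ ξ : E₆, ξ = generator x := ⟨generator x, rfl⟩
  set ℓ := fderiv ℝ f (φ x) with hℓ
  have hℓΩ : ∀ u, ℓ u = η ![u, ξ] := fun u => by
    rw [hη, hξ]; exact fderiv_moment_coordinate hΦ hf.continuousAt hfΦ u
  have hηT : ∀ k ∈ MulAction.stabilizer Circle x, ∀ u v,
      η ![isotropyDeriv k x u, isotropyDeriv k x v] = η ![u, v] := fun k hk u v => by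
    rw [hη]; exact isotropyDeriv_form hinv hk u v
  have hξT : ∀ k ∈ MulAction.stabilizer Circle x, isotropyDeriv k x ξ = ξ := fun k hk => by
    rw [hξ]; exact isotropyDeriv_generator hk
  have hηnd : ∀ u, (∀ v, η ![u, v] = 0) → u = 0 := by
    rw [hη]; exact hΩ.nondegenerate x
  obtain ⟨θ₀, U₀, hU₀, hxU₀, hU₀t, hθ₀, hθ₀x, hθ₀d, hθ₀K⟩ := exists_average_finite hKx
  have hℓT : ∀ k ∈ K, ∀ u, ℓ (isotropyDeriv k x u) = ℓ u := fun k hk u => by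
    rw [hℓΩ, hℓΩ, ← hηT k hk u ξ, hξT k hk]
  -- an invariant vector transverse to the level
  set c : ℝ := (Fintype.card K : ℝ)⁻¹ with hc
  have hcard : c * Fintype.card K = 1 := inv_mul_cancel₀ (by simp)
  set n' := c • ∑ k : K, isotropyDeriv (k : Circle) x n with hn'
  have hn'1 : ℓ n' = 1 := by
    rw [hn', map_smul, map_sum]
    simp only [hℓT _ (Subtype.prop _), hn, Finset.sum_const, Finset.card_univ, nsmul_eq_mul, mul_one,
      smul_eq_mul, hcard]
  have hn'K : ∀ j ∈ K, isotropyDeriv j x n' = n' := by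
    intro j hj
    rw [hn', map_smul, map_sum]
    congr 1
    refine Fintype.sum_equiv (Equiv.mulLeft ⟨j, hj⟩) _ _ fun k => ?_
    rw [← isotropyDeriv_mul (hKx _ hj) (hKx _ k.2)]
    rfl
  -- equivariant coordinates in which the moment map is linear
  set θ : X → E₆ := fun y =>
    θ₀ y + (f (φ y) - f (φ x) - ℓ (θ₀ y)) • n' with hθ
  have hℓθ : ∀ y, ℓ (θ y) = f (φ y) - f (φ x) := fun y => by
    simp only [hθ, map_add, map_smul, hn'1, smul_eq_mul]; ring
  have hθeq : ∀ y ∈ φ.target, θ (φ.symm y) = θ₀ (φ.symm y) +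
      (f y - f (φ x) - ℓ (θ₀ (φ.symm y))) • n' := fun y hy => by
    simp only [hθ, φ.right_inv hy]
  have hθs : ContDiffOn ℝ ∞ (fun y => θ (φ.symm y)) (U₀ ∩ V) := by
    have h1 := hθ₀.mono (Set.inter_subset_left (t := V))
    have h2 : ContDiffOn ℝ ∞ (fun y => f y - f (φ x) - ℓ (θ₀ (φ.symm y))) (U₀ ∩ V) :=
      ((hfV.mono Set.inter_subset_right).sub contDiffOn_const).sub
        (ℓ.contDiff.comp_contDiffOn h1)
    exact (h1.add (h2.smul (contDiffOn_const (c := n')))).congr fun y hy => hθeq y (hU₀t hy.1)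
  have hθd : ∀ u, fderiv ℝ (fun y => θ (φ.symm y)) (φ x) u = u := by
    intro u
    have h0 := ((hθ₀.contDiffAt (hU₀.mem_nhds hxU₀)).differentiableAt (by simp)).hasFDerivAt
    have h1 := (hf.differentiableAt (by simp)).hasFDerivAt
    have h2 := h0.fun_add (((h1.sub_const (f (φ x))).fun_sub
      (ℓ.hasFDerivAt.comp (φ x) h0)).smul_const n')
    have hev : (fun y => θ (φ.symm y)) =ᶠ[𝓝 (φ x)] fun y => θ₀ (φ.symm y) +
      (f y - f (φ x) - ℓ (θ₀ (φ.symm y))) • n' := by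
      filter_upwards [hU₀.mem_nhds hxU₀] with y hy using hθeq y (hU₀t hy)
    rw [(h2.congr_of_eventuallyEq hev).fderiv]
    simp only [add_apply, sub_apply, ContinuousLinearMap.smulRight_apply,
      ContinuousLinearMap.comp_apply]
    rw [hθ₀d, ← hℓ, sub_self, zero_smul, add_zero]
  obtain ⟨δT, hδT, hT⟩ := exists_pos_of_coe_eq T
  have hfφ : ContinuousAt (fun y => f (φ y)) x :=
    ContinuousAt.comp (f := φ) hf.continuousAt (continuousAt_extChartAt x)
  have hθK : ∀ᶠ y in 𝓝 x, ∀ k ∈ (K : Set Circle), θ (k • y) = isotropyDeriv k x (θ y) := by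
    have hnear : ∀ᶠ y in 𝓝 x, Φ y = f (φ y) ∧ |f (φ y) - f (φ x)| < δT / 2 :=
      hfΦ.and (hfφ.eventually (Metric.ball_mem_nhds _ (half_pos hδT)))
    have hnearK : ∀ᶠ y in 𝓝 x, ∀ k ∈ (K : Set Circle),
        Φ (k • y) = f (φ (k • y)) ∧ |f (φ (k • y)) - f (φ x)| < δT / 2 := by
      refine hKc.eventually_forall_of_forall_eventually fun k hk => ?_
      have hc : Continuous fun z : X × Circle => z.2 • z.1 := by fun_prop
      have hc' := hc.tendsto (x, k)
      simp only [hKx k hk] at hc'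
      exact hc'.eventually hnear
    filter_upwards [hnear, hnearK] with y hy hyK k hk
    have e : f (φ (k • y)) = f (φ y) := by
      refine hT _ _ ?_ ?_
      · have h1 := abs_lt.1 hy.2
        have h2 := abs_lt.1 (hyK k hk).2
        rw [abs_lt]
        constructor <;> linarith
      · rw [← (hyK k hk).1, ← hy.1, moment_smul hΦ]
    simp only [hθ, map_add, map_smul]
    rw [e, hθ₀K y k hk, hℓT k hk, hn'K k hk]
  obtain ⟨δ, Ψ, hδ, hΨ0, hΨs, hθΨ, hΨK, hΨd⟩ := exists_equivariant_inverse (by simp) hKc hKx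
    (hU₀.inter hV) ⟨hxU₀, hxV⟩ hθs (by simp [hθ, hθ₀x]) (fun u hu => by rwa [hθd] at hu) hθK
  have hΨd' : ∀ u, fderiv ℝ (fun v => φ (Ψ v)) 0 u = u := fun u => by rw [← hθd (fderiv _ _ _ _), hΨd]
  -- the symplectic complement
  set m : E₆ →L[ℝ] ℝ :=
    formBilin E₆ η n' with hm
  have hmΩ : ∀ u, m u = η ![n', u] := fun u => rfl
  have hmξ : m ξ = 1 := by rw [hmΩ, ← hn'1, hℓΩ]
  have hmn : m n' = 0 := by rw [hmΩ, form_self]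
  have hℓξ : ℓ ξ = 0 := by rw [hℓΩ, form_self]
  have hmT : ∀ k ∈ K, ∀ u, m (isotropyDeriv k x u) = m u := fun k hk u => by
    rw [hmΩ, hmΩ, ← hηT k hk n' u, hn'K k hk]
  set M : E₆ →L[ℝ] ℝ × ℝ := ℓ.prod m with hM
  have hMsurj : Function.Surjective M := by
    rintro ⟨a, b⟩
    refine ⟨a • n' + b • ξ, ?_⟩
    simp [hM, hn'1, hℓξ, hmξ, hmn]
  have hrank : Module.finrank ℝ (LinearMap.ker M.toLinearMap) = Module.finrank ℝ ℂ² := by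
    have h1 := M.toLinearMap.finrank_range_add_finrank_ker
    rw [LinearMap.range_eq_top.2 hMsurj] at h1
    simp only [finrank_top, Module.finrank_prod, Module.finrank_self, finrank_euclideanSpace_fin,
      Complex.finrank_real_complex] at h1 ⊢
    omega
  let e : ℂ² ≃L[ℝ] LinearMap.ker M.toLinearMap := ContinuousLinearEquiv.ofFinrankEq hrank.symm
  set ι : ℂ² →L[ℝ] E₆ :=
    (LinearMap.ker M.toLinearMap).subtypeL.comp e.toContinuousLinearMap with hι
  have hιinj : Function.Injective ι := fun a b hab => e.injective (Subtype.ext hab)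
  have hιM : ∀ z, ℓ (ι z) = 0 ∧ m (ι z) = 0 := fun z => by
    have h := LinearMap.mem_ker.1 (e z).2
    exact ⟨congrArg Prod.fst h, congrArg Prod.snd h⟩
  have hιsurj : ∀ v, ℓ v = 0 → m v = 0 → ∃ z, ι z = v := fun v h1 h2 =>
    ⟨e.symm ⟨v, LinearMap.mem_ker.2 (Prod.ext h1 h2)⟩, by simp [hι]⟩
  -- the linear action
  have hRex : ∀ k : K, ∃ R : ℂ² →L[ℝ] ℂ², ∀ z, ι (R z) = isotropyDeriv (k : Circle) x (ι z) := by
    intro k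
    have hker : ∀ z, isotropyDeriv (k : Circle) x (ι z) ∈ LinearMap.ker M.toLinearMap := fun z =>
      LinearMap.mem_ker.2 (Prod.ext ((hℓT k k.2 _).trans (hιM z).1) ((hmT k k.2 _).trans (hιM z).2))
    refine ⟨e.symm.toContinuousLinearMap.comp
      (((isotropyDeriv (k : Circle) x).comp ι).codRestrict _ hker), fun z => ?_⟩
    simp [hι]
  choose R hR using hRex
  let Rhom : K →* (ℂ² →L[ℝ] ℂ²) :=
    { toFun := R
      map_one' := ContinuousLinearMap.ext fun z => hιinj (by
        rw [hR]; exact isotropyDeriv_one x _)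
      map_mul' := fun j k => ContinuousLinearMap.ext fun z => hιinj (by
        rw [mul_apply_eq_comp, hR, hR, hR]
        exact isotropyDeriv_mul (hKx _ j.2) (hKx _ k.2) _) }
  -- the section
  set τ : ℂ² → X := fun z => Ψ (ι z) with hτ
  have hτ0 : τ 0 = x := by simp only [hτ, map_zero, hΨ0]
  have hWo : IsOpen (ι ⁻¹' Metric.ball 0 δ) := Metric.isOpen_ball.preimage ι.continuous
  have h0W : (0 : ℂ²) ∈ ι ⁻¹' Metric.ball 0 δ := by simp [hδ]
  have hτs : ContMDiffOn 𝓘(ℝ, ℂ²) (𝓡 6) ∞ τ (ι ⁻¹' Metric.ball 0 δ) :=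
    hΨs.comp ι.contDiff.contMDiff.contMDiffOn fun _ h => h
  have hτc := (hτs.contMDiffAt (hWo.mem_nhds h0W)).continuousAt.tendsto
  rw [hτ0] at hτc
  have hτform : ∀ u v, pullbackForm Ω τ 0 ![u, v] =
      η ![ι u, ι v] := by
    intro u v
    have hd : ∀ u, fderiv ℝ (fun z => φ (τ z)) 0 u = ι u := fun u => by
      have h1 : DifferentiableAt ℝ (fun v => φ (Ψ v)) (ι 0) := by
        rw [map_zero]
        refine (contDiffAt_chart_comp (hΨs.contMDiffAt (Metric.isOpen_ball.mem_nhds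
          (Metric.mem_ball_self hδ))) ?_).differentiableAt (by simp)
        rw [hΨ0]; exact mem_extChartAt_source x
      have h2 := (h1.hasFDerivAt.comp (0 : ℂ²) ι.hasFDerivAt).fderiv
      have h3 : (fun v => φ (Ψ v)) ∘ ι = fun z => φ (τ z) := rfl
      rw [h3] at h2
      rw [h2, ContinuousLinearMap.comp_apply, map_zero, hΨd']
    rw [pullbackForm_eq_chart hτ0 ((hτs.contMDiffAt (hWo.mem_nhds h0W)).mdifferentiableAt (by simp)),
      hd, hd, hη]
    rfl
  have hnd0 : ∀ u, (∀ v, pullbackForm Ω τ 0 ![u, v] = 0) → u = 0 := by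
    intro u hu
    refine hιinj ?_
    rw [map_zero]
    refine hηnd (ι u) fun v => ?_
    obtain ⟨z, hz⟩ := hιsurj (v - (ℓ v • n' + m v • ξ))
      (by simp [hn'1, hℓξ]) (by simp [hmξ, hmn])
    have hv : v = ι z + (ℓ v • n' + m v • ξ) := by rw [hz]; abel
    have h1 : η ![ι u, n'] = 0 := by rw [form_swap, ← hmΩ, (hιM u).2, neg_zero]
    have h2 : η ![ι u, ξ] = 0 := by rw [← hℓΩ, (hιM u).1]
    have h3 : η ![ι u, ι z] = 0 := by rw [← hτform, hu]
    clear_value n'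
    rw [← formBilin_apply] at h1 h2 h3 ⊢
    rw [hv, map_add, map_add, map_smul, map_smul, h1, h2, h3]
    simp
  -- the domain
  have hform := contDiffOn_pullbackForm hΩ hWo hτs
  have hev : ∀ᶠ z in 𝓝 (0 : ℂ²), z ∈ ι ⁻¹' Metric.ball 0 δ ∧ Φ (τ z) = l ∧
      (∀ u, (∀ v, pullbackForm Ω τ z ![u, v] = 0) → u = 0) ∧
      (generator (τ z) : E₆) ≠ 0 := by
    have hpf : ContinuousAt (fun z => pfaffian (pullbackForm Ω τ z)) 0 :=
      (continuousOn_pfaffian fun u v => (contDiffOn_form_iff.1 hform u v).continuousOn).continuousAt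
        (hWo.mem_nhds h0W)
    filter_upwards [hWo.mem_nhds h0W, hτc.eventually hfΦ,
      hpf.eventually_ne ((pfaffian_ne_zero_iff _).2 hnd0),
      hτc.eventually (isClosed_fixed.isOpen_compl.mem_nhds hgen)] with z hz hzΦ hzp hzg
    refine ⟨hz, ?_, (pfaffian_ne_zero_iff _).1 hzp, hzg⟩
    have h1 := hℓθ (τ z)
    rw [show θ (τ z) = ι z from hθΨ _ hz, (hιM z).1] at h1
    rw [hzΦ, ← hx, hfΦ.self_of_nhds]
    congr 1
    linarith
  obtain ⟨W, hW, hWopen, h0⟩ := mem_nhds_iff.1 hev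
  refine ⟨W, τ, Rhom, h0, hτ0, ⟨hWopen, hτs.mono fun z hz => (hW hz).1, fun z hz => (hW hz).2.1,
    fun z hz => (hW hz).2.2.1, fun z hz => (hW hz).2.2.2⟩, fun k z hz hRz => ?_⟩
  have h1 : τ (Rhom k z) = Ψ (isotropyDeriv (k : Circle) x (ι z)) := congrArg Ψ (hR k z)
  rw [h1]
  refine hΨK _ (hW hz).1 _ k.2 ?_
  rw [← hR]
  exact (hW hRz).1

/-- Near `z` the map `f` into the reduced space lifts to a symplectic section that pulls back the
form to `α`. -/
def HasSection (Ω : (x : X) → TangentSpace (𝓡 6) x [⋀^Fin 2]→L[ℝ] ℝ)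
    (Φ : X → AddCircle T) (l : AddCircle T) (U : Set ℂ²) (f : ℂ² → ReducedSpace Φ l)
    (α : ℂ² → ℂ² [⋀^Fin 2]→L[ℝ] ℝ) (z : ℂ²) : Prop :=
  ∃ (W : Set ℂ²) (σ : ℂ² → X), z ∈ W ∧ W ⊆ U ∧ IsSymplecticSection Ω Φ l W σ ∧
    ∀ y ∈ W, (∃ hy : Φ (σ y) = l, f y = ReducedSpace.mk Φ l (σ y) hy) ∧
      pullbackForm Ω σ y = α y

/-- The chart `c` comes from symplectic sections of the level set. -/
def IsReductionChart (Ω : (x : X) → TangentSpace (𝓡 6) x [⋀^Fin 2]→L[ℝ] ℝ)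
    (Φ : X → AddCircle T) (l : AddCircle T) (c : UniformizingChart (ReducedSpace Φ l)) : Prop :=
  ∀ z ∈ c.dom, HasSection Ω Φ l c.dom c.map c.form z

theorem exists_reduction_chart [T2Space X] (hΩ : IsSymplecticForm Ω) (hinv : IsInvariantForm Ω)
    (hΦ : IsMomentMap Ω Φ) {x : X} (hx : Φ x = l)
    (hgen : (generator x : E₆) ≠ 0) :
    ∃ c : UniformizingChart (ReducedSpace Φ l), IsReductionChart Ω Φ l c ∧
      ∃ z ∈ c.dom, c.map z = ReducedSpace.mk Φ l x hx := by
  have hcs : ContinuousSMul Circle X := ContMDiffSMul.continuousSMul (I := 𝓡 1) (I' := 𝓡 6) ∞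
  obtain ⟨W, τ, R, h0W, hτ0, hτ, hRτ⟩ := exists_linear_slice hΩ hinv hΦ hx hgen
  have hfin : Finite (MulAction.stabilizer Circle x) := finite_stabilizer hgen
  have hτc : Filter.Tendsto τ (𝓝 0) (𝓝 x) := by
    have := (hτ.smooth.continuousOn.continuousAt (hτ.isOpen.mem_nhds h0W)).tendsto
    rwa [hτ0] at this
  have hRc : ∀ k, Filter.Tendsto (R k) (𝓝 0) (𝓝 0) := fun k => by
    have := (R k).continuous.tendsto 0
    rwa [map_zero] at this
  -- close points of the section are equivalent only under the stabilizer
  have hrigid : ∀ᶠ p in 𝓝 ((0 : ℂ²), (0 : ℂ²)), ∀ g ∈ (Set.univ : Set Circle),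
      g • τ p.1 = τ p.2 → ∃ k, R k p.1 = p.2 := by
    refine isCompact_univ.eventually_forall_of_forall_eventually fun g _ => ?_
    have h1 : Filter.Tendsto (fun q : (ℂ² × ℂ²) × Circle => (q.2 • τ q.1.1, τ q.1.2))
        (𝓝 ((0, 0), g)) (𝓝 (g • x, x)) := by
      have ht : Filter.Tendsto (fun q : (ℂ² × ℂ²) × Circle => q) (𝓝 ((0, 0), g))
        (𝓝 ((0, 0), g)) := Filter.tendsto_id
      exact ((continuous_snd.tendsto' _ g rfl).smul
        (hτc.comp ((continuous_fst.comp continuous_fst).tendsto' _ 0 rfl))).prodMk_nhds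
        (hτc.comp ((continuous_snd.comp continuous_fst).tendsto' _ 0 rfl))
    by_cases hg : g • x = x
    · obtain ⟨N, θ, π, hN, hxN, -, hπ, hθ0, hπ0, -, -, htube⟩ := exists_tube_coordinates hΩ hinv hΦ
        hτ.isOpen h0W hτ.smooth hτ.level (hτ.not_fixed 0 h0W) (hτ.nondegenerate 0 h0W)
      set k : MulAction.stabilizer Circle x := ⟨g, hg⟩
      have harg : Filter.Tendsto (fun q : (ℂ² × ℂ²) × Circle =>
          (Complex.arg (q.2 * g⁻¹ : Circle) / (2 * Real.pi), R k q.1.1)) (𝓝 ((0, 0), g))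
          (𝓝 (0, 0)) := by
        refine Filter.Tendsto.prodMk_nhds ?_ ((hRc k).comp
          ((continuous_fst.comp continuous_fst).tendsto' _ 0 rfl))
        have hc : ContinuousAt (fun g : Circle => Complex.arg g / (2 * Real.pi)) 1 := by
          have h1 : ContinuousAt Complex.arg ((1 : Circle) : ℂ) := Complex.continuousAt_arg (by simp)
          have h2 : ContinuousAt (fun g : Circle => (g : ℂ)) 1 := continuous_subtype_val.continuousAt
          exact (ContinuousAt.comp (f := fun g : Circle => (g : ℂ)) h1 h2).div_const _
        have hc' := hc.tendsto
        simp only [Circle.coe_one, Complex.arg_one, zero_div] at hc'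
        refine hc'.comp ?_
        exact (continuous_snd.mul continuous_const).tendsto' _ _ (by simp)
      filter_upwards [harg.eventually htube, (((continuous_snd.comp continuous_fst).tendsto'
          (((0 : ℂ²), (0 : ℂ²)), g) (0 : ℂ²) rfl)).eventually
          ((Continuous.prodMk_right (0 : ℝ)).tendsto (0 : ℂ²) |>.eventually htube),
        (((continuous_fst.comp continuous_fst).tendsto'
          (((0 : ℂ²), (0 : ℂ²)), g) (0 : ℂ²) rfl)).eventually
          ((hτ.isOpen.mem_nhds h0W)),
        (((continuous_fst.comp continuous_fst).tendsto'
          (((0 : ℂ²), (0 : ℂ²)), g) (0 : ℂ²) rfl)).eventually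
          ((hRc k).eventually (hτ.isOpen.mem_nhds h0W))] with q hq1 hq2 hq3 hq4 hq5
      refine ⟨k, ?_⟩
      have hr : rotation (Complex.arg (q.2 * g⁻¹ : Circle) / (2 * Real.pi)) = q.2 * g⁻¹ := by
        rw [rotation, mul_div_cancel₀ _ (by positivity)]
        exact Circle.exp_arg _
      have e1 := hq1.2.2
      have e2 := hq2.2.2
      simp only [Function.comp_apply] at e1 e2 hq3 hq4
      rw [hr, hRτ k _ hq3 hq4, smul_smul] at e1
      rw [rotation_zero, one_smul] at e2
      have e3 : (q.2 * g⁻¹ * (k : Circle)) = q.2 := by simp [k]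
      rw [e3, hq5, e2] at e1
      exact e1.symm
    · have h2 := h1.eventually (isClosed_diagonal.isOpen_compl.mem_nhds
        (show (g • x, x) ∈ (Set.diagonal X)ᶜ from hg))
      filter_upwards [h2] with q hq hq'
      exact absurd hq' hq
  rw [nhds_prod_eq] at hrigid
  obtain ⟨D, hD, hDD⟩ := Filter.mem_prod_same_iff.1 hrigid
  obtain ⟨D', hD'D, hD'o, h0D'⟩ := mem_nhds_iff.1 (Filter.inter_mem hD (hτ.isOpen.mem_nhds h0W))
  set dom : Set ℂ² := ⋂ k, R k ⁻¹' D' with hdom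
  have hdomo : IsOpen dom := isOpen_iInter_of_finite fun k => hD'o.preimage (R k).continuous
  have h0dom : (0 : ℂ²) ∈ dom := Set.mem_iInter.2 fun k => by
    rw [Set.mem_preimage, map_zero]; exact h0D'
  have hRmul : ∀ j k z, R (j * k) z = R j (R k z) := fun j k z => by
    rw [map_mul, mul_apply_eq_comp]
  have hR1 : ∀ z, R 1 z = z := fun z => by rw [map_one, one_apply_eq_self]
  have hdomR : ∀ k, ∀ z ∈ dom, R k z ∈ dom := fun k z hz => Set.mem_iInter.2 fun j => by
    rw [Set.mem_preimage, ← hRmul]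
    exact Set.mem_iInter.1 hz (j * k)
  have hdomD : dom ⊆ D' := fun z hz => by
    have := Set.mem_iInter.1 hz 1
    rwa [Set.mem_preimage, hR1] at this
  have hdomW : dom ⊆ W := fun z hz => (hD'D (hdomD hz)).2
  have hτdom := hτ.mono hdomo hdomW
  have hτR : ∀ k, ∀ z ∈ dom, τ (R k z) = (k : Circle) • τ z := fun k z hz =>
    hRτ k z (hdomW hz) (hdomW (hdomR k z hz))
  let act : MulAction.stabilizer Circle x →* Equiv.Perm ℂ² :=
    MonoidHom.toHomPerm
      { toFun := fun k => (fun z => R k z : ℂ² → ℂ²)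
        map_one' := funext hR1
        map_mul' := fun j k => funext (hRmul j k) }
  have hact : ∀ k z, act k z = R k z := fun k z => rfl
  refine ⟨{ dom := dom
            isOpen_dom := hdomo
            Γ := act.range
            finite := Set.finite_range act
            maps_dom := ?_
            smooth_act := ?_
            effective := ?_
            map := fun z => orbitClass Φ hx (τ z)
            continuousOn_map := continuousOn_orbitClass hx hτdom.smooth.continuousOn hτdom.level
            isOpen_image := fun V hV hVo => hτdom.isOpen_image hx hΩ hinv hΦ hV hVo
            map_eq_iff := ?_
            form := pullbackForm Ω τ
            smooth_form := contDiffOn_pullbackForm hΩ hdomo hτdom.smooth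
            closed_form := fun z hz => extDeriv_pullbackForm hΩ (hdomo.mem_nhds hz) hτdom.smooth
            nondegenerate_form := hτdom.nondegenerate
            invariant_form := ?_ }, ?_, 0, h0dom, ?_⟩
  · rintro _ ⟨k, rfl⟩ z hz
    exact hdomR k z hz
  · rintro _ ⟨k, rfl⟩
    exact (R k).contDiff.contDiffOn
  · rintro _ ⟨k, rfl⟩ z hz hev
    have h1 : (R k : ℂ² → ℂ²) =ᶠ[𝓝 z] id := hev
    have h2 := h1.fderiv_eq (𝕜 := ℝ)
    rw [fderiv_id, (R k).fderiv] at h2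
    exact Equiv.ext fun y => congrArg (fun L : ℂ² →L[ℝ] ℂ² => L y) h2
  · intro z hz w hw
    rw [orbitClass_eq_iff hx (hτdom.level z hz) (hτdom.level w hw)]
    constructor
    · rintro ⟨g, hg⟩
      obtain ⟨k, hk⟩ := hDD (Set.mk_mem_prod (hD'D (hdomD hz)).1 (hD'D (hdomD hw)).1) g trivial hg
      exact ⟨act k, ⟨k, rfl⟩, hk⟩
    · rintro ⟨_, ⟨k, rfl⟩, hk⟩
      exact ⟨k, by rw [← hτR k z hz, ← hk]; rfl⟩
  · rintro _ ⟨k, rfl⟩ z hz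
    have hs := fun z hz => (hτdom.smooth.contMDiffAt (hdomo.mem_nhds hz)).mdifferentiableAt
      (x := z) (by simp)
    have h1 := pullbackForm_comp (Ω := Ω) (h := R k) (hs _ (hdomR k z hz)) (R k).differentiableAt
    have h2 : (fun y => τ (R k y)) =ᶠ[𝓝 z] fun y => (k : Circle) • τ y := by
      filter_upwards [hdomo.mem_nhds hz] with y hy using hτR k y hy
    rw [pullbackForm_congr h2, pullbackForm_smul hinv _ (hs _ hz)] at h1
    exact h1.symm
  · intro z hz
    exact ⟨dom, τ, hz, subset_rfl, hτdom, fun y hy =>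
      ⟨⟨hτdom.level y hy, orbitClass_eq hx _⟩, rfl⟩⟩
  · change orbitClass Φ hx (τ 0) = _
    rw [hτ0, orbitClass_eq hx hx]

end Slice

/-! ### The linear model -/

theorem stdForm2_apply (u v : ℂ²) : stdForm2 ![u, v] = Real.pi⁻¹ *
    ((u.1.re * v.1.im - u.1.im * v.1.re) + (u.2.re * v.2.im - u.2.im * v.2.re)) := by
  have h : stdForm2 ![u, v] = Real.pi⁻¹ *
    ((areaForm.compContinuousLinearMap (ContinuousLinearMap.fst ℝ ℂ ℂ)) ![u, v] +
    (areaForm.compContinuousLinearMap (ContinuousLinearMap.snd ℝ ℂ ℂ)) ![u, v]) := rfl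
  rw [h, compContinuousLinearMap_pair, compContinuousLinearMap_pair, areaForm_apply, areaForm_apply]
  rfl

theorem stdForm3_apply (u v : ℂ³) : stdForm3 ![u, v] = Real.pi⁻¹ *
    ((u.1.re * v.1.im - u.1.im * v.1.re) + (u.2.1.re * v.2.1.im - u.2.1.im * v.2.1.re) +
      (u.2.2.re * v.2.2.im - u.2.2.im * v.2.2.re)) := by
  have h : stdForm3 ![u, v] = Real.pi⁻¹ *
    ((areaForm.compContinuousLinearMap (ContinuousLinearMap.fst ℝ ℂ ℂ²)) ![u, v]) +
    (stdForm2.compContinuousLinearMap (ContinuousLinearMap.snd ℝ ℂ ℂ²)) ![u, v] := rfl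
  rw [h, compContinuousLinearMap_pair, compContinuousLinearMap_pair, areaForm_apply, stdForm2_apply]
  simp only [ContinuousLinearMap.coe_fst', ContinuousLinearMap.coe_snd']
  ring

/-- The linear action as a continuous linear equivalence. -/
def weightEquiv (a b c : ℤ) (g : Circle) : ℂ³ ≃L[ℝ] ℂ³ :=
  (_root_.rotation (g ^ a)).toContinuousLinearEquiv.prodCongr
    ((_root_.rotation (g ^ b)).toContinuousLinearEquiv.prodCongr
      (_root_.rotation (g ^ c)).toContinuousLinearEquiv)

theorem weightEquiv_apply (a b c : ℤ) (g : Circle) (z : ℂ³) :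
    weightEquiv a b c g z = weightAct a b c g z := rfl

theorem weightAct_mul (a b c : ℤ) (g k : Circle) (z : ℂ³) :
    weightAct a b c (g * k) z = weightAct a b c g (weightAct a b c k z) := by
  simp only [weightAct, mul_zpow, Circle.coe_mul, mul_assoc]

theorem norm_weightAct (a b c : ℤ) (g : Circle) (z : ℂ³) : ‖weightAct a b c g z‖ = ‖z‖ := by
  simp only [weightAct, Prod.norm_def, norm_mul, Circle.norm_coe, one_mul]

theorem coe_rotation_zpow (n : ℤ) (t : ℝ) :
    ((rotation t ^ n : Circle) : ℂ) = Complex.exp ((2 * Real.pi * n * t : ℝ) * Complex.I) := by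
  rw [Circle.coe_zpow, rotation, Circle.coe_exp, ← Complex.exp_int_mul]
  congr 1
  push_cast
  ring

theorem contDiff_rotation_zpow (n : ℤ) :
    ContDiff ℝ ∞ fun t : ℝ => ((rotation t ^ n : Circle) : ℂ) := by
  simp only [coe_rotation_zpow]
  exact ((Complex.ofRealCLM.contDiff.comp (contDiff_const.mul contDiff_id)).mul
    contDiff_const).cexp

theorem hasDerivAt_rotation_zpow (n : ℤ) :
    HasDerivAt (fun t : ℝ => ((rotation t ^ n : Circle) : ℂ)) (2 * Real.pi * n * Complex.I) 0 := by
  simp only [coe_rotation_zpow]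
  have h1 : HasDerivAt (fun t : ℝ => ((2 * Real.pi * n * t : ℝ) : ℂ) * Complex.I)
      (2 * Real.pi * n * Complex.I) 0 := by
    have := (((hasDerivAt_id (0 : ℝ)).const_mul (2 * Real.pi * n)).ofReal_comp).mul_const Complex.I
    simpa using this
  simpa using h1.cexp

/-- The velocity field of the linear action. -/
def weightField (a b c : ℤ) (z : ℂ³) : ℂ³ :=
  (2 * Real.pi * a * Complex.I * z.1, 2 * Real.pi * b * Complex.I * z.2.1,
    2 * Real.pi * c * Complex.I * z.2.2)

theorem contDiff_weightAct_rotation (a b c : ℤ) :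
    ContDiff ℝ ∞ fun p : ℝ × ℂ³ => weightAct a b c (rotation p.1) p.2 := by
  have h := fun n : ℤ => (contDiff_rotation_zpow n).comp
    (contDiff_fst : ContDiff ℝ ∞ (Prod.fst : ℝ × ℂ³ → ℝ))
  exact ((h a).mul (contDiff_fst.comp contDiff_snd)).prodMk
    (((h b).mul (contDiff_fst.comp (contDiff_snd.comp contDiff_snd))).prodMk
      ((h c).mul (contDiff_snd.comp (contDiff_snd.comp contDiff_snd))))

theorem hasDerivAt_weightAct (a b c : ℤ) (z : ℂ³) :
    HasDerivAt (fun t : ℝ => weightAct a b c (rotation t) z) (weightField a b c z) 0 :=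
  ((hasDerivAt_rotation_zpow a).mul_const z.1).prodMk
    (((hasDerivAt_rotation_zpow b).mul_const z.2.1).prodMk
      ((hasDerivAt_rotation_zpow c).mul_const z.2.2))

theorem hasFDerivAt_stdMoment (a b c : ℤ) (z : ℂ³) : DifferentiableAt ℝ (stdMoment a b c) z ∧
    ∀ u, fderiv ℝ (stdMoment a b c) z u = stdForm3 ![u, weightField a b c z] := by
  have h1 : HasFDerivAt (fun z : ℂ³ => z.1) (ContinuousLinearMap.fst ℝ ℂ ℂ²) z :=
    hasFDerivAt_fst
  have h2 : HasFDerivAt (fun z : ℂ³ => z.2.1) ((ContinuousLinearMap.fst ℝ ℂ ℂ).comp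
      (ContinuousLinearMap.snd ℝ ℂ ℂ²)) z := ((ContinuousLinearMap.fst ℝ ℂ ℂ).comp
      (ContinuousLinearMap.snd ℝ ℂ ℂ²)).hasFDerivAt
  have h3 : HasFDerivAt (fun z : ℂ³ => z.2.2) ((ContinuousLinearMap.snd ℝ ℂ ℂ).comp
      (ContinuousLinearMap.snd ℝ ℂ ℂ²)) z := ((ContinuousLinearMap.snd ℝ ℂ ℂ).comp
      (ContinuousLinearMap.snd ℝ ℂ ℂ²)).hasFDerivAt
  have h := ((h1.norm_sq.const_mul (a : ℝ)).fun_add (h2.norm_sq.const_mul (b : ℝ))).fun_add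
    (h3.norm_sq.const_mul (c : ℝ))
  refine ⟨h.differentiableAt, fun u => ?_⟩
  have e : fderiv ℝ (stdMoment a b c) z = _ := h.fderiv
  rw [e, stdForm3_apply]
  simp [weightField, Complex.inner]
  field_simp

section Darboux

variable {X : Type*} [TopologicalSpace X] [ChartedSpace E₆ X]
  [IsManifold (𝓡 6) ∞ X]
  [MulAction Circle X] [ContMDiffSMul (𝓡 1) (𝓡 6) ∞ Circle X]
  {Ω : (x : X) → TangentSpace (𝓡 6) x [⋀^Fin 2]→L[ℝ] ℝ} {T : ℝ} {Φ : X → AddCircle T}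

/-! ### The equivariant Darboux theorem -/

theorem mfderiv_weightField {a b c : ℤ} {Ψ : ℂ³ → X} {r : ℝ}
    (hΨ : ContMDiffOn 𝓘(ℝ, ℂ³) (𝓡 6) ∞ Ψ (Metric.ball 0 r))
    (heq : ∀ z ∈ Metric.ball (0 : ℂ³) r, ∀ g : Circle, Ψ (weightAct a b c g z) = g • Ψ z)
    {z : ℂ³} (hz : z ∈ Metric.ball (0 : ℂ³) r) :
    (mfderiv 𝓘(ℝ, ℂ³) (𝓡 6) Ψ z (weightField a b c z) : E₆) =
      generator (Ψ z) := by
  have h0 : weightAct a b c (rotation 0) z = z := by simp [weightAct, rotation_zero]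
  have hd : MDifferentiableAt 𝓘(ℝ, ℂ³) (𝓡 6) Ψ (weightAct a b c (rotation 0) z) := by
    rw [h0]; exact (hΨ.contMDiffAt (Metric.isOpen_ball.mem_nhds hz)).mdifferentiableAt (by simp)
  have h1 := mfderiv_comp_normedSpace (h := fun t : ℝ => weightAct a b c (rotation t) z) hd
    (hasDerivAt_weightAct a b c z).differentiableAt 1
  have h2 : (fun t : ℝ => Ψ (weightAct a b c (rotation t) z)) = fun t : ℝ => rotation t • Ψ z :=
    funext fun t => heq z hz _
  have h3 : fderiv ℝ (fun t : ℝ => weightAct a b c (rotation t) z) 0 1 = weightField a b c z := by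
    rw [fderiv_apply_one_eq_deriv, (hasDerivAt_weightAct a b c z).deriv]
  have h4 : (mfderiv 𝓘(ℝ, ℝ) (𝓡 6) (fun t : ℝ => Ψ (weightAct a b c (rotation t) z)) 0 (1 : ℝ) :
      E₆) = generator (Ψ z) :=
    ((congrArg (fun f : ℝ → X => (mfderiv 𝓘(ℝ, ℝ) (𝓡 6) f 0 (1 : ℝ) : E₆))
      h2).trans (mfderiv_orbit (Ψ z) 0)).trans
      (congrArg (fun y : X => (generator y : E₆))
        (by rw [rotation_zero, one_smul]))
  have key : ∀ (y v : ℂ³), y = z → v = weightField a b c z →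
      (mfderiv 𝓘(ℝ, ℂ³) (𝓡 6) Ψ y v : E₆) =
        mfderiv 𝓘(ℝ, ℂ³) (𝓡 6) Ψ z (weightField a b c z) := by
    rintro y v rfl rfl; rfl
  exact (key _ _ h0 h3).symm.trans (h1.symm.trans h4)

theorem IsEquivariantDarbouxChart.moment_eq (hΦ : IsMomentMap Ω Φ) {x : X} {a b c : ℤ} {r : ℝ}
    (hr : 0 < r) {Ψ : ℂ³ → X} (h : IsEquivariantDarbouxChart Ω x a b c r Ψ)
    {z : ℂ³} (hz : z ∈ Metric.ball (0 : ℂ³) r) :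
    Φ (Ψ z) = Φ x + (stdMoment a b c z : AddCircle T) := by
  have h1 := moment_sub_eq_of_fderiv_eq hΦ (σ := Ψ) (h := stdMoment a b c) Metric.isOpen_ball
    (convex_ball (0 : ℂ³) r).isPreconnected h.smooth
    (fun y _ => (hasFDerivAt_stdMoment a b c y).1.differentiableWithinAt) (fun y hy (u : ℂ³) => by
      refine Eq.trans ?_ ((hasFDerivAt_stdMoment a b c y).2 u).symm
      rw [← h.symplectic y hy]
      refine Eq.trans ?_ (pullbackForm_apply (Ω := Ω) Ψ y u _).symm
      exact congrArg (fun e : E₆ => (Ω (Ψ y) :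
        E₆ [⋀^Fin 2]→L[ℝ] ℝ)
        ![(mfderiv 𝓘(ℝ, ℂ³) (𝓡 6) Ψ y u : E₆), e])
        (mfderiv_weightField h.smooth h.equivariant hy).symm) hz (Metric.mem_ball_self hr)
  have h2 : stdMoment a b c 0 = 0 := by simp [stdMoment]
  rw [h.map_zero, h2, AddCircle.coe_zero, sub_zero, sub_eq_iff_eq_add] at h1
  exact h1

theorem exists_equivariant_darboux (hΩ : IsSymplecticForm Ω) (hinv : IsInvariantForm Ω) {x : X}
    {a b c : ℤ} (hx : HasIsotropyWeights Ω x a b c) :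
    ∃ (r : ℝ) (Ψ : ℂ³ → X), 0 < r ∧ IsEquivariantDarbouxChart Ω x a b c r Ψ := by
  obtain ⟨hfix, A, hA, hAeq⟩ := hx
  set L : E₆ →L[ℝ] ℂ³ := A.symm.toContinuousLinearMap with hL
  have hLA : ∀ u, L (A u) = u := fun u => A.symm_apply_apply u
  have hAL : ∀ u : E₆, (A (L u) : E₆) = u := fun u =>
    A.apply_symm_apply u
  obtain ⟨θ, U, hU, hxU, hθs, hθ0, hθd, hθeq⟩ := exists_average_circle hfix (weightEquiv a b c)
    (fun g k u => weightAct_mul a b c g k u) (contDiff_weightAct_rotation a b c) L (fun g u => by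
      have h1 := hAeq g (L u)
      rw [weightEquiv_apply, ← hLA (weightAct a b c g (L u))]
      refine congrArg L ?_
      rw [isotropyDeriv_eq (hfix g)]
      refine Eq.trans ?_ h1
      exact congrArg (fun e : E₆ =>
        (mfderiv (𝓡 6) (𝓡 6) (fun y : X => g • y) x e : E₆)) (hAL u).symm)
  obtain ⟨δ, Ψ, hδ, hΨ0, hΨs, hθΨ, hΨeq, hΨd⟩ := exists_equivariant_inverse
    (E := ℂ³) (by simp) (isCompact_univ (X := Circle)) (fun k _ => hfix k) hU hxU hθs hθ0
    (fun u hu => by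
      rw [hθd] at hu
      rw [← hAL u, hu]
      exact map_zero A) (ρ := fun g => weightEquiv a b c g)
    (Filter.Eventually.of_forall fun y k _ => hθeq y k)
  have hΨd' : ∀ u, fderiv ℝ (fun v => extChartAt (𝓡 6) x (Ψ v)) 0 u =
      (A u : E₆) := fun u => by
    have := hΨd u
    rw [hθd] at this
    rw [← hAL (fderiv ℝ (fun v => extChartAt (𝓡 6) x (Ψ v)) 0 u), this]
  have hball : ∀ g, ∀ v ∈ Metric.ball (0 : ℂ³) δ, weightAct a b c g v ∈ Metric.ball 0 δ := by
    intro g v hv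
    rw [mem_ball_zero_iff] at hv ⊢
    rwa [norm_weightAct]
  have hΨeq' : ∀ v ∈ Metric.ball (0 : ℂ³) δ, ∀ g : Circle,
      Ψ (weightAct a b c g v) = g • Ψ v := fun v hv g => hΨeq v hv g trivial (hball g v hv)
  have hdiff : ∀ v ∈ Metric.ball (0 : ℂ³) δ, MDifferentiableAt 𝓘(ℝ, ℂ³) (𝓡 6) Ψ v :=
    fun v hv => (hΨs.contMDiffAt (Metric.isOpen_ball.mem_nhds hv)).mdifferentiableAt (by simp)
  have hη0 : pullbackForm Ω Ψ 0 = stdForm3 := by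
    refine form_ext fun u v => ?_
    rw [pullbackForm_eq_chart hΨ0 (hdiff 0 (Metric.mem_ball_self hδ)), hΨd', hΨd']
    exact hA u v
  obtain ⟨r, ρ, hr, hρs, hρm, hρ0, hρinj, hρform, hρeq⟩ := exists_moser_diffeo hδ
    (contDiffOn_pullbackForm hΩ Metric.isOpen_ball hΨs)
    (fun v hv => extDeriv_pullbackForm hΩ (Metric.isOpen_ball.mem_nhds hv) hΨs)
    (fun u hu => by
      rw [hη0] at hu
      have h1 := hu (Complex.I, 0, 0)
      have h2 := hu (1, 0, 0)
      have h3 := hu (0, Complex.I, 0)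
      have h4 := hu (0, 1, 0)
      have h5 := hu (0, 0, Complex.I)
      have h6 := hu (0, 0, 1)
      rw [stdForm3_apply] at h1 h2 h3 h4 h5 h6
      simp [Real.pi_ne_zero] at h1 h2 h3 h4 h5 h6
      exact Prod.ext (Complex.ext h1 h2) (Prod.ext (Complex.ext h3 h4) (Complex.ext h5 h6)))
    (Set.range fun g => (weightEquiv a b c g).toContinuousLinearMap)
    (by rintro _ ⟨g, rfl⟩ v; exact norm_weightAct a b c g v)
    (by
      rintro _ ⟨g, rfl⟩ v hv
      have h1 := pullbackForm_comp (Ω := Ω) (h := fun v => weightEquiv a b c g v)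
        (hdiff _ (hball g v hv)) (weightEquiv a b c g).differentiableAt
      have h2 : (fun v => Ψ (weightEquiv a b c g v)) =ᶠ[𝓝 v] fun v => g • Ψ v := by
        filter_upwards [Metric.isOpen_ball.mem_nhds hv] with w hw using hΨeq' w hw g
      rw [pullbackForm_congr h2, pullbackForm_smul hinv _ (hdiff v hv)] at h1
      rw [h1]
      congr 1
      exact ((weightEquiv a b c g).fderiv (x := v)).symm)
  refine ⟨r, fun z => Ψ (ρ z), hr, ⟨?_, ?_, ?_, ?_, ?_⟩⟩
  · rw [hρ0, hΨ0]
  · exact hΨs.comp hρs.contMDiffOn hρm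
  · intro y hy z hz hyz
    refine hρinj hy hz ?_
    rw [← hθΨ _ (hρm hy), ← hθΨ _ (hρm hz)]
    exact congrArg θ hyz
  · intro z hz g
    have := hρeq _ ⟨g, rfl⟩ z hz
    rw [← hΨeq' _ (hρm hz)]
    exact congrArg Ψ this
  · intro z hz
    have h1 := pullbackForm_comp (Ω := Ω) (h := ρ) (hdiff _ (hρm hz))
      ((hρs.contDiffAt (Metric.isOpen_ball.mem_nhds hz)).differentiableAt (by simp))
    rw [hρform z hz, hη0] at h1
    exact h1

end Darboux

section ReducedOrbifold

variable {X : Type*} [TopologicalSpace X] [ChartedSpace E₆ X]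
  [IsManifold (𝓡 6) ∞ X]
  [MulAction Circle X] [ContMDiffSMul (𝓡 1) (𝓡 6) ∞ Circle X]
  {Ω : (x : X) → TangentSpace (𝓡 6) x [⋀^Fin 2]→L[ℝ] ℝ} {T : ℝ} {Φ : X → AddCircle T}
  {l : AddCircle T}

/-! ### The topology of the reduced space -/

theorem isClosed_singleton_addCircle (l : AddCircle T) : IsClosed ({l} : Set (AddCircle T)) := by
  obtain ⟨δ, hδ, hT⟩ := exists_pos_of_coe_eq T
  have hq : Topology.IsQuotientMap (fun a : ℝ => (a : AddCircle T)) :=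
    isQuotientMap_quotient_mk' (s := QuotientAddGroup.leftRel (AddSubgroup.zmultiples T))
  rw [← hq.isClosed_preimage]
  refine Metric.isClosed_of_pairwise_le_dist hδ fun a ha b hb hab => ?_
  by_contra! h
  exact hab (hT a b h ((Set.mem_singleton_iff.1 ha).trans (Set.mem_singleton_iff.1 hb).symm))

theorem continuous_momentMap (hΦ : IsMomentMap Ω Φ) : Continuous Φ := by
  refine continuous_iff_continuousAt.2 fun x => ?_
  obtain ⟨U, hU, hxU, f, hf, hfU⟩ := hΦ x
  have h1 : ContinuousAt (fun y => (f y : AddCircle T)) x :=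
    (AddCircle.continuous_mk' T).continuousAt.comp (hf.contMDiffAt (hU.mem_nhds hxU)).continuousAt
  refine h1.congr ?_
  filter_upwards [hU.mem_nhds hxU] with y hy using (hfU y hy).1.symm

theorem isClosed_level (hΦ : IsMomentMap Ω Φ) (l : AddCircle T) : IsClosed {x | Φ x = l} :=
  (isClosed_singleton_addCircle l).preimage (continuous_momentMap hΦ)

theorem compactSpace_reducedSpace [CompactSpace X] (hΦ : IsMomentMap Ω Φ) :
    CompactSpace (ReducedSpace Φ l) := by
  have : CompactSpace {x : X // Φ x = l} :=
    isCompact_iff_compactSpace.1 (isClosed_level hΦ l).isCompact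
  exact Quotient.compactSpace (s := levelSetoid Φ l)

theorem t2Space_reducedSpace [T2Space X] (hΦ : IsMomentMap Ω Φ) : T2Space (ReducedSpace Φ l) := by
  have hcs : ContinuousSMul Circle X := ContMDiffSMul.continuousSMul (I := 𝓡 1) (I' := 𝓡 6) ∞
  have hq : IsOpenQuotientMap fun y : {x : X // Φ x = l} => ReducedSpace.mk Φ l y.1 y.2 := by
    refine ⟨fun m => ?_, continuous_mk, fun V hV => ?_⟩
    · obtain ⟨y, hy, rfl⟩ := exists_mk_eq m
      exact ⟨⟨y, hy⟩, rfl⟩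
    · rw [isOpen_reducedSpace_iff]
      have hact : ∀ g : Circle, Continuous fun y : {x : X // Φ x = l} =>
          (⟨g • y.1, by rw [moment_smul hΦ, y.2]⟩ : {x : X // Φ x = l}) := fun g =>
        ((continuous_const_smul g).comp continuous_subtype_val).subtype_mk _
      have h1 : {y : {x : X // Φ x = l} | ReducedSpace.mk Φ l y.1 y.2 ∈
          (fun y : {x : X // Φ x = l} => ReducedSpace.mk Φ l y.1 y.2) '' V} =
          ⋃ g : Circle, (fun y : {x : X // Φ x = l} =>
            (⟨g • y.1, by rw [moment_smul hΦ, y.2]⟩ : {x : X // Φ x = l})) ⁻¹' V := by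
        ext y
        simp only [Set.mem_ofPred_eq, Set.mem_iUnion, Set.mem_preimage, Set.mem_image]
        constructor
        · rintro ⟨z, hz, hzy⟩
          obtain ⟨g, hg⟩ := (mk_eq_mk_iff y.2 z.2).1 hzy.symm
          refine ⟨g, ?_⟩
          have : (⟨g • y.1, by rw [moment_smul hΦ, y.2]⟩ : {x : X // Φ x = l}) = z := Subtype.ext hg
          rwa [this]
        · rintro ⟨g, hg⟩
          exact ⟨_, hg, ((mk_eq_mk_iff y.2 _).2 ⟨g, rfl⟩).symm⟩
      rw [h1]
      exact isOpen_iUnion fun g => hV.preimage (hact g)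
  rw [t2Space_iff_of_isOpenQuotientMap hq]
  have hc : IsClosed {p : Circle × ({x : X // Φ x = l} × {x : X // Φ x = l}) |
      p.1 • p.2.1.1 = p.2.2.1} := isClosed_eq (by fun_prop) (by fun_prop)
  have h2 := isClosedMap_snd_of_compactSpace _ hc
  convert h2 using 1
  ext ⟨y, z⟩
  simp only [Set.mem_image, Set.mem_ofPred_eq, Prod.exists, exists_eq_right]
  exact mk_eq_mk_iff y.2 z.2

/-! ### Compatibility of sections -/

theorem HasSection.exists_lift (hΩ : IsSymplecticForm Ω) (hinv : IsInvariantForm Ω)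
    (hΦ : IsMomentMap Ω Φ) {U : Set ℂ²} {f : ℂ² → ReducedSpace Φ l}
    {α : ℂ² → ℂ² [⋀^Fin 2]→L[ℝ] ℝ} {z w : ℂ²} (hf : HasSection Ω Φ l U f α z)
    {d : UniformizingChart (ReducedSpace Φ l)} (hd : HasSection Ω Φ l d.dom d.map d.form w)
    (hzw : d.map w = f z) :
    ∃ h, IsLocalLift h U f d z w ∧ PreservesForm h α d.form := by
  obtain ⟨V, σ, hzV, hVU, hσ, hσf⟩ := hf
  obtain ⟨W, τ, hwW, hWd, hτ, hτf⟩ := hd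
  obtain ⟨⟨hz, hfz⟩, -⟩ := hσf z hzV
  obtain ⟨⟨hw, hdw⟩, -⟩ := hτf w hwW
  rw [hfz, hdw] at hzw
  obtain ⟨g, hg⟩ := (mk_eq_mk_iff hw hz).1 hzw
  obtain ⟨h, hzh, hhz, hsV, htW, hs, hs', hlift, hform⟩ := exists_lift_between_sections hΩ hinv hΦ
    hσ.isOpen hzV hσ.smooth hσ.level (hσ.nondegenerate z hzV) hτ.isOpen hwW hτ.smooth hτ.level
    (hτ.nondegenerate w hwW) (hτ.not_fixed w hwW) hg
  refine ⟨h, ⟨hzh, hhz, hsV.trans hVU, htW.trans hWd, hs, hs', fun y hy => ?_⟩, fun y hy => ?_⟩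
  · obtain ⟨hy1, hy1'⟩ := (hσf y (hsV hy)).1
    obtain ⟨hy2, hy2'⟩ := (hτf _ (htW (h.map_source hy))).1
    rw [hy1', hy2', mk_eq_mk_iff]
    exact hlift y hy
  · rw [← (hτf _ (htW (h.map_source hy))).2, hform y hy, (hσf y (hsV hy)).2]

/-- The orbifold structure on the reduced space whose charts come from symplectic sections,
together with some additional charts. -/
theorem exists_reducedOrbifold [T2Space X] [CompactSpace X] (hΩ : IsSymplecticForm Ω)
    (hinv : IsInvariantForm Ω) (hΦ : IsMomentMap Ω Φ)
    (E : Set (UniformizingChart (ReducedSpace Φ l)))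
    (hE : ∀ c ∈ E, ∀ z ∈ c.dom, HasSection Ω Φ l c.dom c.map c.form z ∨
      ∃ (x : X) (hx : Φ x = l), (generator x : E₆) = 0 ∧
        c.map z = ReducedSpace.mk Φ l x hx)
    (hEE : ∀ c ∈ E, ∀ d ∈ E, ∀ z ∈ c.dom, ∀ w ∈ d.dom, d.map w = c.map z →
      ∃ h, IsLocalLift h c.dom c.map d z w ∧ PreservesForm h c.form d.form)
    (hcover : ∀ (x : X) (hx : Φ x = l), (generator x : E₆) = 0 →
      ∃ c ∈ E, ∃ z ∈ c.dom, c.map z = ReducedSpace.mk Φ l x hx) :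
    ∃ O : SymplecticOrbifold (ReducedSpace Φ l), O.charts = {c | IsReductionChart Ω Φ l c} ∪ E := by
  have hsec : ∀ c ∈ E, ∀ d, IsReductionChart Ω Φ l d → ∀ z ∈ c.dom, ∀ w ∈ d.dom,
      c.map z = d.map w → HasSection Ω Φ l c.dom c.map c.form z := by
    intro c hc d hd z hz w hw hzw
    refine (hE c hc z hz).resolve_right ?_
    rintro ⟨x, hx, hgen, hcx⟩
    obtain ⟨W, σ, hwW, -, hσ, hσf⟩ := hd w hw
    obtain ⟨⟨hy, hy'⟩, -⟩ := hσf w hwW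
    rw [hcx, hy', mk_eq_mk_iff] at hzw
    obtain ⟨g, hg⟩ := hzw
    refine hσ.not_fixed w hwW (generator_eq_zero_of_smul_eq fun k => ?_)
    rw [← hg, smul_eq_of_generator_eq_zero hgen, smul_eq_of_generator_eq_zero hgen]
  refine ⟨⟨compactSpace_reducedSpace hΦ, t2Space_reducedSpace hΦ,
    {c | IsReductionChart Ω Φ l c} ∪ E, ?_, ?_⟩, rfl⟩
  · intro m
    obtain ⟨x, hx, rfl⟩ := exists_mk_eq m
    by_cases hgen : (generator x : E₆) = 0
    · obtain ⟨c, hc, h⟩ := hcover x hx hgen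
      exact ⟨c, Or.inr hc, h⟩
    · obtain ⟨c, hc, h⟩ := exists_reduction_chart hΩ hinv hΦ hx hgen
      exact ⟨c, Or.inl hc, h⟩
  · rintro c hc d hd z hz w hw hzw
    rcases hc with hc | hc <;> rcases hd with hd | hd
    · exact (hc z hz).exists_lift hΩ hinv hΦ (hd w hw) hzw
    · exact (hc z hz).exists_lift hΩ hinv hΦ (hsec d hd c hc w hw z hz hzw) hzw
    · exact (hsec c hc d hd z hz w hw hzw.symm).exists_lift hΩ hinv hΦ (hd w hw) hzw
    · exact hEE c hc d hd z hz w hw hzw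

theorem HasSection.isReductionOn_aux {U : Set ℂ²} {f : ℂ² → ReducedSpace Φ l}
    {α : ℂ² → ℂ² [⋀^Fin 2]→L[ℝ] ℝ} {z : ℂ²} (hf : HasSection Ω Φ l U f α z) :
    ∃ (W : Set ℂ²) (σ : ℂ² → X), IsOpen W ∧ z ∈ W ∧ W ⊆ U ∧
      ContMDiffOn 𝓘(ℝ, ℂ²) (𝓡 6) ∞ σ W ∧
      ∀ y ∈ W, (∃ hy : Φ (σ y) = l, f y = ReducedSpace.mk Φ l (σ y) hy) ∧
        (Ω (σ y)).compContinuousLinearMap (mfderiv 𝓘(ℝ, ℂ²) (𝓡 6) σ y) = α y := by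
  obtain ⟨W, σ, hz, hW, hσ, h⟩ := hf
  exact ⟨W, σ, hσ.isOpen, hz, hW, hσ.smooth, h⟩

end ReducedOrbifold

/-! ### Phases -/

theorem norm_phase (u : ℂ) : ‖phase u‖ = 1 := by
  unfold phase
  split_ifs with h
  · simp
  · rw [norm_div, Complex.norm_real, norm_norm, div_self (norm_ne_zero_iff.2 h)]

/-- The phase as an element of the circle. -/
def circlePhase (u : ℂ) : Circle := ⟨phase u, mem_sphere_zero_iff_norm.2 (norm_phase u)⟩

theorem coe_circlePhase (u : ℂ) : (circlePhase u : ℂ) = phase u := rfl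

theorem phase_mul_norm (u : ℂ) : phase u * (‖u‖ : ℂ) = u := by
  unfold phase
  split_ifs with h
  · simp [h]
  · exact div_mul_cancel₀ _ (by simpa using h)

theorem circlePhase_inv_mul (u : ℂ) : ((circlePhase u ^ (-1 : ℤ) : Circle) : ℂ) * u = (‖u‖ : ℂ) := by
  have h : phase u ≠ 0 := norm_ne_zero_iff.1 (by rw [norm_phase]; exact one_ne_zero)
  rw [zpow_neg_one, Circle.coe_inv, coe_circlePhase, inv_mul_eq_iff_eq_mul₀ h, phase_mul_norm]

theorem continuousAt_phase {u : ℂ} (hu : u ≠ 0) : ContinuousAt phase u := by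
  have h : (fun u : ℂ => u / (‖u‖ : ℂ)) =ᶠ[𝓝 u] phase := by
    filter_upwards [isOpen_ne.mem_nhds hu] with v hv
    rw [phase, if_neg hv]
  refine ContinuousAt.congr ?_ h
  exact continuousAt_id.div (Complex.continuous_ofReal.comp continuous_norm).continuousAt
    (by simpa using hu)

/-- The first two coordinates after rotating the third one to a nonnegative real number. -/
def rotateCoord (p q : ℕ) (v : ℂ³) : ℂ² :=
  (phase v.2.2 ^ p * v.1, phase v.2.2 ^ q * v.2.1)

theorem norm_rotateCoord_fst (p q : ℕ) (v : ℂ³) : ‖(rotateCoord p q v).1‖ = ‖v.1‖ := by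
  simp [rotateCoord, norm_phase]

theorem norm_rotateCoord_snd (p q : ℕ) (v : ℂ³) : ‖(rotateCoord p q v).2‖ = ‖v.2.1‖ := by
  simp [rotateCoord, norm_phase]

theorem stdMoment_eq (p q : ℕ) (v : ℂ³) :
    stdMoment p q (-1) v = p * ‖v.1‖ ^ 2 + q * ‖v.2.1‖ ^ 2 - ‖v.2.2‖ ^ 2 := by
  simp only [stdMoment, Int.cast_natCast, Int.cast_neg, Int.cast_one]
  ring

theorem weightAct_circlePhase (p q : ℕ) (v : ℂ³) :
    weightAct p q (-1) (circlePhase v.2.2) v =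
      levelSection p q (stdMoment p q (-1) v) (rotateCoord p q v) := by
  have h : (p : ℝ) * ‖v.1‖ ^ 2 + q * ‖v.2.1‖ ^ 2 - stdMoment p q (-1) v = ‖v.2.2‖ ^ 2 := by
    rw [stdMoment_eq]; ring
  refine Prod.ext ?_ (Prod.ext ?_ ?_)
  · simp [weightAct, levelSection, rotateCoord, coe_circlePhase]
  · simp [weightAct, levelSection, rotateCoord, coe_circlePhase]
  · simp only [weightAct, levelSection, norm_rotateCoord_fst, norm_rotateCoord_snd, h,
      Real.sqrt_sq (norm_nonneg _), circlePhase_inv_mul]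

theorem norm_levelSection (p q : ℕ) (s : ℝ) (z : ℂ²)
    (h : s ≤ p * ‖z.1‖ ^ 2 + q * ‖z.2‖ ^ 2) :
    ‖(levelSection p q s z).2.2‖ ^ 2 = p * ‖z.1‖ ^ 2 + q * ‖z.2‖ ^ 2 - s := by
  rw [levelSection, Complex.norm_real, Real.norm_eq_abs, sq_abs, Real.sq_sqrt (by linarith)]

theorem stdMoment_levelSection (p q : ℕ) (s : ℝ) (z : ℂ²)
    (h : s ≤ p * ‖z.1‖ ^ 2 + q * ‖z.2‖ ^ 2) : stdMoment p q (-1) (levelSection p q s z) = s := by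
  rw [stdMoment_eq, norm_levelSection p q s z h]
  simp [levelSection]

theorem continuous_levelSection (p q : ℕ) (s : ℝ) : Continuous (levelSection p q s) := by
  unfold levelSection
  fun_prop

/-- Two points of the slice `levelSection` on one orbit. -/
theorem exists_weightAct_levelSection_iff {p q : ℕ} {s : ℝ} {z w : ℂ²}
    (hw : s ≤ p * ‖w.1‖ ^ 2 + q * ‖w.2‖ ^ 2) :
    (∃ g : Circle, weightAct p q (-1) g (levelSection p q s z) = levelSection p q s w) ↔
      z = w ∨ (p * ‖z.1‖ ^ 2 + q * ‖z.2‖ ^ 2 = s ∧ p * ‖w.1‖ ^ 2 + q * ‖w.2‖ ^ 2 = s ∧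
        ∃ g : Circle, (g : ℂ) ^ p * z.1 = w.1 ∧ (g : ℂ) ^ q * z.2 = w.2) := by
  constructor
  · rintro ⟨g, hg⟩
    simp only [weightAct, levelSection, Prod.mk.injEq, zpow_natCast, Circle.coe_pow] at hg
    obtain ⟨h1, h2, h3⟩ := hg
    have n1 : ‖z.1‖ = ‖w.1‖ := by rw [← h1, norm_mul, norm_pow, Circle.norm_coe, one_pow, one_mul]
    have n2 : ‖z.2‖ = ‖w.2‖ := by rw [← h2, norm_mul, norm_pow, Circle.norm_coe, one_pow, one_mul]
    rw [n1, n2] at h3 ⊢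
    rcases hw.eq_or_lt with h | h
    · exact Or.inr ⟨h.symm, h.symm, g, h1, h2⟩
    · left
      have h4 : (Real.sqrt (p * ‖w.1‖ ^ 2 + q * ‖w.2‖ ^ 2 - s) : ℂ) ≠ 0 := by
        rw [Ne, Complex.ofReal_eq_zero]
        exact (Real.sqrt_pos.2 (by linarith)).ne'
      have h5 : ((g ^ (-1 : ℤ) : Circle) : ℂ) = 1 := mul_right_cancel₀ h4 (by rw [h3, one_mul])
      have h6 : g = 1 := by
        rw [zpow_neg_one] at h5
        exact Circle.ext (by simpa using h5)
      subst h6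
      refine Prod.ext ?_ ?_
      · simpa using h1
      · simpa using h2
  · rintro (rfl | ⟨h1, h2, g, h3, h4⟩)
    · exact ⟨1, by simp [weightAct]⟩
    · refine ⟨g, ?_⟩
      simp only [weightAct, levelSection, zpow_natCast, Circle.coe_pow, h3, h4, h1, h2]
      simp

theorem mem_ball_prod {r : ℝ} {v : ℂ³} :
    v ∈ Metric.ball (0 : ℂ³) r ↔ ‖v.1‖ < r ∧ ‖v.2.1‖ < r ∧ ‖v.2.2‖ < r := by
  rw [mem_ball_zero_iff, Prod.norm_def, max_lt_iff, Prod.norm_def, max_lt_iff]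

/-- The domain of the chart of the reduced space at level zero. -/
def sliceDom (p q : ℕ) (r : ℝ) : Set ℂ² :=
  {z | levelSection p q 0 z ∈ Metric.ball (0 : ℂ³) r}

theorem mem_sliceDom {p q : ℕ} (hp : 0 < p) (hq : 0 < q) {r : ℝ} (hr : 0 < r) {z : ℂ²} :
    z ∈ sliceDom p q r ↔ p * ‖z.1‖ ^ 2 + q * ‖z.2‖ ^ 2 < r ^ 2 := by
  have hp' : (1 : ℝ) ≤ p := by exact_mod_cast hp
  have hq' : (1 : ℝ) ≤ q := by exact_mod_cast hq
  have h0 : (0 : ℝ) ≤ p * ‖z.1‖ ^ 2 + q * ‖z.2‖ ^ 2 := by positivity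
  have h3 := norm_levelSection p q 0 z h0
  rw [sub_zero] at h3
  have e : z ∈ sliceDom p q r ↔ ‖z.1‖ < r ∧ ‖z.2‖ < r ∧ ‖(levelSection p q 0 z).2.2‖ < r :=
    mem_ball_prod
  rw [e, ← h3]
  constructor
  · rintro ⟨-, -, h⟩
    exact pow_lt_pow_left₀ h (norm_nonneg _) two_ne_zero
  · intro h
    refine ⟨?_, ?_, lt_of_pow_lt_pow_left₀ 2 hr.le h⟩
    · refine lt_of_pow_lt_pow_left₀ 2 hr.le ?_
      nlinarith [sq_nonneg ‖z.1‖, sq_nonneg ‖z.2‖]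
    · refine lt_of_pow_lt_pow_left₀ 2 hr.le ?_
      nlinarith [sq_nonneg ‖z.1‖, sq_nonneg ‖z.2‖]

theorem levelSection_mem_ball {p q : ℕ} {r s : ℝ} (hs : 0 ≤ s) {z : ℂ²}
    (hz : z ∈ sliceDom p q r) : levelSection p q s z ∈ Metric.ball (0 : ℂ³) r := by
  rw [sliceDom, Set.mem_ofPred_eq, mem_ball_prod] at hz
  refine mem_ball_prod.2 ⟨hz.1, hz.2.1, lt_of_le_of_lt ?_ hz.2.2⟩
  simp only [levelSection, Complex.norm_real, Real.norm_eq_abs, abs_of_nonneg (Real.sqrt_nonneg _)]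
  exact Real.sqrt_le_sqrt (by linarith)

theorem isOpen_sliceDom (p q : ℕ) (r : ℝ) : IsOpen (sliceDom p q r) :=
  Metric.isOpen_ball.preimage (continuous_levelSection p q 0)

theorem rotateCoord_mem_sliceDom {p q : ℕ} {r : ℝ} {v : ℂ³}
    (hv : v ∈ Metric.ball (0 : ℂ³) r) (h : p * ‖v.1‖ ^ 2 + q * ‖v.2.1‖ ^ 2 < r ^ 2) (hr : 0 < r) :
    rotateCoord p q v ∈ sliceDom p q r := by
  rw [mem_ball_prod] at hv
  refine mem_ball_prod.2 ⟨?_, ?_, ?_⟩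
  · exact (norm_rotateCoord_fst p q v).trans_lt hv.1
  · exact (norm_rotateCoord_snd p q v).trans_lt hv.2.1
  · refine lt_of_pow_lt_pow_left₀ 2 hr.le ?_
    rw [norm_levelSection _ _ _ _ (by positivity), norm_rotateCoord_fst, norm_rotateCoord_snd]
    linarith

theorem continuousAt_rotateCoord (p q : ℕ) {v : ℂ³} (hv : v.2.2 ≠ 0) :
    ContinuousAt (rotateCoord p q) v := by
  have h : ContinuousAt (fun v : ℂ³ => phase v.2.2) v :=
    ContinuousAt.comp (f := fun v : ℂ³ => v.2.2) (continuousAt_phase hv) (by fun_prop)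
  unfold rotateCoord
  exact ((h.pow p).mul (by fun_prop)).prodMk ((h.pow q).mul (by fun_prop))

theorem continuousAt_rotateCoord_zero (p q : ℕ) : ContinuousAt (rotateCoord p q) 0 := by
  have h0 : rotateCoord p q 0 = 0 := by simp [rotateCoord]
  rw [ContinuousAt, h0]
  refine squeeze_zero_norm (a := fun v => ‖v‖) (fun v => ?_) (by
    simpa using (continuous_norm (E := ℂ³)).tendsto 0)
  rw [Prod.norm_def, norm_rotateCoord_fst, norm_rotateCoord_snd]
  exact max_le (norm_fst_le v) ((norm_fst_le v.2).trans (norm_snd_le v))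

/-! ### Exceptional charts -/

/-- A lift of `exceptionalMap₁` to the level set. -/
def exceptionalLift₁ (p q : ℕ) (s : ℝ) (y : ℂ²) : ℂ³ :=
  ((Real.sqrt ((s + ‖y.2‖ ^ 2 - q * ‖y.1‖ ^ 2) / p) : ℂ), y.1, y.2)

/-- A lift of `exceptionalMap₂` to the level set. -/
def exceptionalLift₂ (p q : ℕ) (s : ℝ) (y : ℂ²) : ℂ³ :=
  (y.1, (Real.sqrt ((s + ‖y.2‖ ^ 2 - p * ‖y.1‖ ^ 2) / q) : ℂ), y.2)

theorem exceptionalMap₁_eq {p q : ℕ} (hp : 0 < p) (hq : 0 < q) (s : ℝ) (y : ℂ²) :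
    exceptionalMap₁ p q (s / (p * q)) y = rotateCoord p q (exceptionalLift₁ p q s y) := by
  have h : (p : ℝ) * q * (s / (p * q)) = s := by field_simp
  simp only [exceptionalMap₁, rotateCoord, exceptionalLift₁, h]

theorem exceptionalMap₂_eq {p q : ℕ} (hp : 0 < p) (hq : 0 < q) (s : ℝ) (y : ℂ²) :
    exceptionalMap₂ p q (s / (p * q)) y = rotateCoord p q (exceptionalLift₂ p q s y) := by
  have h : (p : ℝ) * q * (s / (p * q)) = s := by field_simp
  simp only [exceptionalMap₂, rotateCoord, exceptionalLift₂, h]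

theorem mem_exceptionalDom₁ {p q : ℕ} (hp : 0 < p) (hq : 0 < q) (s : ℝ) (y : ℂ²) :
    y ∈ exceptionalDom₁ p q (s / (p * q)) ↔ q * ‖y.1‖ ^ 2 < s + ‖y.2‖ ^ 2 := by
  have h : (p : ℝ) * q * (s / (p * q)) = s := by field_simp
  simp only [exceptionalDom₁, Set.mem_ofPred_eq, h]

theorem mem_exceptionalDom₂ {p q : ℕ} (hp : 0 < p) (hq : 0 < q) (s : ℝ) (y : ℂ²) :
    y ∈ exceptionalDom₂ p q (s / (p * q)) ↔ p * ‖y.1‖ ^ 2 < s + ‖y.2‖ ^ 2 := by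
  have h : (p : ℝ) * q * (s / (p * q)) = s := by field_simp
  simp only [exceptionalDom₂, Set.mem_ofPred_eq, h]

theorem norm_exceptionalLift₁ {p q : ℕ} (hp : 0 < p) {s : ℝ} {y : ℂ²}
    (h : q * ‖y.1‖ ^ 2 ≤ s + ‖y.2‖ ^ 2) :
    p * ‖(exceptionalLift₁ p q s y).1‖ ^ 2 = s + ‖y.2‖ ^ 2 - q * ‖y.1‖ ^ 2 := by
  rw [exceptionalLift₁, Complex.norm_real, Real.norm_eq_abs, sq_abs,
    Real.sq_sqrt (div_nonneg (by linarith) (by positivity))]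
  field_simp

theorem norm_exceptionalLift₂ {p q : ℕ} (hq : 0 < q) {s : ℝ} {y : ℂ²}
    (h : p * ‖y.1‖ ^ 2 ≤ s + ‖y.2‖ ^ 2) :
    q * ‖(exceptionalLift₂ p q s y).2.1‖ ^ 2 = s + ‖y.2‖ ^ 2 - p * ‖y.1‖ ^ 2 := by
  rw [exceptionalLift₂, Complex.norm_real, Real.norm_eq_abs, sq_abs,
    Real.sq_sqrt (div_nonneg (by linarith) (by positivity))]
  field_simp

theorem stdMoment_exceptionalLift₁ {p q : ℕ} (hp : 0 < p) {s : ℝ} {y : ℂ²}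
    (h : q * ‖y.1‖ ^ 2 ≤ s + ‖y.2‖ ^ 2) :
    stdMoment p q (-1) (exceptionalLift₁ p q s y) = s := by
  rw [stdMoment_eq, norm_exceptionalLift₁ hp h]
  simp [exceptionalLift₁]

theorem stdMoment_exceptionalLift₂ {p q : ℕ} (hq : 0 < q) {s : ℝ} {y : ℂ²}
    (h : p * ‖y.1‖ ^ 2 ≤ s + ‖y.2‖ ^ 2) :
    stdMoment p q (-1) (exceptionalLift₂ p q s y) = s := by
  rw [stdMoment_eq, norm_exceptionalLift₂ hq h]
  simp [exceptionalLift₂]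

/-! ### Symplectic sections in the standard space -/

/-- A linear symplectic plane field graph: adding a real function along a complementary isotropic
direction does not change the pulled back form. -/
theorem stdForm3_graph {A : ℂ² →L[ℝ] ℂ³} {e : ℂ³}
    (hA : ∀ u v (a b : ℝ), stdForm3 ![A u + a • e, A v + b • e] = stdForm2 ![u, v])
    {ρ : ℂ² → ℝ} {y : ℂ²} (hρ : DifferentiableAt ℝ ρ y) (u v : ℂ²) :
    stdForm3 ![fderiv ℝ (fun y => A y + ρ y • e) y u, fderiv ℝ (fun y => A y + ρ y • e) y v] =
      stdForm2 ![u, v] := by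
  have h : HasFDerivAt (fun y => A y + ρ y • e) (A + (fderiv ℝ ρ y).smulRight e) y :=
    A.hasFDerivAt.add (hρ.hasFDerivAt.smul_const e)
  rw [h.fderiv]
  simpa using hA u v (fderiv ℝ ρ y u) (fderiv ℝ ρ y v)

theorem contDiff_real_quadratic (a b s : ℝ) :
    ContDiff ℝ ∞ fun y : ℂ² => a * ‖y.1‖ ^ 2 + b * ‖y.2‖ ^ 2 + s :=
  ((contDiff_const.mul (contDiff_fst.norm_sq ℝ)).add
    (contDiff_const.mul (contDiff_snd.norm_sq ℝ))).add contDiff_const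

theorem contDiffAt_sqrt_quadratic {a b s : ℝ} {y : ℂ²}
    (h : 0 < a * ‖y.1‖ ^ 2 + b * ‖y.2‖ ^ 2 + s) :
    ContDiffAt ℝ ∞ (fun y : ℂ² => Real.sqrt (a * ‖y.1‖ ^ 2 + b * ‖y.2‖ ^ 2 + s)) y :=
  (contDiff_real_quadratic a b s).contDiffAt.sqrt h.ne'

/-- `f` is smooth at `y` and pulls back the standard form to the standard form there. -/
def IsStdSectionAt (f : ℂ² → ℂ³) (y : ℂ²) : Prop :=
  ContDiffAt ℝ ∞ f y ∧
    ∀ u v, stdForm3 ![fderiv ℝ f y u, fderiv ℝ f y v] = stdForm2 ![u, v]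

theorem isStdSectionAt_graph {A : ℂ² →L[ℝ] ℂ³} {e : ℂ³}
    (hA : ∀ u v (a b : ℝ), stdForm3 ![A u + a • e, A v + b • e] = stdForm2 ![u, v])
    {a b s : ℝ} {y : ℂ²} (h : 0 < a * ‖y.1‖ ^ 2 + b * ‖y.2‖ ^ 2 + s)
    {f : ℂ² → ℂ³}
    (hf : f = fun y => A y + Real.sqrt (a * ‖y.1‖ ^ 2 + b * ‖y.2‖ ^ 2 + s) • e) :
    IsStdSectionAt f y := by
  have h1 := contDiffAt_sqrt_quadratic h
  subst hf
  exact ⟨A.contDiff.contDiffAt.add (h1.smul contDiffAt_const),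
    stdForm3_graph hA (h1.differentiableAt (by simp))⟩

theorem isStdSectionAt_levelSection {p q : ℕ} {s : ℝ} {y : ℂ²}
    (h : s < p * ‖y.1‖ ^ 2 + q * ‖y.2‖ ^ 2) : IsStdSectionAt (levelSection p q s) y := by
  refine isStdSectionAt_graph (a := p) (b := q) (s := -s) (e := (0, 0, 1))
    (A := (ContinuousLinearMap.fst ℝ ℂ ℂ).prod ((ContinuousLinearMap.snd ℝ ℂ ℂ).prod 0))
    (fun u v a b => ?_) (by linarith) ?_
  · rw [stdForm3_apply, stdForm2_apply]
    simp
  · funext y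
    simp [levelSection, sub_eq_add_neg]

theorem isStdSectionAt_exceptionalLift₁ {p q : ℕ} (hp : 0 < p) {s : ℝ} {y : ℂ²}
    (h : q * ‖y.1‖ ^ 2 < s + ‖y.2‖ ^ 2) : IsStdSectionAt (exceptionalLift₁ p q s) y := by
  have hp' : (0 : ℝ) < p := by exact_mod_cast hp
  have key : ∀ y : ℂ², (s + ‖y.2‖ ^ 2 - q * ‖y.1‖ ^ 2) / p =
      (-q / p) * ‖y.1‖ ^ 2 + (1 / p) * ‖y.2‖ ^ 2 + s / p := fun y => by field_simp; ring
  refine isStdSectionAt_graph (a := -q / p) (b := 1 / p) (s := s / p) (e := (1, 0, 0))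
    (A := (0 : ℂ² →L[ℝ] ℂ).prod ((ContinuousLinearMap.fst ℝ ℂ ℂ).prod
      (ContinuousLinearMap.snd ℝ ℂ ℂ)))
    (fun u v a b => ?_) ?_ ?_
  · rw [stdForm3_apply, stdForm2_apply]
    simp
  · rw [← key]
    exact div_pos (by linarith) hp'
  · funext y
    simp only [exceptionalLift₁, key]
    simp

theorem isStdSectionAt_exceptionalLift₂ {p q : ℕ} (hq : 0 < q) {s : ℝ} {y : ℂ²}
    (h : p * ‖y.1‖ ^ 2 < s + ‖y.2‖ ^ 2) : IsStdSectionAt (exceptionalLift₂ p q s) y := by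
  have hq' : (0 : ℝ) < q := by exact_mod_cast hq
  have key : ∀ y : ℂ², (s + ‖y.2‖ ^ 2 - p * ‖y.1‖ ^ 2) / q =
      (-p / q) * ‖y.1‖ ^ 2 + (1 / q) * ‖y.2‖ ^ 2 + s / q := fun y => by field_simp; ring
  refine isStdSectionAt_graph (a := -p / q) (b := 1 / q) (s := s / q) (e := (0, 1, 0))
    (A := (ContinuousLinearMap.fst ℝ ℂ ℂ).prod ((0 : ℂ² →L[ℝ] ℂ).prod
      (ContinuousLinearMap.snd ℝ ℂ ℂ)))
    (fun u v a b => ?_) ?_ ?_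
  · rw [stdForm3_apply, stdForm2_apply]
    simp
  · rw [← key]
    exact div_pos (by linarith) hq'
  · funext y
    simp only [exceptionalLift₂, key]
    simp

theorem stdForm3_nondegenerate {u : ℂ³} (h : ∀ v, stdForm3 ![u, v] = 0) : u = 0 := by
  have hpi : Real.pi⁻¹ ≠ 0 := inv_ne_zero Real.pi_ne_zero
  have h1 := h (1, 0, 0)
  have h2 := h (Complex.I, 0, 0)
  have h3 := h (0, 1, 0)
  have h4 := h (0, Complex.I, 0)
  have h5 := h (0, 0, 1)
  have h6 := h (0, 0, Complex.I)
  simp only [stdForm3_apply, mul_eq_zero, hpi, false_or] at h1 h2 h3 h4 h5 h6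
  refine Prod.ext (Complex.ext ?_ ?_) (Prod.ext (Complex.ext ?_ ?_) (Complex.ext ?_ ?_)) <;>
    simp at h1 h2 h3 h4 h5 h6 ⊢ <;> assumption

theorem stdForm2_nondegenerate {u : ℂ²} (h : ∀ v, stdForm2 ![u, v] = 0) : u = 0 := by
  have hpi : Real.pi⁻¹ ≠ 0 := inv_ne_zero Real.pi_ne_zero
  have h3 := h (1, 0)
  have h4 := h (Complex.I, 0)
  have h5 := h (0, 1)
  have h6 := h (0, Complex.I)
  simp only [stdForm2_apply, mul_eq_zero, hpi, false_or] at h3 h4 h5 h6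
  refine Prod.ext (Complex.ext ?_ ?_) (Complex.ext ?_ ?_) <;>
    simp at h3 h4 h5 h6 ⊢ <;> assumption

section LocalModel

variable {X : Type*} [TopologicalSpace X] [ChartedSpace E₆ X]
  [IsManifold (𝓡 6) ∞ X]
  [MulAction Circle X] [ContMDiffSMul (𝓡 1) (𝓡 6) ∞ Circle X]
  {Ω : (x : X) → TangentSpace (𝓡 6) x [⋀^Fin 2]→L[ℝ] ℝ} {T : ℝ} {Φ : X → AddCircle T}

/-- An immersion of full dimension is a local diffeomorphism in a chart. -/
theorem exists_localDiffeo_chart {F : Type} [NormedAddCommGroup F] [NormedSpace ℝ F]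
    [FiniteDimensional ℝ F] (hdim : Module.finrank ℝ F = 6) {σ : F → X} {W : Set F}
    (hW : IsOpen W) (hσ : ContMDiffOn 𝓘(ℝ, F) (𝓡 6) ∞ σ W) {z : F} (hz : z ∈ W)
    (hinj : ∀ u, (mfderiv 𝓘(ℝ, F) (𝓡 6) σ z u : E₆) = 0 → u = 0) :
    ∃ k : OpenPartialHomeomorph F E₆, z ∈ k.source ∧ k.source ⊆ W ∧
      (∀ w ∈ k.source, σ w ∈ (extChartAt (𝓡 6) (σ z)).source) ∧
      (∀ w, k w = extChartAt (𝓡 6) (σ z) (σ w)) ∧ ContDiffOn ℝ ∞ k.symm k.target := by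
  have hσ' : ∀ w ∈ W, ContMDiffAt 𝓘(ℝ, F) (𝓡 6) ∞ σ w := fun w hw =>
    hσ.contMDiffAt (hW.mem_nhds hw)
  have h1 : ∀ᶠ y in 𝓝 z, y ∈ W ∧ σ y ∈ (extChartAt (𝓡 6) (σ z)).source :=
    (show ∀ᶠ y in 𝓝 z, y ∈ W from hW.mem_nhds hz).and
      ((hσ' z hz).continuousAt.eventually (extChartAt_source_mem_nhds (σ z)))
  obtain ⟨U, hUs, hU, hzU⟩ := mem_nhds_iff.1 h1
  obtain ⟨k, hzk, hks, hk, hkd, -⟩ := exists_localDiffeo (E := F)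
    (F := E₆) (f := fun y => extChartAt (𝓡 6) (σ z) (σ y)) (by simp [hdim]) hU
    (fun y hy => (contDiffAt_chart_comp (hσ' y (hUs hy).1) (hUs hy).2).contDiffWithinAt) hzU
    (fun u hu => hinj u ((fderiv_chart_comp_eq_zero_iff ((hσ' z hz).mdifferentiableAt (by simp))
      (hUs hzU).2).1 hu))
  exact ⟨k, hzk, fun w hw => (hUs (hks hw)).1, fun w hw => (hUs (hks hw)).2, hk, hkd⟩

/-! ### Equivariant Darboux charts -/

theorem IsEquivariantDarbouxChart.mono {x : X} {a b c : ℤ} {r r' : ℝ} {Ψ : ℂ³ → X}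
    (h : IsEquivariantDarbouxChart Ω x a b c r Ψ) (hr : r' ≤ r) :
    IsEquivariantDarbouxChart Ω x a b c r' Ψ :=
  have hs := Metric.ball_subset_ball (x := (0 : ℂ³)) hr
  ⟨h.map_zero, h.smooth.mono hs, h.injOn.mono hs, fun z hz => h.equivariant z (hs hz),
    fun z hz => h.symplectic z (hs hz)⟩

theorem weightAct_mem_ball {a b c : ℤ} {r : ℝ} (g : Circle) {z : ℂ³}
    (hz : z ∈ Metric.ball (0 : ℂ³) r) :
    weightAct a b c g z ∈ Metric.ball (0 : ℂ³) r := by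
  rwa [mem_ball_zero_iff, norm_weightAct, ← mem_ball_zero_iff]

namespace IsEquivariantDarbouxChart

variable {x : X} {a b c : ℤ} {r : ℝ} {Ψ : ℂ³ → X}

theorem contMDiffAt (h : IsEquivariantDarbouxChart Ω x a b c r Ψ) {z : ℂ³}
    (hz : z ∈ Metric.ball (0 : ℂ³) r) :
    ContMDiffAt 𝓘(ℝ, ℂ³) (𝓡 6) ∞ Ψ z :=
  h.smooth.contMDiffAt (Metric.isOpen_ball.mem_nhds hz)

theorem pullback (h : IsEquivariantDarbouxChart Ω x a b c r Ψ) {z : ℂ³}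
    (hz : z ∈ Metric.ball (0 : ℂ³) r) : pullbackForm Ω Ψ z = stdForm3 :=
  h.symplectic z hz

theorem mfderiv_injective (h : IsEquivariantDarbouxChart Ω x a b c r Ψ) {z u : ℂ³}
    (hz : z ∈ Metric.ball (0 : ℂ³) r)
    (hu : (mfderiv 𝓘(ℝ, ℂ³) (𝓡 6) Ψ z u : E₆) = 0) : u = 0 := by
  refine stdForm3_nondegenerate fun v => ?_
  rw [← h.pullback hz, pullbackForm_apply]
  exact (congrArg (fun t : E₆ =>
    (Ω (Ψ z) : E₆ [⋀^Fin 2]→L[ℝ] ℝ) ![t, mfderiv 𝓘(ℝ, ℂ³) (𝓡 6) Ψ z v])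
    hu).trans (form_zero_left (E := E₆) (Ω (Ψ z)) _)

theorem isOpen_image (h : IsEquivariantDarbouxChart Ω x a b c r Ψ) {V : Set ℂ³}
    (hV : IsOpen V) (hVr : V ⊆ Metric.ball 0 r) : IsOpen (Ψ '' V) := by
  rw [isOpen_iff_mem_nhds]
  rintro _ ⟨z, hz, rfl⟩
  obtain ⟨k, hzk, hkV, hks, hk, -⟩ := exists_localDiffeo_chart (F := ℂ³) (by simp) hV
    (h.smooth.mono hVr) hz fun u hu => h.mfderiv_injective (hVr hz) hu
  have h2 : k.target ∈ 𝓝 (extChartAt (𝓡 6) (Ψ z) (Ψ z)) := by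
    rw [← hk z]
    exact k.open_target.mem_nhds (k.map_source hzk)
  have h3 := ((continuousAt_extChartAt (I := 𝓡 6) (Ψ z)).eventually h2).and
    (extChartAt_source_mem_nhds (I := 𝓡 6) (Ψ z))
  filter_upwards [h3] with y hy
  have hs := k.map_target hy.1
  refine ⟨_, hkV hs, (extChartAt (𝓡 6) (Ψ z)).injOn (hks _ hs) hy.2 ?_⟩
  rw [← hk, k.right_inv hy.1]

theorem generator_ne_zero (h : IsEquivariantDarbouxChart Ω x a b c r Ψ) (ha : a ≠ 0) (hb : b ≠ 0)
    (hc : c ≠ 0) {z : ℂ³} (hz : z ∈ Metric.ball (0 : ℂ³) r) (hz0 : z ≠ 0) :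
    (generator (Ψ z) : E₆) ≠ 0 := by
  intro h0
  rw [← mfderiv_weightField h.smooth h.equivariant hz] at h0
  have h1 := h.mfderiv_injective hz h0
  refine hz0 ?_
  simp only [weightField, Prod.mk_eq_zero, mul_eq_zero, Complex.I_ne_zero, Int.cast_eq_zero, ha, hb,
    hc, or_false, false_or, Complex.ofReal_eq_zero, Real.pi_ne_zero, OfNat.ofNat_ne_zero] at h1
  exact Prod.ext h1.1 (Prod.ext h1.2.1 h1.2.2)

/-- Sections of level sets that come from the standard space. -/
theorem isSymplecticSection (h : IsEquivariantDarbouxChart Ω x a b c r Ψ) (hΦ : IsMomentMap Ω Φ)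
    (ha : a ≠ 0) (hb : b ≠ 0) (hc : c ≠ 0) {l : AddCircle T} {s : ℝ}
    (hl : Φ x + (s : AddCircle T) = l) {f : ℂ² → ℂ³} {W : Set ℂ²} (hW : IsOpen W)
    (hf : ∀ y ∈ W, IsStdSectionAt f y) (hfr : ∀ y ∈ W, f y ∈ Metric.ball (0 : ℂ³) r)
    (hf0 : ∀ y ∈ W, f y ≠ 0) (hfs : ∀ y ∈ W, stdMoment a b c (f y) = s) :
    IsSymplecticSection Ω Φ l W (fun y => Ψ (f y)) ∧
      ∀ y ∈ W, pullbackForm Ω (fun y => Ψ (f y)) y = stdForm2 := by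
  have hr : 0 < r ∨ W = ∅ := by
    rcases W.eq_empty_or_nonempty with h0 | ⟨y, hy⟩
    · exact Or.inr h0
    · exact Or.inl ((norm_nonneg _).trans_lt (mem_ball_zero_iff.1 (hfr y hy)))
  have hpb : ∀ y ∈ W, pullbackForm Ω (fun y => Ψ (f y)) y = stdForm2 := fun y hy => by
    rw [pullbackForm_comp ((h.contMDiffAt (hfr y hy)).mdifferentiableAt (by simp))
      ((hf y hy).1.differentiableAt (by simp)), h.pullback (hfr y hy)]
    exact form_ext fun u v => by rw [compContinuousLinearMap_pair, (hf y hy).2]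
  refine ⟨⟨hW, fun y hy => ?_, fun y hy => ?_, fun y hy u hu => ?_, fun y hy => ?_⟩, hpb⟩
  · exact ((h.contMDiffAt (hfr y hy)).comp y (hf y hy).1.contMDiffAt).contMDiffWithinAt
  · rcases hr with hr | h0
    · rw [h.moment_eq hΦ hr (hfr y hy), hfs y hy, hl]
    · simp [h0] at hy
  · exact stdForm2_nondegenerate fun v => by rw [← hpb y hy, hu v]
  · exact h.generator_ne_zero ha hb hc (hfr y hy) (hf0 y hy)

theorem hasSection (h : IsEquivariantDarbouxChart Ω x a b c r Ψ) (hΦ : IsMomentMap Ω Φ)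
    (ha : a ≠ 0) (hb : b ≠ 0) (hc : c ≠ 0) {l : AddCircle T} {s : ℝ}
    (hl : Φ x + (s : AddCircle T) = l) {f : ℂ² → ℂ³} {U : Set ℂ²}
    {F : ℂ² → ReducedSpace Φ l} {z : ℂ²} {W : Set ℂ²} (hW : IsOpen W) (hWU : W ⊆ U)
    (hz : z ∈ W)
    (hf : ∀ y ∈ W, IsStdSectionAt f y) (hfr : ∀ y ∈ W, f y ∈ Metric.ball (0 : ℂ³) r)
    (hf0 : ∀ y ∈ W, f y ≠ 0) (hfs : ∀ y ∈ W, stdMoment a b c (f y) = s)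
    (hF : ∀ y ∈ W, ∃ hy : Φ (Ψ (f y)) = l, F y = ReducedSpace.mk Φ l (Ψ (f y)) hy) :
    HasSection Ω Φ l U F (fun _ => stdForm2) z := by
  obtain ⟨h1, h2⟩ := h.isSymplecticSection hΦ ha hb hc hl hW hf hfr hf0 hfs
  exact ⟨W, fun y => Ψ (f y), hz, hWU, h1, fun y hy => ⟨hF y hy, h2 y hy⟩⟩

/-- Orbits inside a Darboux chart. -/
theorem smul_eq_iff (h : IsEquivariantDarbouxChart Ω x a b c r Ψ) {v w : ℂ³}
    (hv : v ∈ Metric.ball (0 : ℂ³) r) (hw : w ∈ Metric.ball (0 : ℂ³) r) (g : Circle) :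
    g • Ψ v = Ψ w ↔ weightAct a b c g v = w := by
  rw [← h.equivariant v hv]
  exact h.injOn.eq_iff (weightAct_mem_ball g hv) hw

theorem smul_mem_image (h : IsEquivariantDarbouxChart Ω x a b c r Ψ) {r' : ℝ} (hr : r' ≤ r)
    (g : Circle) {y : X} : g • y ∈ Ψ '' Metric.ball 0 r' ↔ y ∈ Ψ '' Metric.ball 0 r' := by
  have key : ∀ (g : Circle) (y : X), y ∈ Ψ '' Metric.ball 0 r' → g • y ∈ Ψ '' Metric.ball 0 r' := by
    rintro g _ ⟨v, hv, rfl⟩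
    exact ⟨weightAct a b c g v, weightAct_mem_ball g hv,
      h.equivariant v (Metric.ball_subset_ball hr hv) g⟩
  exact ⟨fun hy => by simpa using key g⁻¹ _ hy, key g y⟩

end IsEquivariantDarbouxChart

/-! ### The chart of the reduced space at the critical level -/

/-- The map from the slice to the reduced space at the critical level. -/
def sliceMap (Φ : X → AddCircle T) (p q : ℕ) (x : X) (Ψ : ℂ³ → X) (z : ℂ²) :
    ReducedSpace Φ (Φ x) :=
  orbitClass Φ (rfl : Φ x = Φ x) (Ψ (levelSection p q 0 z))

namespace IsEquivariantDarbouxChart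

variable {x : X} {p q : ℕ} {r : ℝ} {Ψ : ℂ³ → X}

theorem moment_levelSection (h : IsEquivariantDarbouxChart Ω x p q (-1) r Ψ) (hr : 0 < r)
    (hΦ : IsMomentMap Ω Φ) {s : ℝ} (hs : 0 ≤ s) {z : ℂ²} (hz : z ∈ sliceDom p q r)
    (hsz : s ≤ p * ‖z.1‖ ^ 2 + q * ‖z.2‖ ^ 2) :
    Φ (Ψ (levelSection p q s z)) = Φ x + (s : AddCircle T) := by
  rw [h.moment_eq hΦ hr (levelSection_mem_ball hs hz), stdMoment_levelSection p q s z hsz]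

theorem moment_levelSection_zero (h : IsEquivariantDarbouxChart Ω x p q (-1) r Ψ) (hr : 0 < r)
    (hΦ : IsMomentMap Ω Φ) {z : ℂ²} (hz : z ∈ sliceDom p q r) :
    Φ (Ψ (levelSection p q 0 z)) = Φ x := by
  have h0 : (0 : ℝ) ≤ p * ‖z.1‖ ^ 2 + q * ‖z.2‖ ^ 2 := by positivity
  rw [h.moment_levelSection hr hΦ le_rfl hz h0, AddCircle.coe_zero, add_zero]

theorem circlePhase_smul (h : IsEquivariantDarbouxChart Ω x p q (-1) r Ψ) {v : ℂ³}
    (hv : v ∈ Metric.ball (0 : ℂ³) r) :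
    circlePhase v.2.2 • Ψ v =
      Ψ (levelSection p q (stdMoment p q (-1) v) (rotateCoord p q v)) := by
  rw [← weightAct_circlePhase, h.equivariant v hv]

theorem orbitClass_levelSection_eq_iff (h : IsEquivariantDarbouxChart Ω x p q (-1) r Ψ) (hr : 0 < r)
    (hΦ : IsMomentMap Ω Φ) {l : AddCircle T} {x' : X} (hx' : Φ x' = l) {s : ℝ} (hs : 0 ≤ s)
    (hl : Φ x + (s : AddCircle T) = l) {z w : ℂ²}
    (hz : z ∈ sliceDom p q r) (hw : w ∈ sliceDom p q r)
    (hsz : s ≤ p * ‖z.1‖ ^ 2 + q * ‖z.2‖ ^ 2) (hsw : s ≤ p * ‖w.1‖ ^ 2 + q * ‖w.2‖ ^ 2) :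
    orbitClass Φ hx' (Ψ (levelSection p q s z)) = orbitClass Φ hx' (Ψ (levelSection p q s w)) ↔
      z = w ∨ (p * ‖z.1‖ ^ 2 + q * ‖z.2‖ ^ 2 = s ∧ p * ‖w.1‖ ^ 2 + q * ‖w.2‖ ^ 2 = s ∧
        ∃ g : Circle, (g : ℂ) ^ p * z.1 = w.1 ∧ (g : ℂ) ^ q * z.2 = w.2) := by
  rw [orbitClass_eq_iff hx' ((h.moment_levelSection hr hΦ hs hz hsz).trans hl)
    ((h.moment_levelSection hr hΦ hs hw hsw).trans hl), ← exists_weightAct_levelSection_iff hsw]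
  exact exists_congr fun g =>
    h.smul_eq_iff (levelSection_mem_ball hs hz) (levelSection_mem_ball hs hw) g

theorem sliceMap_eq (h : IsEquivariantDarbouxChart Ω x p q (-1) r Ψ) (hr : 0 < r)
    (hΦ : IsMomentMap Ω Φ) {z : ℂ²} (hz : z ∈ sliceDom p q r) :
    ∃ hz : Φ (Ψ (levelSection p q 0 z)) = Φ x,
      sliceMap Φ p q x Ψ z = ReducedSpace.mk Φ (Φ x) (Ψ (levelSection p q 0 z)) hz :=
  ⟨h.moment_levelSection_zero hr hΦ hz, orbitClass_eq _ _⟩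

theorem injOn_sliceMap (h : IsEquivariantDarbouxChart Ω x p q (-1) r Ψ) (hp : 0 < p) (hq : 0 < q)
    (hr : 0 < r) (hΦ : IsMomentMap Ω Φ) :
    Set.InjOn (sliceMap Φ p q x Ψ) (sliceDom p q r) := by
  intro z hz w hw hzw
  rcases (h.orbitClass_levelSection_eq_iff hr hΦ rfl le_rfl (by simp) hz hw (by positivity)
    (by positivity)).1 hzw with h1 | ⟨h1, h2, -⟩
  · exact h1
  · have hp' : (0 : ℝ) < p := by exact_mod_cast hp
    have hq' : (0 : ℝ) < q := by exact_mod_cast hq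
    have key : ∀ z : ℂ², p * ‖z.1‖ ^ 2 + q * ‖z.2‖ ^ 2 = 0 → z = 0 := fun z hz => by
      have h3 : ‖z.1‖ ^ 2 = 0 := by nlinarith [sq_nonneg ‖z.1‖, sq_nonneg ‖z.2‖]
      have h4 : ‖z.2‖ ^ 2 = 0 := by nlinarith [sq_nonneg ‖z.1‖, sq_nonneg ‖z.2‖]
      exact Prod.ext (by simpa using h3) (by simpa using h4)
    rw [key z h1, key w h2]

/-- Every orbit of the Darboux chart meets the image of `levelSection`. -/
theorem mk_eq_levelSection (h : IsEquivariantDarbouxChart Ω x p q (-1) r Ψ) (hr : 0 < r)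
    (hΦ : IsMomentMap Ω Φ) {l : AddCircle T} {s : ℝ} {v : ℂ³}
    (hv : v ∈ Metric.ball (0 : ℂ³) r) (hvl : Φ (Ψ v) = l) (hs : stdMoment p q (-1) v = s)
    (hvr : ‖v.2.2‖ ^ 2 + s < r ^ 2) :
    rotateCoord p q v ∈ sliceDom p q r ∧
      s ≤ p * ‖(rotateCoord p q v).1‖ ^ 2 + q * ‖(rotateCoord p q v).2‖ ^ 2 ∧
      ∃ hy : Φ (Ψ (levelSection p q s (rotateCoord p q v))) = l,
        ReducedSpace.mk Φ l (Ψ v) hvl =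
          ReducedSpace.mk Φ l (Ψ (levelSection p q s (rotateCoord p q v))) hy := by
  have hm := stdMoment_eq p q v
  refine ⟨rotateCoord_mem_sliceDom hv (by linarith) hr, ?_, ?_⟩
  · rw [norm_rotateCoord_fst, norm_rotateCoord_snd]
    nlinarith [sq_nonneg ‖v.2.2‖]
  · subst hs
    have h1 := h.circlePhase_smul hv
    refine ⟨by rw [← h1, moment_smul hΦ, hvl], ?_⟩
    rw [mk_eq_mk_iff]
    exact ⟨_, h1⟩

theorem mk_mem_image_sliceMap_iff (h : IsEquivariantDarbouxChart Ω x p q (-1) r Ψ) (hp : 0 < p)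
    (hq : 0 < q) (hr : 0 < r) (hΦ : IsMomentMap Ω Φ)
    (hsep : ∀ v ∈ Metric.ball (0 : ℂ³) r, Φ (Ψ v) = Φ x → stdMoment p q (-1) v = 0)
    {V : Set ℂ²} (hV : V ⊆ sliceDom p q r) {y : X} (hy : Φ y = Φ x) :
    ReducedSpace.mk Φ (Φ x) y hy ∈ sliceMap Φ p q x Ψ '' V ↔
      ∃ v ∈ Metric.ball (0 : ℂ³) r, Ψ v = y ∧ rotateCoord p q v ∈ V := by
  have key : ∀ v ∈ Metric.ball (0 : ℂ³) r, ∀ hv : Φ (Ψ v) = Φ x,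
      rotateCoord p q v ∈ sliceDom p q r ∧
      ReducedSpace.mk Φ (Φ x) (Ψ v) hv = sliceMap Φ p q x Ψ (rotateCoord p q v) := by
    intro v hv hvl
    have h2 := (mem_ball_prod.1 hv).2.2
    obtain ⟨h3, -, h4, h5⟩ := h.mk_eq_levelSection hr hΦ hv hvl (hsep v hv hvl)
      (by rw [add_zero]; exact pow_lt_pow_left₀ h2 (norm_nonneg _) two_ne_zero)
    exact ⟨h3, by rw [h5, (h.sliceMap_eq hr hΦ h3).2]⟩
  constructor
  · rintro ⟨z, hz, hzy⟩
    obtain ⟨h1, h2⟩ := h.sliceMap_eq hr hΦ (hV hz)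
    obtain ⟨g, hg⟩ := (mk_eq_mk_iff h1 hy).1 (h2.symm.trans hzy)
    have hb := levelSection_mem_ball le_rfl (hV hz)
    have hgv := (h.equivariant _ hb g).trans hg
    have hb' := weightAct_mem_ball (a := p) (b := q) (c := -1) g hb
    obtain ⟨h3, h4⟩ := key _ hb' (by rw [hgv, hy])
    refine ⟨_, hb', hgv, ?_⟩
    have h5 : z = rotateCoord p q (weightAct p q (-1) g (levelSection p q 0 z)) := by
      refine h.injOn_sliceMap hp hq hr hΦ (hV hz) h3 ?_
      rw [← h4, h2, mk_eq_mk_iff]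
      exact ⟨g, (h.equivariant _ hb g).symm⟩
    rwa [← h5]
  · rintro ⟨v, hv, rfl, hvV⟩
    exact ⟨_, hvV, (key v hv hy).2.symm⟩

theorem isOpen_image_sliceMap (h : IsEquivariantDarbouxChart Ω x p q (-1) r Ψ) (hp : 0 < p)
    (hq : 0 < q) (hr : 0 < r) (hΦ : IsMomentMap Ω Φ)
    (hsep : ∀ v ∈ Metric.ball (0 : ℂ³) r, Φ (Ψ v) = Φ x → stdMoment p q (-1) v = 0)
    {V : Set ℂ²} (hV : V ⊆ sliceDom p q r) (hVo : IsOpen V) :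
    IsOpen (sliceMap Φ p q x Ψ '' V) := by
  rw [isOpen_reducedSpace_iff]
  rw [isOpen_iff_mem_nhds]
  rintro ⟨y, hy⟩ hyV
  obtain ⟨v, hv, rfl, hvV⟩ := (h.mk_mem_image_sliceMap_iff hp hq hr hΦ hsep hV hy).1 hyV
  have hm := stdMoment_eq p q v
  rw [hsep v hv hy] at hm
  have hc : ContinuousAt (rotateCoord p q) v := by
    by_cases h0 : v.2.2 = 0
    · have hp' : (0 : ℝ) < p := by exact_mod_cast hp
      have hq' : (0 : ℝ) < q := by exact_mod_cast hq
      rw [h0] at hm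
      simp only [norm_zero] at hm
      have h3 : ‖v.1‖ ^ 2 = 0 := by nlinarith [sq_nonneg ‖v.1‖, sq_nonneg ‖v.2.1‖]
      have h4 : ‖v.2.1‖ ^ 2 = 0 := by nlinarith [sq_nonneg ‖v.1‖, sq_nonneg ‖v.2.1‖]
      have hv0 : v = 0 := Prod.ext (by simpa using h3) (Prod.ext (by simpa using h4) h0)
      rw [hv0]
      exact continuousAt_rotateCoord_zero p q
    · exact continuousAt_rotateCoord p q h0
  have h1 : ∀ᶠ w in 𝓝 v, w ∈ Metric.ball (0 : ℂ³) r ∧ rotateCoord p q w ∈ V :=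
    (show ∀ᶠ w in 𝓝 v, w ∈ Metric.ball (0 : ℂ³) r from
      Metric.isOpen_ball.mem_nhds hv).and (hc.eventually (hVo.mem_nhds hvV))
  obtain ⟨N, hN, hNo, hvN⟩ := mem_nhds_iff.1 h1
  have h2 := (h.isOpen_image hNo fun w hw => (hN hw).1).mem_nhds ⟨v, hvN, rfl⟩
  filter_upwards [continuousAt_subtype_val.eventually h2]
  rintro ⟨y', hy'⟩ ⟨w, hw, hwy⟩
  exact (h.mk_mem_image_sliceMap_iff hp hq hr hΦ hsep hV hy').2 ⟨w, (hN hw).1, hwy, (hN hw).2⟩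

theorem continuousOn_sliceMap (h : IsEquivariantDarbouxChart Ω x p q (-1) r Ψ) (hr : 0 < r)
    (hΦ : IsMomentMap Ω Φ) : ContinuousOn (sliceMap Φ p q x Ψ) (sliceDom p q r) := by
  refine continuousOn_orbitClass _ (h.smooth.continuousOn.comp
    (continuous_levelSection p q 0).continuousOn fun z hz => hz) fun z hz => ?_
  exact h.moment_levelSection_zero hr hΦ hz

theorem exists_center_chart (h : IsEquivariantDarbouxChart Ω x p q (-1) r Ψ) (hp : 0 < p)
    (hq : 0 < q) (hr : 0 < r) (hΦ : IsMomentMap Ω Φ)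
    (hsep : ∀ v ∈ Metric.ball (0 : ℂ³) r, Φ (Ψ v) = Φ x → stdMoment p q (-1) v = 0) :
    ∃ c : UniformizingChart (ReducedSpace Φ (Φ x)), c.dom = sliceDom p q r ∧
      c.map = sliceMap Φ p q x Ψ ∧ c.form = fun _ => stdForm2 := by
  refine ⟨⟨sliceDom p q r, isOpen_sliceDom p q r, ⊥, inferInstance, ?_, ?_, ?_,
    sliceMap Φ p q x Ψ, h.continuousOn_sliceMap hr hΦ,
    fun W hW hWo => h.isOpen_image_sliceMap hp hq hr hΦ hsep hW hWo, ?_, fun _ => stdForm2,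
    contDiffOn_const, ?_, ?_, ?_⟩, rfl, rfl, rfl⟩
  · rintro γ hγ z hz
    rw [Subgroup.mem_bot.1 hγ]
    exact hz
  · rintro γ hγ
    rw [Subgroup.mem_bot.1 hγ]
    exact contDiffOn_id
  · rintro γ hγ - - -
    exact Subgroup.mem_bot.1 hγ
  · intro z hz w hw
    rw [(h.injOn_sliceMap hp hq hr hΦ).eq_iff hz hw]
    exact ⟨fun hzw => ⟨1, Subgroup.mem_bot.2 rfl, hzw⟩,
      fun ⟨γ, hγ, hzw⟩ => by rwa [Subgroup.mem_bot.1 hγ] at hzw⟩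
  · intro z hz
    ext v
    rw [extDeriv_apply (differentiableAt_const _)]
    simp
  · exact fun z hz u hu => stdForm2_nondegenerate hu
  · rintro γ hγ z hz
    rw [Subgroup.mem_bot.1 hγ]
    refine form_ext fun u v => ?_
    have h1 : ((1 : Equiv.Perm ℂ²) : ℂ² → ℂ²) = id := rfl
    rw [compContinuousLinearMap_pair, h1, fderiv_id]
    rfl

/-- Away from the center, the slice is a reduction chart. -/
theorem hasSection_sliceMap (h : IsEquivariantDarbouxChart Ω x p q (-1) r Ψ) (hp : 0 < p)
    (hq : 0 < q) (hr : 0 < r) (hΦ : IsMomentMap Ω Φ) {z : ℂ²} (hz : z ∈ sliceDom p q r)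
    (hz0 : z ≠ 0) :
    HasSection Ω Φ (Φ x) (sliceDom p q r) (sliceMap Φ p q x Ψ) (fun _ => stdForm2) z := by
  have hp' : (0 : ℝ) < p := by exact_mod_cast hp
  have hq' : (0 : ℝ) < q := by exact_mod_cast hq
  refine h.hasSection hΦ (by exact_mod_cast hp.ne') (by exact_mod_cast hq.ne') (by norm_num)
    (s := 0) (by simp) (f := levelSection p q 0) (W := sliceDom p q r ∩ {z | z ≠ 0})
    ((isOpen_sliceDom p q r).inter isOpen_ne) Set.inter_subset_left ⟨hz, hz0⟩ (fun y hy => ?_)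
    (fun y hy => levelSection_mem_ball le_rfl hy.1) (fun y hy h0 => hy.2 ?_)
    (fun y hy => stdMoment_levelSection p q 0 y (by positivity))
    (fun y hy => h.sliceMap_eq hr hΦ hy.1)
  · refine isStdSectionAt_levelSection ?_
    rcases not_and_or.1 (mt Prod.ext_iff.2 hy.2) with h1 | h1
    · have : 0 < ‖y.1‖ := norm_pos_iff.2 h1
      positivity
    · have : 0 < ‖y.2‖ := norm_pos_iff.2 h1
      positivity
  · exact Prod.ext (congrArg (fun v : ℂ³ => v.1) h0)
      (congrArg (fun v : ℂ³ => v.2.1) h0)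

end IsEquivariantDarbouxChart

end LocalModel

section CriticalLevel

variable {X : Type*} [TopologicalSpace X] [ChartedSpace E₆ X]
  [IsManifold (𝓡 6) ∞ X]
  [MulAction Circle X] [ContMDiffSMul (𝓡 1) (𝓡 6) ∞ Circle X]
  {Ω : (x : X) → TangentSpace (𝓡 6) x [⋀^Fin 2]→L[ℝ] ℝ} {T : ℝ} {Φ : X → AddCircle T}

/-! ### Symplectic local diffeomorphisms from sections -/

theorem isLocalSymplecto_of_hasSection (hΩ : IsSymplecticForm Ω) (hinv : IsInvariantForm Ω)
    (hΦ : IsMomentMap Ω Φ) {l : AddCircle T} {O : SymplecticOrbifold (ReducedSpace Φ l)}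
    (hO : ∀ c ∈ O.charts, IsReductionChart Ω Φ l c) {U : Set ℂ²}
    {F : ℂ² → ReducedSpace Φ l}
    (hF : ∀ z ∈ U, HasSection Ω Φ l U F (fun _ => stdForm2) z) : IsLocalSymplecto O U F :=
  fun z hz d hd w hw hdw => (hF z hz).exists_lift hΩ hinv hΦ (hO d hd w hw) hdw

theorem isReductionOn_of_isReductionChart {l : AddCircle T}
    {O : SymplecticOrbifold (ReducedSpace Φ l)} {S : Set (ReducedSpace Φ l)}
    (hO : ∀ c ∈ O.charts, ∀ z ∈ c.dom, c.map z ∈ S → HasSection Ω Φ l c.dom c.map c.form z) :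
    IsReductionOn Ω Φ l O S :=
  fun c hc z hz hS => (hO c hc z hz hS).isReductionOn_aux

/-- The orbifold structure on a regular reduced space. -/
theorem exists_regular_orbifold [T2Space X] [CompactSpace X] (hΩ : IsSymplecticForm Ω)
    (hinv : IsInvariantForm Ω) (hΦ : IsMomentMap Ω Φ) {l : AddCircle T}
    (hl : ∀ x : X, Φ x = l → (generator x : E₆) ≠ 0) :
    ∃ O : SymplecticOrbifold (ReducedSpace Φ l), ∀ c ∈ O.charts, IsReductionChart Ω Φ l c := by
  obtain ⟨O, hO⟩ := exists_reducedOrbifold (l := l) hΩ hinv hΦ ∅ (by simp) (by simp)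
    (fun x hx h0 => absurd h0 (hl x hx))
  refine ⟨O, fun c hc => ?_⟩
  rw [hO] at hc
  simpa using hc

namespace IsEquivariantDarbouxChart

variable {x : X} {p q : ℕ} {r : ℝ} {Ψ : ℂ³ → X}

/-- The orbifold structure on the reduced space at the critical level. -/
theorem exists_critical_orbifold [T2Space X] [CompactSpace X]
    (h : IsEquivariantDarbouxChart Ω x p q (-1) r Ψ) (hp : 0 < p)
    (hq : 0 < q) (hr : 0 < r) (hΩ : IsSymplecticForm Ω) (hinv : IsInvariantForm Ω)
    (hΦ : IsMomentMap Ω Φ)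
    (hsep : ∀ v ∈ Metric.ball (0 : ℂ³) r, Φ (Ψ v) = Φ x → stdMoment p q (-1) v = 0)
    (hfix : ∀ g : Circle, g • x = x)
    (honly : ∀ y : X, Φ y = Φ x → (generator y : E₆) = 0 → y = x) :
    ∃ O : SymplecticOrbifold (ReducedSpace Φ (Φ x)),
      (∀ c ∈ O.charts, ∀ z ∈ c.dom, c.map z ≠ ReducedSpace.mk Φ (Φ x) x rfl →
        HasSection Ω Φ (Φ x) c.dom c.map c.form z) ∧
      (∃ c ∈ O.charts, c.dom = sliceDom p q r ∧ c.map = sliceMap Φ p q x Ψ ∧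
        c.form = fun _ => stdForm2) ∧
      IsDarbouxChart O (sliceDom p q r) (sliceMap Φ p q x Ψ)
        (ReducedSpace.mk Φ (Φ x) x rfl) := by
  obtain ⟨c₀, hc1, hc2, hc3⟩ := h.exists_center_chart hp hq hr hΦ hsep
  have h0 : (0 : ℂ²) ∈ sliceDom p q r := by
    rw [mem_sliceDom hp hq hr]
    simpa using pow_pos hr 2
  have hm0 : sliceMap Φ p q x Ψ 0 = ReducedSpace.mk Φ (Φ x) x rfl := by
    obtain ⟨h1, h2⟩ := h.sliceMap_eq hr hΦ h0
    rw [h2, mk_eq_mk_iff]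
    refine ⟨1, ?_⟩
    have h3 : levelSection p q 0 0 = 0 := by simp [levelSection]
    rw [one_smul, h3, h.map_zero]
  have hgen := generator_eq_zero_of_smul_eq hfix
  suffices key : ∃ O : SymplecticOrbifold (ReducedSpace Φ (Φ x)),
      O.charts = {c | IsReductionChart Ω Φ (Φ x) c} ∪ {c₀} by
    obtain ⟨O, hO⟩ := key
    have hc₀ : c₀ ∈ O.charts := by rw [hO]; exact Or.inr rfl
    refine ⟨O, fun c hc z hz hcz => ?_, ⟨c₀, hc₀, hc1, hc2, hc3⟩, isOpen_sliceDom p q r, h0, hm0,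
      h.injOn_sliceMap hp hq hr hΦ, fun z hz d hd w hw hdw => ?_⟩
    · rw [hO] at hc
      rcases hc with hc | rfl
      · exact hc z hz
      · rw [hc1, hc2, hc3]
        refine h.hasSection_sliceMap hp hq hr hΦ (by rwa [hc1] at hz) ?_
        rintro rfl
        rw [hc2] at hcz
        exact hcz hm0
    · have h1 := O.compatible c₀ hc₀ d hd z (by rwa [hc1]) w hw (by rwa [hc2])
      rwa [hc1, hc2, hc3] at h1
  refine exists_reducedOrbifold (l := Φ x) hΩ hinv hΦ {c₀} ?_ ?_ ?_
  · rintro c rfl z hz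
    by_cases hz0 : z = 0
    · exact Or.inr ⟨x, rfl, hgen, by rw [hz0, hc2, hm0]⟩
    · left
      rw [hc1, hc2, hc3]
      exact h.hasSection_sliceMap hp hq hr hΦ (by rwa [hc1] at hz) hz0
  · rintro c rfl d hd z hz w hw hzw
    obtain rfl : d = c := hd
    rw [hc2] at hzw
    rw [hc1] at hz hw
    obtain rfl := h.injOn_sliceMap hp hq hr hΦ hw hz hzw
    refine ⟨OpenPartialHomeomorph.ofSet d.dom d.isOpen_dom, ⟨?_, rfl, ?_, ?_, ?_, ?_, ?_⟩, ?_⟩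
    · simpa [hc1] using hz
    · simp
    · simp
    · exact contDiffOn_id
    · exact contDiffOn_id
    · exact fun y hy => rfl
    · intro y hy
      refine form_ext fun u v => ?_
      rw [compContinuousLinearMap_pair, hc3]
      have h1 : ((OpenPartialHomeomorph.ofSet d.dom d.isOpen_dom : ℂ² → ℂ²)) = id := rfl
      rw [h1, fderiv_id]
      rfl
  · intro y hy hy0
    refine ⟨c₀, rfl, 0, by rwa [hc1], ?_⟩
    obtain rfl := honly y hy hy0
    rw [hc2, hm0]

/-! ### The collapse map inside the Darboux chart -/

variable {l : AddCircle T} {ε : ℝ} {K : ℂ² → ReducedSpace Φ l}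

theorem hasSection_levelSection (h : IsEquivariantDarbouxChart Ω x p q (-1) r Ψ) (hp : 0 < p)
    (hq : 0 < q) (hΦ : IsMomentMap Ω Φ) (hε : 0 < ε)
    (hl : Φ x + (ε : AddCircle T) = l)
    (hK : ∀ z ∈ sliceDom p q r, ε ≤ p * ‖z.1‖ ^ 2 + q * ‖z.2‖ ^ 2 →
      ∃ hz : Φ (Ψ (levelSection p q ε z)) = l, K z = ReducedSpace.mk Φ l _ hz)
    {z : ℂ²} (hz : z ∈ sliceDom p q r) (hεz : ε < p * ‖z.1‖ ^ 2 + q * ‖z.2‖ ^ 2) :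
    HasSection Ω Φ l (sliceDom p q r ∩ {z | ε < p * ‖z.1‖ ^ 2 + q * ‖z.2‖ ^ 2}) K
      (fun _ => stdForm2) z := by
  refine h.hasSection hΦ (by exact_mod_cast hp.ne') (by exact_mod_cast hq.ne') (by norm_num)
    hl (f := levelSection p q ε)
    (W := sliceDom p q r ∩ {z | ε < p * ‖z.1‖ ^ 2 + q * ‖z.2‖ ^ 2})
    ((isOpen_sliceDom p q r).inter (isOpen_lt (by fun_prop) (by fun_prop)))
    subset_rfl ⟨hz, hεz⟩ (fun y hy => isStdSectionAt_levelSection hy.2)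
    (fun y hy => levelSection_mem_ball hε.le hy.1) (fun y hy h0 => ?_)
    (fun y hy => stdMoment_levelSection p q ε y (le_of_lt hy.2)) (fun y hy => hK y hy.1 (le_of_lt hy.2))
  have h1 := stdMoment_levelSection p q ε y (le_of_lt hy.2)
  rw [h0] at h1
  simp [stdMoment] at h1
  exact hε.ne h1

theorem hasSection_exceptional {E : ℂ² → ℂ³} {U : Set ℂ²}
    (h : IsEquivariantDarbouxChart Ω x p q (-1) r Ψ) (hp : 0 < p)
    (hq : 0 < q) (hr : 0 < r) (hΦ : IsMomentMap Ω Φ) (hε : 0 < ε)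
    (hl : Φ x + (ε : AddCircle T) = l)
    (hK : ∀ z ∈ sliceDom p q r, ε ≤ p * ‖z.1‖ ^ 2 + q * ‖z.2‖ ^ 2 →
      ∃ hz : Φ (Ψ (levelSection p q ε z)) = l, K z = ReducedSpace.mk Φ l _ hz)
    (hU : IsOpen U) (hE : ∀ y ∈ U, IsStdSectionAt E y)
    (hEs : ∀ y ∈ U, stdMoment p q (-1) (E y) = ε) (hE3 : ∀ y ∈ U, ‖(E y).2.2‖ ^ 2 + ε < r ^ 2)
    {z : ℂ²} (hz : z ∈ U) :
    HasSection Ω Φ l U (fun y => K (rotateCoord p q (E y))) (fun _ => stdForm2) z := by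
  have hp' : (1 : ℝ) ≤ p := by exact_mod_cast hp
  have hq' : (1 : ℝ) ≤ q := by exact_mod_cast hq
  have hball : ∀ y ∈ U, E y ∈ Metric.ball (0 : ℂ³) r := by
    intro y hy
    have h1 := hEs y hy
    have h2 := hE3 y hy
    rw [stdMoment_eq] at h1
    refine mem_ball_prod.2 ⟨?_, ?_, ?_⟩ <;> refine lt_of_pow_lt_pow_left₀ 2 hr.le ?_ <;>
      nlinarith [sq_nonneg ‖(E y).1‖, sq_nonneg ‖(E y).2.1‖]
  refine h.hasSection hΦ (by exact_mod_cast hp.ne') (by exact_mod_cast hq.ne') (by norm_num)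
    hl (f := E) (W := U) hU subset_rfl hz hE hball (fun y hy h0 => ?_) hEs (fun y hy => ?_)
  · have h1 := hEs y hy
    rw [h0] at h1
    simp [stdMoment] at h1
    exact hε.ne h1
  · have hv : Φ (Ψ (E y)) = l := by rw [h.moment_eq hΦ hr (hball y hy), hEs y hy, hl]
    obtain ⟨h1, h2, h3, h4⟩ := h.mk_eq_levelSection hr hΦ (hball y hy) hv (hEs y hy) (hE3 y hy)
    obtain ⟨h5, h6⟩ := hK _ h1 h2
    exact ⟨hv, by rw [h6, h4]⟩

theorem hasSection_exceptional₁ (h : IsEquivariantDarbouxChart Ω x p q (-1) r Ψ) (hp : 0 < p)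
    (hq : 0 < q) (hr : 0 < r) (hΦ : IsMomentMap Ω Φ) (hε : 0 < ε)
    (hl : Φ x + (ε : AddCircle T) = l)
    (hK : ∀ z ∈ sliceDom p q r, ε ≤ p * ‖z.1‖ ^ 2 + q * ‖z.2‖ ^ 2 →
      ∃ hz : Φ (Ψ (levelSection p q ε z)) = l, K z = ReducedSpace.mk Φ l _ hz) {z : ℂ²}
    (hz : z ∈ exceptionalDom₁ p q (ε / (p * q)) ∩
      exceptionalMap₁ p q (ε / (p * q)) ⁻¹' sliceDom p q r) :
    HasSection Ω Φ l (exceptionalDom₁ p q (ε / (p * q)) ∩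
      exceptionalMap₁ p q (ε / (p * q)) ⁻¹' sliceDom p q r)
      (fun y => K (exceptionalMap₁ p q (ε / (p * q)) y)) (fun _ => stdForm2) z := by
  have hU : exceptionalDom₁ p q (ε / (p * q)) ∩ exceptionalMap₁ p q (ε / (p * q)) ⁻¹' sliceDom p q r =
      {y | q * ‖y.1‖ ^ 2 < ε + ‖y.2‖ ^ 2 ∧ ‖y.2‖ ^ 2 + ε < r ^ 2} := by
    ext y
    rw [Set.mem_inter_iff, mem_exceptionalDom₁ hp hq, Set.mem_preimage, exceptionalMap₁_eq hp hq,
      mem_sliceDom hp hq hr, norm_rotateCoord_fst, norm_rotateCoord_snd, Set.mem_ofPred_eq]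
    refine and_congr_right fun hy => ?_
    rw [norm_exceptionalLift₁ hp hy.le]
    simp only [exceptionalLift₁]
    rw [sub_add_cancel, add_comm]
  simp only [exceptionalMap₁_eq hp hq] at hU ⊢
  rw [hU]
  refine h.hasSection_exceptional hp hq hr hΦ hε hl hK ?_
    (fun y hy => isStdSectionAt_exceptionalLift₁ hp hy.1)
    (fun y hy => stdMoment_exceptionalLift₁ hp (le_of_lt hy.1)) (fun y hy => hy.2) ?_
  · exact (isOpen_lt (f := fun y : ℂ² => (q : ℝ) * ‖y.1‖ ^ 2) (g := fun y => ε + ‖y.2‖ ^ 2)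
      (by fun_prop) (by fun_prop)).inter (isOpen_lt (f := fun y : ℂ² => ‖y.2‖ ^ 2 + ε)
      (g := fun _ => r ^ 2) (by fun_prop) (by fun_prop))
  · rwa [hU] at hz

theorem hasSection_exceptional₂ (h : IsEquivariantDarbouxChart Ω x p q (-1) r Ψ) (hp : 0 < p)
    (hq : 0 < q) (hr : 0 < r) (hΦ : IsMomentMap Ω Φ) (hε : 0 < ε)
    (hl : Φ x + (ε : AddCircle T) = l)
    (hK : ∀ z ∈ sliceDom p q r, ε ≤ p * ‖z.1‖ ^ 2 + q * ‖z.2‖ ^ 2 →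
      ∃ hz : Φ (Ψ (levelSection p q ε z)) = l, K z = ReducedSpace.mk Φ l _ hz) {z : ℂ²}
    (hz : z ∈ exceptionalDom₂ p q (ε / (p * q)) ∩
      exceptionalMap₂ p q (ε / (p * q)) ⁻¹' sliceDom p q r) :
    HasSection Ω Φ l (exceptionalDom₂ p q (ε / (p * q)) ∩
      exceptionalMap₂ p q (ε / (p * q)) ⁻¹' sliceDom p q r)
      (fun y => K (exceptionalMap₂ p q (ε / (p * q)) y)) (fun _ => stdForm2) z := by
  have hU : exceptionalDom₂ p q (ε / (p * q)) ∩ exceptionalMap₂ p q (ε / (p * q)) ⁻¹' sliceDom p q r =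
      {y | p * ‖y.1‖ ^ 2 < ε + ‖y.2‖ ^ 2 ∧ ‖y.2‖ ^ 2 + ε < r ^ 2} := by
    ext y
    rw [Set.mem_inter_iff, mem_exceptionalDom₂ hp hq, Set.mem_preimage, exceptionalMap₂_eq hp hq,
      mem_sliceDom hp hq hr, norm_rotateCoord_fst, norm_rotateCoord_snd, Set.mem_ofPred_eq]
    refine and_congr_right fun hy => ?_
    rw [norm_exceptionalLift₂ hq hy.le]
    simp only [exceptionalLift₂]
    rw [add_sub_cancel, add_comm]
  simp only [exceptionalMap₂_eq hp hq] at hU ⊢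
  rw [hU]
  refine h.hasSection_exceptional hp hq hr hΦ hε hl hK ?_
    (fun y hy => isStdSectionAt_exceptionalLift₂ hq hy.1)
    (fun y hy => stdMoment_exceptionalLift₂ hq (le_of_lt hy.1)) (fun y hy => hy.2) ?_
  · exact (isOpen_lt (f := fun y : ℂ² => (p : ℝ) * ‖y.1‖ ^ 2) (g := fun y => ε + ‖y.2‖ ^ 2)
      (by fun_prop) (by fun_prop)).inter (isOpen_lt (f := fun y : ℂ² => ‖y.2‖ ^ 2 + ε)
      (g := fun _ => r ^ 2) (by fun_prop) (by fun_prop))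
  · rwa [hU] at hz

end IsEquivariantDarbouxChart

end CriticalLevel

/-! ### Characteristic leaves of the boundary of an ellipsoid -/

theorem gauge_mul {p q : ℕ} (hp : 0 < p) (hq : 0 < q) (z : ℂ²) :
    p * q * gauge p q z = p * ‖z.1‖ ^ 2 + q * ‖z.2‖ ^ 2 := by
  unfold gauge
  field_simp

theorem hasFDerivAt_gauge (p q : ℕ) (z : ℂ²) : ∃ A : ℂ² →L[ℝ] ℝ,
    HasFDerivAt (gauge p q) A z ∧ ∀ v, A v = 2 * ((z.1.re * v.1.re + z.1.im * v.1.im) / q +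
      (z.2.re * v.2.re + z.2.im * v.2.im) / p) := by
  have h1 : HasFDerivAt (fun z : ℂ² => z.1)
    (ContinuousLinearMap.fst ℝ ℂ ℂ) z := (ContinuousLinearMap.fst ℝ ℂ ℂ).hasFDerivAt
  have h2 : HasFDerivAt (fun z : ℂ² => z.2)
    (ContinuousLinearMap.snd ℝ ℂ ℂ) z := (ContinuousLinearMap.snd ℝ ℂ ℂ).hasFDerivAt
  refine ⟨_, (h1.norm_sq.mul_const ((q : ℝ)⁻¹)).add (h2.norm_sq.mul_const ((p : ℝ)⁻¹)),
    fun v => ?_⟩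
  simp [Complex.inner]
  ring

theorem fderiv_gauge (p q : ℕ) (z v : ℂ²) : fderiv ℝ (gauge p q) z v =
    2 * ((z.1.re * v.1.re + z.1.im * v.1.im) / q + (z.2.re * v.2.re + z.2.im * v.2.im) / p) := by
  obtain ⟨A, h1, h2⟩ := hasFDerivAt_gauge p q z
  rw [h1.fderiv, h2]

theorem sameCharacteristicLeaf_of_smul {p q : ℕ} (hp : 0 < p) (hq : 0 < q) {δ : ℝ} {z w : ℂ²}
    (hz : gauge p q z = δ) (g : Circle) (h1 : (g : ℂ) ^ p * z.1 = w.1)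
    (h2 : (g : ℂ) ^ q * z.2 = w.2) : SameCharacteristicLeaf p q δ z w := by
  obtain ⟨k, rfl⟩ := Circle.exp_surjective g
  have hp' : (p : ℝ) ≠ 0 := by exact_mod_cast hp.ne'
  have hq' : (q : ℝ) ≠ 0 := by exact_mod_cast hq.ne'
  let e : ℕ → ℝ → ℂ := fun n t => Complex.exp ((n * k * t : ℝ) * Complex.I)
  have he : ∀ n, ContDiff ℝ ∞ (e n) := fun n => by
    refine ContDiff.cexp ?_
    exact (Complex.ofRealCLM.contDiff.comp (contDiff_const.mul contDiff_id)).mul contDiff_const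
  have hd : ∀ n t, HasDerivAt (e n) (e n t * ((n * k : ℝ) * Complex.I)) t := fun n t => by
    refine HasDerivAt.cexp ?_
    have h3 : HasDerivAt (fun t : ℝ => n * k * t) (n * k) t := by
      simpa using (hasDerivAt_id t).const_mul ((n : ℝ) * k)
    exact h3.ofReal_comp.mul_const Complex.I
  have hn : ∀ n t, ‖e n t‖ = 1 := fun n t => Complex.norm_exp_ofReal_mul_I _
  have he1 : ∀ n : ℕ, e n 1 = (Circle.exp k : ℂ) ^ n := fun n => by
    rw [Circle.coe_exp, ← Complex.exp_nat_mul]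
    simp only [e]
    congr 1
    push_cast
    ring
  refine ⟨fun t => (e p t * z.1, e q t * z.2),
    ((he p).mul contDiff_const).prodMk ((he q).mul contDiff_const), ?_, ?_, fun t => ?_,
    fun t v hv => ?_⟩
  · simp [e]
  · simp only [he1, h1, h2]
  · simp only [gauge, norm_mul, hn, one_mul]
    exact hz
  · have h3 : HasDerivAt (fun t => (e p t * z.1, e q t * z.2)) _ t :=
      ((hd p t).mul_const z.1).prodMk ((hd q t).mul_const z.2)
    rw [h3.deriv, stdForm2_apply]
    rw [fderiv_gauge] at hv
    have h4 : ∀ (n : ℕ) (b : ℂ), e n t * ((n * k : ℝ) * Complex.I) * b =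
        ((n * k : ℝ) : ℂ) * (Complex.I * (e n t * b)) := fun n b => by ring
    simp only [h4] at *
    generalize e p t * z.1 = x at *
    generalize e q t * z.2 = y at *
    have h5 : q * p * (2 * ((x.re * v.1.re + x.im * v.1.im) / q +
        (y.re * v.2.re + y.im * v.2.im) / p)) = 2 * (p * (x.re * v.1.re + x.im * v.1.im) +
        q * (y.re * v.2.re + y.im * v.2.im)) := by
      field_simp
    rw [hv, mul_zero] at h5
    simp only [Complex.re_ofReal_mul, Complex.im_ofReal_mul, Complex.I_mul_re, Complex.I_mul_im]
    refine mul_eq_zero_of_right _ ?_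
    linear_combination (k / 2) * h5

theorem exists_smul_of_sameCharacteristicLeaf {p q : ℕ} (hp : 0 < p) (hq : 0 < q) {δ : ℝ}
    (hδ : 0 < δ) {z w : ℂ²} (h : SameCharacteristicLeaf p q δ z w) :
    ∃ g : Circle, (g : ℂ) ^ p * z.1 = w.1 ∧ (g : ℂ) ^ q * z.2 = w.2 := by
  obtain ⟨c, hc, rfl, rfl, hg, hker⟩ := h
  have hp' : (0 : ℝ) < p := by exact_mod_cast hp
  have hq' : (0 : ℝ) < q := by exact_mod_cast hq
  have hc' : Continuous (deriv c) := hc.continuous_deriv (by simp)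
  have hcd : ∀ t, HasDerivAt c (deriv c t) t := fun t =>
    ((hc.differentiable (by simp)) t).hasDerivAt
  have hcc := hc.continuous
  set a := deriv c with ha
  let N : ℝ → ℝ := fun t => ‖(c t).1‖ ^ 2 / q ^ 2 + ‖(c t).2‖ ^ 2 / p ^ 2
  let M : ℝ → ℝ := fun t => ((a t).1.re * (c t).1.im - (a t).1.im * (c t).1.re) / q +
    ((a t).2.re * (c t).2.im - (a t).2.im * (c t).2.re) / p
  have hN : ∀ t, 0 < N t := fun t => by
    have h1 := hg t
    simp only [gauge] at h1
    rcases eq_or_ne (c t).1 0 with h2 | h2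
    · rcases eq_or_ne (c t).2 0 with h3 | h3
      · rw [h2, h3] at h1
        simp at h1
        exact absurd h1 hδ.ne
      · have := norm_pos_iff.2 h3
        positivity
    · have := norm_pos_iff.2 h2
      positivity
  have hμ : Continuous fun t => -(M t / N t) / (p * q) :=
    ((Continuous.div (by fun_prop) (by fun_prop) fun t => (hN t).ne').neg).div_const _
  have hvel : ∀ t, (a t).1 = Complex.I * ((p : ℂ) * ((-(M t / N t) / (p * q) : ℝ) : ℂ)) * (c t).1 ∧
      (a t).2 = Complex.I * ((q : ℂ) * ((-(M t / N t) / (p * q) : ℝ) : ℂ)) * (c t).2 := by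
    intro t
    have hNt : N t = ((c t).1.re ^ 2 + (c t).1.im ^ 2) / q ^ 2 +
        ((c t).2.re ^ 2 + (c t).2.im ^ 2) / p ^ 2 := by
      simp only [N, Complex.sq_norm, Complex.normSq_apply]
      ring
    have key : ∀ v : ℂ², (a t).1.re * v.1.im - (a t).1.im * v.1.re +
        ((a t).2.re * v.2.im - (a t).2.im * v.2.re) =
        (M t / N t) * (((c t).1.re * v.1.re + (c t).1.im * v.1.im) / q +
          ((c t).2.re * v.2.re + (c t).2.im * v.2.im) / p) := by
      intro v
      set s : ℝ := (((c t).1.re * v.1.re + (c t).1.im * v.1.im) / q +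
          ((c t).2.re * v.2.re + (c t).2.im * v.2.im) / p) / N t with hs
      have hsN : s * N t = ((c t).1.re * v.1.re + (c t).1.im * v.1.im) / q +
          ((c t).2.re * v.2.re + (c t).2.im * v.2.im) / p := div_mul_cancel₀ _ (hN t).ne'
      have h1 := hker t (v - s • ((q : ℝ)⁻¹ • (c t).1, (p : ℝ)⁻¹ • (c t).2)) (by
        rw [fderiv_gauge]
        rw [hNt] at hsN
        simp only [Prod.fst_sub, Prod.snd_sub, Prod.smul_fst, Prod.smul_snd, Complex.sub_re,
          Complex.sub_im, Complex.real_smul, Complex.mul_re, Complex.mul_im, Complex.ofReal_re,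
          Complex.ofReal_im, zero_mul, sub_zero, add_zero]
        linear_combination (-2) * hsN)
      rw [stdForm2_apply] at h1
      have h2 := (mul_eq_zero.1 h1).resolve_left (inv_ne_zero Real.pi_ne_zero)
      simp only [Prod.fst_sub, Prod.snd_sub, Prod.smul_fst, Prod.smul_snd, Complex.sub_re,
          Complex.sub_im, Complex.real_smul, Complex.mul_re, Complex.mul_im, Complex.ofReal_re,
          Complex.ofReal_im, zero_mul, sub_zero, add_zero] at h2
      have h3 : M t / N t * (s * N t) = M t * s := by
        field_simp [(hN t).ne']
      rw [← hsN, h3]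
      simp only [M]
      linear_combination h2
    obtain ⟨m, hm⟩ : ∃ m : ℝ, m = -(M t / N t) / (p * q) := ⟨_, rfl⟩
    have hK : M t / N t = -(p * q * m) := by
      rw [hm]
      field_simp
    rw [hK] at key
    rw [← hm]
    have k1 := key (1, 0)
    have k2 := key (Complex.I, 0)
    have k3 := key (0, 1)
    have k4 := key (0, Complex.I)
    simp at k1 k2 k3 k4
    field_simp at k1 k2 k3 k4
    constructor
    · refine Complex.ext ?_ ?_
      · simp
        linear_combination k2
      · simp
        linear_combination k1
    · refine Complex.ext ?_ ?_
      · simp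
        linear_combination k4
      · simp
        linear_combination k3
  set μ : ℝ → ℝ := fun t => -(M t / N t) / (p * q) with hμdef
  have hθ : ∀ t, HasDerivAt (fun t => ∫ s in (0 : ℝ)..t, μ s) (μ t) t := fun t =>
    intervalIntegral.integral_hasDerivAt_right (hμ.intervalIntegrable _ _)
      (hμ.stronglyMeasurableAtFilter _ _) hμ.continuousAt
  set θ : ℝ → ℝ := fun t => ∫ s in (0 : ℝ)..t, μ s with hθdef
  have hθ0 : θ 0 = 0 := intervalIntegral.integral_same
  have rot : ∀ (n : ℕ) (f f' : ℝ → ℂ), (∀ t, HasDerivAt f (f' t) t) →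
      (∀ t, f' t = Complex.I * ((n : ℂ) * (μ t : ℂ)) * f t) →
      (Circle.exp (θ 1) : ℂ) ^ n * f 0 = f 1 := by
    intro n f f' hf hf'
    let F : ℝ → ℂ := fun t => Complex.exp (-(n * (θ t : ℂ) * Complex.I)) * f t
    have hF : ∀ t, HasDerivAt F 0 t := fun t => by
      have h1 : HasDerivAt (fun t => -((n : ℂ) * (θ t : ℂ) * Complex.I))
          (-((n : ℂ) * (μ t : ℂ) * Complex.I)) t :=
        (((hθ t).ofReal_comp.const_mul (n : ℂ)).mul_const Complex.I).neg
      have h2 := h1.cexp.mul (hf t)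
      refine h2.congr_deriv ?_
      rw [hf']
      ring
    have h3 : F 0 = F 1 := is_const_of_deriv_eq_zero (fun t => (hF t).differentiableAt)
      (fun t => (hF t).deriv) 0 1
    simp only [F, hθ0, Complex.ofReal_zero, mul_zero, zero_mul, neg_zero, Complex.exp_zero,
      one_mul] at h3
    rw [h3, Circle.coe_exp, ← Complex.exp_nat_mul, ← mul_assoc, ← Complex.exp_add]
    have : (n : ℂ) * ((θ 1 : ℂ) * Complex.I) + -(n * (θ 1 : ℂ) * Complex.I) = 0 := by ring
    rw [this, Complex.exp_zero, one_mul]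
  refine ⟨Circle.exp (θ 1), rot p _ _ (fun t => ?_) (fun t => (hvel t).1),
    rot q _ _ (fun t => ?_) (fun t => (hvel t).2)⟩
  · exact ((ContinuousLinearMap.fst ℝ ℂ ℂ).hasFDerivAt.comp_hasDerivAt t (hcd t))
  · exact ((ContinuousLinearMap.snd ℝ ℂ ℂ).hasFDerivAt.comp_hasDerivAt t (hcd t))

/-! ### Local flows -/

/-- Smooth dependence of the local flow of an autonomous smooth vector field on time and on the
initial value. -/
theorem exists_local_flow {E : Type} [NormedAddCommGroup E] [NormedSpace ℝ E]
    [FiniteDimensional ℝ E] {v : E → E} {O : Set E} (hO : IsOpen O) (hv : ContDiffOn ℝ ∞ v O)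
    {y₀ : E} (hy₀ : y₀ ∈ O) :
    ∃ (U : Set (ℝ × E)) (H : ℝ × E → E), IsOpen U ∧ ((0 : ℝ), y₀) ∈ U ∧ ContDiffOn ℝ ∞ H U ∧
      (∀ z ∈ U, H z ∈ O) ∧ (∀ z ∈ U, z.1 = 0 → H z = z.2) ∧
      ∀ z ∈ U, HasDerivAt (fun s => H (s, z.2)) (v (H z)) z.1 := by
  have : CompleteSpace E := FiniteDimensional.complete ℝ E
  obtain ⟨w, hw, hwv⟩ := exists_contDiff_eventuallyEq hO isClosed_singleton
    (Set.singleton_subset_iff.2 hy₀) hv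
  rw [nhdsSet_singleton] at hwv
  have hf : ContDiff ℝ ∞ fun z : ℝ × ℝ × E => z.2.1 • w z.2.2 :=
    (contDiff_fst.comp contDiff_snd).smul (hw.comp (contDiff_snd.comp contDiff_snd))
  have hfd : ∀ z h : ℝ × ℝ × E, fderiv ℝ (fun z : ℝ × ℝ × E => z.2.1 • w z.2.2) z h =
      z.2.1 • fderiv ℝ w z.2.2 h.2.2 + h.2.1 • w z.2.2 := by
    intro z h
    have h1 : HasFDerivAt (fun z : ℝ × ℝ × E => z.2.1) ((ContinuousLinearMap.fst ℝ ℝ E).comp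
        (ContinuousLinearMap.snd ℝ ℝ (ℝ × E))) z :=
      ((ContinuousLinearMap.fst ℝ ℝ E).comp (ContinuousLinearMap.snd ℝ ℝ (ℝ × E))).hasFDerivAt
    have h2 : HasFDerivAt (fun z : ℝ × ℝ × E => z.2.2) ((ContinuousLinearMap.snd ℝ ℝ E).comp
        (ContinuousLinearMap.snd ℝ ℝ (ℝ × E))) z :=
      ((ContinuousLinearMap.snd ℝ ℝ E).comp (ContinuousLinearMap.snd ℝ ℝ (ℝ × E))).hasFDerivAt
    have h3 := h1.smul (((hw.differentiable (by simp)) z.2.2).hasFDerivAt.comp z h2)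
    have h4 : HasFDerivAt (fun z : ℝ × ℝ × E => z.2.1 • w z.2.2) _ z := h3
    rw [h4.fderiv]
    simp
  let f : C(ℝ × ℝ × E, E) := ⟨fun z => z.2.1 • w z.2.2, hf.continuous⟩
  obtain ⟨U, G, hU, h0U, hG, hG0, hsol⟩ := exists_smooth_solution (P := ℝ) f hf 0 y₀
    (fun t _ => by simp [f]) (fun t _ u => by
      change fderiv ℝ (fun z : ℝ × ℝ × E => z.2.1 • w z.2.2) _ _ = 0
      rw [hfd]
      simp)
  have h1mem : (1 : ℝ) ∈ TimeInterval := ⟨by norm_num, by norm_num⟩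
  have h0mem : (0 : ℝ) ∈ TimeInterval := ⟨by norm_num, by norm_num⟩
  have hH := contDiffOn_extendTime hG h1mem
  have hHc : ContinuousOn (fun z => extendTime (G z) 1) U := hH.continuousOn
  have hinit : ∀ z ∈ U, extendTime (G z) 0 = z.2 := by
    intro z hz
    rw [extendTime_of_mem _ h0mem, hsol z hz]
    simp [primitive]
  have hN : {y | w y = v y} ∩ O ∈ 𝓝 y₀ := Filter.inter_mem hwv (hO.mem_nhds hy₀)
  obtain ⟨N, hNs, hNo, hyN⟩ := mem_nhds_iff.1 hN
  refine ⟨U ∩ (fun z => extendTime (G z) 1) ⁻¹' N, fun z => extendTime (G z) 1,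
    hHc.isOpen_inter_preimage hU hNo, ⟨h0U, ?_⟩, hH.mono Set.inter_subset_left,
    fun z hz => (hNs hz.2).2, ?_, ?_⟩
  · change extendTime (G (0, y₀)) 1 ∈ N
    rw [hG0, extendTime_of_mem _ h1mem]
    exact hyN
  · rintro ⟨s, y⟩ hz (rfl : s = 0)
    have h2 := hsol _ hz.1
    have h3 : f.comp (graphPath ((0 : ℝ), G ((0 : ℝ), y))) = 0 := by
      ext t
      simp [f, graphPath]
    rw [h3, map_zero, add_zero] at h2
    change extendTime (G (0, y)) 1 = y
    rw [extendTime_of_mem _ h1mem, h2]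
    rfl
  · rintro ⟨s, y⟩ ⟨hz, hzN⟩
    have hGz : HasFDerivAt G (fderiv ℝ G (s, y)) (s, y) :=
      ((hG.contDiffAt (hU.mem_nhds hz)).differentiableAt (by simp)).hasFDerivAt
    set W : ℝ → E := fun t => extendTime (fderiv ℝ G (s, y) (1, 0)) t with hW
    set γ : ℝ → E := extendTime (G (s, y)) with hγ
    have hγc : Continuous γ := continuous_extendTime _
    have hIoo : ∀ t ∈ Set.Icc (0 : ℝ) 1, t ∈ Set.Ioo (-2 : ℝ) 2 := fun t ht =>
      ⟨by linarith [ht.1], by linarith [ht.2]⟩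
    have hWd : ∀ t ∈ Set.Icc (0 : ℝ) 1,
        HasDerivAt W (s • fderiv ℝ w (γ t) (W t) + w (γ t)) t := fun t ht => by
      have h2 := hasDerivAt_fderiv_solution (f := f) hf hU hG hsol hz (1, 0) (hIoo t ht)
      have h3 : fderiv ℝ f (t, s, γ t) (0, 1, W t) = s • fderiv ℝ w (γ t) (W t) + w (γ t) := by
        refine (hfd _ _).trans ?_
        simp
      exact h2.congr_deriv h3
    have hγd : ∀ t ∈ Set.Icc (0 : ℝ) 1, HasDerivAt γ (s • w (γ t)) t := fun t ht => by
      have h2 := hasDerivAt_of_eq_primitive (hsol _ hz) (hIoo t ht)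
      rw [extendTime_of_mem _ (Set.Ioo_subset_Icc_self (hIoo t ht))] at h2
      refine h2.congr_deriv ?_
      simp [f, graphPath, hγ, extendTime_of_mem _ (Set.Ioo_subset_Icc_self (hIoo t ht))]
    have hZd : ∀ t ∈ Set.Icc (0 : ℝ) 1, HasDerivAt (fun t => t • w (γ t))
        (s • fderiv ℝ w (γ t) (t • w (γ t)) + w (γ t)) t := fun t ht => by
      have h2 : HasDerivAt (fun t => w (γ t)) (fderiv ℝ w (γ t) (s • w (γ t))) t :=
        ((hw.differentiable (by simp)) (γ t)).hasFDerivAt.comp_hasDerivAt t (hγd t ht)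
      have h3 := (hasDerivAt_id t).smul h2
      refine h3.congr_deriv ?_
      simp [smul_smul, mul_comm]
    have hcont : Continuous fun t => s • fderiv ℝ w (γ t) :=
      ((hw.continuous_fderiv (by simp)).comp hγc).const_smul s
    obtain ⟨C, hC⟩ := isCompact_Icc.exists_bound_of_continuousOn (s := Set.Icc (0 : ℝ) 1)
      hcont.continuousOn
    have hC0 : 0 ≤ C := (norm_nonneg _).trans (hC 0 ⟨le_rfl, zero_le_one⟩)
    have huniq := ODE_solution_unique_of_mem_Icc_right (a := (0 : ℝ)) (b := 1)
      (v := fun t z => s • fderiv ℝ w (γ t) z + w (γ t)) (s := fun _ => Set.univ)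
      (f := W) (g := fun t => t • w (γ t)) (K := ⟨C, hC0⟩)
      (fun t ht => by
        refine LipschitzOnWith.of_dist_le_mul fun a _ b _ => ?_
        rw [dist_add_right, dist_eq_norm, ← smul_sub, ← map_sub, dist_eq_norm]
        exact ((s • fderiv ℝ w (γ t)).le_opNorm (a - b)).trans
          (mul_le_mul_of_nonneg_right (hC t (Set.Ico_subset_Icc_self ht)) (norm_nonneg _)))
      (fun t ht => (hWd t ht).continuousAt.continuousWithinAt)
      (fun t ht => (hWd t (Set.Ico_subset_Icc_self ht)).hasDerivWithinAt)
      (fun _ _ => Set.mem_univ _)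
      (fun t ht => (hZd t ht).continuousAt.continuousWithinAt)
      (fun t ht => (hZd t (Set.Ico_subset_Icc_self ht)).hasDerivWithinAt)
      (fun _ _ => Set.mem_univ _) (by
        have h2 := hasFDerivAt_extendTime hGz ⟨0, h0mem⟩
        have h3 : HasFDerivAt (fun z : ℝ × E => extendTime (G z) 0)
            (ContinuousLinearMap.snd ℝ ℝ E) (s, y) := by
          refine (ContinuousLinearMap.snd ℝ ℝ E).hasFDerivAt.congr_of_eventuallyEq ?_
          filter_upwards [hU.mem_nhds hz] with z hz using hinit z hz
        have h4 := congrArg (fun A : (ℝ × E) →L[ℝ] E => A (1, 0)) (h2.unique h3)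
        have h5 : W 0 = fderiv ℝ G (s, y) (1, 0) ⟨0, h0mem⟩ := extendTime_of_mem _ h0mem
        simpa [h5] using h4)
    have h2 := hasFDerivAt_extendTime hGz ⟨1, h1mem⟩
    have h3 : HasDerivAt (fun s => ((s, y) : ℝ × E)) (1, 0) s :=
      (hasDerivAt_id s).prodMk (hasDerivAt_const s y)
    have h4 := h2.comp_hasDerivAt s h3
    refine h4.congr_deriv ?_
    have h5 : W 1 = fderiv ℝ G (s, y) (1, 0) ⟨1, h1mem⟩ := extendTime_of_mem _ h1mem
    have h6 : W 1 = (1 : ℝ) • w (γ 1) := huniq ⟨zero_le_one, le_rfl⟩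
    rw [one_smul] at h6
    have h7 : w (γ 1) = v (γ 1) := (hNs hzN).1
    exact (h5.symm.trans h6).trans h7

/-! ### Vector fields and flows on manifolds -/

section Field

variable {X : Type*} [TopologicalSpace X] [ChartedSpace E₆ X]
  [IsManifold (𝓡 6) ∞ X]

/-- The expression of a vector field in the preferred chart at `x`. -/
def fieldInChart (V : (x : X) → TangentSpace (𝓡 6) x) (x : X) (y : E₆) :
    E₆ :=
  mfderiv (𝓡 6) 𝓘(ℝ, E₆) (extChartAt (𝓡 6) x)
    ((extChartAt (𝓡 6) x).symm y) (V ((extChartAt (𝓡 6) x).symm y))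

theorem contMDiffAt_field_iff (V : (x : X) → TangentSpace (𝓡 6) x) {x₀ x : X}
    (hx : x ∈ (extChartAt (𝓡 6) x₀).source) :
    ContMDiffAt (𝓡 6) (𝓡 6).tangent ∞ (fun x => (⟨x, V x⟩ : TangentBundle (𝓡 6) X)) x ↔
      ContDiffAt ℝ ∞ (fieldInChart V x₀) (extChartAt (𝓡 6) x₀ x) := by
  rw [extChartAt_source] at hx
  have h1 : (fun x => (trivializationAt E₆ (TangentSpace (𝓡 6)) x₀
      (⟨x, V x⟩ : TangentBundle (𝓡 6) X)).2) =ᶠ[𝓝 x]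
      fun x => mfderiv (𝓡 6) 𝓘(ℝ, E₆) (extChartAt (𝓡 6) x₀) x (V x) := by
    filter_upwards [(chartAt E₆ x₀).open_source.mem_nhds hx] with x hx
    rw [← TangentBundle.continuousLinearMapAt_trivializationAt hx]
    exact (Bundle.Trivialization.continuousLinearMapAt_apply_of_mem _ _ (by simpa using hx) _).symm
  have key : ∀ f : X → E₆,
      ContMDiffAt (𝓡 6) 𝓘(ℝ, E₆) ∞ f x ↔
      ContDiffAt ℝ ∞ (fun y => f ((extChartAt (𝓡 6) x₀).symm y)) (extChartAt (𝓡 6) x₀ x) := by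
    intro f
    rw [contMDiffAt_iff_source_of_mem_source (x := x₀) hx]
    simp only [ModelWithCorners.range_eq_univ, contMDiffWithinAt_univ]
    exact contMDiffAt_iff_contDiffAt
  rw [(trivializationAt E₆ (TangentSpace (𝓡 6)) x₀).contMDiffAt_section_iff
    (s := V) (by simpa using hx), Filter.EventuallyEq.contMDiffAt_iff h1]
  exact key _

theorem mfderiv_symm_fieldInChart (V : (x : X) → TangentSpace (𝓡 6) x) {x₀ : X}
    {y : E₆} (hy : y ∈ (extChartAt (𝓡 6) x₀).target) :
    (mfderiv 𝓘(ℝ, E₆) (𝓡 6) (extChartAt (𝓡 6) x₀).symm y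
      (fieldInChart V x₀ y) : E₆) = V ((extChartAt (𝓡 6) x₀).symm y) := by
  have h := mfderivWithin_extChartAt_symm_comp_mfderiv_extChartAt (I := 𝓡 6) (x := x₀) hy
  rw [ModelWithCorners.range_eq_univ, mfderivWithin_univ] at h
  exact congrArg (fun A : E₆ →L[ℝ] E₆ =>
    A (V ((extChartAt (𝓡 6) x₀).symm y))) h

/-- Smooth vector fields. -/
def IsSmoothField (V : (x : X) → TangentSpace (𝓡 6) x) : Prop :=
  ContMDiff (𝓡 6) (𝓡 6).tangent ∞ (fun x => (⟨x, V x⟩ : TangentBundle (𝓡 6) X))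

theorem IsSmoothField.contDiffOn {V : (x : X) → TangentSpace (𝓡 6) x} (hV : IsSmoothField V)
    (x₀ : X) : ContDiffOn ℝ ∞ (fieldInChart V x₀) (extChartAt (𝓡 6) x₀).target := by
  intro y hy
  have h1 := (contMDiffAt_field_iff V ((extChartAt (𝓡 6) x₀).map_target hy)).1 (hV _)
  rw [(extChartAt (𝓡 6) x₀).right_inv hy] at h1
  exact h1.contDiffWithinAt

/-- `F` is the flow of the vector field `V` for times in `(-ε, ε)`. -/
structure IsFlow (V : (x : X) → TangentSpace (𝓡 6) x) (ε : ℝ) (F : ℝ → X → X) : Prop where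
  pos : 0 < ε
  zero : ∀ x, F 0 x = x
  smooth : ∀ t ∈ Set.Ioo (-ε) ε, ∀ x,
    ContMDiffAt (𝓘(ℝ, ℝ).prod (𝓡 6)) (𝓡 6) ∞ (fun z : ℝ × X => F z.1 z.2) (t, x)
  deriv : ∀ x, ∀ t ∈ Set.Ioo (-ε) ε,
    HasMFDerivAt 𝓘(ℝ, ℝ) (𝓡 6) (fun s => F s x) t ((1 : ℝ →L[ℝ] ℝ).smulRight (V (F t x)))

theorem exists_flow_near {V : (x : X) → TangentSpace (𝓡 6) x} (hV : IsSmoothField V) (x₀ : X) :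
    ∃ (W : Set X) (ε : ℝ) (G : ℝ → X → X), IsOpen W ∧ x₀ ∈ W ∧ 0 < ε ∧ (∀ x ∈ W, G 0 x = x) ∧
      (∀ t ∈ Set.Ioo (-ε) ε, ∀ x ∈ W,
        ContMDiffAt (𝓘(ℝ, ℝ).prod (𝓡 6)) (𝓡 6) ∞ (fun z : ℝ × X => G z.1 z.2) (t, x)) ∧
      ∀ x ∈ W, ∀ t ∈ Set.Ioo (-ε) ε,
        HasMFDerivAt 𝓘(ℝ, ℝ) (𝓡 6) (fun s => G s x) t
          ((1 : ℝ →L[ℝ] ℝ).smulRight (V (G t x))) := by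
  set φ := extChartAt (𝓡 6) x₀
  obtain ⟨U, H, hU, h0U, hH, hHt, hH0, hHd⟩ := exists_local_flow (isOpen_extChartAt_target x₀)
    (hV.contDiffOn x₀) (mem_extChartAt_target x₀)
  obtain ⟨I, hI, N, hN, hIN⟩ := mem_nhds_prod_iff.1 (hU.mem_nhds h0U)
  obtain ⟨ε, hε, hεI⟩ := Metric.mem_nhds_iff.1 hI
  rw [Real.ball_eq_Ioo, zero_sub, zero_add] at hεI
  obtain ⟨N', hN'N, hN'o, hxN'⟩ := mem_nhds_iff.1 hN
  have hmem : ∀ t ∈ Set.Ioo (-ε) ε, ∀ y ∈ N', (t, y) ∈ U := fun t ht y hy =>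
    hIN ⟨hεI ht, hN'N hy⟩
  refine ⟨φ.source ∩ φ ⁻¹' N', ε, fun t x => φ.symm (H (t, φ x)),
    (continuousOn_extChartAt x₀).isOpen_inter_preimage (isOpen_extChartAt_source x₀) hN'o,
    ⟨mem_extChartAt_source x₀, hxN'⟩, hε, fun x hx => ?_, fun t ht x hx => ?_, fun x hx t ht => ?_⟩
  · change φ.symm (H (0, φ x)) = x
    rw [hH0 _ (hmem 0 ⟨by linarith, hε⟩ _ hx.2) rfl]
    exact φ.left_inv hx.1
  · have hm := hmem t ht _ hx.2
    have h1 : ContMDiffAt (𝓘(ℝ, ℝ).prod (𝓡 6)) 𝓘(ℝ, ℝ × E₆) ∞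
        (fun z : ℝ × X => (z.1, φ z.2)) (t, x) := by
      refine contMDiffAt_fst.prodMk_space ?_
      exact ContMDiffAt.comp (t, x) (contMDiffAt_chart hx.1) contMDiffAt_snd
    have h2 : ContMDiffAt 𝓘(ℝ, ℝ × E₆) 𝓘(ℝ, E₆) ∞ H
        (t, φ x) := (hH.contDiffAt (hU.mem_nhds hm)).contMDiffAt
    have h3 := ContMDiffAt.comp (t, x) (contMDiffAt_extChartAt_symm (hHt _ hm))
      (ContMDiffAt.comp (t, x) h2 h1)
    exact h3
  · have hm := hmem t ht _ hx.2
    have h1 := (hHd _ hm).hasFDerivAt.hasMFDerivAt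
    have h2 := ((contMDiffAt_extChartAt_symm (hHt _ hm)).mdifferentiableAt
      (by simp)).hasMFDerivAt
    have h3 := HasMFDerivAt.comp t h2 h1
    refine h3.congr_mfderiv ?_
    refine ContinuousLinearMap.ext fun (a : ℝ) => ?_
    have h4 := mfderiv_symm_fieldInChart V (hHt _ hm)
    have h5 : ∀ (A : E₆ →L[ℝ] E₆)
        (b c : E₆), A b = c → A (a • b) = a • c := fun A b c h => by
      rw [map_smul, h]
    exact h5 _ _ _ h4

theorem integralCurve_eqOn [T2Space X] {V : (x : X) → TangentSpace (𝓡 6) x}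
    (hV : IsSmoothField V) {γ γ' : ℝ → X} {a b t₀ : ℝ} (ht₀ : t₀ ∈ Set.Ioo a b)
    (hγ : ∀ t ∈ Set.Ioo a b, HasMFDerivAt 𝓘(ℝ, ℝ) (𝓡 6) γ t
      ((1 : ℝ →L[ℝ] ℝ).smulRight (V (γ t))))
    (hγ' : ∀ t ∈ Set.Ioo a b, HasMFDerivAt 𝓘(ℝ, ℝ) (𝓡 6) γ' t
      ((1 : ℝ →L[ℝ] ℝ).smulRight (V (γ' t))))
    (h : γ t₀ = γ' t₀) : Set.EqOn γ γ' (Set.Ioo a b) := by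
  have : IsManifold (𝓡 6) 1 X := IsManifold.of_le (n := ∞) (by norm_cast)
  have hV1 : ContMDiff (𝓡 6) (𝓡 6).tangent 1 (fun x => (⟨x, V x⟩ : TangentBundle (𝓡 6) X)) :=
    ContMDiff.of_le hV (by norm_cast)
  exact isMIntegralCurveOn_Ioo_eqOn_of_contMDiff_boundaryless ht₀ hV1
    (fun t ht => (hγ t ht).hasMFDerivWithinAt) (fun t ht => (hγ' t ht).hasMFDerivWithinAt) h

theorem exists_flow [T2Space X] [CompactSpace X] {V : (x : X) → TangentSpace (𝓡 6) x}
    (hV : IsSmoothField V) : ∃ (ε : ℝ) (F : ℝ → X → X), IsFlow V ε F := by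
  choose W e G hWo hxW he hG0 hGs hGd using exists_flow_near hV
  obtain ⟨S, -, hS⟩ := isCompact_univ.elim_nhds_subcover W fun x _ => (hWo x).mem_nhds (hxW x)
  have hcov : ∀ x, ∃ i ∈ S, x ∈ W i := fun x => by
    simpa using hS (Set.mem_univ x)
  choose i hiS hi using hcov
  obtain ⟨ε, hε, hεe⟩ : ∃ ε : ℝ, 0 < ε ∧ ∀ j ∈ S, ε ≤ e j := by
    rcases S.eq_empty_or_nonempty with h | h
    · exact ⟨1, one_pos, by simp [h]⟩
    · obtain ⟨j, hj, hmin⟩ := S.exists_min_image e h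
      exact ⟨e j, he j, hmin⟩
  have hsub : ∀ j ∈ S, Set.Ioo (-ε) ε ⊆ Set.Ioo (-e j) (e j) := fun j hj t ht =>
    ⟨by linarith [ht.1, hεe j hj], by linarith [ht.2, hεe j hj]⟩
  have hF : ∀ j ∈ S, ∀ x ∈ W j, ∀ t ∈ Set.Ioo (-ε) ε, G (i x) t x = G j t x := by
    intro j hj x hx
    exact integralCurve_eqOn hV (t₀ := 0) ⟨by linarith, hε⟩
      (fun t ht => hGd (i x) x (hi x) t (hsub _ (hiS x) ht))
      (fun t ht => hGd j x hx t (hsub j hj ht)) (by rw [hG0 _ _ (hi x), hG0 j x hx])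
  refine ⟨ε, fun t x => G (i x) t x, hε, fun x => hG0 _ _ (hi x), fun t ht x => ?_,
    fun x t ht => hGd (i x) x (hi x) t (hsub _ (hiS x) ht)⟩
  refine (hGs (i x) t (hsub _ (hiS x) ht) x (hi x)).congr_of_eventuallyEq ?_
  filter_upwards [(isOpen_Ioo.prod (hWo (i x))).mem_nhds ⟨ht, hi x⟩] with z hz
  exact hF (i x) (hiS x) z.2 hz.2 z.1 hz.1

namespace IsFlow

variable {V : (x : X) → TangentSpace (𝓡 6) x} {ε : ℝ} {F : ℝ → X → X}

theorem eq_of_integralCurve [T2Space X] (h : IsFlow V ε F) (hV : IsSmoothField V) {a b : ℝ}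
    (ha : -ε ≤ a) (hb : b ≤ ε) (h0 : (0 : ℝ) ∈ Set.Ioo a b) {γ : ℝ → X}
    (hγ : ∀ t ∈ Set.Ioo a b, HasMFDerivAt 𝓘(ℝ, ℝ) (𝓡 6) γ t
      ((1 : ℝ →L[ℝ] ℝ).smulRight (V (γ t)))) {t : ℝ} (ht : t ∈ Set.Ioo a b) :
    F t (γ 0) = γ t :=
  integralCurve_eqOn hV h0 (fun t ht => h.deriv _ t ⟨by linarith [ht.1], by linarith [ht.2]⟩) hγ
    (h.zero _) ht

theorem contMDiffAt_comp (h : IsFlow V ε F) {E : Type} [NormedAddCommGroup E] [NormedSpace ℝ E]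
    {θ : E → ℝ} {σ : E → X} {y : E} (hy : θ y ∈ Set.Ioo (-ε) ε) (hθ : ContDiffAt ℝ ∞ θ y)
    (hσ : ContMDiffAt 𝓘(ℝ, E) (𝓡 6) ∞ σ y) :
    ContMDiffAt 𝓘(ℝ, E) (𝓡 6) ∞ (fun z => F (θ z) (σ z)) y :=
  ContMDiffAt.comp y (g := fun z : ℝ × X => F z.1 z.2) (f := fun z => (θ z, σ z))
    (h.smooth _ hy _) (hθ.contMDiffAt.prodMk hσ)

theorem continuousOn (h : IsFlow V ε F) :
    ContinuousOn (fun z : ℝ × X => F z.1 z.2) (Set.Ioo (-ε) ε ×ˢ Set.univ) :=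
  fun z hz => (h.smooth z.1 hz.1 z.2).continuousAt.continuousWithinAt

theorem contMDiff (h : IsFlow V ε F) {t : ℝ} (ht : t ∈ Set.Ioo (-ε) ε) :
    ContMDiff (𝓡 6) (𝓡 6) ∞ (F t) := fun x =>
  ContMDiffAt.comp x (g := fun z : ℝ × X => F z.1 z.2) (f := fun x => (t, x))
    (h.smooth _ ht _) (contMDiffAt_const.prodMk contMDiffAt_id)

theorem neg_apply [T2Space X] (h : IsFlow V ε F) (hV : IsSmoothField V) {s : ℝ} (hs : 2 * |s| < ε)
    (x : X) : F (-s) (F s x) = x := by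
  obtain ⟨h1, h2⟩ := abs_lt.1 (show |s| < ε / 2 by linarith)
  have h3 := h.pos
  have key := h.eq_of_integralCurve hV (a := -(ε / 2)) (b := ε / 2) (by linarith) (by linarith)
    ⟨by linarith, by linarith⟩ (γ := fun t => F (t + s) x) (fun t ht => ?_) (t := -s)
    ⟨by linarith, by linarith⟩
  · simpa [h.zero] using key
  · have h4 := h.deriv x (t + s) ⟨by linarith [ht.1], by linarith [ht.2]⟩
    have h5 : HasMFDerivAt 𝓘(ℝ, ℝ) 𝓘(ℝ, ℝ) (fun t : ℝ => t + s) t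
        ((1 : ℝ →L[ℝ] ℝ).smulRight (1 : ℝ)) :=
      ((hasDerivAt_id t).add_const s).hasFDerivAt.hasMFDerivAt
    refine (HasMFDerivAt.comp t h4 h5).congr_mfderiv ?_
    refine ContinuousLinearMap.ext fun (a : ℝ) => ?_
    have h6 : ∀ b : E₆, (a • (1 : ℝ)) • b = a • b := fun b => by simp
    exact h6 _

end IsFlow

end Field

section Average

variable {X : Type*} [TopologicalSpace X] [ChartedSpace E₆ X]
  [IsManifold (𝓡 6) ∞ X]
  [MulAction Circle X] [ContMDiffSMul (𝓡 1) (𝓡 6) ∞ Circle X]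
  {Ω : (x : X) → TangentSpace (𝓡 6) x [⋀^Fin 2]→L[ℝ] ℝ} {T : ℝ} {Φ : X → AddCircle T}

/-- The derivative of the action of `g` at `x`, as an endomorphism of the model space. -/
def smulDeriv (g : Circle) (x : X) : E₆ →L[ℝ] E₆ :=
  mfderiv (𝓡 6) (𝓡 6) (fun y : X => g • y) x

theorem hasMFDerivAt_smul (g : Circle) (x : X) :
    HasMFDerivAt (𝓡 6) (𝓡 6) (fun y : X => g • y) x (smulDeriv g x) :=
  ((contMDiff_const_smul g x).mdifferentiableAt (by simp)).hasMFDerivAt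

theorem smulDeriv_mul (g k : Circle) (x : X) (u : E₆) :
    smulDeriv (g * k) x u = smulDeriv g (k • x) (smulDeriv k x u) := by
  have h := (HasMFDerivAt.comp x (hasMFDerivAt_smul g (k • x)) (hasMFDerivAt_smul k x)).mfderiv
  have h1 : (fun y : X => g • y) ∘ (fun y : X => k • y) = fun y => (g * k) • y :=
    funext fun y => (mul_smul g k y).symm
  rw [h1] at h
  exact congrArg (fun A : E₆ →L[ℝ] E₆ => A u) h

theorem smulDeriv_one (x : X) (u : E₆) : smulDeriv 1 x u = u := by
  have h1 : (fun y : X => (1 : Circle) • y) = id := funext fun y => one_smul _ y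
  have h2 : HasMFDerivAt (𝓡 6) (𝓡 6) (fun y : X => (1 : Circle) • y) x
      (ContinuousLinearMap.id ℝ E₆) := by
    rw [h1]
    exact hasMFDerivAt_id x
  exact congrArg (fun A : E₆ →L[ℝ] E₆ => A u) h2.mfderiv

/-- A vector field that is invariant under the action. -/
def IsInvariantField (V : (x : X) → TangentSpace (𝓡 6) x) : Prop :=
  ∀ (g : Circle) (x : X), smulDeriv g x (V x) = V (g • x)

theorem form_smulDeriv_generator (hinv : IsInvariantForm Ω) (g : Circle) {x y : X} (hy : g • x = y)
    (u : E₆) :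
    (Ω y : E₆ [⋀^Fin 2]→L[ℝ] ℝ) ![smulDeriv g x u, generator y] =
      (Ω x : E₆ [⋀^Fin 2]→L[ℝ] ℝ) ![u, generator x] := by
  subst hy
  have h1 := congrArg (fun α : E₆ [⋀^Fin 2]→L[ℝ] ℝ => α ![u, generator x])
    (hinv g x)
  have h2 := (compContinuousLinearMap_pair (E := E₆)
    (F := E₆) (Ω (g • x)) (smulDeriv g x) u (generator x)).symm.trans h1
  have h3 : smulDeriv g x (generator x) = generator (g • x) := mfderiv_smul_generator g x
  rw [h3] at h2
  exact h2

theorem IsFlow.smul_apply [T2Space X] {V : (x : X) → TangentSpace (𝓡 6) x} {ε : ℝ} {F : ℝ → X → X}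
    (h : IsFlow V ε F) (hV : IsSmoothField V) (hVi : IsInvariantField V) {t : ℝ}
    (ht : t ∈ Set.Ioo (-ε) ε) (g : Circle) (x : X) : F t (g • x) = g • F t x := by
  have h3 := h.pos
  have key := h.eq_of_integralCurve hV (a := -ε) (b := ε) le_rfl le_rfl
    ⟨by linarith, by linarith⟩ (γ := fun t => g • F t x) (fun t ht => ?_) ht
  · simpa [h.zero] using key
  · refine (HasMFDerivAt.comp t (hasMFDerivAt_smul g (F t x)) (h.deriv x t ht)).congr_mfderiv ?_
    refine ContinuousLinearMap.ext fun (a : ℝ) => ?_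
    have h6 : ∀ (A : E₆ →L[ℝ] E₆)
        (b c : E₆), A b = c → A (a • b) = a • c := fun A b c h => by
      rw [map_smul, h]
    exact h6 _ _ _ (hVi g (F t x))

theorem form_smul_left {E : Type} [NormedAddCommGroup E] [NormedSpace ℝ E]
    (η : E [⋀^Fin 2]→L[ℝ] ℝ) (a : ℝ) (u v : E) : η ![a • u, v] = a * η ![u, v] := by
  rw [← formBilin_apply, ← formBilin_apply, map_smul]
  rfl

theorem IsFlow.moment_eq (hΦ : IsMomentMap Ω Φ) {V : (x : X) → TangentSpace (𝓡 6) x} {ε : ℝ}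
    {F : ℝ → X → X} (h : IsFlow V ε F) {a b t : ℝ} (ha : -ε ≤ a) (hb : b ≤ ε)
    (h0 : (0 : ℝ) ∈ Set.Ioo a b) (ht : t ∈ Set.Ioo a b) {x : X}
    (hR : ∀ s ∈ Set.Ioo a b, (Ω (F s x) : E₆ [⋀^Fin 2]→L[ℝ] ℝ)
      ![V (F s x), generator (F s x)] = 1) :
    Φ (F t x) = Φ x + (t : AddCircle T) := by
  have hsub : ∀ s ∈ Set.Ioo a b, s ∈ Set.Ioo (-ε) ε := fun s hs =>
    ⟨by linarith [hs.1], by linarith [hs.2]⟩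
  have key := moment_sub_eq_of_fderiv_eq hΦ (σ := fun s => F s x) (h := fun s : ℝ => s)
    isOpen_Ioo isPreconnected_Ioo
    (fun s hs => (h.contMDiffAt_comp (θ := fun s : ℝ => s) (σ := fun _ => x) (hsub s hs)
      contDiffAt_id contMDiffAt_const).contMDiffWithinAt)
    differentiableOn_id (fun s hs (u : ℝ) => ?_) ht h0
  · have h1 : Φ (F 0 x) - ((0 : ℝ) : AddCircle T) = Φ x := by
      rw [h.zero, AddCircle.coe_zero, sub_zero]
    exact sub_eq_iff_eq_add.1 (key.trans h1)
  · have h1 : (mfderiv 𝓘(ℝ, ℝ) (𝓡 6) (fun s => F s x) s u : E₆) =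
        (HSMul.hSMul (α := ℝ) (β := E₆) u (V (F s x))) :=
      congrArg (fun A : ℝ →L[ℝ] E₆ => A u) (h.deriv x s (hsub s hs)).mfderiv
    have h2 : fderiv ℝ (fun s : ℝ => s) s u = u := by
      rw [fderiv_fun_id]; rfl
    refine Eq.trans ?_ h2.symm
    have h3 := (form_smul_left (E := E₆) (Ω (F s x)) u (V (F s x))
      (generator (F s x))).trans (by rw [hR s hs, mul_one] :
        u * (Ω (F s x) : E₆ [⋀^Fin 2]→L[ℝ] ℝ)
          ![V (F s x), generator (F s x)] = u)
    exact (congrArg (fun a : E₆ =>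
      (Ω (F s x) : E₆ [⋀^Fin 2]→L[ℝ] ℝ) ![a, generator (F s x)]) h1).trans h3

/-! ### Averaging of vector fields -/

/-- The vector field `V`, transported back to `x` from the point `rotation t • x` of its orbit. -/
def rotatedField (V : (x : X) → TangentSpace (𝓡 6) x) (t : ℝ) (x : X) :
    E₆ :=
  smulDeriv (rotation (-t)) (rotation t • x) (V (rotation t • x))

theorem contDiffOn_rotatedField [T2Space X] [CompactSpace X] {V : (x : X) → TangentSpace (𝓡 6) x}
    (hV : IsSmoothField V) (x₀ : X) :
    ContDiffOn ℝ ∞ (fun z : ℝ × E₆ =>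
      fieldInChart (rotatedField V z.1) x₀ z.2)
      {z | z.2 ∈ (extChartAt (𝓡 6) x₀).target} := by
  set φ := extChartAt (𝓡 6) x₀ with hφ
  obtain ⟨ε, F, hF⟩ := exists_flow hV
  have hε := hF.pos
  have h0 : (0 : ℝ) ∈ Set.Ioo (-ε) ε := ⟨by linarith, hε⟩
  let Q : (ℝ × E₆) × ℝ → X := fun w =>
    rotation (-w.1.1) • F w.2 (rotation w.1.1 • φ.symm w.1.2)
  have hQ0 : ∀ z : ℝ × E₆, Q (z, 0) = φ.symm z.2 := fun z => by
    simp only [Q]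
    rw [hF.zero, smul_smul, ← rotation_add, neg_add_cancel, rotation_zero, one_smul]
  have hQ : ∀ z : ℝ × E₆, z.2 ∈ φ.target →
      ContMDiffAt 𝓘(ℝ, (ℝ × E₆) × ℝ) (𝓡 6) ∞ Q (z, 0) := by
    intro z hz
    have h1 : ContMDiffAt 𝓘(ℝ, (ℝ × E₆) × ℝ) (𝓡 6) ∞
        (fun w : (ℝ × E₆) × ℝ => φ.symm w.1.2) (z, 0) :=
      ContMDiffAt.comp ((z, (0 : ℝ)) : (ℝ × E₆) × ℝ)
        (f := fun w : (ℝ × E₆) × ℝ => w.1.2)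
        (contMDiffAt_extChartAt_symm hz) (contDiff_snd.comp contDiff_fst).contDiffAt.contMDiffAt
    have h2 := contMDiffAt_rotation_smul (θ := fun w : (ℝ × E₆) × ℝ => w.1.1)
      (contDiff_fst.comp contDiff_fst).contDiffAt h1
    have h3 := hF.contMDiffAt_comp (θ := fun w : (ℝ × E₆) × ℝ => w.2)
      (y := (z, 0)) h0 contDiff_snd.contDiffAt h2
    exact contMDiffAt_rotation_smul (θ := fun w : (ℝ × E₆) × ℝ => -w.1.1)
      (contDiff_fst.comp contDiff_fst).neg.contDiffAt h3
  let q : (ℝ × E₆) × ℝ → E₆ := fun w => φ (Q w)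
  have hq : ∀ z : ℝ × E₆, z.2 ∈ φ.target → ContDiffAt ℝ ∞ q (z, 0) := by
    intro z hz
    refine contDiffAt_chart_comp (hQ z hz) ?_
    rw [hQ0]
    exact φ.map_target hz
  have hval : ∀ z : ℝ × E₆, z.2 ∈ φ.target →
      fieldInChart (rotatedField V z.1) x₀ z.2 = fderiv ℝ q (z, 0) (0, 1) := by
    intro z hz
    have h1 := hF.deriv (rotation z.1 • φ.symm z.2) 0 h0
    have h2 := HasMFDerivAt.comp (0 : ℝ) (hasMFDerivAt_smul (rotation (-z.1))
      (F 0 (rotation z.1 • φ.symm z.2))) h1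
    have hs : (rotation (-z.1) • F 0 (rotation z.1 • φ.symm z.2)) = φ.symm z.2 := hQ0 z
    have h3 := HasMFDerivAt.comp (0 : ℝ) (g := φ)
      ((contMDiffAt_chart (x := x₀) (by rw [hs]; exact φ.map_target hz)).mdifferentiableAt
        (by simp) : MDifferentiableAt (𝓡 6) 𝓘(ℝ, E₆) φ
          (rotation (-z.1) • F 0 (rotation z.1 • φ.symm z.2))).hasMFDerivAt h2
    have h4 : HasFDerivAt (fun s : ℝ => q (z, s)) _ 0 := h3.hasFDerivAt
    have h5 : HasFDerivAt (fun s : ℝ => q (z, s))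
        ((fderiv ℝ q (z, 0)).comp (ContinuousLinearMap.inr ℝ _ ℝ)) 0 :=
      (((hq z hz).differentiableAt (by simp)).hasFDerivAt).comp (0 : ℝ)
        (hasFDerivAt_prodMk_right z (0 : ℝ))
    have h6 := congrArg (fun A : ℝ →L[ℝ] E₆ => A 1) (h5.unique h4)
    have h7 : fderiv ℝ q (z, 0) (0, 1) = _ := h6
    rw [h7]
    have key : ∀ (p p' : X) (x x' : X) (v : (x : X) → TangentSpace (𝓡 6) x), p = p' → x = x' →
        (mfderiv (𝓡 6) 𝓘(ℝ, E₆) φ x (smulDeriv (rotation (-z.1)) p (v p)) :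
          E₆) =
        mfderiv (𝓡 6) 𝓘(ℝ, E₆) φ x' (smulDeriv (rotation (-z.1)) p'
          (HSMul.hSMul (α := ℝ) (β := E₆) 1 (v p'))) := by
      rintro p _ x _ v rfl rfl
      exact congrArg (fun u : E₆ =>
        (mfderiv (𝓡 6) 𝓘(ℝ, E₆) φ x :
          E₆ →L[ℝ] E₆)
          (smulDeriv (rotation (-z.1)) p u))
        (one_smul ℝ (v p : E₆)).symm
    exact key _ _ _ _ V (hF.zero _).symm hs.symm
  intro z hz
  have h1 : ContDiffAt ℝ ∞ (fun w => fderiv ℝ q w) (z, 0) :=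
    (hq z hz).fderiv_right (m := ∞) (by norm_cast)
  have h2 : ContDiffAt ℝ ∞ (fun z : ℝ × E₆ =>
      fderiv ℝ q (z, 0) ((0 : ℝ × E₆), (1 : ℝ))) z :=
    (ContDiffAt.comp z (f := fun z : ℝ × E₆ => (z, (0 : ℝ))) h1
      (contDiff_id.prodMk contDiff_const).contDiffAt).clm_apply contDiffAt_const
  refine (h2.congr_of_eventuallyEq ?_).contDiffWithinAt
  have hopen : IsOpen {z : ℝ × E₆ | z.2 ∈ φ.target} :=
    (isOpen_extChartAt_target x₀).preimage continuous_snd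
  filter_upwards [hopen.mem_nhds hz] with z hz using hval z hz

theorem continuous_rotatedField [T2Space X] [CompactSpace X] {V : (x : X) → TangentSpace (𝓡 6) x}
    (hV : IsSmoothField V) (x : X) : Continuous fun t => rotatedField V t x := by
  have hx := mem_extChartAt_target (I := 𝓡 6) x
  have h1 : Continuous fun t : ℝ => fieldInChart (rotatedField V t) x (extChartAt (𝓡 6) x x) := by
    refine (contDiffOn_rotatedField hV x).continuousOn.comp_continuous
      (f := fun t : ℝ => (t, extChartAt (𝓡 6) x x)) (by fun_prop) fun t => hx
  have h2 := (mfderiv 𝓘(ℝ, E₆) (𝓡 6) (extChartAt (𝓡 6) x).symm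
    (extChartAt (𝓡 6) x x) : E₆ →L[ℝ] E₆).continuous.comp
      h1
  refine h2.congr fun t => ?_
  refine (mfderiv_symm_fieldInChart (rotatedField V t) hx).trans ?_
  rw [extChartAt_to_inv]

/-- The average of a vector field over the circle. -/
def averageField (V : (x : X) → TangentSpace (𝓡 6) x) (x : X) : TangentSpace (𝓡 6) x :=
  (∫ t in (0 : ℝ)..1, rotatedField V t x : E₆)

theorem clm_averageField [T2Space X] [CompactSpace X] {V : (x : X) → TangentSpace (𝓡 6) x}
    (hV : IsSmoothField V) {G : Type} [NormedAddCommGroup G] [NormedSpace ℝ G] [CompleteSpace G]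
    (A : E₆ →L[ℝ] G) (x : X) :
    A (averageField V x) = ∫ t in (0 : ℝ)..1, A (rotatedField V t x) :=
  (ContinuousLinearMap.intervalIntegral_comp_comm A
    ((continuous_rotatedField hV x).intervalIntegrable (μ := MeasureTheory.volume) 0 1)).symm

theorem isSmoothField_averageField [T2Space X] [CompactSpace X]
    {V : (x : X) → TangentSpace (𝓡 6) x} (hV : IsSmoothField V) :
    IsSmoothField (averageField V) := by
  intro x
  rw [contMDiffAt_field_iff _ (mem_extChartAt_source x)]
  have hopen : IsOpen {z : ℝ × E₆ | z.2 ∈ (extChartAt (𝓡 6) x).target} :=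
    (isOpen_extChartAt_target x).preimage continuous_snd
  obtain ⟨U, hU, hxU, -, hs, -⟩ := contDiffOn_parametric_integral hopen
    (contDiffOn_rotatedField hV x) (x₀ := extChartAt (𝓡 6) x x)
    (fun t _ => mem_extChartAt_target (I := 𝓡 6) x)
  refine (hs.contDiffAt (hU.mem_nhds hxU)).congr_of_eventuallyEq
    (Filter.Eventually.of_forall fun y => ?_)
  exact clm_averageField hV (G := E₆) (mfderiv (𝓡 6) 𝓘(ℝ, E₆) (extChartAt (𝓡 6) x)
    ((extChartAt (𝓡 6) x).symm y)) _

theorem rotatedField_add (V : (x : X) → TangentSpace (𝓡 6) x) (s t : ℝ) (x : X) :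
    rotatedField V t (rotation s • x) = smulDeriv (rotation s) x (rotatedField V (t + s) x) := by
  have key : ∀ (g g' : Circle) (p p' : X), g = g' → p = p' →
      smulDeriv g p (V p) = smulDeriv g' p' (V p') := by
    rintro g _ p _ rfl rfl; rfl
  have hx : rotation (-(t + s)) • rotation (t + s) • x = x := by
    rw [smul_smul, ← rotation_add, neg_add_cancel, rotation_zero, one_smul]
  have h1 := smulDeriv_mul (rotation s) (rotation (-(t + s))) (rotation (t + s) • x)
    (V (rotation (t + s) • x))
  rw [hx] at h1
  refine Eq.trans ?_ h1
  refine key _ _ _ _ ?_ ?_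
  · rw [← rotation_add]
    congr 1
    ring
  · rw [smul_smul, ← rotation_add]

theorem isInvariantField_averageField [T2Space X] [CompactSpace X]
    {V : (x : X) → TangentSpace (𝓡 6) x} (hV : IsSmoothField V) :
    IsInvariantField (averageField V) := by
  intro g x
  obtain ⟨s, rfl⟩ := rotation_surjective g
  have hper : Function.Periodic (fun t => rotatedField V t x) 1 := fun t => by
    simp only [rotatedField]
    have h1 : rotation (t + 1) = rotation t := by rw [rotation_add, rotation_one, mul_one]
    have h2 : rotation (-(t + 1)) = rotation (-t) := by
      have := rotation_add (-(t + 1)) 1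
      rw [rotation_one, mul_one] at this
      rw [← this]; congr 1; ring
    rw [h1, h2]
  refine (clm_averageField hV (smulDeriv (rotation s) x) x).trans ?_
  have h2 : Function.Periodic (fun t => smulDeriv (rotation s) x (rotatedField V t x)) 1 := hper.comp (smulDeriv (rotation s) x)
  have h3 := h2.intervalIntegral_add_eq 0 s
  rw [zero_add] at h3
  refine h3.trans ?_
  have h4 : (∫ t in (0 : ℝ)..1, rotatedField V t (rotation s • x)) =
      ∫ t in (0 : ℝ)..1, smulDeriv (rotation s) x (rotatedField V (t + s) x) :=
    intervalIntegral.integral_congr fun t _ => rotatedField_add V s t x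
  refine Eq.trans ?_ h4.symm
  rw [intervalIntegral.integral_comp_add_right
    (fun t => smulDeriv (rotation s) x (rotatedField V t x)), zero_add, add_comm 1 s]

theorem averageField_form [T2Space X] [CompactSpace X] (hinv : IsInvariantForm Ω)
    {V : (x : X) → TangentSpace (𝓡 6) x} (hV : IsSmoothField V) {x : X}
    (h : ∀ g : Circle, (Ω (g • x) : E₆ [⋀^Fin 2]→L[ℝ] ℝ)
      ![V (g • x), generator (g • x)] = 1) :
    (Ω x : E₆ [⋀^Fin 2]→L[ℝ] ℝ) ![averageField V x, generator x] = 1 := by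
  refine (clm_averageField hV
    ((formBilin E₆ (Ω x)).flip (generator x)) x).trans ?_
  have h2 : ∀ t : ℝ, (formBilin E₆ (Ω x)).flip (generator x)
      (rotatedField V t x) = 1 := fun t =>
    (form_smulDeriv_generator hinv (rotation (-t)) (by
      rw [smul_smul, ← rotation_add, neg_add_cancel, rotation_zero, one_smul]) _).trans (h _)
  simp only [h2]
  simp

theorem averageField_eq {V : (x : X) → TangentSpace (𝓡 6) x} {x : X}
    (h : ∀ g : Circle, smulDeriv g x (V x) = V (g • x)) : averageField V x = V x := by
  have h2 : ∀ t : ℝ, rotatedField V t x = V x := fun t => by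
    refine (congrArg (smulDeriv (rotation (-t)) (rotation t • x)) (h (rotation t)).symm).trans ?_
    refine (smulDeriv_mul _ _ _ _).symm.trans ?_
    rw [← rotation_add, neg_add_cancel, rotation_zero]
    exact smulDeriv_one _ _
  have h3 : ∀ u : E₆, ∫ _ in (0 : ℝ)..1, u = u := by simp
  exact (intervalIntegral.integral_congr fun t _ => h2 t).trans (h3 _)

end Average

section Construction

variable {X : Type*} [TopologicalSpace X] [ChartedSpace E₆ X]
  [IsManifold (𝓡 6) ∞ X]
  [MulAction Circle X] [ContMDiffSMul (𝓡 1) (𝓡 6) ∞ Circle X]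
  {Ω : (x : X) → TangentSpace (𝓡 6) x [⋀^Fin 2]→L[ℝ] ℝ} {T : ℝ} {Φ : X → AddCircle T}

theorem contMDiffAt_pushforward {F : Type} [NormedAddCommGroup F] [NormedSpace ℝ F]
    [FiniteDimensional ℝ F] (hdim : Module.finrank ℝ F = 6) {σ : F → X} {W : Set F}
    (hW : IsOpen W) (hσ : ContMDiffOn 𝓘(ℝ, F) (𝓡 6) ∞ σ W) {z : F} (hz : z ∈ W)
    (hinj : ∀ u, (mfderiv 𝓘(ℝ, F) (𝓡 6) σ z u : E₆) = 0 → u = 0)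
    {v : F → F} (hv : ContDiffAt ℝ ∞ v z) {V : (x : X) → TangentSpace (𝓡 6) x}
    (hV : ∀ᶠ w in 𝓝 z, (V (σ w) : E₆) = mfderiv 𝓘(ℝ, F) (𝓡 6) σ w (v w)) :
    ContMDiffAt (𝓡 6) (𝓡 6).tangent ∞ (fun x => (⟨x, V x⟩ : TangentBundle (𝓡 6) X)) (σ z) := by
  rw [contMDiffAt_field_iff V (mem_extChartAt_source (σ z))]
  obtain ⟨k, hzk, hkW, hks, hk, hkd⟩ := exists_localDiffeo_chart hdim hW hσ hz hinj
  set φ := extChartAt (𝓡 6) (σ z)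
  have hkz : φ (σ z) = k z := (hk z).symm
  rw [hkz]
  have hks1 : k.symm (k z) = z := k.left_inv hzk
  have hkzt := k.map_source hzk
  have hsymm : ContDiffAt ℝ ∞ k.symm (k z) := hkd.contDiffAt (k.open_target.mem_nhds hkzt)
  have hks2 : Filter.Tendsto k.symm (𝓝 (k z)) (𝓝 z) := by
    have := hsymm.continuousAt
    rwa [ContinuousAt, hks1] at this
  have hkc : ContDiffAt ℝ ∞ (fun w => φ (σ w)) z :=
    contDiffAt_chart_comp (hσ.contMDiffAt (hW.mem_nhds hz)) (hks z hzk)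
  have h1 : ContDiffAt ℝ ∞ (fun y => fderiv ℝ (fun w => φ (σ w)) (k.symm y) (v (k.symm y))) (k z) := by
    refine ContDiffAt.clm_apply ?_ ?_
    · refine ContDiffAt.comp (k z) (g := fun w => fderiv ℝ (fun w => φ (σ w)) w) ?_ hsymm
      rw [hks1]
      exact hkc.fderiv_right (m := ∞) (by norm_cast)
    · refine ContDiffAt.comp (k z) ?_ hsymm
      rwa [hks1]
  refine h1.congr_of_eventuallyEq ?_
  filter_upwards [k.open_target.mem_nhds hkzt, hks2.eventually hV] with y hy hyV
  have hyk := k.map_target hy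
  have h2 : φ.symm y = σ (k.symm y) := by
    have h3 : φ (σ (k.symm y)) = y := by rw [← hk, k.right_inv hy]
    conv_lhs => rw [← h3]
    exact φ.left_inv (hks _ hyk)
  rw [mfderiv_chart_comp ((hσ.contMDiffAt (hW.mem_nhds (hkW hyk))).mdifferentiableAt (by simp))
    (hks _ hyk)]
  have key : ∀ (x x' : X) (u : E₆), x = x' → V x' = u →
      (mfderiv (𝓡 6) 𝓘(ℝ, E₆) φ x (V x) : E₆) =
        mfderiv (𝓡 6) 𝓘(ℝ, E₆) φ x' u := by
    rintro x _ _ rfl rfl; rfl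
  exact key _ _ _ h2 hyV

/-- Near a point that is not fixed there is a smooth vector field along which the moment map has
derivative one. -/
theorem exists_local_field (hΩ : IsSymplecticForm Ω) (hΦ : IsMomentMap Ω Φ) {x : X}
    (hgen : (generator x : E₆) ≠ 0) :
    ∃ (U : Set X) (V : (x : X) → TangentSpace (𝓡 6) x), IsOpen U ∧ x ∈ U ∧
      ContMDiffOn (𝓡 6) (𝓡 6).tangent ∞ (fun x => (⟨x, V x⟩ : TangentBundle (𝓡 6) X)) U ∧
      ∀ y ∈ U, (Ω y : E₆ [⋀^Fin 2]→L[ℝ] ℝ) ![V y, generator y] = 1 := by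
  set φ := extChartAt (𝓡 6) x with hφ
  obtain ⟨N, hN, hxN, f, hf, hfN⟩ := hΦ x
  let g : E₆ → ℝ := fun w => f (φ.symm w)
  let S : Set E₆ := φ.target ∩ φ.symm ⁻¹' N
  have hS : IsOpen S := (continuousOn_extChartAt_symm x).isOpen_inter_preimage
    (isOpen_extChartAt_target x) hN
  have hxS : φ x ∈ S := ⟨mem_extChartAt_target x, by
    rw [Set.mem_preimage, extChartAt_to_inv]; exact hxN⟩
  have hfd : ∀ y ∈ N, ContMDiffAt (𝓡 6) 𝓘(ℝ, ℝ) ∞ f y := fun y hy => hf.contMDiffAt (hN.mem_nhds hy)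
  have hg : ContDiffOn ℝ ∞ g S := fun w hw =>
    (ContMDiffAt.comp w (hfd _ hw.2) (contMDiffAt_extChartAt_symm hw.1)).contDiffAt.contDiffWithinAt
  have hgd : ∀ w ∈ S, ∀ u, fderiv ℝ g w u = (Ω (φ.symm w) : E₆
      [⋀^Fin 2]→L[ℝ] ℝ) ![mfderiv 𝓘(ℝ, E₆) (𝓡 6) φ.symm w u,
        generator (φ.symm w)] := fun w hw =>
    (fderiv_moment_comp ((contMDiffAt_extChartAt_symm hw.1).mdifferentiableAt (by simp))
      ((hfd _ hw.2).mdifferentiableAt (by simp)) (hfN _ hw.2).2).2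
  have hbij : ∀ w ∈ φ.target, ∀ b : E₆, ∃ u,
      (mfderiv 𝓘(ℝ, E₆) (𝓡 6) φ.symm w u : E₆) = b :=
    fun w hw b => ⟨_, mfderiv_symm_fieldInChart (fun _ => b) hw⟩
  have hinj : ∀ w ∈ φ.target, ∀ u,
      (mfderiv 𝓘(ℝ, E₆) (𝓡 6) φ.symm w u : E₆) = 0 →
        u = 0 := by
    intro w hw u hu
    have h1 : ∀ A : E₆ →L[ℝ] E₆,
        (∀ b, ∃ u, A u = b) → A u = 0 → u = 0 := fun A hA hu =>
      (LinearMap.injective_iff_surjective (V := E₆)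
        (f := (A : E₆ →ₗ[ℝ] E₆))).2 hA
        (hu.trans (map_zero A).symm)
    exact h1 _ (hbij w hw) hu
  obtain ⟨u, hu⟩ : ∃ u, fderiv ℝ g (φ x) u ≠ 0 := by
    by_contra! hcon
    have h1 : φ.symm (φ x) = x := extChartAt_to_inv x
    refine hgen ?_
    refine hΩ.nondegenerate x (generator x) fun b => ?_
    obtain ⟨u, hu⟩ := hbij (φ x) hxS.1 b
    have h2 := (hgd _ hxS u).symm.trans (hcon u)
    have key : ∀ (y : X) (b' : E₆), y = x → b' = b →
        (Ω y : E₆ [⋀^Fin 2]→L[ℝ] ℝ) ![b', generator y] = 0 →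
        (Ω x : E₆ [⋀^Fin 2]→L[ℝ] ℝ) ![b, generator x] = 0 := by
      rintro y _ rfl rfl h; exact h
    have h3 := key _ _ h1 hu h2
    exact (form_swap (E := E₆) _ _ _).trans ((congrArg Neg.neg h3).trans neg_zero)
  have hgc : ContinuousOn (fun w => fderiv ℝ g w u) S :=
    ((hg.continuousOn_fderiv_of_isOpen hS (by simp)).clm_apply continuousOn_const)
  let S' : Set E₆ := S ∩ {w | fderiv ℝ g w u ≠ 0}
  have hS' : IsOpen S' := hgc.isOpen_inter_preimage hS isOpen_ne
  have hv : ∀ w ∈ S', ContDiffAt ℝ ∞ (fun w => (fderiv ℝ g w u)⁻¹ • u) w := fun w hw =>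
    ((((hg.contDiffAt (hS.mem_nhds hw.1)).fderiv_right (m := ∞) (by norm_cast)).clm_apply
      contDiffAt_const).inv hw.2).smul contDiffAt_const
  let V : (x : X) → TangentSpace (𝓡 6) x := fun y =>
    (mfderiv 𝓘(ℝ, E₆) (𝓡 6) φ.symm (φ y) ((fderiv ℝ g (φ y) u)⁻¹ • u) :
      E₆)
  have hVe : ∀ w ∈ φ.target, (V (φ.symm w) : E₆) =
      mfderiv 𝓘(ℝ, E₆) (𝓡 6) φ.symm w ((fderiv ℝ g w u)⁻¹ • u) := by
    intro w hw
    simp only [V]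
    rw [φ.right_inv hw]
  refine ⟨φ.source ∩ φ ⁻¹' S', V, (continuousOn_extChartAt x).isOpen_inter_preimage
    (isOpen_extChartAt_source x) hS', ⟨mem_extChartAt_source x, hxS, hu⟩, fun y hy => ?_,
    fun y hy => ?_⟩
  · have h1 := contMDiffAt_pushforward (F := E₆) (by simp)
      (isOpen_extChartAt_target x)
      (contMDiffOn_extChartAt_symm x) hy.2.1.1 (hinj _ hy.2.1.1) (hv _ hy.2) (V := V)
      (by filter_upwards [(isOpen_extChartAt_target x).mem_nhds hy.2.1.1] with w hw using hVe w hw)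
    rw [φ.left_inv hy.1] at h1
    exact h1.contMDiffWithinAt
  · have h1 := hgd _ hy.2.1 ((fderiv ℝ g (φ y) u)⁻¹ • u)
    rw [map_smul, smul_eq_mul, inv_mul_cancel₀ hy.2.2] at h1
    have key : ∀ y' : X, y' = y → (Ω y' : E₆ [⋀^Fin 2]→L[ℝ] ℝ)
        ![(mfderiv 𝓘(ℝ, E₆) (𝓡 6) φ.symm (φ y) ((fderiv ℝ g (φ y) u)⁻¹ • u) :
          E₆), generator y'] =
        (Ω y : E₆ [⋀^Fin 2]→L[ℝ] ℝ) ![V y, generator y] := by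
      rintro _ rfl; rfl
    exact (key _ (φ.left_inv hy.1)).symm.trans h1.symm

/-- The vector field on `ℂ³` that shrinks the last coordinate so that the moment map of the action
with weights `(a, b, -1)` grows at unit speed. -/
def verticalField (z : ℂ³) : ℂ³ := (0, 0, (-(2 * ‖z.2.2‖ ^ 2)⁻¹ : ℝ) • z.2.2)

theorem contDiffAt_verticalField {z : ℂ³} (hz : z.2.2 ≠ 0) :
    ContDiffAt ℝ ∞ verticalField z := by
  have h1 : ContDiffAt ℝ ∞ (fun z : ℂ³ => z.2.2) z := contDiff_snd.snd.contDiffAt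
  have h2 : ContDiffAt ℝ ∞ (fun z : ℂ³ => 2 * ‖z.2.2‖ ^ 2) z :=
    contDiffAt_const.mul (h1.norm_sq ℝ)
  exact contDiffAt_const.prodMk (contDiffAt_const.prodMk
    (((h2.inv (by positivity)).neg).smul h1))

theorem stdForm3_verticalField (a b : ℤ) {z : ℂ³} (hz : z.2.2 ≠ 0) :
    stdForm3 ![verticalField z, weightField a b (-1) z] = 1 := by
  have h1 : ‖z.2.2‖ ^ 2 = z.2.2.re * z.2.2.re + z.2.2.im * z.2.2.im := by
    rw [← Complex.normSq_eq_norm_sq, Complex.normSq_apply]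
  have h2 : z.2.2.re * z.2.2.re + z.2.2.im * z.2.2.im ≠ 0 := by rw [← h1]; positivity
  rw [stdForm3_apply]
  simp only [verticalField, weightField, h1, Complex.smul_re, Complex.smul_im, smul_eq_mul]
  simp
  field_simp
  linear_combination mul_inv_cancel₀ h2

theorem weightAct_verticalField (a b c : ℤ) (g : Circle) (z : ℂ³) :
    weightAct a b c g (verticalField z) = verticalField (weightAct a b c g z) := by
  simp only [weightAct, verticalField, mul_zero, norm_mul, Circle.norm_coe, one_mul,
    Complex.real_smul]
  congr 2
  ring

theorem exists_field [T2Space X] [CompactSpace X] (hΩ : IsSymplecticForm Ω)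
    (hinv : IsInvariantForm Ω) (hΦ : IsMomentMap Ω Φ) {x : X} {a b : ℤ} {r : ℝ}
    {Ψ : ℂ³ → X} (h : IsEquivariantDarbouxChart Ω x a b (-1) r Ψ) {R : Set X}
    (hR : IsClosed R) (hRi : ∀ g : Circle, ∀ y ∈ R, g • y ∈ R)
    (hfix : ∀ y ∈ R, (generator y : E₆) ≠ 0) {C : Set ℂ³}
    (hC : IsCompact C) (hCr : C ⊆ Metric.ball 0 r) (hC0 : ∀ z ∈ C, z.2.2 ≠ 0)
    (hCi : ∀ g : Circle, ∀ z ∈ C, weightAct a b (-1) g z ∈ C) :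
    ∃ V : (x : X) → TangentSpace (𝓡 6) x, IsSmoothField V ∧ IsInvariantField V ∧
      (∀ y ∈ R, (Ω y : E₆ [⋀^Fin 2]→L[ℝ] ℝ) ![V y, generator y] = 1) ∧
      ∀ z ∈ C, (V (Ψ z) : E₆) =
        mfderiv 𝓘(ℝ, ℂ³) (𝓡 6) Ψ z (verticalField z) := by
  classical
  let Vx : (x : X) → TangentSpace (𝓡 6) x := fun y =>
    (mfderiv 𝓘(ℝ, ℂ³) (𝓡 6) Ψ (Function.invFunOn Ψ (Metric.ball 0 r) y)
      (verticalField (Function.invFunOn Ψ (Metric.ball 0 r) y)) : E₆)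
  have hVx : ∀ z ∈ Metric.ball (0 : ℂ³) r, (Vx (Ψ z) : E₆) =
      mfderiv 𝓘(ℝ, ℂ³) (𝓡 6) Ψ z (verticalField z) := by
    intro z hz
    simp only [Vx]
    rw [h.injOn.leftInvOn_invFunOn hz]
  let D : Set ℂ³ := Metric.ball 0 r ∩ {z | z.2.2 ≠ 0}
  have hD : IsOpen D := Metric.isOpen_ball.inter (isOpen_ne_fun (by fun_prop) (by fun_prop))
  have hDo : IsOpen (Ψ '' D) := h.isOpen_image hD Set.inter_subset_left
  have hVs : ContMDiffOn (𝓡 6) (𝓡 6).tangent ∞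
      (fun x => (⟨x, Vx x⟩ : TangentBundle (𝓡 6) X)) (Ψ '' D) := by
    rintro _ ⟨z, hz, rfl⟩
    refine (contMDiffAt_pushforward (F := ℂ³) (by simp) Metric.isOpen_ball h.smooth hz.1
      (fun u hu => h.mfderiv_injective hz.1 hu) (contDiffAt_verticalField hz.2) (V := Vx)
      ?_).contMDiffWithinAt
    filter_upwards [Metric.isOpen_ball.mem_nhds hz.1] with w hw using hVx w hw
  have hVf : ∀ z ∈ D, (Ω (Ψ z) : E₆ [⋀^Fin 2]→L[ℝ] ℝ)
      ![Vx (Ψ z), generator (Ψ z)] = 1 := by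
    intro z hz
    have h1 := congrArg (fun η : ℂ³ [⋀^Fin 2]→L[ℝ] ℝ =>
      η ![verticalField z, weightField a b (-1) z]) (h.pullback hz.1)
    have h2 := (pullbackForm_apply (Ω := Ω) Ψ z (verticalField z)
      (weightField a b (-1) z)).symm.trans (h1.trans (stdForm3_verticalField a b hz.2))
    have key : ∀ u v u' v' : E₆, u = u' → v = v' →
        (Ω (Ψ z) : E₆ [⋀^Fin 2]→L[ℝ] ℝ) ![u', v'] = 1 →
        (Ω (Ψ z) : E₆ [⋀^Fin 2]→L[ℝ] ℝ) ![u, v] = 1 := by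
      rintro u v _ _ rfl rfl h; exact h
    exact key _ _ _ _ (hVx z hz.1) (mfderiv_weightField h.smooth h.equivariant hz.1).symm h2
  have hCD : C ⊆ D := fun z hz => ⟨hCr hz, hC0 z hz⟩
  have hCc : IsClosed (Ψ '' C) := (hC.image_of_continuousOn (h.smooth.continuousOn.mono hCr)).isClosed
  let t : (y : X) → Set (TangentSpace (𝓡 6) y) := fun y =>
    {u | (y ∈ R → (Ω y : E₆ [⋀^Fin 2]→L[ℝ] ℝ) ![u, generator y] = 1) ∧
      (y ∈ Ψ '' C → (u : E₆) = Vx y)}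
  have ht : ∀ y, Convex ℝ (t y) := by
    intro y
    have key : ∀ (η : E₆ [⋀^Fin 2]→L[ℝ] ℝ) (w w' : E₆)
        (P Q : Prop), Convex ℝ {u : E₆ | (P → η ![u, w] = 1) ∧
          (Q → u = w')} := by
      rintro η w w' P Q u ⟨hu, hu'⟩ v ⟨hv, hv'⟩ s s' hs hs' hss
      refine ⟨fun hP => ?_, fun hQ => ?_⟩
      · have h1 := (formBilin E₆ η).map_add (s • u) (s' • v)
        have h2 : η ![s • u + s' • v, w] = η ![s • u, w] + η ![s' • v, w] :=
          congrArg (fun A : E₆ →L[ℝ] ℝ => A w) h1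
        rw [h2, form_smul_left, form_smul_left, hu hP, hv hP, mul_one, mul_one, hss]
      · rw [hu' hQ, hv' hQ, ← add_smul, hss, one_smul]
    exact key (Ω y) (generator y) (Vx y) (y ∈ R) (y ∈ Ψ '' C)
  obtain ⟨V, hV⟩ := exists_contMDiffSection_forall_mem_convex_of_local (n := (⊤ : ℕ∞)) (𝓡 6)
    (F_fiber := E₆)
    (fun y : X => TangentSpace (𝓡 6) y) t ht (by
      intro y
      by_cases hyC : y ∈ Ψ '' C
      · refine ⟨Ψ '' D, hDo.mem_nhds (Set.image_mono hCD hyC), Vx, hVs, ?_⟩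
        rintro _ ⟨z, hz, rfl⟩
        exact ⟨fun _ => hVf z hz, fun _ => rfl⟩
      by_cases hyR : y ∈ R
      · obtain ⟨U, V, hU, hyU, hVU, hV1⟩ := exists_local_field hΩ hΦ (hfix y hyR)
        exact ⟨U ∩ (Ψ '' C)ᶜ, (hU.inter hCc.isOpen_compl).mem_nhds ⟨hyU, hyC⟩, V,
          hVU.mono Set.inter_subset_left, fun w hw => ⟨fun _ => hV1 w hw.1, fun hw' => (hw.2 hw').elim⟩⟩
      · refine ⟨Rᶜ ∩ (Ψ '' C)ᶜ, (hR.isOpen_compl.inter hCc.isOpen_compl).mem_nhds ⟨hyR, hyC⟩,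
          fun y => 0, (Bundle.contMDiff_zeroSection ℝ (TangentSpace (𝓡 6) : X → Type)).contMDiffOn,
          fun w hw => ⟨fun hw' => (hw.1 hw').elim, fun hw' => (hw.2 hw').elim⟩⟩)
  have hVs : IsSmoothField (fun y => V y) := V.contMDiff
  refine ⟨averageField (fun y => V y), isSmoothField_averageField hVs,
    isInvariantField_averageField hVs, fun y hy => averageField_form hinv hVs fun g =>
      (hV (g • y)).1 (hRi g y hy), fun z hz => ?_⟩
  have hVC : ∀ w ∈ C, (V (Ψ w) : E₆) =
      mfderiv 𝓘(ℝ, ℂ³) (𝓡 6) Ψ w (verticalField w) := fun w hw =>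
    ((hV (Ψ w)).2 ⟨w, hw, rfl⟩).trans (hVx w (hCr hw))
  refine (averageField_eq fun g => ?_).trans (hVC z hz)
  have hΨ : ∀ w ∈ Metric.ball (0 : ℂ³) r, MDifferentiableAt 𝓘(ℝ, ℂ³) (𝓡 6) Ψ w :=
    fun w hw => (h.contMDiffAt hw).mdifferentiableAt (by simp)
  have h1 : (mfderiv 𝓘(ℝ, ℂ³) (𝓡 6) (fun w => Ψ (weightEquiv a b (-1) g w)) z
      (verticalField z) : E₆) =
      mfderiv 𝓘(ℝ, ℂ³) (𝓡 6) Ψ (weightAct a b (-1) g z)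
        (weightAct a b (-1) g (verticalField z)) := by
    have h2 := mfderiv_comp_normedSpace (σ := Ψ) (h := weightEquiv a b (-1) g) (y := z)
      (hΨ _ (weightAct_mem_ball g (hCr hz))) (weightEquiv a b (-1) g).differentiableAt
      (verticalField z)
    rw [(weightEquiv a b (-1) g).fderiv] at h2
    exact h2
  have h2 : (mfderiv 𝓘(ℝ, ℂ³) (𝓡 6) (fun w => Ψ (weightEquiv a b (-1) g w)) z
      (verticalField z) : E₆) =
      smulDeriv g (Ψ z) (mfderiv 𝓘(ℝ, ℂ³) (𝓡 6) Ψ z (verticalField z)) := by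
    have h3 : (fun w => Ψ (weightEquiv a b (-1) g w)) =ᶠ[𝓝 z] fun w => g • Ψ w := by
      filter_upwards [Metric.isOpen_ball.mem_nhds (hCr hz)] with w hw using h.equivariant w hw g
    rw [h3.mfderiv_eq]
    exact mfderiv_smul_comp g (hΨ z (hCr hz)) (verticalField z)
  rw [weightAct_verticalField] at h1
  have key : ∀ y : X, y = g • Ψ z → (V y : E₆) = V (g • Ψ z) := by
    rintro _ rfl; rfl
  exact (congrArg (smulDeriv g (Ψ z)) (hVC z hz)).trans (h2.symm.trans (h1.trans
    ((hVC _ (hCi g z hz)).symm.trans (key _ (h.equivariant z (hCr hz) g)))))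

end Construction

/-! ### Transport of symplectic sections by an invariant flow -/

theorem nondegenerate_of_transverse {E : Type} [NormedAddCommGroup E] [NormedSpace ℝ E]
    [FiniteDimensional ℝ E] (hdim : Module.finrank ℝ E = 6) {η : E [⋀^Fin 2]→L[ℝ] ℝ}
    (hη : ∀ u, (∀ v, η ![u, v] = 0) → u = 0) {ξ : E} (hξ : ξ ≠ 0) (A : ℂ² →L[ℝ] E)
    (hA : ∀ v, η ![A v, ξ] = 0) (hker : ∀ (v : ℂ²) (c : ℝ), A v = c • ξ → v = 0) {u : ℂ²}
    (hu : ∀ v, η ![A u, A v] = 0) : u = 0 := by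
  set β := formBilin E η with hβ
  have hβ' : ∀ a b, η ![a, b] = β a b := fun a b => rfl
  obtain ⟨w, hw⟩ : ∃ w, β ξ w ≠ 0 := by
    by_contra! hcon
    exact hξ (hη ξ hcon)
  have hξξ : β ξ ξ = 0 := form_self η ξ
  have hξA : ∀ v, β ξ (A v) = 0 := fun v => by
    rw [← hβ', form_swap, hA, neg_zero]
  let M : (ℝ × ℝ × ℂ²) →ₗ[ℝ] E :=
    LinearMap.coprod (LinearMap.toSpanSingleton ℝ E w)
      (LinearMap.coprod (LinearMap.toSpanSingleton ℝ E ξ) (A : ℂ² →ₗ[ℝ] E))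
  have hM : ∀ a b v, M (a, b, v) = a • w + (b • ξ + A v) := fun a b v => by simp [M]
  have hMs : Function.Surjective M := by
    refine (LinearMap.injective_iff_surjective_of_finrank_eq_finrank (by simp [hdim])).1 ?_
    rw [injective_iff_map_eq_zero]
    rintro ⟨a, b, v⟩ h
    rw [hM] at h
    have h1 := congrArg (β ξ) h
    simp only [map_add, map_smul, hξξ, hξA, smul_eq_mul, mul_zero, add_zero, map_zero,
      mul_eq_zero, hw, or_false] at h1
    rw [h1, zero_smul, zero_add] at h
    have h2 : v = 0 := hker v (-b) (by rw [neg_smul]; exact eq_neg_of_add_eq_zero_right h)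
    rw [h2, map_zero, add_zero, smul_eq_zero, or_iff_left hξ] at h
    rw [h1, h2, h]
    rfl
  have h3 : A u - (β (A u) w / β ξ w) • ξ = 0 := by
    refine hη _ fun x => ?_
    obtain ⟨⟨a, b, v⟩, rfl⟩ := hMs x
    rw [hβ', hM]
    have h4 : β (A u) ξ = 0 := hA u
    have h5 : β (A u) (A v) = 0 := hu v
    simp only [map_sub, map_smul, map_add, sub_apply, smul_apply, h4, h5, hξξ, hξA, smul_eq_mul]
    field_simp
    ring
  exact hker u _ (sub_eq_zero.1 h3)

section Transport

variable {X : Type*} [TopologicalSpace X] [T2Space X]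
  [ChartedSpace E₆ X] [IsManifold (𝓡 6) ∞ X]
  [MulAction Circle X] [ContMDiffSMul (𝓡 1) (𝓡 6) ∞ Circle X]
  {Ω : (x : X) → TangentSpace (𝓡 6) x [⋀^Fin 2]→L[ℝ] ℝ} {T : ℝ} {Φ : X → AddCircle T}
  {V : (x : X) → TangentSpace (𝓡 6) x} {ε : ℝ} {F : ℝ → X → X} {l : AddCircle T}

theorem IsFlow.mfderiv_generator (h : IsFlow V ε F) (hV : IsSmoothField V)
    (hVi : IsInvariantField V) {t : ℝ} (ht : t ∈ Set.Ioo (-ε) ε) (x : X) :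
    (mfderiv (𝓡 6) (𝓡 6) (F t) x (generator x) : E₆) =
      generator (F t x) := by
  have h0 : (fun s : ℝ => F t (rotation s • x)) = fun s => rotation s • F t x :=
    funext fun s => h.smul_apply hV hVi ht _ _
  have h1 : MDifferentiableAt 𝓘(ℝ, ℝ) (𝓡 6) (fun s : ℝ => rotation s • x) 0 :=
    (contMDiff_orbit x).contMDiffAt.mdifferentiableAt (by simp)
  have hx : rotation 0 • x = x := by rw [rotation_zero, one_smul]
  have h2 : MDifferentiableAt (𝓡 6) (𝓡 6) (F t) (rotation 0 • x) :=
    (h.contMDiff ht).contMDiffAt.mdifferentiableAt (by simp)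
  have h3 := congrArg (fun A => (A (1 : ℝ) : E₆))
    (mfderiv_comp (0 : ℝ) h2 h1)
  have hgen : ∀ y z : X, y = z → (generator y : E₆) = generator z := by
    rintro y _ rfl; rfl
  have h4 : ∀ f : ℝ → X, f = (fun s => rotation s • F t x) → (mfderiv 𝓘(ℝ, ℝ) (𝓡 6) f 0 (1 : ℝ) :
      E₆) = generator (F t x) := by
    rintro _ rfl
    exact (mfderiv_orbit (F t x) 0).trans (hgen _ _ (by rw [rotation_zero, one_smul]))
  have key : ∀ y : X, y = x → (mfderiv (𝓡 6) (𝓡 6) (F t) y (generator y) :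
      E₆) = mfderiv (𝓡 6) (𝓡 6) (F t) x (generator x) := by
    rintro _ rfl; rfl
  refine (key _ hx).symm.trans (Eq.trans ?_ (h3.symm.trans (h4 _ h0)))
  exact congrArg (fun u : E₆ =>
    (mfderiv (𝓡 6) (𝓡 6) (F t) (rotation 0 • x) u : E₆))
    (mfderiv_orbit x 0).symm

theorem IsFlow.contMDiffAt_section (h : IsFlow V ε F) {t : ℝ} (ht : t ∈ Set.Ioo (-ε) ε)
    {E : Type} [NormedAddCommGroup E] [NormedSpace ℝ E] {σ : E → X} {y : E}
    (hσ : ContMDiffAt 𝓘(ℝ, E) (𝓡 6) ∞ σ y) :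
    ContMDiffAt 𝓘(ℝ, E) (𝓡 6) ∞ (fun z => F t (σ z)) y :=
  h.contMDiffAt_comp (θ := fun _ => t) ht contDiffAt_const hσ

theorem IsFlow.isSymplecticSection (hΩ : IsSymplecticForm Ω) (hΦ : IsMomentMap Ω Φ)
    (h : IsFlow V ε F) (hV : IsSmoothField V) (hVi : IsInvariantField V) {t : ℝ} (ht : 2 * |t| < ε)
    {W : Set ℂ²} {σ : ℂ² → X} (hσ : IsSymplecticSection Ω Φ l W σ) {l' : AddCircle T}
    (hl : ∀ y ∈ W, Φ (F t (σ y)) = l') :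
    IsSymplecticSection Ω Φ l' W (fun y => F t (σ y)) := by
  have ht' : t ∈ Set.Ioo (-ε) ε := abs_lt.1 (by linarith [abs_nonneg t])
  have htn : -t ∈ Set.Ioo (-ε) ε := abs_lt.1 (by rw [abs_neg]; linarith [abs_nonneg t])
  have hs : ∀ y ∈ W, ContMDiffAt 𝓘(ℝ, ℂ²) (𝓡 6) ∞ (fun y => F t (σ y)) y := fun y hy =>
    h.contMDiffAt_section ht' (hσ.smooth.contMDiffAt (hσ.isOpen.mem_nhds hy))
  have hfix : ∀ y ∈ W, (generator (F t (σ y)) : E₆) ≠ 0 := by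
    intro y hy h0
    refine hσ.not_fixed y hy (generator_eq_zero_of_smul_eq fun g => ?_)
    have h1 : F t (g • σ y) = F t (σ y) := by
      rw [h.smul_apply hV hVi ht', smul_eq_of_generator_eq_zero h0]
    rw [← h.neg_apply hV ht (g • σ y), h1, h.neg_apply hV ht]
  refine ⟨hσ.isOpen, fun y hy => (hs y hy).contMDiffWithinAt, hl, fun y hy u hu => ?_, hfix⟩
  have hW : ∀ᶠ z in 𝓝 y, z ∈ W := hσ.isOpen.mem_nhds hy
  refine nondegenerate_of_transverse (E := E₆) (by simp)
    (η := (Ω (F t (σ y)) : E₆ [⋀^Fin 2]→L[ℝ] ℝ))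
    (fun u hu => hΩ.nondegenerate _ u hu) (hfix y hy)
    (mfderiv 𝓘(ℝ, ℂ²) (𝓡 6) (fun y => F t (σ y)) y)
    (fun v => form_generator_eq_zero hΦ (hs y hy) (hW.mono hl) v) (fun v c hv => ?_)
    fun v => (pullbackForm_apply (Ω := Ω) _ y u v).symm.trans (hu v)
  refine hσ.nondegenerate y hy v fun v' => ?_
  have h1 : (mfderiv 𝓘(ℝ, ℂ²) (𝓡 6) σ y v : E₆) =
      c • (generator (σ y) : E₆) := by
    have h2 := congrArg (fun A => (A v : E₆)) (mfderiv_comp y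
      (((h.contMDiff htn).contMDiffAt (x := F t (σ y))).mdifferentiableAt (by simp))
      ((hs y hy).mdifferentiableAt (by simp)))
    have h3 : (F (-t)) ∘ (fun y => F t (σ y)) = σ := funext fun z => h.neg_apply hV ht _
    rw [h3] at h2
    have h4 : (mfderiv (𝓡 6) (𝓡 6) (F (-t)) (F t (σ y)) (generator (F t (σ y))) :
        E₆) = generator (σ y) := by
      have h5 := h.mfderiv_generator hV hVi htn (F t (σ y))
      rwa [h.neg_apply hV ht] at h5
    have key : ∀ (A : E₆ →L[ℝ] E₆)
        (a b d : E₆), a = c • b → A b = d → A a = c • d := by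
      rintro A a b d rfl rfl; exact map_smul A c b
    exact h2.trans (key _ _ _ _ hv h4)
  have h2 := form_generator_eq_zero hΦ (hσ.smooth.contMDiffAt (hσ.isOpen.mem_nhds hy))
    (hW.mono hσ.level) v'
  have key : ∀ (η : E₆ [⋀^Fin 2]→L[ℝ] ℝ)
      (a b d : E₆), a = c • b → η ![d, b] = 0 → η ![a, d] = 0 := by
    rintro η a b d rfl h
    rw [form_smul_left, form_swap, h, neg_zero, mul_zero]
  exact (pullbackForm_apply (Ω := Ω) σ y v v').trans (key _ _ _ _ h1 h2)

theorem IsFlow.pfaffian_mul_pos (hΩ : IsSymplecticForm Ω) (hΦ : IsMomentMap Ω Φ)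
    (h : IsFlow V ε F) (hV : IsSmoothField V) (hVi : IsInvariantField V) {t : ℝ} (ht : 2 * |t| < ε)
    {W : Set ℂ²} {σ : ℂ² → X} (hσ : IsSymplecticSection Ω Φ l W σ)
    (hl : ∀ s ∈ Set.uIcc 0 t, ∀ y ∈ W, Φ (F s (σ y)) = l + (s : AddCircle T)) {y : ℂ²}
    (hy : y ∈ W) :
    0 < pfaffian (pullbackForm Ω (fun y => F t (σ y)) y) * pfaffian (pullbackForm Ω σ y) := by
  have habs : ∀ s ∈ Set.uIcc 0 t, 2 * |s| < ε := fun s hs => by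
    have := Set.abs_sub_left_of_mem_uIcc hs
    simp only [sub_zero] at this
    linarith
  have hmem : ∀ s ∈ Set.uIcc 0 t, s ∈ Set.Ioo (-ε) ε := fun s hs =>
    abs_lt.1 (by linarith [habs s hs, abs_nonneg s])
  let f : ℝ → ℝ := fun s => pfaffian (pullbackForm Ω (fun y => F s (σ y)) y)
  have hne : ∀ s ∈ Set.uIcc 0 t, f s ≠ 0 := fun s hs =>
    (pfaffian_ne_zero_iff _).2 ((h.isSymplecticSection hΩ hΦ hV hVi (habs s hs) hσ
      (hl s hs)).nondegenerate y hy)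
  have hσs : ∀ z ∈ W, ContMDiffAt 𝓘(ℝ, ℂ²) (𝓡 6) ∞ σ z := fun z hz =>
    hσ.smooth.contMDiffAt (hσ.isOpen.mem_nhds hz)
  let S : Set (ℝ × ℂ²) := Set.Ioo (-ε) ε ×ˢ W
  have hS : IsOpen S := isOpen_Ioo.prod hσ.isOpen
  have hθ : ContMDiffOn 𝓘(ℝ, ℝ × ℂ²) (𝓡 6) ∞ (fun z : ℝ × ℂ² => F z.1 (σ z.2)) S := by
    rintro ⟨s, z⟩ hz
    refine (h.contMDiffAt_comp (E := ℝ × ℂ²) (θ := Prod.fst) hz.1 contDiffAt_fst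
      (σ := fun z => σ z.2) ?_).contMDiffWithinAt
    exact ContMDiffAt.comp (s, z) (hσs z hz.2)
      (contDiff_snd (𝕜 := ℝ) (E := ℝ) (F := ℂ²)).contMDiff.contMDiffAt
  have hc := (contDiffOn_pullbackForm hΩ hS hθ).continuousOn
  have hfc : ContinuousOn f (Set.uIcc 0 t) := by
    refine continuousOn_pfaffian fun u v => ?_
    have h1 : ContinuousOn (fun s : ℝ => formBilin (ℝ × ℂ²)
        (pullbackForm Ω (fun z : ℝ × ℂ² => F z.1 (σ z.2)) (s, y)) (0, u) (0, v))
        (Set.uIcc 0 t) :=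
      (((formBilin (ℝ × ℂ²)).continuous.comp_continuousOn (hc.comp
        (by fun_prop : ContinuousOn (fun s : ℝ => (s, y)) (Set.uIcc 0 t))
        fun s hs => ⟨hmem s hs, hy⟩)).clm_apply continuousOn_const).clm_apply continuousOn_const
    refine h1.congr fun s hs => ?_
    have h2 : HasFDerivAt (fun y : ℂ² => (s, y)) (ContinuousLinearMap.inr ℝ ℝ ℂ²) y :=
      hasFDerivAt_prodMk_right s y
    have h3 := pullbackForm_comp (Ω := Ω) (σ := fun z : ℝ × ℂ² => F z.1 (σ z.2))
      (h := fun y : ℂ² => (s, y)) (y := y)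
      ((hθ.contMDiffAt (hS.mem_nhds ⟨hmem s hs, hy⟩)).mdifferentiableAt (by simp))
      h2.differentiableAt
    rw [h2.fderiv] at h3
    show pullbackForm Ω (fun y => F s (σ y)) y ![u, v] = _
    rw [h3, compContinuousLinearMap_pair]
    rfl
  have h0 : f 0 = pfaffian (pullbackForm Ω σ y) := by
    simp only [f, h.zero]
  rw [← h0]
  by_contra! hcon
  have h5 : (0 : ℝ) ∈ f '' Set.uIcc 0 t := by
    refine intermediate_value_uIcc hfc ?_
    rw [Set.mem_uIcc]
    rcases mul_nonpos_iff.1 hcon with ⟨h6, h7⟩ | ⟨h6, h7⟩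
    · exact Or.inl ⟨h7, h6⟩
    · exact Or.inr ⟨h6, h7⟩
  obtain ⟨s, hs, hs0⟩ := h5
  exact hne s hs hs0

end Transport

/-! ### A flow between level sets -/

section LevelFlow

variable {X : Type*} [TopologicalSpace X] [ChartedSpace E₆ X]
  [IsManifold (𝓡 6) ∞ X]
  [MulAction Circle X] [ContMDiffSMul (𝓡 1) (𝓡 6) ∞ Circle X]
  {Ω : (x : X) → TangentSpace (𝓡 6) x [⋀^Fin 2]→L[ℝ] ℝ} {T : ℝ} {Φ : X → AddCircle T}
  {x : X} {p q : ℕ} {r : ℝ} {Ψ : ℂ³ → X}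

/-- For times less than `δ` the flow `F` shifts the levels of the moment map outside of the
polydisc of radius `r / 3`; near the boundary of the polydisc of radius `r` it is the explicit
flow that shrinks the last coordinate. -/
structure IsLevelFlow (Φ : X → AddCircle T) (p q : ℕ) (x : X) (r : ℝ) (Ψ : ℂ³ → X) (δ : ℝ)
    (F : ℝ → X → X) : Prop where
  moment : ∀ (s t : ℝ) (y : X), |s| < δ → |t| < δ → Φ y = Φ x + (t : AddCircle T) →
    y ∉ Ψ '' Metric.ball 0 (r / 3) → Φ (F s y) = Φ y + (s : AddCircle T)
  not_fixed : ∀ (t : ℝ) (y : X), |t| < δ → Φ y = Φ x + (t : AddCircle T) →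
    y ∉ Ψ '' Metric.ball 0 (r / 3) → (generator y : E₆) ≠ 0
  mapsTo : ∀ (s : ℝ) (y : X), |s| < δ → y ∈ Ψ '' Metric.ball 0 (r / 3) →
    F s y ∈ Ψ '' Metric.ball 0 (r / 2)
  levelSection : ∀ (s : ℝ) (z : ℂ²), |s| < δ → z ∈ sliceDom p q r →
    r ^ 2 / 9 ≤ p * ‖z.1‖ ^ 2 + q * ‖z.2‖ ^ 2 →
    F s (Ψ (levelSection p q 0 z)) = Ψ (levelSection p q s z)

theorem hasDerivAt_levelSection (p q : ℕ) {s : ℝ} {z : ℂ²}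
    (h : s < p * ‖z.1‖ ^ 2 + q * ‖z.2‖ ^ 2) :
    HasDerivAt (fun s => SymplecticReduction.levelSection p q s z)
      (verticalField (SymplecticReduction.levelSection p q s z)) s := by
  have h1 : 0 < p * ‖z.1‖ ^ 2 + q * ‖z.2‖ ^ 2 - s := by linarith
  have h2 := (((hasDerivAt_id s).const_sub (p * ‖z.1‖ ^ 2 + q * ‖z.2‖ ^ 2)).sqrt h1.ne').ofReal_comp
  have h3 := (hasDerivAt_const s z.1).prodMk ((hasDerivAt_const s z.2).prodMk h2)
  refine h3.congr_deriv ?_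
  have h4 := Real.sq_sqrt h1.le
  have h5 := Real.sqrt_pos.2 h1
  simp only [verticalField, SymplecticReduction.levelSection, id]
  congr 2
  rw [Complex.norm_real, Real.norm_of_nonneg h5.le, Complex.real_smul, ← Complex.ofReal_mul]
  congr 1
  field_simp

theorem exists_invariant_neighborhood [T2Space X] [CompactSpace X] {K : Set X} (hK : IsClosed K)
    (hfix : ∀ y ∈ K, (generator y : E₆) ≠ 0) :
    ∃ O R : Set X, IsOpen O ∧ K ⊆ O ∧ O ⊆ R ∧ IsClosed R ∧ (∀ g : Circle, ∀ y ∈ R, g • y ∈ R) ∧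
      ∀ y ∈ R, (generator y : E₆) ≠ 0 := by
  have hcs : ContinuousSMul Circle X := ContMDiffSMul.continuousSMul (I := 𝓡 1) (I' := 𝓡 6) ∞
  obtain ⟨N, hN, hfN, hNK⟩ := normal_exists_closure_subset (isClosed_fixed (X := X))
    hK.isOpen_compl fun y hy hyK => hfix y hyK hy
  refine ⟨(closure N)ᶜ, (fun z : Circle × X => z.1 • z.2) '' (Set.univ ×ˢ Nᶜ),
    isClosed_closure.isOpen_compl, fun y hy hyN => hNK hyN hy, fun y hy =>
      ⟨(1, y), ⟨trivial, fun h => hy (subset_closure h)⟩, one_smul _ y⟩,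
    ((isCompact_univ.prod hN.isClosed_compl.isCompact).image (by fun_prop)).isClosed, ?_, ?_⟩
  · rintro g _ ⟨⟨k, y⟩, hy, rfl⟩
    exact ⟨(g * k, y), hy, mul_smul g k y⟩
  · rintro _ ⟨⟨k, y⟩, hy, rfl⟩
    exact generator_smul_ne_zero k fun h => hy.2 (hfN h)

theorem IsFlow.continuousAt_zero {V : (x : X) → TangentSpace (𝓡 6) x} {ε : ℝ} {F : ℝ → X → X}
    (h : IsFlow V ε F) (y : X) : ContinuousAt (fun z : ℝ × X => F z.1 z.2) (0, y) :=
  h.continuousOn.continuousAt ((isOpen_Ioo.prod isOpen_univ).mem_nhds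
    ⟨⟨neg_lt_zero.2 h.pos, h.pos⟩, trivial⟩)

theorem IsEquivariantDarbouxChart.exists_levelFlow [T2Space X] [CompactSpace X]
    (h : IsEquivariantDarbouxChart Ω x p q (-1) (2 * r) Ψ) (hp : 0 < p) (hq : 0 < q) (hr : 0 < r)
    (hΩ : IsSymplecticForm Ω) (hinv : IsInvariantForm Ω) (hΦ : IsMomentMap Ω Φ)
    (honly : ∀ y : X, Φ y = Φ x → (generator y : E₆) = 0 → y = x) :
    ∃ (V : (x : X) → TangentSpace (𝓡 6) x) (ε : ℝ) (F : ℝ → X → X) (δ : ℝ), IsSmoothField V ∧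
      IsInvariantField V ∧ IsFlow V ε F ∧ 0 < δ ∧ 2 * δ ≤ ε ∧ 16 * δ ≤ r ^ 2 ∧
      IsLevelFlow Φ p q x r Ψ δ F := by
  have hB : ∀ {a : ℝ}, a ≤ 2 * r → IsOpen (Ψ '' Metric.ball 0 a) := fun ha =>
    h.isOpen_image Metric.isOpen_ball (Metric.ball_subset_ball ha)
  have hr3 : IsOpen (Ψ '' Metric.ball 0 (r / 3)) := hB (by linarith)
  obtain ⟨O, R, hO, hKO, hOR, hR, hRi, hRf⟩ := exists_invariant_neighborhood
    (K := {y : X | Φ y = Φ x} ∩ (Ψ '' Metric.ball 0 (r / 3))ᶜ)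
    ((isClosed_level hΦ _).inter hr3.isClosed_compl) (by
      rintro y ⟨hy, hyB⟩ h0
      exact hyB ⟨0, Metric.mem_ball_self (by linarith), h.map_zero.trans (honly y hy h0).symm⟩)
  let C : Set ℂ³ := Metric.closedBall 0 (3 * r / 2) ∩ {z | r / 8 ≤ ‖z.2.2‖}
  have hC : IsCompact C := (isCompact_closedBall _ _).inter_right
    (isClosed_le continuous_const (by fun_prop))
  have hC3 : ∀ z ∈ C, z.2.2 ≠ 0 := fun z hz h0 => by
    have h1 := hz.2
    rw [Set.mem_ofPred_eq, h0, norm_zero] at h1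
    linarith
  obtain ⟨V, hV, hVi, hVR, hVC⟩ := exists_field hΩ hinv hΦ h hR hRi hRf hC
    (Set.inter_subset_left.trans (Metric.closedBall_subset_ball (by linarith))) hC3 (by
      rintro g z ⟨hz, hz'⟩
      refine ⟨?_, ?_⟩
      · rwa [mem_closedBall_zero_iff, norm_weightAct, ← mem_closedBall_zero_iff]
      · simpa only [Set.mem_ofPred_eq, weightAct, norm_mul, Circle.norm_coe, one_mul] using hz')
  obtain ⟨ε, F, hF⟩ := exists_flow hV
  have htube₁ : ∀ᶠ w : ℝ × ℝ in 𝓝 (0, 0), ∀ y ∈ (Set.univ : Set X),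
      y ∈ Ψ '' Metric.ball 0 (r / 3) ∨ Φ y ≠ Φ x + (w.2 : AddCircle T) ∨ F w.1 y ∈ O := by
    refine isCompact_univ.eventually_forall_of_forall_eventually fun y _ => ?_
    by_cases hy : y ∈ Ψ '' Metric.ball 0 (r / 3)
    · filter_upwards [continuous_snd.continuousAt.eventually
        (show ∀ᶠ y' in 𝓝 y, y' ∈ Ψ '' Metric.ball 0 (r / 3) from hr3.mem_nhds hy)] with w hw
      exact Or.inl hw
    by_cases hyΦ : Φ y = Φ x
    · have h1 : ContinuousAt (fun z : (ℝ × ℝ) × X => F z.1.1 z.2) ((0, 0), y) :=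
        ContinuousAt.comp (g := fun z : ℝ × X => F z.1 z.2)
          (f := fun z : (ℝ × ℝ) × X => (z.1.1, z.2)) (x := ((0, 0), y)) (hF.continuousAt_zero y)
          (by fun_prop)
      have h2 : F 0 y ∈ O := by rw [hF.zero]; exact hKO ⟨hyΦ, hy⟩
      filter_upwards [h1.eventually (show ∀ᶠ y' in 𝓝 (F 0 y), y' ∈ O from hO.mem_nhds h2)] with w hw
      exact Or.inr (Or.inr hw)
    · have h1 : Continuous fun z : (ℝ × ℝ) × X => Φ z.2 - (z.1.2 : AddCircle T) :=
        ((continuous_momentMap hΦ).comp continuous_snd).sub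
          (continuous_quotient_mk'.comp (continuous_snd.comp continuous_fst))
      have h2 : IsOpen {z : (ℝ × ℝ) × X | Φ z.2 - (z.1.2 : AddCircle T) ∈ ({Φ x} : Set _)ᶜ} :=
        (isClosed_singleton_addCircle (Φ x)).isOpen_compl.preimage h1
      filter_upwards [h2.mem_nhds (show Φ y - ((0 : ℝ) : AddCircle T) ∈ ({Φ x} : Set _)ᶜ by
        simpa using hyΦ)] with w hw
      refine Or.inr (Or.inl fun h3 => hw ?_)
      rw [Set.mem_singleton_iff, h3, add_sub_cancel_right]
  have htube₂ : ∀ᶠ s : ℝ in 𝓝 0, ∀ y ∈ Ψ '' Metric.closedBall 0 (r / 3),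
      F s y ∈ Ψ '' Metric.ball 0 (r / 2) := by
    refine IsCompact.eventually_forall_of_forall_eventually
      ((isCompact_closedBall _ _).image_of_continuousOn (h.smooth.continuousOn.mono
        (Metric.closedBall_subset_ball (by linarith)))) fun y hy => ?_
    refine (hF.continuousAt_zero y).eventually
      (show ∀ᶠ y' in 𝓝 (F 0 y), y' ∈ Ψ '' Metric.ball 0 (r / 2) from
        (hB (by linarith)).mem_nhds ?_)
    rw [hF.zero]
    exact Set.image_mono (Metric.closedBall_subset_ball (by linarith)) hy
  obtain ⟨δ₁, hδ₁, htube₁⟩ := Metric.eventually_nhds_iff.1 htube₁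
  obtain ⟨δ₂, hδ₂, htube₂⟩ := Metric.eventually_nhds_iff.1 htube₂
  have hε := hF.pos
  let δ := min (min δ₁ δ₂) (min (ε / 2) (r ^ 2 / 16))
  have hδ : 0 < δ := lt_min (lt_min hδ₁ hδ₂) (lt_min (by linarith) (by positivity))
  have hle₁ : δ ≤ δ₁ := (min_le_left _ _).trans (min_le_left _ _)
  have hle₂ : δ ≤ δ₂ := (min_le_left _ _).trans (min_le_right _ _)
  have hleε : δ ≤ ε / 2 := (min_le_right _ _).trans (min_le_left _ _)
  have hler : δ ≤ r ^ 2 / 16 := (min_le_right _ _).trans (min_le_right _ _)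
  have hFR : ∀ (s t : ℝ) (y : X), |s| < δ → |t| < δ → Φ y = Φ x + (t : AddCircle T) →
      y ∉ Ψ '' Metric.ball 0 (r / 3) → F s y ∈ R := by
    intro s t y hs ht hy hyB
    have h1 : dist (s, t) ((0 : ℝ), (0 : ℝ)) < δ₁ := by
      simp only [Prod.dist_eq, Real.dist_eq, sub_zero]
      exact max_lt (hs.trans_le hle₁) (ht.trans_le hle₁)
    exact hOR (((htube₁ h1 y trivial).resolve_left hyB).resolve_left fun h2 => h2 hy)
  refine ⟨V, ε, F, δ, hV, hVi, hF, hδ, by linarith, by linarith, fun s t y hs ht hy hyB => ?_,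
    fun t y ht hy hyB => ?_, fun s y hs hy => ?_, fun s z hs hz hz' => ?_⟩
  · exact hF.moment_eq hΦ (a := -δ) (b := δ) (by linarith) (by linarith) ⟨by linarith, hδ⟩
      (abs_lt.1 hs) fun s' hs' => hVR _ (hFR s' t y (abs_lt.2 hs') ht hy hyB)
  · have h1 := hFR 0 t y (by simpa using hδ) ht hy hyB
    rw [hF.zero] at h1
    exact hRf y h1
  · exact htube₂ (by rw [Real.dist_eq, sub_zero]; exact hs.trans_le hle₂) y
      (Set.image_mono Metric.ball_subset_closedBall hy)
  · have hzr := (mem_sliceDom hp hq hr).1 hz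
    have hlt : ∀ s ∈ Set.Ioo (-δ) δ, r ^ 2 / 64 < p * ‖z.1‖ ^ 2 + q * ‖z.2‖ ^ 2 - s := fun s hs => by
      have := sq_pos_of_pos hr
      linarith [hs.2]
    have hCs : ∀ s ∈ Set.Ioo (-δ) δ, SymplecticReduction.levelSection p q s z ∈ C := by
      intro s hs
      have h1 := levelSection_mem_ball (p := p) (q := q) le_rfl hz
      rw [mem_ball_prod] at h1
      have h2 := norm_levelSection p q s z (by linarith [hlt s hs, sq_pos_of_pos hr])
      have h3 := hlt s hs
      rw [← h2] at h3
      refine ⟨?_, ?_⟩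
      · rw [mem_closedBall_zero_iff, Prod.norm_def, Prod.norm_def]
        refine max_le (h1.1.le.trans (by linarith)) (max_le (h1.2.1.le.trans (by linarith)) ?_)
        refine abs_le_of_sq_le_sq' ?_ (by linarith) |>.2
        rw [h2]
        nlinarith [hs.1]
      · refine abs_le_of_sq_le_sq' ?_ (norm_nonneg _) |>.2
        rw [div_pow]
        linarith
    refine hF.eq_of_integralCurve hV (a := -δ) (b := δ) (by linarith) (by linarith)
      ⟨by linarith, hδ⟩ (γ := fun s => Ψ (SymplecticReduction.levelSection p q s z))
      (fun s hs => ?_) (abs_lt.1 hs)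
    have hsC := hCs s hs
    have h1 := (h.contMDiffAt (Metric.closedBall_subset_ball (by linarith) hsC.1)).mdifferentiableAt
      (by simp) |>.hasMFDerivAt
    have h2 := (hasDerivAt_levelSection p q (z := z) (s := s)
      (by linarith [hlt s hs, sq_pos_of_pos hr])).hasFDerivAt.hasMFDerivAt
    refine (HasMFDerivAt.comp s h1 h2).congr_mfderiv ?_
    refine ContinuousLinearMap.ext fun (a : ℝ) => ?_
    have key : ∀ (A : ℂ³ →L[ℝ] E₆) (v : ℂ³)
        (b : E₆), b = A v → A (a • v) = a • b := fun A v b hb => by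
      rw [map_smul, hb]
    exact key _ _ _ (hVC _ hsC)

end LevelFlow

/-! ### The collapse map -/

theorem IsLocalLift.trans {M M' : Type*} [TopologicalSpace M] [TopologicalSpace M'] {κ : M → M'}
    {h k : OpenPartialHomeomorph ℂ² ℂ²} {U U' : Set ℂ²} {f : ℂ² → M}
    {c : UniformizingChart M} {d : UniformizingChart M'} {z w y : ℂ²}
    (hh : IsLocalLift h U f c z w) (hk : IsLocalLift k U' (fun y => κ (c.map y)) d w y) :
    IsLocalLift (h.trans k) U (fun y => κ (f y)) d z y where
  mem_source := by
    rw [h.trans_source]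
    exact ⟨hh.mem_source, by rw [Set.mem_preimage, hh.map_point]; exact hk.mem_source⟩
  map_point := by rw [h.coe_trans, Function.comp_apply, hh.map_point, hk.map_point]
  source_subset := fun a ha => hh.source_subset (h.trans_source k ▸ ha).1
  target_subset := fun a ha => hk.target_subset (h.trans_target k ▸ ha).1
  smooth := by
    rw [h.coe_trans, h.trans_source]
    exact hk.smooth.comp (hh.smooth.mono Set.inter_subset_left) fun a ha => ha.2
  smooth_symm := by
    rw [h.trans_symm_eq_symm_trans_symm, k.symm.coe_trans, h.trans_target]
    exact hh.smooth_symm.comp (hk.smooth_symm.mono Set.inter_subset_left) fun a ha => ha.2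
  lifts := fun a ha => by
    rw [h.trans_source] at ha
    rw [h.coe_trans, Function.comp_apply, hk.lifts _ ha.2, hh.lifts a ha.1]

theorem PreservesForm.trans {h k : OpenPartialHomeomorph ℂ² ℂ²}
    {α β γ : ℂ² → ℂ² [⋀^Fin 2]→L[ℝ] ℝ} (hs : ContDiffOn ℝ ∞ h h.source)
    (ks : ContDiffOn ℝ ∞ k k.source) (hh : PreservesForm h α β) (hk : PreservesForm k β γ) :
    PreservesForm (h.trans k) α γ := by
  intro a ha
  rw [h.trans_source] at ha
  have h1 : DifferentiableAt ℝ h a :=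
    (hs.contDiffAt (h.open_source.mem_nhds ha.1)).differentiableAt (by simp)
  have h2 : DifferentiableAt ℝ k (h a) :=
    (ks.contDiffAt (k.open_source.mem_nhds ha.2)).differentiableAt (by simp)
  rw [h.coe_trans, fderiv_comp a h2 h1, ← hh a ha.1, ← hk _ ha.2]
  rfl

theorem PreservesForm.preservesOrientation {h : OpenPartialHomeomorph ℂ² ℂ²}
    {α β γ : ℂ² → ℂ² [⋀^Fin 2]→L[ℝ] ℝ} (hh : PreservesForm h γ β)
    (hpos : ∀ y ∈ h.source, 0 < pfaffian (γ y) * pfaffian (α y)) : PreservesOrientation h α β :=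
  fun y hy => by rw [hh y hy]; exact hpos y hy

section Collapse

variable {X : Type*} [TopologicalSpace X] [ChartedSpace E₆ X]
  [IsManifold (𝓡 6) ∞ X]
  [MulAction Circle X] [ContMDiffSMul (𝓡 1) (𝓡 6) ∞ Circle X]

/-- An equivariant Darboux chart on a polydisc of radius `2 r` in which the levels of `Φ` are those
of the quadratic moment map, together with a flow that shifts the levels of `Φ`. -/
structure CollapseSetup (Ω : (x : X) → TangentSpace (𝓡 6) x [⋀^Fin 2]→L[ℝ] ℝ) {T : ℝ}
    (Φ : X → AddCircle T) (p q : ℕ) (x : X) (r : ℝ) (Ψ : ℂ³ → X) (δ : ℝ)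
    (F : ℝ → X → X) : Prop where
  form : IsSymplecticForm Ω
  invariant : IsInvariantForm Ω
  moment : IsMomentMap Ω Φ
  hp : 0 < p
  hq : 0 < q
  hr : 0 < r
  le : 16 * δ ≤ r ^ 2
  chart : IsEquivariantDarbouxChart Ω x p q (-1) (2 * r) Ψ
  sep : ∀ v ∈ Metric.ball (0 : ℂ³) (2 * r), ∀ s : ℝ, |s| < r ^ 2 →
    Φ (Ψ v) = Φ x + (s : AddCircle T) → stdMoment p q (-1) v = s
  flow : ∃ (V : (x : X) → TangentSpace (𝓡 6) x) (ε : ℝ), IsSmoothField V ∧ IsInvariantField V ∧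
    IsFlow V ε F ∧ 2 * δ ≤ ε
  level : IsLevelFlow Φ p q x r Ψ δ F

/-- `κ` is the map to the level `ε` that is explicit in the Darboux chart and is given by the flow
far away from the fixed point. -/
structure IsCollapse {T : ℝ} (Φ : X → AddCircle T) (p q : ℕ) (x : X) (r : ℝ) (Ψ : ℂ³ → X)
    (F : ℝ → X → X) (ε : ℝ)
    (κ : ReducedSpace Φ (Φ x) → ReducedSpace Φ (Φ x + (ε : AddCircle T))) : Prop where
  near : ∀ z ∈ sliceDom p q r, ε ≤ p * ‖z.1‖ ^ 2 + q * ‖z.2‖ ^ 2 →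
    ∃ hz : Φ (Ψ (levelSection p q ε z)) = Φ x + (ε : AddCircle T),
      κ (sliceMap Φ p q x Ψ z) = ReducedSpace.mk Φ _ (Ψ (levelSection p q ε z)) hz
  far : ∀ (y : X) (hy : Φ y = Φ x), y ∉ Ψ '' Metric.ball 0 (r / 3) →
    ∃ hy' : Φ (F ε y) = Φ x + (ε : AddCircle T),
      κ (ReducedSpace.mk Φ _ y hy) = ReducedSpace.mk Φ _ (F ε y) hy'

variable {Ω : (x : X) → TangentSpace (𝓡 6) x [⋀^Fin 2]→L[ℝ] ℝ} {T : ℝ} {Φ : X → AddCircle T}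
  {x : X} {p q : ℕ} {r δ ε : ℝ} {Ψ : ℂ³ → X} {F : ℝ → X → X}
  {κ : ReducedSpace Φ (Φ x) → ReducedSpace Φ (Φ x + (ε : AddCircle T))}

theorem mem_ball_of_stdMoment (hp : 0 < p) (hq : 0 < q) {a : ℝ} (ha : 0 < a) {v : ℂ³}
    (h0 : 0 ≤ stdMoment p q (-1) v) (h : ‖v.2.2‖ ^ 2 + stdMoment p q (-1) v < a ^ 2) :
    v ∈ Metric.ball (0 : ℂ³) a := by
  rw [stdMoment_eq] at h h0
  have hp' : (1 : ℝ) ≤ p := by exact_mod_cast hp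
  have hq' : (1 : ℝ) ≤ q := by exact_mod_cast hq
  have h1 := sq_nonneg ‖v.1‖
  have h2 := sq_nonneg ‖v.2.1‖
  exact mem_ball_prod.2 ⟨lt_of_pow_lt_pow_left₀ 2 ha.le (by nlinarith),
    lt_of_pow_lt_pow_left₀ 2 ha.le (by nlinarith), lt_of_pow_lt_pow_left₀ 2 ha.le (by nlinarith)⟩

namespace CollapseSetup

theorem chart' (S : CollapseSetup Ω Φ p q x r Ψ δ F) :
    IsEquivariantDarbouxChart Ω x p q (-1) r Ψ := S.chart.mono (by linarith [S.hr])

theorem sep' (S : CollapseSetup Ω Φ p q x r Ψ δ F) :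
    ∀ v ∈ Metric.ball (0 : ℂ³) r, Φ (Ψ v) = Φ x → stdMoment p q (-1) v = 0 :=
  fun v hv h => S.sep v (Metric.ball_subset_ball (by linarith [S.hr]) hv) 0
    (by simpa using pow_pos S.hr 2) (by simpa using h)

theorem sliceMap_rotateCoord (S : CollapseSetup Ω Φ p q x r Ψ δ F) {v : ℂ³}
    (hv : v ∈ Metric.ball (0 : ℂ³) r) (hvx : Φ (Ψ v) = Φ x) :
    rotateCoord p q v ∈ sliceDom p q r ∧
      sliceMap Φ p q x Ψ (rotateCoord p q v) = ReducedSpace.mk Φ _ (Ψ v) hvx := by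
  have h3 := (mem_ball_prod.1 hv).2.2
  obtain ⟨h1, -, hy, h2⟩ := S.chart'.mk_eq_levelSection S.hr S.moment hv hvx (S.sep' v hv hvx)
    (by rw [add_zero]; exact pow_lt_pow_left₀ h3 (norm_nonneg _) two_ne_zero)
  obtain ⟨hy', h4⟩ := S.chart'.sliceMap_eq S.hr S.moment h1
  exact ⟨h1, h4.trans h2.symm⟩

theorem mk_mem_image_iff (S : CollapseSetup Ω Φ p q x r Ψ δ F) {a : ℝ} (ha : 0 < a) (har : a ≤ r)
    {y : X} (hy : Φ y = Φ x) : ReducedSpace.mk Φ _ y hy ∈ sliceMap Φ p q x Ψ '' sliceDom p q a ↔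
      y ∈ Ψ '' Metric.ball 0 a := by
  have hsub : sliceDom p q a ⊆ sliceDom p q r := fun z hz => Metric.ball_subset_ball har hz
  have hnorm : ∀ v ∈ Metric.ball (0 : ℂ³) r, Φ (Ψ v) = Φ x →
      p * ‖(rotateCoord p q v).1‖ ^ 2 + q * ‖(rotateCoord p q v).2‖ ^ 2 = ‖v.2.2‖ ^ 2 := by
    intro v hv hvx
    have h1 := S.sep' v hv hvx
    rw [stdMoment_eq] at h1
    rw [norm_rotateCoord_fst, norm_rotateCoord_snd]
    linarith
  rw [S.chart'.mk_mem_image_sliceMap_iff S.hp S.hq S.hr S.moment S.sep' hsub]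
  constructor
  · rintro ⟨v, hv, rfl, hva⟩
    rw [mem_sliceDom S.hp S.hq ha, hnorm v hv hy] at hva
    have h1 := S.sep' v hv hy
    exact ⟨v, mem_ball_of_stdMoment S.hp S.hq ha h1.ge (by rwa [h1, add_zero]), rfl⟩
  · rintro ⟨v, hv, rfl⟩
    have hvr := Metric.ball_subset_ball har hv
    refine ⟨v, hvr, rfl, ?_⟩
    rw [mem_sliceDom S.hp S.hq ha, hnorm v hvr hy]
    exact pow_lt_pow_left₀ (mem_ball_prod.1 hv).2.2 (norm_nonneg _) two_ne_zero

theorem neg_apply [T2Space X] (S : CollapseSetup Ω Φ p q x r Ψ δ F) {s : ℝ} (hs : |s| < δ) (y : X) :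
    F (-s) (F s y) = y := by
  obtain ⟨V, ε, hV, -, hF, hδ⟩ := S.flow
  exact hF.neg_apply hV (by linarith) y

theorem smul_apply [T2Space X] (S : CollapseSetup Ω Φ p q x r Ψ δ F) {s : ℝ} (hs : |s| < δ)
    (g : Circle) (y : X) : F s (g • y) = g • F s y := by
  obtain ⟨V, ε, hV, hVi, hF, hδ⟩ := S.flow
  exact hF.smul_apply hV hVi (abs_lt.1 (by linarith [abs_nonneg s])) g y

theorem continuous_flow (S : CollapseSetup Ω Φ p q x r Ψ δ F) {s : ℝ} (hs : |s| < δ) :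
    Continuous (F s) := by
  obtain ⟨V, ε, hV, hVi, hF, hδ⟩ := S.flow
  exact (hF.contMDiff (abs_lt.1 (by linarith [abs_nonneg s]))).continuous

theorem moment_flow (S : CollapseSetup Ω Φ p q x r Ψ δ F) {s : ℝ} (hs : |s| < δ) {y : X}
    (hy : Φ y = Φ x) (hyr : y ∉ Ψ '' Metric.ball 0 (r / 3)) :
    Φ (F s y) = Φ x + (s : AddCircle T) := by
  rw [S.level.moment s 0 y hs (by simpa using (abs_nonneg s).trans_lt hs) (by simpa using hy) hyr, hy]

theorem exists_collapse [T2Space X] (S : CollapseSetup Ω Φ p q x r Ψ δ F) (hε : 0 < ε)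
    (hεδ : ε < δ) :
    ∃ κ : ReducedSpace Φ (Φ x) → ReducedSpace Φ (Φ x + (ε : AddCircle T)),
      IsCollapse Φ p q x r Ψ F ε κ := by
  classical
  have habs : |ε| < δ := by rwa [abs_of_pos hε]
  have hε16 : ε < r ^ 2 := by linarith [S.le, hε]
  have hx' : ∃ x', Φ x' = Φ x + (ε : AddCircle T) := by
    have hp' : (0 : ℝ) < p := by exact_mod_cast S.hp
    have h1 : (p : ℝ) * ‖((Real.sqrt (ε / p) : ℂ), (0 : ℂ)).1‖ ^ 2 +
        q * ‖((Real.sqrt (ε / p) : ℂ), (0 : ℂ)).2‖ ^ 2 = ε := by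
      simp only [Complex.norm_real, Real.norm_eq_abs, sq_abs, norm_zero]
      rw [Real.sq_sqrt (by positivity)]
      field_simp
      ring
    exact ⟨_, S.chart'.moment_levelSection S.hr S.moment hε.le (z := ((Real.sqrt (ε / p) : ℂ), 0))
      ((mem_sliceDom S.hp S.hq S.hr).2 (by rw [h1]; exact hε16)) h1.ge⟩
  obtain ⟨x', hx'⟩ := hx'
  let ψ := sliceMap Φ p q x Ψ
  have hinj : Set.InjOn ψ (sliceDom p q r) := S.chart'.injOn_sliceMap S.hp S.hq S.hr S.moment
  let κ : ReducedSpace Φ (Φ x) → ReducedSpace Φ (Φ x + (ε : AddCircle T)) := fun m =>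
    if m ∈ ψ '' sliceDom p q r then
      orbitClass Φ hx' (Ψ (levelSection p q ε (Function.invFunOn ψ (sliceDom p q r) m)))
    else orbitClass Φ hx' (F ε (exists_mk_eq m).choose)
  have hκ : ∀ z ∈ sliceDom p q r, κ (ψ z) = orbitClass Φ hx' (Ψ (levelSection p q ε z)) := by
    intro z hz
    simp only [κ]
    rw [if_pos ⟨z, hz, rfl⟩, hinj.leftInvOn_invFunOn hz]
  refine ⟨κ, fun z hz hεz => ?_, fun y hy hyr => ?_⟩
  · have h1 := S.chart'.moment_levelSection S.hr S.moment hε.le hz hεz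
    exact ⟨h1, (hκ z hz).trans (orbitClass_eq hx' h1)⟩
  · have h1 := S.moment_flow habs hy hyr
    refine ⟨h1, ?_⟩
    rw [← orbitClass_eq hx' h1]
    by_cases hm : ReducedSpace.mk Φ _ y hy ∈ ψ '' sliceDom p q r
    · obtain ⟨v, hv, rfl⟩ := (S.mk_mem_image_iff S.hr le_rfl hy).1 hm
      obtain ⟨h2, h3⟩ := S.sliceMap_rotateCoord hv hy
      have h0 := S.sep' v hv hy
      have h4 := S.chart'.circlePhase_smul hv
      rw [h0] at h4
      have h5 : r ^ 2 / 9 ≤ ‖v.2.2‖ ^ 2 := by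
        by_contra! hcon
        exact hyr ⟨v, mem_ball_of_stdMoment S.hp S.hq (by linarith [S.hr]) h0.ge
          (by rw [h0, add_zero, div_pow]; linarith), rfl⟩
      have h6 : p * ‖(rotateCoord p q v).1‖ ^ 2 + q * ‖(rotateCoord p q v).2‖ ^ 2 = ‖v.2.2‖ ^ 2 := by
        rw [stdMoment_eq] at h0
        rw [norm_rotateCoord_fst, norm_rotateCoord_snd]
        linarith
      rw [← h3, hκ _ h2, ← S.level.levelSection ε _ habs h2 (by rw [h6]; exact h5), ← h4,
        S.smul_apply habs, orbitClass_eq_iff hx' ((moment_smul S.moment _ _).trans h1) h1]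
      exact ⟨(circlePhase v.2.2)⁻¹, inv_smul_smul _ _⟩
    · simp only [κ]
      rw [if_neg hm]
      obtain ⟨hy', h2⟩ := (exists_mk_eq (ReducedSpace.mk Φ _ y hy)).choose_spec
      obtain ⟨g, hg⟩ := (mk_eq_mk_iff hy' hy).1 h2
      rw [eq_inv_smul_iff.2 hg, S.smul_apply habs,
        orbitClass_eq_iff hx' ((moment_smul S.moment _ _).trans h1) h1]
      exact ⟨(g⁻¹)⁻¹, inv_smul_smul _ _⟩

/-- The reduced space away from the open ellipsoid. -/
theorem mk_mem_of_not_mem (S : CollapseSetup Ω Φ p q x r Ψ δ F) (hε : ε < r ^ 2 / 9) {y : X}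
    (hy : Φ y = Φ x) (hyr : y ∉ Ψ '' Metric.ball 0 (r / 3)) :
    ReducedSpace.mk Φ _ y hy ∉
      sliceMap Φ p q x Ψ '' {z | p * ‖z.1‖ ^ 2 + q * ‖z.2‖ ^ 2 < ε} := by
  rintro ⟨z, hz, hzy⟩
  have hr := S.hr
  rw [← S.mk_mem_image_iff (a := r / 3) (by linarith) (by linarith) hy, ← hzy] at hyr
  refine hyr ⟨z, (mem_sliceDom S.hp S.hq (by linarith)).2 ?_, rfl⟩
  have : p * ‖z.1‖ ^ 2 + q * ‖z.2‖ ^ 2 < ε := hz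
  linarith [div_pow r 3 2]

end CollapseSetup

end Collapse

section CollapseMap

variable {X : Type*} [TopologicalSpace X] [ChartedSpace E₆ X]
  [IsManifold (𝓡 6) ∞ X]
  [MulAction Circle X] [ContMDiffSMul (𝓡 1) (𝓡 6) ∞ Circle X]
  {Ω : (x : X) → TangentSpace (𝓡 6) x [⋀^Fin 2]→L[ℝ] ℝ} {T : ℝ} {Φ : X → AddCircle T}
  {x : X} {p q : ℕ} {r δ ε : ℝ} {Ψ : ℂ³ → X} {F : ℝ → X → X}
  {κ : ReducedSpace Φ (Φ x) → ReducedSpace Φ (Φ x + (ε : AddCircle T))}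

namespace IsCollapse

theorem not_mem_image (S : CollapseSetup Ω Φ p q x r Ψ δ F) {E : Set ℂ²}
    (hE : E ⊆ sliceDom p q r) {z : ℂ²} (hz : z ∈ sliceDom p q r) (hzE : z ∉ E) :
    sliceMap Φ p q x Ψ z ∉ sliceMap Φ p q x Ψ '' E := by
  rintro ⟨w, hw, hwz⟩
  exact hzE (S.chart'.injOn_sliceMap S.hp S.hq S.hr S.moment (hE hw) hz hwz ▸ hw)

theorem ellipsoid_subset (S : CollapseSetup Ω Φ p q x r Ψ δ F) (hεδ : ε < δ) :
    {z : ℂ² | p * ‖z.1‖ ^ 2 + q * ‖z.2‖ ^ 2 ≤ ε} ⊆ sliceDom p q r := fun z hz =>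
  (mem_sliceDom S.hp S.hq S.hr).2 (lt_of_le_of_lt hz (by
    linarith [S.le, pow_pos S.hr 2]))

theorem ellipsoid_subset' (S : CollapseSetup Ω Φ p q x r Ψ δ F) (hεδ : ε < δ) :
    {z : ℂ² | p * ‖z.1‖ ^ 2 + q * ‖z.2‖ ^ 2 < ε} ⊆ sliceDom p q r :=
  fun z hz => ellipsoid_subset S hεδ
    (show p * ‖z.1‖ ^ 2 + q * ‖z.2‖ ^ 2 ≤ ε from le_of_lt hz)

theorem exists_eq [T2Space X] (S : CollapseSetup Ω Φ p q x r Ψ δ F)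
    (K : IsCollapse Φ p q x r Ψ F ε κ) (hε : 0 < ε) (hεδ : ε < δ)
    (m' : ReducedSpace Φ (Φ x + (ε : AddCircle T))) :
    ∃ m ∉ sliceMap Φ p q x Ψ '' {z | p * ‖z.1‖ ^ 2 + q * ‖z.2‖ ^ 2 < ε}, κ m = m' := by
  have hr := S.hr
  have habs : |ε| < δ := by rwa [abs_of_pos hε]
  have habs' : |(-ε)| < δ := by rwa [abs_neg]
  have hr2 := pow_pos hr 2
  have hε16 : 16 * ε < r ^ 2 := by linarith [S.le]
  obtain ⟨y, hy, rfl⟩ := exists_mk_eq m'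
  by_cases hyB : y ∈ Ψ '' Metric.ball 0 (r / 2)
  · obtain ⟨v, hv, rfl⟩ := hyB
    have hvr : v ∈ Metric.ball (0 : ℂ³) r := Metric.ball_subset_ball (by linarith) hv
    have hs := S.sep v (Metric.ball_subset_ball (by linarith) hv) ε
      (by rw [abs_of_pos hε]; linarith) hy
    have h3 : ‖v.2.2‖ ^ 2 < (r / 2) ^ 2 :=
      pow_lt_pow_left₀ (mem_ball_prod.1 hv).2.2 (norm_nonneg _) two_ne_zero
    obtain ⟨h1, h2, hy', h4⟩ := S.chart'.mk_eq_levelSection S.hr S.moment hvr hy hs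
      (by linarith [div_pow r 2 2])
    obtain ⟨_, h5⟩ := K.near _ h1 h2
    exact ⟨_, not_mem_image S (ellipsoid_subset' S hεδ) h1 (not_lt.2 h2), h5.trans h4.symm⟩
  · have h1 : F ε (F (-ε) y) = y := by
      have := S.neg_apply habs' y
      rwa [neg_neg] at this
    have h2 : F (-ε) y ∉ Ψ '' Metric.ball 0 (r / 3) := fun h =>
      hyB (h1 ▸ S.level.mapsTo ε _ habs h)
    have h3 : Φ (F (-ε) y) = Φ x := by
      rw [S.level.moment (-ε) ε y habs' habs hy fun h => hyB
        (Set.image_mono (Metric.ball_subset_ball (by linarith)) h), hy]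
      simp
    obtain ⟨hy', h4⟩ := K.far _ h3 h2
    refine ⟨_, S.mk_mem_of_not_mem (by linarith) h3 h2, h4.trans ?_⟩
    congr 1

theorem isOpen_image (S : CollapseSetup Ω Φ p q x r Ψ δ F) {E : Set ℂ²}
    (hE : E ⊆ sliceDom p q r) (hE' : IsOpen E) : IsOpen (sliceMap Φ p q x Ψ '' E) :=
  S.chart'.isOpen_image_sliceMap S.hp S.hq S.hr S.moment S.sep' hE hE'

/-- The part of the reduced space on which the collapse map is given by the flow. -/
theorem exists_far_neighborhood [T2Space X] (S : CollapseSetup Ω Φ p q x r Ψ δ F)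
    {m : ReducedSpace Φ (Φ x)} (hm : m ∉ sliceMap Φ p q x Ψ '' sliceDom p q r) :
    ∃ W : Set (ReducedSpace Φ (Φ x)), IsOpen W ∧ m ∈ W ∧
      ∀ (y : X) (hy : Φ y = Φ x), ReducedSpace.mk Φ _ y hy ∈ W → y ∉ Ψ '' Metric.ball 0 (r / 3) := by
  have hr := S.hr
  have hT2 : T2Space (ReducedSpace Φ (Φ x)) := t2Space_reducedSpace S.moment
  let E : Set ℂ² := closure (sliceDom p q (r / 3))
  have hE : E ⊆ {z : ℂ² | p * ‖z.1‖ ^ 2 + q * ‖z.2‖ ^ 2 ≤ (r / 3) ^ 2} :=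
    closure_minimal (fun z hz => ((mem_sliceDom S.hp S.hq (by linarith)).1 hz).le)
      (isClosed_le (f := fun z : ℂ² => (p : ℝ) * ‖z.1‖ ^ 2 + q * ‖z.2‖ ^ 2)
        (by fun_prop) continuous_const)
  have hEr : E ⊆ sliceDom p q r := fun z hz => (mem_sliceDom S.hp S.hq hr).2
    (lt_of_le_of_lt (hE hz) (pow_lt_pow_left₀ (by linarith) (by linarith) two_ne_zero))
  have hEc : IsCompact E := by
    refine Metric.isCompact_of_isClosed_isBounded isClosed_closure
      ((Metric.isBounded_closedBall (x := (0 : ℂ²)) (r := r)).subset fun z hz => ?_)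
    have h1 := mem_ball_prod.1 (hEr hz)
    rw [mem_closedBall_zero_iff, Prod.norm_def]
    exact max_le h1.1.le h1.2.1.le
  refine ⟨(sliceMap Φ p q x Ψ '' E)ᶜ, (hEc.image_of_continuousOn
    ((S.chart'.continuousOn_sliceMap hr S.moment).mono hEr)).isClosed.isOpen_compl,
    fun h => hm (Set.image_mono hEr h), fun y hy hyW hyB => hyW ?_⟩
  exact Set.image_mono subset_closure
    ((S.mk_mem_image_iff (a := r / 3) (by linarith) (by linarith) hy).2 hyB)

theorem continuousOn [T2Space X] (S : CollapseSetup Ω Φ p q x r Ψ δ F)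
    (K : IsCollapse Φ p q x r Ψ F ε κ) (hε : 0 < ε) (hεδ : ε < δ) :
    ContinuousOn κ (sliceMap Φ p q x Ψ '' {z | p * ‖z.1‖ ^ 2 + q * ‖z.2‖ ^ 2 < ε})ᶜ := by
  have habs : |ε| < δ := by rwa [abs_of_pos hε]
  set ψ := sliceMap Φ p q x Ψ
  intro m hm
  by_cases hmB : m ∈ ψ '' sliceDom p q r
  · obtain ⟨z, hz, rfl⟩ := hmB
    let D : Set ℂ² := sliceDom p q r ∩ {z | ε ≤ p * ‖z.1‖ ^ 2 + q * ‖z.2‖ ^ 2}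
    have hD : ∀ w ∈ sliceDom p q r,
        ψ w ∈ (ψ '' {z | p * ‖z.1‖ ^ 2 + q * ‖z.2‖ ^ 2 < ε})ᶜ → w ∈ D :=
      fun w hw h => ⟨hw, show ε ≤ p * ‖w.1‖ ^ 2 + q * ‖w.2‖ ^ 2 from
        not_lt.1 fun h' => h ⟨w, h', rfl⟩⟩
    have hzD := hD z hz hm
    obtain ⟨hx', h1⟩ := K.near z hz hzD.2
    have h2 : ∀ w ∈ D, κ (ψ w) = orbitClass Φ hx' (Ψ (levelSection p q ε w)) := fun w hw => by
      obtain ⟨hw', h3⟩ := K.near w hw.1 hw.2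
      rw [h3, orbitClass_eq hx' hw']
    have hc : ContinuousOn (fun w => orbitClass Φ hx' (Ψ (levelSection p q ε w))) D :=
      continuousOn_orbitClass hx' (S.chart'.smooth.continuousOn.comp
        (continuous_levelSection p q ε).continuousOn fun w hw => levelSection_mem_ball hε.le hw.1)
        fun w hw => (K.near w hw.1 hw.2).1
    have hc' : ContinuousOn (fun w => κ (ψ w)) D := hc.congr h2
    intro N hN
    obtain ⟨U, hU, hzU, hUN⟩ := mem_nhdsWithin.1 (hc' z hzD hN)
    have hUB : U ∩ sliceDom p q r ⊆ sliceDom p q r := Set.inter_subset_right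
    refine mem_nhdsWithin.2 ⟨ψ '' (U ∩ sliceDom p q r),
      isOpen_image S hUB (hU.inter (isOpen_sliceDom p q r)), ⟨z, ⟨hzU, hz⟩, rfl⟩, ?_⟩
    rintro _ ⟨⟨w, hw, rfl⟩, hwA⟩
    exact hUN ⟨hw.1, hD w hw.2 hwA⟩
  · obtain ⟨W, hW, hmW, hfar⟩ := exists_far_neighborhood S hmB
    refine (ContinuousOn.continuousAt ?_ (hW.mem_nhds hmW)).continuousWithinAt
    rw [continuousOn_open_iff hW]
    intro t ht
    rw [isOpen_reducedSpace_iff]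
    have h1 : {y : {y : X // Φ y = Φ x} | ReducedSpace.mk Φ _ y.1 y.2 ∈ W ∩ κ ⁻¹' t} =
        {y | ∃ hy' : Φ (F ε y.1) = Φ x + (ε : AddCircle T), ReducedSpace.mk Φ _ y.1 y.2 ∈ W ∧
          ReducedSpace.mk Φ _ (F ε y.1) hy' ∈ t} := by
      ext y
      constructor
      · rintro ⟨h1, h2⟩
        obtain ⟨hy', h3⟩ := K.far y.1 y.2 (hfar _ _ h1)
        exact ⟨hy', h1, h3 ▸ h2⟩
      · rintro ⟨hy', h1, h2⟩
        obtain ⟨_, h3⟩ := K.far y.1 y.2 (hfar _ _ h1)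
        exact ⟨h1, by rw [Set.mem_preimage, h3]; exact h2⟩
    rw [h1, isOpen_iff_mem_nhds]
    rintro y ⟨hy', h2, h3⟩
    have hWo : IsOpen {y : {y : X // Φ y = Φ x} | ReducedSpace.mk Φ _ y.1 y.2 ∈ W} :=
      isOpen_reducedSpace_iff.1 hW
    have hlev : ∀ y ∈ {y : {y : X // Φ y = Φ x} | ReducedSpace.mk Φ _ y.1 y.2 ∈ W},
        Φ (F ε y.1) = Φ x + (ε : AddCircle T) := fun y hy => S.moment_flow habs y.2 (hfar _ _ hy)
    have hc := (continuousOn_orbitClass hy' (σ := fun y : {y : X // Φ y = Φ x} => F ε y.1)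
      ((S.continuous_flow habs).comp continuous_subtype_val).continuousOn hlev).isOpen_inter_preimage
      hWo ht
    refine Filter.mem_of_superset (hc.mem_nhds ⟨h2, ?_⟩) ?_
    · rw [Set.mem_preimage, orbitClass_eq hy' hy']
      exact h3
    · rintro y₁ ⟨h4, h5⟩
      rw [Set.mem_preimage, orbitClass_eq hy' (hlev y₁ h4)] at h5
      exact ⟨hlev y₁ h4, h4, h5⟩

theorem isQuotientMap [T2Space X] [CompactSpace X] (S : CollapseSetup Ω Φ p q x r Ψ δ F)
    (K : IsCollapse Φ p q x r Ψ F ε κ) (hε : 0 < ε) (hεδ : ε < δ) :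
    Topology.IsQuotientMap ((sliceMap Φ p q x Ψ ''
      {z | p * ‖z.1‖ ^ 2 + q * ‖z.2‖ ^ 2 < ε})ᶜ.domRestrict κ) := by
  have hT2 : T2Space (ReducedSpace Φ (Φ x + (ε : AddCircle T))) := t2Space_reducedSpace S.moment
  have hc : CompactSpace (ReducedSpace Φ (Φ x)) := compactSpace_reducedSpace S.moment
  have hopen := isOpen_image S (ellipsoid_subset' S hεδ)
    (isOpen_lt (f := fun z : ℂ² => (p : ℝ) * ‖z.1‖ ^ 2 + q * ‖z.2‖ ^ 2) (by fun_prop)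
      continuous_const)
  have hA : CompactSpace ((sliceMap Φ p q x Ψ ''
      {z | p * ‖z.1‖ ^ 2 + q * ‖z.2‖ ^ 2 < ε})ᶜ : Set _) :=
    isCompact_iff_compactSpace.1 hopen.isClosed_compl.isCompact
  have hcont := continuousOn_iff_continuous_domRestrict.1 (K.continuousOn S hε hεδ)
  refine hcont.isClosedMap.isQuotientMap hcont fun m' => ?_
  obtain ⟨m, hm, hmm⟩ := K.exists_eq S hε hεδ m'
  exact ⟨⟨m, hm⟩, hmm⟩

theorem ne_of_mem_of_not_mem [T2Space X] (S : CollapseSetup Ω Φ p q x r Ψ δ F)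
    (K : IsCollapse Φ p q x r Ψ F ε κ) (hε : 0 < ε) (hεδ : ε < δ) {y₁ y₂ : X} (hy₁ : Φ y₁ = Φ x)
    (hy₂ : Φ y₂ = Φ x) (h₁ : y₁ ∈ Ψ '' Metric.ball 0 (r / 3)) (h₂ : y₂ ∉ Ψ '' Metric.ball 0 r)
    (ha : ReducedSpace.mk Φ _ y₁ hy₁ ∉
      sliceMap Φ p q x Ψ '' {z | p * ‖z.1‖ ^ 2 + q * ‖z.2‖ ^ 2 < ε}) :
    κ (ReducedSpace.mk Φ _ y₁ hy₁) ≠ κ (ReducedSpace.mk Φ _ y₂ hy₂) := by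
  intro h
  have hr := S.hr
  have habs : |ε| < δ := by rwa [abs_of_pos hε]
  have habs' : |(-ε)| < δ := by rwa [abs_neg]
  obtain ⟨z, hz, hzy⟩ := (S.mk_mem_image_iff (a := r / 3) (by linarith) (by linarith) hy₁).2 h₁
  have hzr : z ∈ sliceDom p q r := Metric.ball_subset_ball (by linarith) hz
  rw [← hzy] at h ha
  obtain ⟨h3, h4⟩ := K.near z hzr (not_lt.1 fun h' => ha ⟨z, h', rfl⟩)
  obtain ⟨h5, h6⟩ := K.far y₂ hy₂ fun h' =>
    h₂ (Set.image_mono (Metric.ball_subset_ball (by linarith)) h')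
  rw [h4, h6, mk_eq_mk_iff] at h
  obtain ⟨g, hg⟩ := h
  have h7 : F ε y₂ ∈ Ψ '' Metric.ball 0 (r / 3) := by
    rw [← hg, S.chart.smul_mem_image (by linarith)]
    exact ⟨_, levelSection_mem_ball hε.le hz, rfl⟩
  have h8 := S.level.mapsTo (-ε) _ habs' h7
  rw [S.neg_apply habs] at h8
  exact h₂ (Set.image_mono (Metric.ball_subset_ball (by linarith)) h8)

theorem eq_iff [T2Space X] (S : CollapseSetup Ω Φ p q x r Ψ δ F)
    (K : IsCollapse Φ p q x r Ψ F ε κ) (hε : 0 < ε) (hεδ : ε < δ) {a b : ReducedSpace Φ (Φ x)}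
    (ha : a ∉ sliceMap Φ p q x Ψ '' {z | p * ‖z.1‖ ^ 2 + q * ‖z.2‖ ^ 2 < ε})
    (hb : b ∉ sliceMap Φ p q x Ψ '' {z | p * ‖z.1‖ ^ 2 + q * ‖z.2‖ ^ 2 < ε}) :
    κ a = κ b ↔ a = b ∨ ∃ z w : ℂ², p * ‖z.1‖ ^ 2 + q * ‖z.2‖ ^ 2 = ε ∧
      p * ‖w.1‖ ^ 2 + q * ‖w.2‖ ^ 2 = ε ∧
      (∃ g : Circle, (g : ℂ) ^ p * z.1 = w.1 ∧ (g : ℂ) ^ q * z.2 = w.2) ∧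
      a = sliceMap Φ p q x Ψ z ∧ b = sliceMap Φ p q x Ψ w := by
  have hr := S.hr
  have habs : |ε| < δ := by rwa [abs_of_pos hε]
  have hnear : ∀ z ∈ sliceDom p q r, ∀ w ∈ sliceDom p q r, ε ≤ p * ‖z.1‖ ^ 2 + q * ‖z.2‖ ^ 2 →
      ε ≤ p * ‖w.1‖ ^ 2 + q * ‖w.2‖ ^ 2 →
      (κ (sliceMap Φ p q x Ψ z) = κ (sliceMap Φ p q x Ψ w) ↔
      z = w ∨ (p * ‖z.1‖ ^ 2 + q * ‖z.2‖ ^ 2 = ε ∧ p * ‖w.1‖ ^ 2 + q * ‖w.2‖ ^ 2 = ε ∧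
        ∃ g : Circle, (g : ℂ) ^ p * z.1 = w.1 ∧ (g : ℂ) ^ q * z.2 = w.2)) := by
    intro z hz w hw hεz hεw
    obtain ⟨hz', h1⟩ := K.near z hz hεz
    obtain ⟨hw', h2⟩ := K.near w hw hεw
    rw [h1, h2, ← S.chart'.orbitClass_levelSection_eq_iff hr S.moment hz' hε.le rfl hz hw hεz hεw,
      orbitClass_eq hz' hz', orbitClass_eq hz' hw']
  constructor
  · intro h
    obtain ⟨y₁, hy₁, rfl⟩ := exists_mk_eq a
    obtain ⟨y₂, hy₂, rfl⟩ := exists_mk_eq b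
    by_cases hfar : y₁ ∉ Ψ '' Metric.ball 0 (r / 3) ∧ y₂ ∉ Ψ '' Metric.ball 0 (r / 3)
    · obtain ⟨_, h1⟩ := K.far y₁ hy₁ hfar.1
      obtain ⟨_, h2⟩ := K.far y₂ hy₂ hfar.2
      rw [h1, h2, mk_eq_mk_iff] at h
      obtain ⟨g, hg⟩ := h
      refine Or.inl ((mk_eq_mk_iff hy₁ hy₂).2 ⟨g, ?_⟩)
      rw [← S.neg_apply habs (g • y₁), S.smul_apply habs, hg, S.neg_apply habs]
    have hB : y₁ ∈ Ψ '' Metric.ball 0 r ∧ y₂ ∈ Ψ '' Metric.ball 0 r := by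
      by_contra hcon
      rw [not_and_or, not_not, not_not] at hfar
      rcases hfar with h1 | h1
      · refine K.ne_of_mem_of_not_mem S hε hεδ hy₁ hy₂ h1 (fun h2 => hcon ⟨?_, h2⟩) ha h
        exact Set.image_mono (Metric.ball_subset_ball (by linarith)) h1
      · refine K.ne_of_mem_of_not_mem S hε hεδ hy₂ hy₁ h1 (fun h2 => hcon ⟨h2, ?_⟩) hb h.symm
        exact Set.image_mono (Metric.ball_subset_ball (by linarith)) h1
    obtain ⟨z, hz, hzy⟩ := (S.mk_mem_image_iff hr le_rfl hy₁).2 hB.1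
    obtain ⟨w, hw, hwy⟩ := (S.mk_mem_image_iff hr le_rfl hy₂).2 hB.2
    rw [← hzy, ← hwy] at h
    rw [← hzy] at ha
    rw [← hwy] at hb
    rw [← hzy, ← hwy]
    rcases (hnear z hz w hw (not_lt.1 fun h' => ha ⟨z, h', rfl⟩)
      (not_lt.1 fun h' => hb ⟨w, h', rfl⟩)).1 h with rfl | ⟨h1, h2, h3⟩
    · exact Or.inl rfl
    · exact Or.inr ⟨z, w, h1, h2, h3, rfl, rfl⟩
  · rintro (rfl | ⟨z, w, h1, h2, h3, rfl, rfl⟩)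
    · rfl
    · exact (hnear z (ellipsoid_subset S hεδ h1.le) w (ellipsoid_subset S hεδ h2.le) h1.ge h2.ge).2
        (Or.inr ⟨h1, h2, h3⟩)

/-- Outside of the closed ellipsoid the collapse map is an orientation preserving diffeomorphism
of orbifolds. -/
theorem exists_lift [T2Space X] (S : CollapseSetup Ω Φ p q x r Ψ δ F)
    (K : IsCollapse Φ p q x r Ψ F ε κ) (hε : 0 < ε) (hεδ : ε < δ)
    {O : SymplecticOrbifold (ReducedSpace Φ (Φ x))}
    (hO : ∀ c ∈ O.charts, ∀ z ∈ c.dom, c.map z ≠ ReducedSpace.mk Φ (Φ x) x rfl →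
        HasSection Ω Φ (Φ x) c.dom c.map c.form z)
    (hO' : ∃ c ∈ O.charts, c.dom = sliceDom p q r ∧ c.map = sliceMap Φ p q x Ψ ∧
        c.form = fun _ => stdForm2)
    {c : UniformizingChart (ReducedSpace Φ (Φ x))} (hc : c ∈ O.charts) {z : ℂ²} (hz : z ∈ c.dom)
    (hzE : c.map z ∉ sliceMap Φ p q x Ψ '' {z | p * ‖z.1‖ ^ 2 + q * ‖z.2‖ ^ 2 ≤ ε})
    {d : UniformizingChart (ReducedSpace Φ (Φ x + (ε : AddCircle T)))} {w : ℂ²}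
    (hd : HasSection Ω Φ _ d.dom d.map d.form w) (hzw : d.map w = κ (c.map z)) :
    ∃ h, IsLocalLift h c.dom (fun y => κ (c.map y)) d z w ∧
      PreservesOrientation h c.form d.form := by
  have hr := S.hr
  have habs : |ε| < δ := by rwa [abs_of_pos hε]
  by_cases hB : c.map z ∈ sliceMap Φ p q x Ψ '' sliceDom p q r
  · obtain ⟨z', hz', hzz'⟩ := hB
    have hεz : ε < p * ‖z'.1‖ ^ 2 + q * ‖z'.2‖ ^ 2 := not_le.1 fun h => hzE ⟨z', h, hzz'⟩
    obtain ⟨c₀, hc₀, hdom, hmap, hform⟩ := hO'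
    obtain ⟨h, hh, hhf⟩ := O.compatible c hc c₀ hc₀ z hz z' (hdom ▸ hz') (by rw [hmap, hzz'])
    obtain ⟨k, hk, hkf⟩ := (S.chart'.hasSection_levelSection S.hp S.hq S.moment hε rfl
      (K := fun z => κ (sliceMap Φ p q x Ψ z)) K.near hz' hεz).exists_lift S.form S.invariant
      S.moment hd (by rw [hzw, hzz'])
    have hk' : IsLocalLift k (sliceDom p q r ∩ {z | ε < p * ‖z.1‖ ^ 2 + q * ‖z.2‖ ^ 2})
        (fun y => κ (c₀.map y)) d z' w := by rw [hmap]; exact hk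
    rw [hform] at hhf
    refine ⟨h.trans k, hh.trans hk', (hhf.trans hh.smooth hk.smooth hkf).preservesOrientation
      fun y hy => mul_self_pos.2 ?_⟩
    exact (pfaffian_ne_zero_iff _).2 (c.nondegenerate_form y ((hh.trans hk').source_subset hy))
  · obtain ⟨W, hW, hzW, hfar⟩ := exists_far_neighborhood S hB
    have hx : c.map z ≠ ReducedSpace.mk Φ (Φ x) x rfl := fun h => hB (by
      rw [h, S.mk_mem_image_iff hr le_rfl rfl]
      exact ⟨0, Metric.mem_ball_self hr, S.chart.map_zero⟩)
    obtain ⟨U, σ, hzU, hUc, hσ, hσf⟩ := hO c hc z hz hx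
    obtain ⟨V, ε₁, hV, hVi, hF, hδε⟩ := S.flow
    let U' : Set ℂ² := U ∩ (c.dom ∩ c.map ⁻¹' W)
    have hU' : IsOpen U' :=
      hσ.isOpen.inter (c.continuousOn_map.isOpen_inter_preimage c.isOpen_dom hW)
    have hσ' := hσ.mono hU' Set.inter_subset_left
    have hσfar : ∀ y ∈ U', σ y ∉ Ψ '' Metric.ball 0 (r / 3) := by
      rintro y ⟨hyU, -, hyW⟩
      obtain ⟨⟨hy, h1⟩, -⟩ := hσf y hyU
      exact hfar _ hy (h1 ▸ hyW)
    have hlev : ∀ s, |s| < δ → ∀ y ∈ U', Φ (F s (σ y)) = Φ x + (s : AddCircle T) :=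
      fun s hs y hy => S.moment_flow hs (hσ'.level y hy) (hσfar y hy)
    have ht : 2 * |ε| < ε₁ := by linarith
    have hsec : HasSection Ω Φ _ U' (fun y => κ (c.map y))
        (pullbackForm Ω fun y => F ε (σ y)) z := by
      refine ⟨U', fun y => F ε (σ y), ⟨hzU, hz, hzW⟩, subset_rfl,
        hF.isSymplecticSection S.form S.moment hV hVi ht hσ' (hlev ε habs), fun y hy => ⟨?_, rfl⟩⟩
      obtain ⟨⟨hy', h1⟩, -⟩ := hσf y hy.1
      obtain ⟨h2, h3⟩ := K.far _ hy' (hσfar y hy)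
      exact ⟨h2, (congrArg κ h1).trans h3⟩
    obtain ⟨h, hh, hhf⟩ := hsec.exists_lift S.form S.invariant S.moment hd hzw
    refine ⟨h, ⟨hh.mem_source, hh.map_point, hh.source_subset.trans fun y hy => hy.2.1,
      hh.target_subset, hh.smooth, hh.smooth_symm, hh.lifts⟩,
      hhf.preservesOrientation fun y hy => ?_⟩
    have hy' := hh.source_subset hy
    rw [← (hσf y hy'.1).2]
    refine hF.pfaffian_mul_pos S.form S.moment hV hVi ht hσ' (fun s hs => hlev s ?_) hy'
    have := Set.abs_sub_left_of_mem_uIcc hs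
    simp only [sub_zero] at this
    exact this.trans_lt habs

end IsCollapse

end CollapseMap

/-! ### The weighted blowup -/

section Blowup

variable {X : Type*} [TopologicalSpace X] [T2Space X] [CompactSpace X]
  [ChartedSpace E₆ X] [IsManifold (𝓡 6) ∞ X]
  [MulAction Circle X] [ContMDiffSMul (𝓡 1) (𝓡 6) ∞ Circle X]
  {Ω : (x : X) → TangentSpace (𝓡 6) x [⋀^Fin 2]→L[ℝ] ℝ} {T : ℝ} {Φ : X → AddCircle T}
  {x : X} {p q : ℕ}

theorem CollapseSetup.not_fixed {r δ ε : ℝ} {Ψ : ℂ³ → X} {F : ℝ → X → X}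
    (S : CollapseSetup Ω Φ p q x r Ψ δ F) (hε : 0 < ε) (hεδ : ε < δ) {y : X}
    (hy : Φ y = Φ x + (ε : AddCircle T)) : (generator y : E₆) ≠ 0 := by
  have hr := S.hr
  have habs : |ε| < δ := by rwa [abs_of_pos hε]
  by_cases hB : y ∈ Ψ '' Metric.ball 0 (r / 3)
  · obtain ⟨v, hv, rfl⟩ := hB
    have hv' : v ∈ Metric.ball (0 : ℂ³) (2 * r) := Metric.ball_subset_ball (by linarith) hv
    have hs := S.sep v hv' ε (by linarith [S.le, pow_pos hr 2]) hy
    refine S.chart.generator_ne_zero (by exact_mod_cast S.hp.ne') (by exact_mod_cast S.hq.ne')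
      (by norm_num) hv' ?_
    rintro rfl
    simp [stdMoment] at hs
    exact hε.ne hs
  · exact S.level.not_fixed ε y habs hy hB

theorem exists_collapseSetup (hΩ : IsSymplecticForm Ω) (hinv : IsInvariantForm Ω)
    (hΦ : IsMomentMap Ω Φ) (hp : 0 < p) (hq : 0 < q) (hx : HasIsotropyWeights Ω x p q (-1))
    (honly : ∀ y : X, Φ y = Φ x → (generator y : E₆) = 0 → y = x) :
    ∃ (r : ℝ) (Ψ : ℂ³ → X) (δ : ℝ) (F : ℝ → X → X), 0 < δ ∧
      CollapseSetup Ω Φ p q x r Ψ δ F := by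
  obtain ⟨r₀, Ψ, hr₀, hΨ⟩ := exists_equivariant_darboux hΩ hinv hx
  obtain ⟨η, hη, hsep⟩ := exists_pos_of_coe_eq T
  let C : ℝ := 4 * (p + q + 1) + 1
  have hC : 0 < C := by positivity
  let r : ℝ := min (r₀ / 2) (min 1 (η / (C + 1)))
  have hr : 0 < r := lt_min (by linarith) (lt_min one_pos (by positivity))
  have hr1 : r ≤ 1 := (min_le_right _ _).trans (min_le_left _ _)
  have hr2 : r * (C + 1) ≤ η :=
    (le_div_iff₀ (by positivity)).1 ((min_le_right _ _).trans (min_le_right _ _))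
  have hr3 : 2 * r ≤ r₀ := by linarith [min_le_left (r₀ / 2) (min 1 (η / (C + 1)))]
  have hrC : C * r ^ 2 < η := by nlinarith
  have hchart := hΨ.mono hr3
  obtain ⟨V, ε, F, δ, hV, hVi, hF, hδ, hδε, hδr, hlevel⟩ :=
    hchart.exists_levelFlow hp hq hr hΩ hinv hΦ honly
  refine ⟨r, Ψ, δ, F, hδ, hΩ, hinv, hΦ, hp, hq, hr, hδr, hchart, fun v hv s hs h => ?_,
    ⟨V, ε, hV, hVi, hF, hδε⟩, hlevel⟩
  rw [hchart.moment_eq hΦ (by linarith) hv] at h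
  refine hsep _ _ ?_ (add_left_cancel h)
  obtain ⟨h1, h2, h3⟩ := mem_ball_prod.1 hv
  have hsq : ∀ a : ℂ, ‖a‖ < 2 * r → ‖a‖ ^ 2 ≤ 4 * r ^ 2 := fun a ha => by
    nlinarith [norm_nonneg a]
  have h4 := mul_le_mul_of_nonneg_left (hsq _ h1) (Nat.cast_nonneg p : (0 : ℝ) ≤ p)
  have h5 := mul_le_mul_of_nonneg_left (hsq _ h2) (Nat.cast_nonneg q : (0 : ℝ) ≤ q)
  have h6 := hsq _ h3
  have h7 := abs_lt.1 hs
  have hCr : C * r ^ 2 = p * (4 * r ^ 2) + q * (4 * r ^ 2) + 4 * r ^ 2 + r ^ 2 := by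
    simp only [C]; ring
  have h8 : 0 ≤ p * ‖v.1‖ ^ 2 := by positivity
  have h9 : 0 ≤ q * ‖v.2.1‖ ^ 2 := by positivity
  have h10 : 0 ≤ ‖v.2.2‖ ^ 2 := by positivity
  have h11 : 0 ≤ p * (4 * r ^ 2) := by positivity
  have h12 : 0 ≤ q * (4 * r ^ 2) := by positivity
  rw [stdMoment_eq, abs_lt]
  constructor <;> linarith

theorem IsCollapse.isWeightedBlowup {r δ ε : ℝ} {Ψ : ℂ³ → X} {F : ℝ → X → X}
    {κ : ReducedSpace Φ (Φ x) → ReducedSpace Φ (Φ x + (ε : AddCircle T))}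
    (S : CollapseSetup Ω Φ p q x r Ψ δ F) (K : IsCollapse Φ p q x r Ψ F ε κ) (hε : 0 < ε)
    (hεδ : ε < δ) {O : SymplecticOrbifold (ReducedSpace Φ (Φ x))}
    (hO : ∀ c ∈ O.charts, ∀ z ∈ c.dom, c.map z ≠ ReducedSpace.mk Φ (Φ x) x rfl →
        HasSection Ω Φ (Φ x) c.dom c.map c.form z)
    (hOc : ∃ c ∈ O.charts, c.dom = sliceDom p q r ∧ c.map = sliceMap Φ p q x Ψ ∧
        c.form = fun _ => stdForm2)
    (hOd : IsDarbouxChart O (sliceDom p q r) (sliceMap Φ p q x Ψ)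
        (ReducedSpace.mk Φ (Φ x) x rfl))
    {O' : SymplecticOrbifold (ReducedSpace Φ (Φ x + (ε : AddCircle T)))}
    (hO' : ∀ c ∈ O'.charts, IsReductionChart Ω Φ _ c) :
    IsWeightedBlowup O (ReducedSpace.mk Φ (Φ x) x rfl) p q (ε / (p * q)) (sliceDom p q r)
      (sliceMap Φ p q x Ψ) O' κ := by
  have hpq : (0 : ℝ) < p * q := by
    have h1 : (0 : ℝ) < p := by exact_mod_cast S.hp
    have h2 : (0 : ℝ) < q := by exact_mod_cast S.hq
    positivity
  have hg := gauge_mul S.hp S.hq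
  have hlt : {z | gauge p q z < ε / (p * q)} =
      {z : ℂ² | p * ‖z.1‖ ^ 2 + q * ‖z.2‖ ^ 2 < ε} := by
    ext z
    rw [Set.mem_ofPred_eq, Set.mem_ofPred_eq, lt_div_iff₀' hpq, hg]
  have hle : {z | gauge p q z ≤ ε / (p * q)} =
      {z : ℂ² | p * ‖z.1‖ ^ 2 + q * ‖z.2‖ ^ 2 ≤ ε} := by
    ext z
    rw [Set.mem_ofPred_eq, Set.mem_ofPred_eq, le_div_iff₀' hpq, hg]
  have heq : ∀ z, gauge p q z = ε / (p * q) ↔ p * ‖z.1‖ ^ 2 + q * ‖z.2‖ ^ 2 = ε := fun z => by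
    rw [eq_div_iff hpq.ne', mul_comm, hg]
  have hpos : 0 < ε / (p * q) := div_pos hε hpq
  refine ⟨hpos, hOd, ?_, ?_, ?_, ?_, ?_, ?_⟩
  · rw [hle]
    exact IsCollapse.ellipsoid_subset S hεδ
  · rw [hlt]
    exact K.isQuotientMap S hε hεδ
  · rw [hlt]
    intro a ha b hb
    rw [K.eq_iff S hε hεδ ha hb]
    refine or_congr_right (exists_congr fun z => exists_congr fun w => ?_)
    rw [heq, heq]
    refine and_congr_right fun hz => and_congr_right fun _ => and_congr_left fun _ =>
      ⟨fun ⟨g, h1, h2⟩ => sameCharacteristicLeaf_of_smul S.hp S.hq ((heq z).2 hz) g h1 h2,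
        exists_smul_of_sameCharacteristicLeaf S.hp S.hq hpos⟩
  · rw [hle]
    intro c hc z hz hzE d hd w hw hzw
    exact K.exists_lift S hε hεδ hO hOc hc hz hzE (hO' d hd w hw) hzw
  · exact isLocalSymplecto_of_hasSection S.form S.invariant S.moment hO' fun z hz =>
      S.chart'.hasSection_exceptional₁ S.hp S.hq S.hr S.moment hε rfl
        (K := fun z => κ (sliceMap Φ p q x Ψ z)) K.near hz
  · exact isLocalSymplecto_of_hasSection S.form S.invariant S.moment hO' fun z hz =>
      S.chart'.hasSection_exceptional₂ S.hp S.hq S.hr S.moment hε rfl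
        (K := fun z => κ (sliceMap Φ p q x Ψ z)) K.near hz

end Blowup

end SymplecticReduction

end

theorem mainTheorem4 {X : Type*} [TopologicalSpace X] [T2Space X] [CompactSpace X]
    [ChartedSpace (EuclideanSpace ℝ (Fin 6)) X] [IsManifold (𝓡 6) ∞ X]
    [MulAction Circle X] [ContMDiffSMul (𝓡 1) (𝓡 6) ∞ Circle X]
    (Ω : (x : X) → TangentSpace (𝓡 6) x [⋀^Fin 2]→L[ℝ] ℝ)
    (hΩ : IsSymplecticForm Ω) (hinv : IsInvariantForm Ω)
    (T : ℝ) (Φ : X → AddCircle T) (hΦ : IsMomentMap Ω Φ)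
    (p q : ℕ) (hp : 0 < p) (hq : 0 < q) (hpq : Nat.Coprime p q)
    (x₀ : X) (hx₀ : HasIsotropyWeights Ω x₀ p q (-1))
    (honly : ∀ x : X, Φ x = Φ x₀ → (∀ g : Circle, g • x = x) → x = x₀) :
    ∃ (r : ℝ) (Ψ : ℂ × ℂ × ℂ → X) (O₀ : SymplecticOrbifold (ReducedSpace Φ (Φ x₀)))
      (B : Set (ℂ × ℂ)) (ψ : ℂ × ℂ → ReducedSpace Φ (Φ x₀)),
      0 < r ∧
      IsEquivariantDarbouxChart Ω x₀ p q (-1) r Ψ ∧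
      (∀ z ∈ Metric.ball (0 : ℂ × ℂ × ℂ) r,
        Φ (Ψ z) = Φ x₀ + (stdMoment p q (-1) z : AddCircle T)) ∧
      IsReductionOn Ω Φ (Φ x₀) O₀ {ReducedSpace.mk Φ (Φ x₀) x₀ rfl}ᶜ ∧
      B = {z | levelSection p q 0 z ∈ Metric.ball (0 : ℂ × ℂ × ℂ) r} ∧
      (∀ z ∈ B, ∃ hz : Φ (Ψ (levelSection p q 0 z)) = Φ x₀,
        ψ z = ReducedSpace.mk Φ (Φ x₀) (Ψ (levelSection p q 0 z)) hz) ∧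
      ∃ ε₀ : ℝ, 0 < ε₀ ∧ ∀ ε : ℝ, 0 < ε → ε < ε₀ →
        ∃ (O : SymplecticOrbifold (ReducedSpace Φ (Φ x₀ + (ε : AddCircle T))))
          (κ : ReducedSpace Φ (Φ x₀) → ReducedSpace Φ (Φ x₀ + (ε : AddCircle T))),
          IsReductionOn Ω Φ (Φ x₀ + (ε : AddCircle T)) O Set.univ ∧
          IsWeightedBlowup O₀ (ReducedSpace.mk Φ (Φ x₀) x₀ rfl) p q (ε / (p * q)) B ψ O κ ∧
          ∀ z ∈ B, ε ≤ p * ‖z.1‖ ^ 2 + q * ‖z.2‖ ^ 2 →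
            ∃ hz : Φ (Ψ (levelSection p q ε z)) = Φ x₀ + (ε : AddCircle T),
              κ (ψ z) = ReducedSpace.mk Φ (Φ x₀ + (ε : AddCircle T))
                (Ψ (levelSection p q ε z)) hz := by
  have honly' : ∀ y : X, Φ y = Φ x₀ → (generator y : EuclideanSpace ℝ (Fin 6)) = 0 → y = x₀ :=
    fun y hy h0 => honly y hy (smul_eq_of_generator_eq_zero h0)
  obtain ⟨r, Ψ, δ, F, hδ, S⟩ := exists_collapseSetup hΩ hinv hΦ hp hq hx₀ honly'
  obtain ⟨O₀, hO, hOc, hOd⟩ := S.chart'.exists_critical_orbifold hp hq S.hr hΩ hinv hΦ S.sep'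
    hx₀.1 honly'
  refine ⟨r, Ψ, O₀, sliceDom p q r, sliceMap Φ p q x₀ Ψ, S.hr, S.chart',
    fun z hz => S.chart'.moment_eq hΦ S.hr hz, isReductionOn_of_isReductionChart hO, rfl,
    fun z hz => S.chart'.sliceMap_eq S.hr hΦ hz, δ, hδ, fun ε hε hεδ => ?_⟩
  obtain ⟨κ, K⟩ := S.exists_collapse hε hεδ
  obtain ⟨O, hO'⟩ := exists_regular_orbifold hΩ hinv hΦ
    (l := Φ x₀ + (ε : AddCircle T)) fun y hy => S.not_fixed hε hεδ hy
  exact ⟨O, κ, isReductionOn_of_isReductionChart fun c hc z hz _ => hO' c hc z hz,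
    K.isWeightedBlowup S hε hεδ hO hOc hOd hO', K.near⟩
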